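/- Let $\mathbb{T}=\mathbb{R}/2\pi\mathbb{Z}$, $j\ge 1$ an integer, $\lambda\ge 0$, and let $g\in C^\infty(\mathbb{T})$ be real-valued and nonnegative with $\int_{\mathbb{T}}g\,dx=1$. Write $\langle x\rangle=(1+x^2)^{1/2}$, $\widehat f(k)=(2\pi)^{-1/2}\int_{\mathbb{T}}e^{-ikx}f(x)\,dx$, $\|f\|_{H^s}^2=\sum_{k\in\mathbb{Z}}\langle k\rangle^{2s}|\widehat f(k)|^2$, and $H^s_0(\mathbb{T})$ for the real-valued $f\in H^s(\mathbb{T})$ with $\int_{\mathbb{T}}f\,dx=0$. Let $W(t)$ be the unitary group on $L^2(\mathbb{T})$ with $\widehat{W(t)f}(k)=e^{itk^{2j+1}}\widehat f(k)$, let $$Gf(x)=g(x)\Big(f(x)-\int_{\mathbb{T}}g(y)f(y)\,dy\Big),$$ and put $K_\lambda=GG^*L_\lambda^{-1}$ on mean-zero functions, where $L_0=I$ and, for $\lambda>0$, $$L_\lambda f=\int_0^1e^{-2\lambda\tau}\,W(-\tau)GG^*W^*(-\tau)f\,d\tau ,$$ inverted on the space of mean-zero functions. For a function $f(t,x)$ on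 $\mathbb{R}\times\mathbb{T}$ with space-time Fourier transform $\widetilde f(\tau,k)=\frac1{2\pi}\int_{\mathbb{R}\times\mathbb{T}}e^{-it\tau-ikx}f(t,x)\,dx\,dt$ let $$\|f\|_{Y^s}=\Big(\frac1{2\pi}\sum_{k}\int_{\mathbb{R}}\langle k\rangle^{2s}\langle\tau-k^{2j+1}\rangle|\widetilde f(\tau,k)|^2\,d\tau\Big)^{1/2}+\Big(\sum_k\Big(\int_{\mathbb{R}}\langle k\rangle^s|\widetilde f(\tau,k)|\,d\tau\Big)^2\Big)^{1/2},$$ and let $Y^s_T$ be its localisation to $(0,T)\times\mathbb{T}$, with norm $\|f\|_{Y^s_T}=\inf\{\|h\|_{Y^s}:h=f\text{ on }(0,T)\times\mathbb{T}\}$. **Theorem (global well-posedness).** Let $s\ge0$ and $T>0$. There is a positive, nondecreasing, continuous function $\alpha_{T,s}:[0,\infty)\to(0,\infty)$ (depending on $T$, $s$ and the fixed data $j,g,\lambda$) such that for every $u_0\in H^s_0(\mathbb{T})$ there exists a unique real-valued $u\in Y^s_T\cap C([0,T];H^s(\mathbb{T}))$ that solves $$\partial_tu+(-1)^{j+1}\partial_x^{2j+1}u+uu_x=-K_\lambda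 u,\qquad u(0)=u_0,$$ on $[0,T]$ in the integral sense $$u(t)=W(t)u_0-\int_0^tW(t-\tau)K_\lambda u(\tau)\,d\tau-\int_0^tW(t-\tau)\,\tfrac12\partial_x(u^2)(\tau)\,d\tau ,$$ the identity being read in the sense of distributions in $x$, and this solution satisfies $$\|u\|_{Y^s_T}\le\alpha_{T,s}(\|u_0\|_{L^2})\,\|u_0\|_{H^s}.$$ -/

import Mathlib

open MeasureTheory Filter Topology Set
open scoped ENNReal NNReal ContDiff InnerProductSpace

namespace PeriodicKdV

noncomputable section

instance two_pi_pos_fact : Fact (0 < 2 * Real.pi) := ⟨Real.two_pi_pos⟩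

/-- The torus `ℝ / 2πℤ`. Its `volume` is Lebesgue measure, of total mass `2π`. -/
abbrev Torus : Type := AddCircle (2 * Real.pi)

/-- Complex `L²(𝕋)`. Mathlib's Fourier basis lives over the normalised Haar measure `dx / 2π`; this
is the same space of classes as for `dx`, with the norm divided by `√(2π)`. The norms that are used
below are `hsNorm` and the Fourier restriction norms, which are written with `dx`. -/
abbrev L2 : Type := Lp ℂ 2 (AddCircle.haarAddCircle : Measure Torus)

/-- `f̂(k) = (2π)^{-1/2} ∫_𝕋 e^{-ikx} f(x) dx`. -/
def hat (f : Torus → ℂ) (k : ℤ) : ℂ :=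
  (1 / (Real.sqrt (2 * Real.pi) : ℂ)) * ∫ x : Torus, fourier (-k) x * f x

/-- The bracket `⟨x⟩ = (1 + x²)^{1/2}`. -/
def bracket (x : ℝ) : ℝ := Real.sqrt (1 + x ^ 2)

/-- The norm `(∑_k ⟨k⟩^{2s} |f̂(k)|²)^{1/2}`, with value `⊤` when `f` is not in `H^s`. -/
def hsNorm (s : ℝ) (f : L2) : ℝ≥0∞ :=
  (∑' k : ℤ, ENNReal.ofReal (bracket k ^ (2 * s) * ‖hat f k‖ ^ 2)) ^ (1 / 2 : ℝ)

/-- For `s ≥ 0`, the Sobolev space `H^s(𝕋)` as a subset of `L²(𝕋)`. -/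
def MemHs (s : ℝ) (f : L2) : Prop := hsNorm s f < ⊤

def IsRealValued (f : L2) : Prop :=
  ∀ᵐ x ∂(AddCircle.haarAddCircle : Measure Torus), (f x).im = 0

def MeanZero (f : L2) : Prop := ∫ x : Torus, f x = 0

/-! The unitary group and the feedback operator -/

lemma hat_eq (f : Torus → ℂ) (k : ℤ) :
    hat f k = (Real.sqrt (2 * Real.pi) : ℂ) * fourierCoeff f k := by
  have h2 : (0 : ℝ) < 2 * Real.pi := Real.two_pi_pos
  have hs : (Real.sqrt (2 * Real.pi) : ℂ) ≠ 0 := by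
    exact_mod_cast (Real.sqrt_pos.2 h2).ne'
  have hm : (Real.sqrt (2 * Real.pi) : ℂ) * Real.sqrt (2 * Real.pi) = 2 * Real.pi := by
    exact_mod_cast Real.mul_self_sqrt h2.le
  unfold hat fourierCoeff
  rw [AddCircle.integral_haarAddCircle]
  simp only [smul_eq_mul, Complex.real_smul]
  push_cast
  rw [← hm]
  field_simp

/-- The symbol `e^{i t k^{2j+1}}` of the group generated by `-(-1)^{j+1} ∂_x^{2j+1}`. -/
def phase (j : ℕ) (t : ℝ) (k : ℤ) : ℂ :=
  Complex.exp (Complex.I * (t : ℂ) * (k : ℂ) ^ (2 * j + 1))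

lemma norm_phase (j : ℕ) (t : ℝ) (k : ℤ) : ‖phase j t k‖ = 1 := by
  have : Complex.I * (t : ℂ) * (k : ℂ) ^ (2 * j + 1)
      = ((t * (k : ℝ) ^ (2 * j + 1) : ℝ) : ℂ) * Complex.I := by
    push_cast; ring
  rw [phase, this, Complex.norm_exp_ofReal_mul_I]

lemma memlp_phase (j : ℕ) (t : ℝ) (a : lp (fun _ : ℤ => ℂ) 2) :
    Memℓp (fun k => phase j t k * a k) 2 := by
  have ha := lp.memℓp a
  rw [memℓp_gen_iff (by norm_num)] at ha ⊢
  simpa [norm_phase] using ha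

/-- Multiplication of the sequence of Fourier coefficients by `phase j t`. -/
def phaseMul (j : ℕ) (t : ℝ) : lp (fun _ : ℤ => ℂ) 2 →ₗᵢ[ℂ] lp (fun _ : ℤ => ℂ) 2 where
  toFun a := ⟨fun k => phase j t k * a k, memlp_phase j t a⟩
  map_add' a b := by
    ext k
    change phase j t k * (a k + b k) = phase j t k * a k + phase j t k * b k
    ring
  map_smul' c a := by
    ext k
    change phase j t k * (c * a k) = c * (phase j t k * a k)
    ring
  norm_map' a := by
    rw [lp.norm_eq_tsum_rpow (by norm_num), lp.norm_eq_tsum_rpow (by norm_num)]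
    simp [norm_phase]

/-- The unitary group `W(t)` on `L²(𝕋)` generated by `-(-1)^{j+1} ∂_x^{2j+1}`. -/
def W (j : ℕ) (t : ℝ) : L2 →L[ℂ] L2 :=
  ((fourierBasis (T := 2 * Real.pi)).repr.symm.toLinearIsometry.comp
    ((phaseMul j t).comp
      (fourierBasis (T := 2 * Real.pi)).repr.toLinearIsometry)).toContinuousLinearMap

lemma hat_W (j : ℕ) (t : ℝ) (f : L2) (k : ℤ) : hat (W j t f) k = phase j t k * hat f k := by
  rw [hat_eq, hat_eq, ← fourierBasis_repr, ← fourierBasis_repr]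
  have : (fourierBasis (T := 2 * Real.pi)).repr (W j t f)
      = phaseMul j t ((fourierBasis (T := 2 * Real.pi)).repr f) :=
    (fourierBasis (T := 2 * Real.pi)).repr.apply_symm_apply _
  rw [this]
  change _ * (phase j t k * _) = _
  ring

lemma bounded_g (g : C(Torus, ℝ)) (x : Torus) : ‖((g x : ℝ) : ℂ)‖ ≤ ‖g‖ := by
  rw [Complex.norm_real]; exact g.norm_coe_le_norm x

lemma memLp_gmul (g : C(Torus, ℝ)) (f : L2) :
    MemLp (fun x => (g x : ℂ) * f x) 2 (AddCircle.haarAddCircle : Measure Torus) :=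
  MemLp.of_le_mul (c := ‖g‖) (Lp.memLp f)
    ((Complex.continuous_ofReal.comp g.continuous).aestronglyMeasurable.mul
      (Lp.aestronglyMeasurable f))
    (Eventually.of_forall fun x => by
      rw [norm_mul]
      exact mul_le_mul_of_nonneg_right (bounded_g g x) (norm_nonneg _))

lemma integrable_gmul (g : C(Torus, ℝ)) (f : L2) :
    Integrable (fun x => (g x : ℂ) * f x) (volume : Measure Torus) := by
  rw [← memLp_one_iff_integrable, ← memLp_haarAddCircle_iff]
  exact (memLp_gmul g f).mono_exponent (by norm_num)

lemma memLp_G (g : C(Torus, ℝ)) (f : L2) :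
    MemLp (fun x => (g x : ℂ) * (f x - ∫ y : Torus, (g y : ℂ) * f y)) 2
      (AddCircle.haarAddCircle : Measure Torus) := by
  have h1 := memLp_gmul g f
  have h2 : MemLp (fun x => (g x : ℂ) * ∫ y : Torus, (g y : ℂ) * f y) 2
      (AddCircle.haarAddCircle : Measure Torus) :=
    MemLp.of_bound (C := ‖g‖ * ‖∫ y : Torus, (g y : ℂ) * f y‖)
      ((Complex.continuous_ofReal.comp g.continuous).aestronglyMeasurable.mul_const _)
      (Eventually.of_forall fun x => by
        rw [norm_mul]
        exact mul_le_mul_of_nonneg_right (bounded_g g x) (norm_nonneg _))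
  have h3 := h1.sub h2
  exact h3.ae_eq (Eventually.of_forall fun x => by simp [mul_sub])

lemma ae_volume_of_haar {p : Torus → Prop}
    (h : ∀ᵐ x ∂(AddCircle.haarAddCircle : Measure Torus), p x) : ∀ᵐ x : Torus, p x := by
  rw [AddCircle.volume_eq_smul_haarAddCircle]
  exact Measure.ae_smul_measure h _

lemma G_bound (g : C(Torus, ℝ)) : ∃ C, ∀ f : L2, ‖(memLp_G g f).toLp _‖ ≤ C * ‖f‖ := by
  have hgm : MemLp (fun x => (g x : ℂ)) 2 (AddCircle.haarAddCircle : Measure Torus) :=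
    MemLp.of_bound (C := ‖g‖) (Complex.continuous_ofReal.comp g.continuous).aestronglyMeasurable
      (Eventually.of_forall (bounded_g g))
  set gL : L2 := hgm.toLp _ with hgL
  have hc : ∀ f : L2, ‖∫ y : Torus, (g y : ℂ) * f y‖ ≤ 2 * Real.pi * (‖gL‖ * ‖f‖) := by
    intro f
    have e1 : ∫ y : Torus, (g y : ℂ) * f y = ((2 * Real.pi : ℝ) : ℂ) * ⟪gL, f⟫_ℂ := by
      rw [L2.inner_def, AddCircle.integral_haarAddCircle, Complex.real_smul, ← mul_assoc,
        ← Complex.ofReal_mul, mul_inv_cancel₀ Real.two_pi_pos.ne', Complex.ofReal_one, one_mul]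
      refine integral_congr_ae ?_
      filter_upwards [ae_volume_of_haar hgm.coeFn_toLp] with x hx
      rw [← hgL] at hx
      rw [hx]
      simp [mul_comm]
    rw [e1, norm_mul, Complex.norm_real, Real.norm_of_nonneg Real.two_pi_pos.le]
    exact mul_le_mul_of_nonneg_left (norm_inner_le_norm _ _) Real.two_pi_pos.le
  refine ⟨‖g‖ + 2 * Real.pi * ‖gL‖ * ‖gL‖, fun f => ?_⟩
  have e2 : (memLp_G g f).toLp _
      = (memLp_gmul g f).toLp _ - (∫ y : Torus, (g y : ℂ) * f y) • gL := by
    rw [hgL, ← MemLp.toLp_const_smul, ← MemLp.toLp_sub, MemLp.toLp_eq_toLp_iff]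
    refine Eventually.of_forall fun x => ?_
    simp only [Pi.sub_apply, Pi.smul_apply, smul_eq_mul]
    ring
  have e3 : ‖(memLp_gmul g f).toLp _‖ ≤ ‖g‖ * ‖f‖ := by
    refine Lp.norm_le_mul_norm_of_ae_le_mul ?_
    filter_upwards [(memLp_gmul g f).coeFn_toLp] with x hx
    rw [hx, norm_mul]
    exact mul_le_mul_of_nonneg_right (bounded_g g x) (norm_nonneg _)
  rw [e2]
  calc _ ≤ ‖(memLp_gmul g f).toLp _‖ + ‖(∫ y : Torus, (g y : ℂ) * f y) • gL‖ := norm_sub_le _ _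
    _ ≤ ‖g‖ * ‖f‖ + 2 * Real.pi * (‖gL‖ * ‖f‖) * ‖gL‖ := by
        rw [norm_smul]
        exact add_le_add e3 (mul_le_mul_of_nonneg_right (hc f) (norm_nonneg _))
    _ = _ := by ring

/-- The operator `(Gf)(x) = g(x) (f(x) - ∫_𝕋 g(y) f(y) dy)` on `L²(𝕋)`. -/
def G (g : C(Torus, ℝ)) : L2 →L[ℂ] L2 :=
  LinearMap.mkContinuousOfExistsBound
    { toFun := fun f => (memLp_G g f).toLp _
      map_add' := fun f₁ f₂ => by
        have hI : ∫ y : Torus, (g y : ℂ) * (f₁ + f₂ : L2) y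
            = (∫ y : Torus, (g y : ℂ) * f₁ y) + ∫ y : Torus, (g y : ℂ) * f₂ y := by
          rw [← integral_add (integrable_gmul g f₁) (integrable_gmul g f₂)]
          refine integral_congr_ae ?_
          filter_upwards [ae_volume_of_haar (Lp.coeFn_add f₁ f₂)] with x hx
          rw [hx, Pi.add_apply, mul_add]
        rw [← MemLp.toLp_add, MemLp.toLp_eq_toLp_iff]
        filter_upwards [Lp.coeFn_add f₁ f₂] with x hx
        simp only [Pi.add_apply] at hx ⊢
        rw [hx, hI]; ring
      map_smul' := fun c f => by
        have hI : ∫ y : Torus, (g y : ℂ) * (c • f : L2) y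
            = c * ∫ y : Torus, (g y : ℂ) * f y := by
          rw [← integral_const_mul]
          refine integral_congr_ae ?_
          filter_upwards [ae_volume_of_haar (Lp.coeFn_smul c f)] with x hx
          rw [hx, Pi.smul_apply, smul_eq_mul]; ring
        rw [RingHom.id_apply, ← MemLp.toLp_const_smul, MemLp.toLp_eq_toLp_iff]
        filter_upwards [Lp.coeFn_smul c f] with x hx
        simp only [Pi.smul_apply, smul_eq_mul] at hx ⊢
        rw [hx, hI]; ring }
    (G_bound g)

lemma coeFn_G (g : C(Torus, ℝ)) (f : L2) :
    G g f =ᵐ[AddCircle.haarAddCircle]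
      fun x => (g x : ℂ) * (f x - ∫ y : Torus, (g y : ℂ) * f y) :=
  (memLp_G g f).coeFn_toLp

/-- For `lam > 0` the operator `∫_0^1 e^{-2 lam τ} W(-τ) G G^* W^*(-τ) dτ`; by convention it is the
identity for `lam = 0`. -/
def L (j : ℕ) (g : C(Torus, ℝ)) (lam : ℝ) (f : L2) : L2 :=
  if lam = 0 then f else
    ∫ τ in (0 : ℝ)..1, (Real.exp (-2 * lam * τ) : ℂ) •
      W j (-τ) (G g ((G g).adjoint ((W j (-τ)).adjoint f)))

/-- The inverse of `L` on the space of mean zero functions. -/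
def LInv (j : ℕ) (g : C(Torus, ℝ)) (lam : ℝ) (f : L2) : L2 :=
  Function.invFunOn (L j g lam) {h | MeanZero h} f

/-- The feedback operator `K_lam = G G^* L_lam^{-1}` on mean zero functions. -/
def K (j : ℕ) (g : C(Torus, ℝ)) (lam : ℝ) (f : L2) : L2 :=
  G g ((G g).adjoint (LInv j g lam f))

/-! Fourier restriction spaces -/

/-- `F` is the space-time Fourier transform of `f`: for almost every `t`,
`f(t,x) = (2π)^{-1} ∑_k ∫_ℝ e^{itτ} e^{ikx} F(τ,k) dτ`, read on Fourier coefficients in `x`. -/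
def IsSpaceTimeFourier (f : ℝ → L2) (F : ℝ → ℤ → ℂ) : Prop :=
  (∀ k, Integrable (fun τ => F τ k)) ∧
  ∀ᵐ t : ℝ, ∀ k : ℤ, hat (f t) k =
    (1 / (Real.sqrt (2 * Real.pi) : ℂ)) *
      ∫ τ : ℝ, Complex.exp (Complex.I * (t : ℂ) * (τ : ℂ)) * F τ k

/-- The `X^{s,b}` norm in terms of the space-time Fourier transform. -/
def xNormF (j : ℕ) (s b : ℝ) (F : ℝ → ℤ → ℂ) : ℝ≥0∞ :=
  (ENNReal.ofReal (1 / (2 * Real.pi)) * ∑' k : ℤ, ∫⁻ τ : ℝ,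
    ENNReal.ofReal (bracket k ^ (2 * s) * bracket (τ - (k : ℝ) ^ (2 * j + 1)) ^ (2 * b)
      * ‖F τ k‖ ^ 2)) ^ (1 / 2 : ℝ)

/-- The norm `‖⟨k⟩^s F‖` in `ℓ²_k L¹_τ`. -/
def l2L1NormF (s : ℝ) (F : ℝ → ℤ → ℂ) : ℝ≥0∞ :=
  (∑' k : ℤ, (∫⁻ τ : ℝ, ENNReal.ofReal (bracket k ^ s * ‖F τ k‖)) ^ 2) ^ (1 / 2 : ℝ)

/-- For `s ≥ 0`, the `Y^s` norm of `f : ℝ → L²(𝕋)`, with value `⊤` when `f` is not in `Y^s`. The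
infimum only serves to name the space-time Fourier transform, which `f` determines almost
everywhere. -/
def yNorm (j : ℕ) (s : ℝ) (f : ℝ → L2) : ℝ≥0∞ :=
  ⨅ (F : ℝ → ℤ → ℂ) (_ : IsSpaceTimeFourier f F), xNormF j s (1 / 2) F + l2L1NormF s F

/-- The norm of `Y^s_T`, the localisation of `Y^s` to the time interval `(0,T)`. -/
def yNormT (j : ℕ) (s T : ℝ) (f : ℝ → L2) : ℝ≥0∞ :=
  ⨅ (h : ℝ → L2) (_ : ∀ᵐ t ∂(volume.restrict (Ioo 0 T)), h t = f t), yNorm j s h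

/-- `f` restricts to an element of `C([0,T]; H^s)`. -/
def IsContHs (s T : ℝ) (f : ℝ → L2) : Prop :=
  (∀ t ∈ Icc 0 T, MemHs s (f t)) ∧
  ∀ t₀ ∈ Icc 0 T, Tendsto (fun t => hsNorm s (f t - f t₀)) (𝓝[Icc 0 T] t₀) (𝓝 0)

/-- `u` solves `∂_t u + (-1)^{j+1} ∂_x^{2j+1} u + u u_x = -K_lam u` on `[0,T]` with `u(0) = u₀`, in
the integral form
`u(t) = W(t)u₀ - ∫_0^t W(t-τ) K_lam u(τ) dτ - ∫_0^t W(t-τ) (∂_x(u²)/2)(τ) dτ`.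
The equality holds in the sense of distributions in `x`: coefficient by coefficient. -/
def IsMildSolution (j : ℕ) (g : C(Torus, ℝ)) (lam T : ℝ) (u₀ : L2) (u : ℝ → L2) : Prop :=
  ∀ t ∈ Icc 0 T, ∀ k : ℤ,
    hat (u t) k = phase j t k * hat u₀ k
      - (∫ τ in (0 : ℝ)..t, phase j (t - τ) k * hat (K j g lam (u τ)) k)
      - ∫ τ in (0 : ℝ)..t, phase j (t - τ) k *
          ((1 / 2 : ℂ) * (Complex.I * (k : ℂ)) * hat (fun x => (u τ x) ^ 2) k)

/-- `u` is a real-valued solution with datum `u₀` in the class `Y^s_T ∩ C([0,T]; H^s)`. -/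
structure IsSolution (j : ℕ) (g : C(Torus, ℝ)) (lam s T : ℝ) (u₀ : L2) (u : ℝ → L2) : Prop where
  real : ∀ t ∈ Icc 0 T, IsRealValued (u t)
  memY : yNormT j s T u < ⊤
  cont : IsContHs s T u
  eqn : IsMildSolution j g lam T u₀ u

end

end PeriodicKdV

/-!
The equation is solved on the Fourier side. A function of space and time is represented by
`U : ℤ × ℝ → ℂ`, its space-time Fourier transform up to a constant, and `ev U t k` is the `k`-th
Fourier coefficient at time `t`. The operator `K_λ` becomes a matrix `κ`, of which only the
properties collected in `FeedbackMatrix` matter: it is bounded on every `H^s` with `s ≥ 0`, it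
commutes with complex conjugation, and its values have mean zero.

*The bilinear estimate.* The integers `p ^ (2j+1) + (n - p) ^ (2j+1)` are well separated, up to the
reflection `p ↦ n - p` (`resonance_int`). Therefore the weights `⟨τ - k ^ (2j+1)⟩ ^ (-7/8)` have a
bounded convolution off the zero mode (`exists_kernel_bound`), and Cauchy-Schwarz gives a Strichartz
estimate for products (`exists_strichartz`). By the resonance identity, the modulation of one of the
three frequencies in a product is large enough to pay for the derivative in `∂ₓ(uv)`. The weights
`M + |τ - k ^ (2j+1)|` describe functions on a time interval of length `1/M`; since the Strichartz
estimate needs only the power `7/16` of the weight, and `1/2` is available, the bilinear estimate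
gains `M ^ (-1/16)` (`exists_bilinear`).

*Short times.* Integration in time is bounded from the space `Z_M` of forcing terms to `Y_M`
(`yn_Duh_le`). For large `M` the gain makes the Picard map a contraction, and `M` depends on the size
of the datum in `L²` only, because the estimates in `H^s` are linear in the highest norm
(`exists_picard_bounds`, `exists_fixed_point`). The difference of two solutions, cut off in time, is
reproduced by a map that halves its norm, hence solutions are unique (`CoeffSolution.unique`), and
they are real-valued if the datum is (`CoeffSolution.real`).

*Global existence.* The equation truncated to finitely many frequencies is solved by the same
argument. There the nonlinear term does not contribute to the energy balance, and the feedback lets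
the `L²` norm grow at most exponentially (`galerkin_energy`). The bound passes to the limit
(`exists_local_solution`). So the existence time stays bounded below on `[0,T]`, and finitely many
local solutions, glued by cutoffs, give a solution on `[0,T]` whose norm in `Y^s` is bounded linearly
by the norm of the datum in `H^s` (`exists_global_solution`).

*The feedback operator.* The matrix of `G G^*` decays rapidly away from the diagonal, and its diagonal
entries tend to the mean of `g²`. In the matrix of `L_λ` the entries off the diagonal carry an
oscillating integral in time, which gains a derivative. So, completed by the identity on constants,
`L_λ` is a positive constant plus a smoothing, hence compact, operator (`smoothing_gramRem`), and the
Fredholm alternative applies. The kernel is finite dimensional, consists of smooth functions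
annihilated by `G W(τ)` for `τ` in `[0,1]`, and is invariant under `∂_x^{2j+1}`; if it were not
trivial, it would contain a single exponential annihilated by `G`, which the decay of the Fourier
coefficients of `g` excludes (`G_expo_ne_zero`, `fullGram_injective`). The inverse is bounded on
every `H^s` because the smoothing part gains a derivative (`exists_bound_inverse`), which gives the
matrix `κ` (`exists_feedbackMatrix`).
-/

namespace PeriodicKdV

/-! ### Resonance estimates for the dispersion relation -/

/-- The pair `(e, o)` of polynomials in `n` and `X` for which
`(n + x) ^ (2j+1) = e (n, x²) + x * o (n, x²)`. Their coefficients are nonnegative, which is what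
makes `e` monotone in `X`. -/
def oddPowParts (n X : ℤ) : ℕ → ℤ × ℤ
  | 0 => (n, 1)
  | j + 1 => ((n ^ 2 + X) * (oddPowParts n X j).1 + 2 * n * X * (oddPowParts n X j).2,
      2 * n * (oddPowParts n X j).1 + (n ^ 2 + X) * (oddPowParts n X j).2)

lemma add_pow_eq_oddPowParts (n x : ℤ) (j : ℕ) :
    (n + x) ^ (2 * j + 1) = (oddPowParts n (x ^ 2) j).1 + x * (oddPowParts n (x ^ 2) j).2 := by
  induction j with
  | zero => simp [oddPowParts]
  | succ j ih =>
    rw [show 2 * (j + 1) + 1 = (2 * j + 1) + 2 by ring, pow_add, ih]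
    simp only [oddPowParts]
    ring

lemma oddPowParts_mono {n X Y : ℤ} (hn : 0 ≤ n) (hY : 0 ≤ Y) (hXY : Y ≤ X) (j : ℕ) :
    0 ≤ (oddPowParts n Y j).1 ∧ 0 ≤ (oddPowParts n Y j).2 ∧
      (oddPowParts n Y j).1 ≤ (oddPowParts n X j).1 ∧
      (oddPowParts n Y j).2 ≤ (oddPowParts n X j).2 := by
  have hX : 0 ≤ X := hY.trans hXY
  induction j with
  | zero => simp [oddPowParts, hn]
  | succ j ih =>
    obtain ⟨h1, h2, h3, h4⟩ := ih
    simp only [oddPowParts]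
    refine ⟨by positivity, by positivity, ?_, ?_⟩
    · gcongr
    · gcongr

lemma oddPowParts_sub_le {n X Y : ℤ} (hn : 0 ≤ n) (hY : 0 ≤ Y) (hXY : Y ≤ X)
    (h4 : 4 ≤ n ^ 2 + X) (j : ℕ) :
    4 ^ j * (3 * n * (X - Y)) ≤ (oddPowParts n X (j + 1)).1 - (oddPowParts n Y (j + 1)).1 := by
  have hX : 0 ≤ X := hY.trans hXY
  induction j with
  | zero => simp only [oddPowParts]; ring_nf; rfl
  | succ j ih =>
    obtain ⟨h1, h2, h3, h5⟩ := oddPowParts_mono hn hY hXY (j + 1)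
    have r : ∀ Z : ℤ, (oddPowParts n Z (j + 1 + 1)).1 = (n ^ 2 + Z) * (oddPowParts n Z (j + 1)).1
        + 2 * n * Z * (oddPowParts n Z (j + 1)).2 := fun Z => rfl
    rw [r, r]
    set a := (oddPowParts n X (j + 1)).1
    set b := (oddPowParts n Y (j + 1)).1
    set c := (oddPowParts n X (j + 1)).2
    set d := (oddPowParts n Y (j + 1)).2
    have e1 : Y * d ≤ X * c := mul_le_mul hXY h5 h2 hX
    have e2 : 0 ≤ 2 * n * (X * c - Y * d) := by
      have := sub_nonneg.2 e1; positivity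
    have e3 : 0 ≤ (X - Y) * b := mul_nonneg (sub_nonneg.2 hXY) h1
    have e4 : 0 ≤ (n ^ 2 + X - 4) * (a - b) :=
      mul_nonneg (sub_nonneg.2 h4) (sub_nonneg.2 h3)
    have e5 : (4 : ℤ) ^ (j + 1) * (3 * n * (X - Y)) = 4 * (4 ^ j * (3 * n * (X - Y))) := by ring
    rw [e5]
    nlinarith

lemma resonance_int_of_nonneg {j : ℕ} (hj : 1 ≤ j) {n : ℤ} (hn : 0 ≤ n) (p q : ℤ) :
    3 * |n| * |p - q| * |p + q - n|
      ≤ |(p ^ (2 * j + 1) + (n - p) ^ (2 * j + 1)) - (q ^ (2 * j + 1) + (n - q) ^ (2 * j + 1))| := by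
  wlog h : (2 * q - n) ^ 2 ≤ (2 * p - n) ^ 2 generalizing p q
  · have := this q p (le_of_not_ge h)
    rw [abs_sub_comm p q, add_comm p q, abs_sub_comm (_ + _) (_ + _)]
    exact this
  obtain ⟨i, rfl⟩ : ∃ i, j = i + 1 := ⟨j - 1, by omega⟩
  have key : ∀ r : ℤ, (2 : ℤ) ^ (2 * (i + 1) + 1) *
      (r ^ (2 * (i + 1) + 1) + (n - r) ^ (2 * (i + 1) + 1))
      = 2 * (oddPowParts n ((2 * r - n) ^ 2) (i + 1)).1 := by
    intro r
    rw [mul_add, ← mul_pow, ← mul_pow]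
    have h1 := add_pow_eq_oddPowParts n (2 * r - n) (i + 1)
    have h2 := add_pow_eq_oddPowParts n (-(2 * r - n)) (i + 1)
    rw [neg_sq] at h2
    rw [show n + (2 * r - n) = 2 * r by ring] at h1
    rw [show n + -(2 * r - n) = 2 * (n - r) by ring] at h2
    rw [h1, h2]; ring
  rcases eq_or_lt_of_le hn with rfl | hn0
  · simp
  rcases eq_or_lt_of_le h with heq | hlt
  · have : (p - q) * (p + q - n) = 0 := by nlinarith
    rw [mul_assoc, ← abs_mul, this]; simp
  -- the two squares have the parity of `n`, so the larger one is at least `9` when `n = 1`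
  have h4 : 4 ≤ n ^ 2 + (2 * p - n) ^ 2 := by
    rcases (show n = 1 ∨ 2 ≤ n by omega) with rfl | h2
    · have : 1 ≤ (2 * q - 1) ^ 2 := by
        have : 2 * q - 1 ≠ 0 := by omega
        have := sq_pos_of_ne_zero this
        omega
      have h3 : 4 ≤ (2 * p - 1) ^ 2 ∨ (2 * p - 1) ^ 2 < 4 := le_or_gt _ _
      rcases h3 with h3 | h3
      · omega
      · have : 2 * p - 1 < 2 := by nlinarith
        have : -2 < 2 * p - 1 := by nlinarith
        have : p = 0 ∨ p = 1 := by omega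
        rcases this with rfl | rfl <;> omega
    · nlinarith [sq_nonneg (2 * p - n)]
  have h5 := oddPowParts_sub_le hn (sq_nonneg (2 * q - n)) h h4 i
  have h6 := key p
  have h7 := key q
  have h8 : (2 : ℤ) ^ (2 * (i + 1) + 1) = 8 * 4 ^ i := by
    rw [show 2 * (i + 1) + 1 = 2 * i + 3 by ring, pow_add, pow_mul]; norm_num; ring
  rw [h8] at h6 h7
  have hpos : (0 : ℤ) < 4 ^ i := by positivity
  set A := p ^ (2 * (i + 1) + 1) + (n - p) ^ (2 * (i + 1) + 1)
  set B := q ^ (2 * (i + 1) + 1) + (n - q) ^ (2 * (i + 1) + 1)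
  have h9 : 4 ^ i * (3 * n * ((p - q) * (p + q - n))) ≤ 4 ^ i * (A - B) := by nlinarith
  have h10 := le_of_mul_le_mul_left h9 hpos
  have h11 : 0 ≤ (p - q) * (p + q - n) := by nlinarith
  calc 3 * |n| * |p - q| * |p + q - n| = 3 * n * ((p - q) * (p + q - n)) := by
        rw [abs_of_nonneg hn, mul_assoc, ← abs_mul, abs_of_nonneg h11]
    _ ≤ A - B := h10
    _ ≤ _ := le_abs_self _

/-- The values of `p ↦ p ^ (2j+1) + (n - p) ^ (2j+1)` are separated, up to the reflection
`p ↦ n - p`, at least as well as for the cubic power. -/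
lemma resonance_int {j : ℕ} (hj : 1 ≤ j) (n p q : ℤ) :
    3 * |n| * |p - q| * |p + q - n|
      ≤ |(p ^ (2 * j + 1) + (n - p) ^ (2 * j + 1)) - (q ^ (2 * j + 1) + (n - q) ^ (2 * j + 1))| := by
  rcases le_total 0 n with hn | hn
  · exact resonance_int_of_nonneg hj hn p q
  · have h := resonance_int_of_nonneg hj (neg_nonneg.2 hn) (-p) (-q)
    have ho : Odd (2 * j + 1) := ⟨j, rfl⟩
    have e1 : -n - -p = -(n - p) := by ring
    have e2 : -n - -q = -(n - q) := by ring
    rw [e1, e2, ho.neg_pow, ho.neg_pow, ho.neg_pow, ho.neg_pow, abs_neg] at h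
    rw [show -p - -q = -(p - q) by ring, show -p + -q - -n = -(p + q - n) by ring, abs_neg,
      abs_neg] at h
    refine h.trans (le_of_eq ?_)
    rw [← abs_neg]
    congr 1
    ring

lemma resonance_real {j : ℕ} (hj : 1 ≤ j) (n p q : ℤ) :
    3 * |(n : ℝ)| * |(p : ℝ) - q| * |(p : ℝ) + q - n|
      ≤ |((p : ℝ) ^ (2 * j + 1) + ((n : ℝ) - p) ^ (2 * j + 1))
        - ((q : ℝ) ^ (2 * j + 1) + ((n : ℝ) - q) ^ (2 * j + 1))| := by
  exact_mod_cast resonance_int hj n p q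

/-- The three modulations that meet in a quadratic interaction cannot all be small. -/
lemma resonance_three {j : ℕ} (hj : 1 ≤ j) (k l : ℤ) :
    3 * (|(k : ℝ)| * |(l : ℝ)| * |(k : ℝ) - l|)
      ≤ |(k : ℝ) ^ (2 * j + 1) - (l : ℝ) ^ (2 * j + 1) - ((k : ℝ) - l) ^ (2 * j + 1)| := by
  have h := resonance_real hj k 0 l
  simp only [Int.cast_zero, zero_sub, zero_add, sub_zero, abs_neg, ne_eq, Nat.add_eq_zero_iff,
    mul_eq_zero, OfNat.ofNat_ne_zero, false_or, one_ne_zero, and_false, not_false_eq_true,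
    zero_pow] at h
  rw [abs_sub_comm (k : ℝ) l, sub_sub, ← mul_assoc, ← mul_assoc]
  exact h

/-! ### The kernel of the `L⁴` Strichartz estimate -/

lemma lintegral_decay_lt_top :
    ∫⁻ τ : ℝ, ENNReal.ofReal ((1 + |τ|) ^ (-(9 / 8) : ℝ)) < ⊤ := by
  have h : Integrable (fun x : ℝ => (1 + ‖x‖) ^ (-(9 / 8 : ℝ))) :=
    integrable_one_add_norm (by simp; norm_num)
  exact (hasFiniteIntegral_iff_ofReal (Eventually.of_forall fun x => by positivity)).1 h.2

lemma tsum_decay_lt_top :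
    ∑' q : ℤ, ENNReal.ofReal ((1 + (q : ℝ) ^ 2) ^ (-(5 / 8) : ℝ)) < ⊤ := by
  have h1 : Summable fun q : ℤ => |(q : ℝ)| ^ (-(5 / 4) : ℝ) :=
    Real.summable_abs_int_rpow (by norm_num)
  have h2 : Summable fun q : ℤ => (1 + (q : ℝ) ^ 2) ^ (-(5 / 8) : ℝ) := by
    have h3 : Summable fun q : ℤ => |(q : ℝ)| ^ (-(5 / 4) : ℝ) + if q = 0 then (1 : ℝ) else 0 :=
      h1.add (summable_of_ne_finset_zero (s := {0}) fun b hb => by simp at hb; simp [hb])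
    refine Summable.of_nonneg_of_le (fun q => by positivity) (fun q => ?_) h3
    split_ifs with hq
    · subst hq; simp
    · have hq' : (0 : ℝ) < |(q : ℝ)| := by simpa using hq
      rw [add_zero, show (-(5 / 4) : ℝ) = 2 * (-(5 / 8)) by norm_num, Real.rpow_mul hq'.le]
      apply Real.rpow_le_rpow_of_nonpos (by positivity) _ (by norm_num)
      rw [Real.rpow_two, sq_abs]; linarith
  rw [← ENNReal.ofReal_tsum_of_nonneg (fun q => by positivity) h2]
  exact ENNReal.ofReal_lt_top

lemma mul_rpow_le_of_add_le {x y z : ℝ} (hx : 0 < x) (hy : 0 < y) (hz : 0 < z)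
    (h : z ≤ x + y) :
    x ^ (-(7 / 8) : ℝ) * y ^ (-(7 / 8) : ℝ)
      ≤ 2 * z ^ (-(5 / 8) : ℝ) * (x ^ (-(9 / 8) : ℝ) + y ^ (-(9 / 8) : ℝ)) := by
  wlog hxy : y ≤ x generalizing x y
  · have := this hy hx (by linarith) (le_of_not_ge hxy)
    rw [mul_comm, add_comm (x ^ _)]; exact this
  have h1 : x ^ (-(7 / 8) : ℝ) = x ^ (-(5 / 8) : ℝ) * x ^ (-(1 / 4) : ℝ) := by
    rw [← Real.rpow_add hx]; norm_num
  have h2 : y ^ (-(9 / 8) : ℝ) = y ^ (-(1 / 4) : ℝ) * y ^ (-(7 / 8) : ℝ) := by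
    rw [← Real.rpow_add hy]; norm_num
  have h3 : x ^ (-(1 / 4) : ℝ) ≤ y ^ (-(1 / 4) : ℝ) :=
    Real.rpow_le_rpow_of_nonpos hy hxy (by norm_num)
  have h4 : x ^ (-(5 / 8) : ℝ) ≤ 2 * z ^ (-(5 / 8) : ℝ) := by
    have : x ^ (-(5 / 8) : ℝ) ≤ (z / 2) ^ (-(5 / 8) : ℝ) :=
      Real.rpow_le_rpow_of_nonpos (by positivity) (by linarith) (by norm_num)
    refine this.trans ?_
    rw [Real.div_rpow hz.le (by norm_num), div_eq_mul_inv, ← Real.rpow_neg (by norm_num), mul_comm]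
    gcongr
    calc (2 : ℝ) ^ (-(-(5 / 8)) : ℝ) ≤ 2 ^ (1 : ℝ) :=
          Real.rpow_le_rpow_of_exponent_le (by norm_num) (by norm_num)
      _ = 2 := by norm_num
  rw [h1]
  have hx9 : 0 ≤ x ^ (-(9 / 8) : ℝ) := by positivity
  calc x ^ (-(5 / 8) : ℝ) * x ^ (-(1 / 4) : ℝ) * y ^ (-(7 / 8) : ℝ)
      ≤ (2 * z ^ (-(5 / 8) : ℝ)) * y ^ (-(1 / 4) : ℝ) * y ^ (-(7 / 8) : ℝ) := by gcongr
    _ = 2 * z ^ (-(5 / 8) : ℝ) * y ^ (-(9 / 8) : ℝ) := by rw [h2]; ring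
    _ ≤ _ := by gcongr; linarith

lemma lintegral_two_decay_le (a b : ℝ) :
    ∫⁻ τ : ℝ, ENNReal.ofReal ((1 + |τ - a|) ^ (-(7 / 8) : ℝ) * (1 + |b - τ|) ^ (-(7 / 8) : ℝ))
      ≤ (4 * ∫⁻ τ : ℝ, ENNReal.ofReal ((1 + |τ|) ^ (-(9 / 8) : ℝ)))
        * ENNReal.ofReal ((1 + |b - a|) ^ (-(5 / 8) : ℝ)) := by
  set I := ∫⁻ τ : ℝ, ENNReal.ofReal ((1 + |τ|) ^ (-(9 / 8) : ℝ))
  have hI1 : ∫⁻ τ : ℝ, ENNReal.ofReal ((1 + |τ - a|) ^ (-(9 / 8) : ℝ)) = I :=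
    lintegral_sub_right_eq_self (fun τ : ℝ => ENNReal.ofReal ((1 + |τ|) ^ (-(9 / 8) : ℝ))) a
  have hI2 : ∫⁻ τ : ℝ, ENNReal.ofReal ((1 + |b - τ|) ^ (-(9 / 8) : ℝ)) = I :=
    lintegral_sub_left_eq_self (fun τ : ℝ => ENNReal.ofReal ((1 + |τ|) ^ (-(9 / 8) : ℝ))) b
  calc _ ≤ ∫⁻ τ : ℝ, ENNReal.ofReal (2 * (1 + |b - a|) ^ (-(5 / 8) : ℝ)) *
        (ENNReal.ofReal ((1 + |τ - a|) ^ (-(9 / 8) : ℝ))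
          + ENNReal.ofReal ((1 + |b - τ|) ^ (-(9 / 8) : ℝ))) := by
        refine lintegral_mono fun τ => ?_
        rw [← ENNReal.ofReal_add (by positivity) (by positivity),
          ← ENNReal.ofReal_mul (by positivity)]
        refine ENNReal.ofReal_le_ofReal (mul_rpow_le_of_add_le (by positivity) (by positivity)
          (by positivity) ?_)
        have : |b - a| ≤ |τ - a| + |b - τ| := by
          rw [show b - a = (τ - a) + (b - τ) by ring]; exact abs_add_le _ _
        linarith
    _ = ENNReal.ofReal (2 * (1 + |b - a|) ^ (-(5 / 8) : ℝ)) * (I + I) := by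
        rw [lintegral_const_mul _ (by fun_prop), lintegral_add_left (by fun_prop), hI1, hI2]
    _ = _ := by
        rw [ENNReal.ofReal_mul (by norm_num), ← two_mul]
        norm_num
        ring

lemma tsum_decay_resonance_le {j : ℕ} (hj : 1 ≤ j) {n : ℤ} (hn : n ≠ 0) (c : ℝ) :
    ∑' p : ℤ, ENNReal.ofReal
        ((1 + |c - ((p : ℝ) ^ (2 * j + 1) + ((n : ℝ) - p) ^ (2 * j + 1))|) ^ (-(5 / 8) : ℝ))
      ≤ 2 * ∑' q : ℤ, ENNReal.ofReal ((1 + (q : ℝ) ^ 2) ^ (-(5 / 8) : ℝ)) := by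
  set h : ℤ → ℝ := fun p => (p : ℝ) ^ (2 * j + 1) + ((n : ℝ) - p) ^ (2 * j + 1) with hh
  set f : ℤ → ℝ≥0∞ := fun q => ENNReal.ofReal ((1 + (q : ℝ) ^ 2) ^ (-(5 / 8) : ℝ)) with hf
  rw [ENNReal.tsum_eq_iSup_sum]
  refine iSup_le fun s => ?_
  rcases s.eq_empty_or_nonempty with rfl | hs
  · simp
  -- all frequencies are compared with the most resonant one
  obtain ⟨p₀, -, hp₀⟩ := s.exists_min_image (fun p => |c - h p|) hs
  have hpt : ∀ p ∈ s, ENNReal.ofReal ((1 + |c - h p|) ^ (-(5 / 8) : ℝ))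
      ≤ f (p - p₀) + f (p - (n - p₀)) := by
    intro p hp
    have h1 := resonance_real hj n p p₀
    have h2 : |h p - h p₀| ≤ |c - h p₀| + |c - h p| := by
      rw [show h p - h p₀ = (c - h p₀) - (c - h p) by ring]; exact abs_sub _ _
    have h3 := hp₀ p hp
    have hn1 : (1 : ℝ) ≤ |(n : ℝ)| := by exact_mod_cast Int.one_le_abs hn
    have h4 : |(p : ℝ) - p₀| * |(p : ℝ) + p₀ - n| ≤ |c - h p| := by
      have h5 : |(p : ℝ) - p₀| * |(p : ℝ) + p₀ - n|
          ≤ |(n : ℝ)| * (|(p : ℝ) - p₀| * |(p : ℝ) + p₀ - n|) :=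
        le_mul_of_one_le_left (by positivity) hn1
      have h6 : 0 ≤ |(p : ℝ) - p₀| * |(p : ℝ) + p₀ - n| := by positivity
      change _ ≤ |h p - h p₀| at h1
      nlinarith
    rcases le_total |(p : ℝ) - p₀| |(p : ℝ) + p₀ - n| with hle | hle
    · refine le_trans ?_ le_self_add
      refine ENNReal.ofReal_le_ofReal
        (Real.rpow_le_rpow_of_nonpos (by positivity) ?_ (by norm_num))
      push_cast
      have : ((p : ℝ) - p₀) ^ 2 ≤ |(p : ℝ) - p₀| * |(p : ℝ) + p₀ - n| := by
        rw [← sq_abs, sq]; gcongr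
      linarith
    · refine le_trans ?_ le_add_self
      refine ENNReal.ofReal_le_ofReal
        (Real.rpow_le_rpow_of_nonpos (by positivity) ?_ (by norm_num))
      push_cast
      have : ((p : ℝ) - (n - p₀)) ^ 2 ≤ |(p : ℝ) - p₀| * |(p : ℝ) + p₀ - n| := by
        rw [show (p : ℝ) - (n - p₀) = p + p₀ - n by ring, ← sq_abs, sq]; gcongr
      linarith
  calc _ ≤ ∑ p ∈ s, (f (p - p₀) + f (p - (n - p₀))) := Finset.sum_le_sum hpt
    _ ≤ ∑' p : ℤ, (f (p - p₀) + f (p - (n - p₀))) := ENNReal.sum_le_tsum s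
    _ = (∑' p : ℤ, f (p - p₀)) + ∑' p : ℤ, f (p - (n - p₀)) := ENNReal.tsum_add
    _ = 2 * ∑' q : ℤ, f q := by
        rw [two_mul]
        exact congrArg₂ (· + ·) ((Equiv.subRight p₀).tsum_eq f)
          ((Equiv.subRight (n - p₀)).tsum_eq f)

/-- The modulation `τ - k ^ (2j+1)` of a space-time frequency `(k, τ)`. -/
def modul (j : ℕ) (ξ : ℤ × ℝ) : ℝ := ξ.2 - (ξ.1 : ℝ) ^ (2 * j + 1)

/-- The weight `M + |τ - k ^ (2j+1)|`. A large `M` corresponds to a short time interval, of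
length `1 / M`. -/
def wt (j : ℕ) (M : ℝ) (ξ : ℤ × ℝ) : ℝ≥0∞ := ENNReal.ofReal (M + |modul j ξ|)

lemma measurable_of_int_prod {α : Type*} [MeasurableSpace α] {f : ℤ × ℝ → α}
    (h : ∀ k, Measurable fun τ => f (k, τ)) : Measurable f :=
  measurable_from_prod_countable_right h

@[fun_prop]
lemma measurable_modul (j : ℕ) : Measurable (modul j) :=
  measurable_of_int_prod fun k => by unfold modul; fun_prop

@[fun_prop]
lemma measurable_wt (j : ℕ) (M : ℝ) : Measurable (wt j M) := by
  unfold wt; fun_prop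

/-- The Haar measure on the group `ℤ × ℝ` of space-time frequencies. -/
noncomputable abbrev freqMeasure : Measure (ℤ × ℝ) := (Measure.count : Measure ℤ).prod volume

lemma lintegral_int_prod {f : ℤ × ℝ → ℝ≥0∞} (hf : Measurable f) :
    ∫⁻ ξ, f ξ ∂freqMeasure = ∑' k : ℤ, ∫⁻ τ : ℝ, f (k, τ) := by
  rw [lintegral_prod _ hf.aemeasurable]
  exact lintegral_count _

/-- The kernel bound behind the Strichartz estimate: two modulation weights, raised to a power
slightly larger than `-1`, have bounded convolution off the zero mode. -/
lemma exists_kernel_bound {j : ℕ} (hj : 1 ≤ j) : ∃ C : ℝ≥0, ∀ ξ : ℤ × ℝ, ξ.1 ≠ 0 →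
    ∫⁻ η : ℤ × ℝ, wt j 1 η ^ (-(7 / 8) : ℝ) * wt j 1 (ξ - η) ^ (-(7 / 8) : ℝ) ∂freqMeasure ≤ C := by
  set I := ∫⁻ τ : ℝ, ENNReal.ofReal ((1 + |τ|) ^ (-(9 / 8) : ℝ))
  set S := ∑' q : ℤ, ENNReal.ofReal ((1 + (q : ℝ) ^ 2) ^ (-(5 / 8) : ℝ))
  have hfin : 4 * I * (2 * S) ≠ ⊤ :=
    ENNReal.mul_ne_top (ENNReal.mul_ne_top (by norm_num) lintegral_decay_lt_top.ne)
      (ENNReal.mul_ne_top (by norm_num) tsum_decay_lt_top.ne)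
  refine ⟨(4 * I * (2 * S)).toNNReal, fun ξ hξ => ?_⟩
  rw [ENNReal.coe_toNNReal hfin]
  obtain ⟨n, c⟩ := ξ
  rw [lintegral_int_prod (by fun_prop)]
  calc _ ≤ ∑' p : ℤ, 4 * I * ENNReal.ofReal
        ((1 + |c - ((p : ℝ) ^ (2 * j + 1) + ((n : ℝ) - p) ^ (2 * j + 1))|) ^ (-(5 / 8) : ℝ)) := by
        refine ENNReal.tsum_le_tsum fun p => ?_
        have h := lintegral_two_decay_le ((p : ℝ) ^ (2 * j + 1)) (c - ((n : ℝ) - p) ^ (2 * j + 1))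
        rw [show c - ((n : ℝ) - p) ^ (2 * j + 1) - (p : ℝ) ^ (2 * j + 1)
          = c - ((p : ℝ) ^ (2 * j + 1) + ((n : ℝ) - p) ^ (2 * j + 1)) by ring] at h
        refine le_trans (le_of_eq (lintegral_congr fun τ => ?_)) h
        simp only [wt, modul, Prod.fst_sub, Prod.snd_sub, Int.cast_sub]
        rw [ENNReal.ofReal_rpow_of_pos (by positivity), ENNReal.ofReal_rpow_of_pos (by positivity),
          ← ENNReal.ofReal_mul (by positivity)]
        congr 5
        ring_nf
    _ ≤ 4 * I * (2 * S) := by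
        rw [ENNReal.tsum_mul_left]
        gcongr
        exact tsum_decay_resonance_le hj hξ c

/-! ### Quadratic means of extended nonnegative functions -/

section L2Norm

variable {α β : Type*} [MeasurableSpace α] [MeasurableSpace β] {μ : Measure α} {ν : Measure β}

/-- The `L²` norm of an extended nonnegative function. -/
noncomputable def nrm (μ : Measure α) (f : α → ℝ≥0∞) : ℝ≥0∞ := (∫⁻ x, f x ^ 2 ∂μ) ^ (1 / 2 : ℝ)

lemma rpow_half_sq (x : ℝ≥0∞) : (x ^ (1 / 2 : ℝ)) ^ 2 = x := by
  rw [← ENNReal.rpow_natCast, ← ENNReal.rpow_mul]; norm_num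

lemma sq_rpow_half (x : ℝ≥0∞) : (x ^ 2) ^ (1 / 2 : ℝ) = x := by
  rw [← ENNReal.rpow_natCast, ← ENNReal.rpow_mul]; norm_num

lemma nrm_sq (f : α → ℝ≥0∞) : nrm μ f ^ 2 = ∫⁻ x, f x ^ 2 ∂μ := rpow_half_sq _

lemma nrm_le_of_sq_le {f : α → ℝ≥0∞} {A : ℝ≥0∞} (h : ∫⁻ x, f x ^ 2 ∂μ ≤ A ^ 2) :
    nrm μ f ≤ A := by
  rw [← sq_rpow_half A]
  exact ENNReal.rpow_le_rpow h (by norm_num)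

lemma nrm_mono_ae {f g : α → ℝ≥0∞} (h : ∀ᵐ x ∂μ, f x ≤ g x) : nrm μ f ≤ nrm μ g := by
  refine ENNReal.rpow_le_rpow (lintegral_mono_ae ?_) (by norm_num)
  filter_upwards [h] with x hx
  gcongr

lemma nrm_mono {f g : α → ℝ≥0∞} (h : ∀ x, f x ≤ g x) : nrm μ f ≤ nrm μ g :=
  nrm_mono_ae (Eventually.of_forall h)

@[simp] lemma nrm_zero : nrm μ (fun _ => 0) = 0 := by simp [nrm]

lemma nrm_add_le {f g : α → ℝ≥0∞} (hf : AEMeasurable f μ) (hg : AEMeasurable g μ) :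
    nrm μ (fun x => f x + g x) ≤ nrm μ f + nrm μ g := by
  have h := ENNReal.lintegral_Lp_add_le (p := 2) hf hg (by norm_num)
  simpa [nrm] using h

lemma nrm_const_mul (c : ℝ≥0∞) {f : α → ℝ≥0∞} (hf : AEMeasurable f μ) :
    nrm μ (fun x => c * f x) = c * nrm μ f := by
  simp only [nrm, mul_pow]
  rw [lintegral_const_mul'' _ (hf.pow_const 2), ENNReal.mul_rpow_of_nonneg _ _ (by norm_num),
    sq_rpow_half]

lemma nrm_const_mul_le (c : ℝ≥0) (f : α → ℝ≥0∞) :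
    nrm μ (fun x => c * f x) ≤ c * nrm μ f := by
  simp only [nrm, mul_pow]
  rw [lintegral_const_mul' _ _ (by simp), ENNReal.mul_rpow_of_nonneg _ _ (by norm_num),
    sq_rpow_half]

lemma lintegral_mul_le_nrm {f g : α → ℝ≥0∞} (hf : AEMeasurable f μ) (hg : AEMeasurable g μ) :
    ∫⁻ x, f x * g x ∂μ ≤ nrm μ f * nrm μ g := by
  have h := ENNReal.lintegral_mul_le_Lp_mul_Lq μ Real.HolderConjugate.two_two hf hg
  simpa [nrm] using h

lemma sq_lintegral_mul_le {f g : α → ℝ≥0∞} (hf : AEMeasurable f μ) (hg : AEMeasurable g μ) :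
    (∫⁻ x, f x * g x ∂μ) ^ 2 ≤ (∫⁻ x, f x ^ 2 ∂μ) * ∫⁻ x, g x ^ 2 ∂μ := by
  rw [← nrm_sq, ← nrm_sq, ← mul_pow]
  gcongr
  exact lintegral_mul_le_nrm hf hg

/-- Minkowski's inequality for superpositions of functions with a common bound. -/
lemma nrm_lintegral_le [SFinite μ] [SFinite ν] {p : β → ℝ≥0∞} {F : β → α → ℝ≥0∞}
    {A : ℝ≥0∞} (hp : Measurable p) (hF : Measurable (Function.uncurry F))
    (h : ∀ y, nrm μ (F y) ≤ A) :
    nrm μ (fun x => ∫⁻ y, p y * F y x ∂ν) ≤ (∫⁻ y, p y ∂ν) * A := by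
  refine nrm_le_of_sq_le ?_
  have hF' : Measurable (fun z : α × β => F z.2 z.1) := hF.comp measurable_swap
  have hFx : ∀ x, Measurable fun y => F y x := fun x => hF.comp measurable_prodMk_right
  have hFy : ∀ y, Measurable fun x => F y x := fun y => hF.comp measurable_prodMk_left
  calc ∫⁻ x, (∫⁻ y, p y * F y x ∂ν) ^ 2 ∂μ
      ≤ ∫⁻ x, (∫⁻ y, p y ∂ν) * ∫⁻ y, p y * F y x ^ 2 ∂ν ∂μ := by
        refine lintegral_mono fun x => ?_
        have h1 := sq_lintegral_mul_le (μ := ν) (f := fun y => p y ^ (1 / 2 : ℝ))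
          (g := fun y => p y ^ (1 / 2 : ℝ) * F y x) (by fun_prop)
          ((hp.pow_const _).mul (hFx x)).aemeasurable
        have h2 : ∀ y, p y ^ (1 / 2 : ℝ) * (p y ^ (1 / 2 : ℝ) * F y x) = p y * F y x := by
          intro y; rw [← mul_assoc, ← sq, rpow_half_sq]
        simpa only [h2, mul_pow, rpow_half_sq] using h1
    _ = (∫⁻ y, p y ∂ν) * ∫⁻ y, p y * ∫⁻ x, F y x ^ 2 ∂μ ∂ν := by
        rw [lintegral_const_mul, lintegral_lintegral_swap]
        · congr 1
          refine lintegral_congr fun y => ?_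
          rw [lintegral_const_mul _ ((hFy y).pow_const 2)]
        · exact ((hp.comp measurable_snd).mul (hF'.pow_const 2)).aemeasurable
        · exact Measurable.lintegral_prod_right' (f := fun z : α × β => p z.2 * F z.2 z.1 ^ 2)
            ((hp.comp measurable_snd).mul (hF'.pow_const 2))
    _ ≤ (∫⁻ y, p y ∂ν) * ∫⁻ y, p y * A ^ 2 ∂ν := by
        gcongr with y
        rw [← nrm_sq]
        gcongr
        exact h y
    _ = ((∫⁻ y, p y ∂ν) * A) ^ 2 := by
        rw [lintegral_mul_const _ hp]; ring

lemma nrm_finset_sum_le {ι : Type*} (s : Finset ι) {f : ι → α → ℝ≥0∞}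
    (hf : ∀ i, Measurable (f i)) :
    nrm μ (fun x => ∑ i ∈ s, f i x) ≤ ∑ i ∈ s, nrm μ (f i) := by
  classical
  induction s using Finset.induction_on with
  | empty => simp
  | insert i s hi ih =>
    simp only [Finset.sum_insert hi]
    exact (nrm_add_le (hf i).aemeasurable
      (Finset.measurable_fun_sum s fun i _ => hf i).aemeasurable).trans (by gcongr)

/-- Fatou's lemma for the `L²` norm. -/
lemma nrm_le_of_forall_liminf {f : ℕ → α → ℝ≥0∞} {g : α → ℝ≥0∞} {A : ℝ≥0∞}
    (hf : ∀ n, Measurable (f n)) (h : ∀ᵐ x ∂μ, g x ≤ liminf (fun n => f n x) atTop)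
    (hA : ∀ n, nrm μ (f n) ≤ A) : nrm μ g ≤ A := by
  refine nrm_le_of_sq_le ?_
  calc ∫⁻ x, g x ^ 2 ∂μ ≤ ∫⁻ x, liminf (fun n => f n x ^ 2) atTop ∂μ := by
        refine lintegral_mono_ae ?_
        filter_upwards [h] with x hx
        have : (liminf (fun n => f n x) atTop) ^ 2 = liminf (fun n => f n x ^ 2) atTop :=
          Monotone.map_liminf_of_continuousAt (f := fun y : ℝ≥0∞ => y ^ 2)
            (fun a b hab => pow_le_pow_left' hab 2) (fun n => f n x)
            (ENNReal.continuous_pow 2).continuousAt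
        rw [← this]
        gcongr
    _ ≤ liminf (fun n => ∫⁻ x, f n x ^ 2 ∂μ) atTop :=
        lintegral_liminf_le fun n => (hf n).pow_const 2
    _ ≤ A ^ 2 := by
        refine (liminf_le_liminf (Eventually.of_forall fun n => ?_)).trans_eq
          (liminf_const (A ^ 2))
        rw [← nrm_sq]
        gcongr
        exact hA n

lemma nrm_tsum_le {f : ℕ → α → ℝ≥0∞} (hf : ∀ i, Measurable (f i)) :
    nrm μ (fun x => ∑' i, f i x) ≤ ∑' i, nrm μ (f i) := by
  refine nrm_le_of_forall_liminf (f := fun n x => ∑ i ∈ Finset.range n, f i x)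
    (fun n => Finset.measurable_fun_sum _ fun i _ => hf i) ?_
    (fun n => (nrm_finset_sum_le _ hf).trans (ENNReal.sum_le_tsum _))
  exact Eventually.of_forall fun x => (ENNReal.tendsto_nat_tsum fun i => f i x).liminf_eq.ge

end L2Norm

/-! ### Bilinear estimate -/

instance : (Measure.count : Measure ℤ).IsNegInvariant where
  neg_eq_self := by
    ext s hs
    rw [Measure.neg_apply, Measure.count_apply hs, Measure.count_apply hs.neg]
    simp

instance : freqMeasure.IsNegInvariant where
  neg_eq_self := by
    have h := (Measure.measurePreserving_neg (Measure.count : Measure ℤ)).prod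
      (Measure.measurePreserving_neg (volume : Measure ℝ))
    exact h.map_eq

/-- Convolution of nonnegative functions on the group of space-time frequencies. -/
noncomputable def cv (a b : ℤ × ℝ → ℝ≥0∞) (ξ : ℤ × ℝ) : ℝ≥0∞ :=
  ∫⁻ η, a η * b (ξ - η) ∂freqMeasure

@[fun_prop]
lemma measurable_cv {a b : ℤ × ℝ → ℝ≥0∞} (ha : Measurable a) (hb : Measurable b) :
    Measurable (cv a b) := by
  unfold cv
  exact Measurable.lintegral_prod_right'
    (f := fun z : (ℤ × ℝ) × (ℤ × ℝ) => a z.2 * b (z.1 - z.2)) (by fun_prop)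

lemma cv_comm (a b : ℤ × ℝ → ℝ≥0∞) : cv a b = cv b a := by
  ext ξ
  unfold cv
  rw [← lintegral_sub_left_eq_self _ ξ]
  simp only [sub_sub_cancel, mul_comm]

lemma lintegral_cv (a b : ℤ × ℝ → ℝ≥0∞) (ha : Measurable a) (hb : Measurable b) (k : ℤ) :
    ∫⁻ τ : ℝ, cv a b (k, τ) = ∑' l : ℤ, (∫⁻ τ : ℝ, a (l, τ)) * ∫⁻ τ : ℝ, b (k - l, τ) := by
  unfold cv
  rw [lintegral_lintegral_swap]
  · rw [lintegral_int_prod]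
    · refine tsum_congr fun l => ?_
      rw [← lintegral_mul_const _ (by fun_prop)]
      refine lintegral_congr fun τ => ?_
      rw [lintegral_const_mul _ (by fun_prop)]
      congr 1
      exact lintegral_sub_right_eq_self (fun σ : ℝ => b (k - l, σ)) τ
    · exact Measurable.lintegral_prod_right'
        (f := fun z : (ℤ × ℝ) × ℝ => a z.1 * b ((k, z.2) - z.1)) (by fun_prop)
  · exact Measurable.aemeasurable (by fun_prop)

lemma wt_pos (j : ℕ) {M : ℝ} (hM : 1 ≤ M) (ξ : ℤ × ℝ) : wt j M ξ ≠ 0 := by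
  have : 0 < M + |modul j ξ| := by positivity
  simpa [wt] using this

lemma wt_ne_top (j : ℕ) (M : ℝ) (ξ : ℤ × ℝ) : wt j M ξ ≠ ⊤ := ENNReal.ofReal_ne_top

lemma one_le_wt (j : ℕ) {M : ℝ} (hM : 1 ≤ M) (ξ : ℤ × ℝ) : 1 ≤ wt j M ξ := by
  rw [wt, ENNReal.one_le_ofReal]
  have := abs_nonneg (modul j ξ); linarith

lemma wt_mono (j : ℕ) {M M' : ℝ} (h : M ≤ M') (ξ : ℤ × ℝ) : wt j M ξ ≤ wt j M' ξ :=
  ENNReal.ofReal_le_ofReal (by gcongr)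

lemma modul_neg (j : ℕ) (ξ : ℤ × ℝ) : modul j (-ξ) = -modul j ξ := by
  have : Odd (2 * j + 1) := ⟨j, rfl⟩
  simp only [modul, Prod.fst_neg, Prod.snd_neg, Int.cast_neg, this.neg_pow]
  ring

lemma wt_neg (j : ℕ) (M : ℝ) (ξ : ℤ × ℝ) : wt j M (-ξ) = wt j M ξ := by
  simp [wt, modul_neg]

/-- The norm of the solution space `Y_M`. -/
noncomputable def yn (j : ℕ) (M : ℝ) (a : ℤ × ℝ → ℝ≥0∞) : ℝ≥0∞ :=
  nrm freqMeasure (fun ξ => wt j M ξ ^ (1 / 2 : ℝ) * a ξ)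
    + nrm Measure.count (fun k => ∫⁻ τ : ℝ, a (k, τ))

/-- The norm of the space `Z_M` of forcing terms, which integration in time maps to `Y_M`. -/
noncomputable def zn (j : ℕ) (M : ℝ) (f : ℤ × ℝ → ℝ≥0∞) : ℝ≥0∞ :=
  nrm freqMeasure (fun ξ => wt j M ξ ^ (-(1 / 2) : ℝ) * f ξ)
    + nrm Measure.count (fun k => ∫⁻ τ : ℝ, wt j M (k, τ) ^ (-1 : ℝ) * f (k, τ))

lemma wt_rpow_add (j : ℕ) {M : ℝ} (hM : 1 ≤ M) (ξ : ℤ × ℝ) (x y : ℝ) :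
    wt j M ξ ^ (x + y) = wt j M ξ ^ x * wt j M ξ ^ y :=
  ENNReal.rpow_add _ _ (wt_pos j hM ξ) (wt_ne_top j M ξ)

lemma wt_rpow_mul_cancel (j : ℕ) {M : ℝ} (hM : 1 ≤ M) (ξ : ℤ × ℝ) (x : ℝ) :
    wt j M ξ ^ (-x) * wt j M ξ ^ x = 1 := by
  rw [← wt_rpow_add j hM]; simp

lemma rpow_sq (x : ℝ≥0∞) (p : ℝ) : (x ^ p) ^ 2 = x ^ (p * 2) := by
  rw [← ENNReal.rpow_natCast, ← ENNReal.rpow_mul]; norm_num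

/-- Strichartz estimate for a product, off its zero mode. -/
lemma exists_strichartz {j : ℕ} (hj : 1 ≤ j) : ∃ C : ℝ≥0,
    (∀ a b : ℤ × ℝ → ℝ≥0∞, Measurable a → Measurable b →
      nrm freqMeasure (fun ξ => if ξ.1 = 0 then 0 else cv a b ξ)
        ≤ C * nrm freqMeasure (fun ξ => wt j 1 ξ ^ (7 / 16 : ℝ) * a ξ)
          * nrm freqMeasure (fun ξ => wt j 1 ξ ^ (7 / 16 : ℝ) * b ξ)) ∧
    (∀ a b : ℤ × ℝ → ℝ≥0∞, Measurable a → Measurable b → (∀ τ, a (0, τ) = 0) →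
      nrm freqMeasure (fun ξ => wt j 1 ξ ^ (-(7 / 16) : ℝ) * cv a b ξ)
        ≤ C * nrm freqMeasure a * nrm freqMeasure (fun ξ => wt j 1 ξ ^ (7 / 16 : ℝ) * b ξ)) := by
  obtain ⟨C, hC⟩ := exists_kernel_bound hj
  have hCs : ((NNReal.sqrt C : ℝ≥0) : ℝ≥0∞) ^ 2 = C := by
    rw [← ENNReal.coe_pow, NNReal.sq_sqrt]
  have he : (-(7 / 16) : ℝ) * 2 = -(7 / 8) := by norm_num
  refine ⟨NNReal.sqrt C, fun a b ha hb => ?_, fun a b ha hb ha0 => ?_⟩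
  -- Cauchy-Schwarz in `η`, with the kernel bound for the integral of the two weights
  · refine nrm_le_of_sq_le ?_
    rw [mul_pow, mul_pow, hCs, nrm_sq, nrm_sq]
    set A : ℤ × ℝ → ℝ≥0∞ := fun ξ => wt j 1 ξ ^ (7 / 16 : ℝ) * a ξ with hA
    set B : ℤ × ℝ → ℝ≥0∞ := fun ξ => wt j 1 ξ ^ (7 / 16 : ℝ) * b ξ with hB
    have hAm : Measurable A := by fun_prop
    have hBm : Measurable B := by fun_prop
    calc _ ≤ ∫⁻ ξ, C * ∫⁻ η, A η ^ 2 * B (ξ - η) ^ 2 ∂freqMeasure ∂freqMeasure := by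
          refine lintegral_mono fun ξ => ?_
          split_ifs with h0
          · simp
          have h1 := sq_lintegral_mul_le (μ := freqMeasure)
            (f := fun η => wt j 1 η ^ (-(7 / 16) : ℝ) * wt j 1 (ξ - η) ^ (-(7 / 16) : ℝ))
            (g := fun η => A η * B (ξ - η)) (by fun_prop) (by fun_prop)
          have h2 : ∀ η, wt j 1 η ^ (-(7 / 16) : ℝ) * wt j 1 (ξ - η) ^ (-(7 / 16) : ℝ)
              * (A η * B (ξ - η)) = a η * b (ξ - η) := by
            intro η
            simp only [hA, hB]
            calc _ = (wt j 1 η ^ (-(7 / 16) : ℝ) * wt j 1 η ^ (7 / 16 : ℝ))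
                * (wt j 1 (ξ - η) ^ (-(7 / 16) : ℝ) * wt j 1 (ξ - η) ^ (7 / 16 : ℝ))
                * (a η * b (ξ - η)) := by ring
              _ = _ := by rw [wt_rpow_mul_cancel j le_rfl, wt_rpow_mul_cancel j le_rfl]; simp
          simp only [h2, mul_pow, rpow_sq, he] at h1
          refine h1.trans ?_
          gcongr
          exact hC ξ h0
      _ = C * ∫⁻ ξ, ∫⁻ η, A η ^ 2 * B (ξ - η) ^ 2 ∂freqMeasure ∂freqMeasure := by
          rw [lintegral_const_mul' _ _ (by simp)]
      _ = C * (∫⁻ ξ, A ξ ^ 2 ∂freqMeasure) * ∫⁻ ξ, B ξ ^ 2 ∂freqMeasure := by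
          rw [lintegral_lintegral_swap (by fun_prop), mul_assoc]
          congr 1
          rw [← lintegral_mul_const _ (by fun_prop)]
          refine lintegral_congr fun η => ?_
          rw [lintegral_const_mul _ (by fun_prop)]
          congr 1
          exact lintegral_sub_right_eq_self (fun ξ => B ξ ^ 2) η
  -- The dual estimate: after Cauchy-Schwarz the kernel bound is applied in `ξ`, at the frequency
  -- `η` of `a`; this is where `a` has to vanish on the zero mode.
  · refine nrm_le_of_sq_le ?_
    rw [mul_pow, mul_pow, hCs, nrm_sq, nrm_sq]
    set B : ℤ × ℝ → ℝ≥0∞ := fun ξ => wt j 1 ξ ^ (7 / 16 : ℝ) * b ξ with hB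
    have hBm : Measurable B := by fun_prop
    set J := ∫⁻ ξ, B ξ ^ 2 ∂freqMeasure with hJ
    calc _ ≤ ∫⁻ ξ, (∫⁻ η, a η ^ 2 * (wt j 1 ξ ^ (-(7 / 8) : ℝ)
              * wt j 1 (ξ - η) ^ (-(7 / 8) : ℝ)) ∂freqMeasure) * J ∂freqMeasure := by
          refine lintegral_mono fun ξ => ?_
          have h1 := sq_lintegral_mul_le (μ := freqMeasure)
            (f := fun η => a η * (wt j 1 ξ ^ (-(7 / 16) : ℝ) * wt j 1 (ξ - η) ^ (-(7 / 16) : ℝ)))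
            (g := fun η => B (ξ - η)) (by fun_prop) (by fun_prop)
          have h2 : ∀ η, a η * (wt j 1 ξ ^ (-(7 / 16) : ℝ) * wt j 1 (ξ - η) ^ (-(7 / 16) : ℝ))
              * B (ξ - η) = wt j 1 ξ ^ (-(7 / 16) : ℝ) * (a η * b (ξ - η)) := by
            intro η
            simp only [hB]
            calc _ = (wt j 1 (ξ - η) ^ (-(7 / 16) : ℝ) * wt j 1 (ξ - η) ^ (7 / 16 : ℝ))
                * (wt j 1 ξ ^ (-(7 / 16) : ℝ) * (a η * b (ξ - η))) := by ring
              _ = _ := by rw [wt_rpow_mul_cancel j le_rfl, one_mul]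
          simp only [h2, mul_pow, rpow_sq, he] at h1
          rw [lintegral_const_mul _ (by fun_prop), mul_pow, rpow_sq, he] at h1
          have h3 : ∫⁻ η, B (ξ - η) ^ 2 ∂freqMeasure = J :=
            lintegral_sub_left_eq_self (fun η => B η ^ 2) ξ
          rw [h3] at h1
          rw [mul_pow, rpow_sq, he]
          exact h1
      _ = (∫⁻ η, a η ^ 2 * ∫⁻ ξ, wt j 1 ξ ^ (-(7 / 8) : ℝ)
              * wt j 1 (η - ξ) ^ (-(7 / 8) : ℝ) ∂freqMeasure ∂freqMeasure) * J := by
          rw [lintegral_mul_const, lintegral_lintegral_swap (by fun_prop)]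
          · congr 1
            refine lintegral_congr fun η => ?_
            rw [lintegral_const_mul _ (by fun_prop)]
            congr 1
            refine lintegral_congr fun ξ => ?_
            rw [← wt_neg j 1 (η - ξ), neg_sub]
          · exact Measurable.lintegral_prod_right' (f := fun z : (ℤ × ℝ) × (ℤ × ℝ) =>
              a z.2 ^ 2 * (wt j 1 z.1 ^ (-(7 / 8) : ℝ) * wt j 1 (z.1 - z.2) ^ (-(7 / 8) : ℝ)))
              (by fun_prop)
      _ ≤ (∫⁻ η, a η ^ 2 * C ∂freqMeasure) * J := by
          refine mul_le_mul_left (lintegral_mono fun η => ?_) J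
          by_cases h0 : η.1 = 0
          · obtain ⟨l, τ⟩ := η
            simp only at h0
            subst h0
            simp [ha0]
          · gcongr
            exact hC η h0
      _ = _ := by
          rw [lintegral_mul_const _ (by fun_prop)]; ring

lemma nrm_count_eq (z : ℤ → ℝ≥0∞) :
    nrm Measure.count z = (∑' k, z k ^ 2) ^ (1 / 2 : ℝ) := by
  rw [nrm, lintegral_count]

lemma nrm_count_sq (z : ℤ → ℝ≥0∞) : nrm Measure.count z ^ 2 = ∑' k, z k ^ 2 := by
  rw [nrm_sq, lintegral_count]

/-- The gain `M ^ (-1/16)` from working on a short time interval. -/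
noncomputable def gain (M : ℝ) : ℝ≥0∞ := ENNReal.ofReal (M ^ (-(1 / 16) : ℝ))

lemma gain_le_one {M : ℝ} (hM : 1 ≤ M) : gain M ≤ 1 := by
  rw [gain, ENNReal.ofReal_le_one]
  exact Real.rpow_le_one_of_one_le_of_nonpos hM (by norm_num)

lemma wt_rpow_le_gain (j : ℕ) {M : ℝ} (hM : 1 ≤ M) (ξ : ℤ × ℝ) :
    wt j M ξ ^ (-(1 / 16) : ℝ) ≤ gain M := by
  have hM0 : 0 < M := by linarith
  have := abs_nonneg (modul j ξ)
  rw [wt, ENNReal.ofReal_rpow_of_pos (by linarith)]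
  exact ENNReal.ofReal_le_ofReal (Real.rpow_le_rpow_of_nonpos hM0 (by linarith) (by norm_num))

lemma wt_one_rpow_le (j : ℕ) {M : ℝ} (hM : 1 ≤ M) (ξ : ℤ × ℝ) :
    wt j 1 ξ ^ (7 / 16 : ℝ) ≤ gain M * wt j M ξ ^ (1 / 2 : ℝ) := by
  calc wt j 1 ξ ^ (7 / 16 : ℝ) ≤ wt j M ξ ^ (7 / 16 : ℝ) :=
        ENNReal.rpow_le_rpow (wt_mono j hM ξ) (by norm_num)
    _ = wt j M ξ ^ (-(1 / 16) : ℝ) * wt j M ξ ^ (1 / 2 : ℝ) := by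
        rw [← wt_rpow_add j hM]; norm_num
    _ ≤ _ := by gcongr; exact wt_rpow_le_gain j hM ξ

lemma nrm_wt_one_le (j : ℕ) {M : ℝ} (hM : 1 ≤ M) {a : ℤ × ℝ → ℝ≥0∞} (ha : Measurable a) :
    nrm freqMeasure (fun ξ => wt j 1 ξ ^ (7 / 16 : ℝ) * a ξ)
      ≤ gain M * nrm freqMeasure (fun ξ => wt j M ξ ^ (1 / 2 : ℝ) * a ξ) := by
  rw [← nrm_const_mul _ (by fun_prop)]
  refine nrm_mono fun ξ => ?_
  rw [← mul_assoc]
  gcongr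
  exact wt_one_rpow_le j hM ξ

lemma wt_neg_rpow_le (j : ℕ) {M : ℝ} (hM : 1 ≤ M) (ξ : ℤ × ℝ) {p q : ℝ} (hq : 0 ≤ q)
    (hpq : q ≤ p) : wt j M ξ ^ (-p) ≤ wt j 1 ξ ^ (-q) := by
  rw [ENNReal.rpow_neg, ENNReal.rpow_neg, ENNReal.inv_le_inv]
  exact (ENNReal.rpow_le_rpow (wt_mono j hM ξ) hq).trans
    (ENNReal.rpow_le_rpow_of_exponent_le (one_le_wt j hM ξ) hpq)

/-- A forcing term in a slightly stronger `L²` space lies in the `ℓ²L¹` part of `Z_M`. -/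
lemma nrm_lintegral_wt_le : ∃ C : ℝ≥0, ∀ (j : ℕ) (M : ℝ), 1 ≤ M → ∀ f : ℤ × ℝ → ℝ≥0∞,
    Measurable f → nrm Measure.count (fun k => ∫⁻ τ : ℝ, wt j M (k, τ) ^ (-1 : ℝ) * f (k, τ))
      ≤ C * nrm freqMeasure (fun ξ => wt j 1 ξ ^ (-(7 / 16) : ℝ) * f ξ) := by
  set I := ∫⁻ τ : ℝ, ENNReal.ofReal ((1 + |τ|) ^ (-(9 / 8) : ℝ)) with hI
  have hIfin : I ≠ ⊤ := lintegral_decay_lt_top.ne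
  refine ⟨NNReal.sqrt I.toNNReal, fun j M hM f hf => nrm_le_of_sq_le ?_⟩
  have hs : ((NNReal.sqrt I.toNNReal : ℝ≥0) : ℝ≥0∞) ^ 2 = I := by
    rw [← ENNReal.coe_pow, NNReal.sq_sqrt, ENNReal.coe_toNNReal hIfin]
  rw [mul_pow, hs, nrm_sq, lintegral_count, lintegral_int_prod (by fun_prop),
    ← ENNReal.tsum_mul_left]
  refine ENNReal.tsum_le_tsum fun k => ?_
  have h1 := sq_lintegral_mul_le (μ := (volume : Measure ℝ))
    (f := fun τ => wt j 1 (k, τ) ^ (-(9 / 16) : ℝ))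
    (g := fun τ => wt j 1 (k, τ) ^ (-(7 / 16) : ℝ) * f (k, τ)) (by fun_prop) (by fun_prop)
  have h2 : ∫⁻ τ : ℝ, (wt j 1 (k, τ) ^ (-(9 / 16) : ℝ)) ^ 2 = I := by
    rw [hI, ← lintegral_sub_right_eq_self
      (fun τ : ℝ => ENNReal.ofReal ((1 + |τ|) ^ (-(9 / 8) : ℝ))) ((k : ℝ) ^ (2 * j + 1))]
    refine lintegral_congr fun τ => ?_
    rw [rpow_sq, wt, ENNReal.ofReal_rpow_of_pos (by positivity)]
    norm_num [modul]
  rw [h2] at h1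
  refine le_trans ?_ h1
  refine pow_le_pow_left' (lintegral_mono fun τ => ?_) 2
  rw [← mul_assoc, ← wt_rpow_add j le_rfl]
  refine mul_le_mul_left ?_ _
  norm_num
  have := wt_neg_rpow_le j hM (k, τ) (p := 1) (q := 1) (by norm_num) le_rfl
  simpa using this

lemma abs_sq_le_resonance {j : ℕ} (hj : 1 ≤ j) {M : ℝ} (hM : 1 ≤ M) {ξ η : ℤ × ℝ}
    (h1 : η.1 ≠ 0) (h2 : ξ.1 - η.1 ≠ 0) :
    |(ξ.1 : ℝ)| ≤ 2 * (|(η.1 : ℝ)| * |(ξ.1 : ℝ) - η.1|) ∧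
    3 * (|(ξ.1 : ℝ)| * (|(η.1 : ℝ)| * |(ξ.1 : ℝ) - η.1|))
      ≤ (M + |modul j ξ|) + (M + |modul j η|) + (M + |modul j (ξ - η)|) := by
  have hl : (1 : ℝ) ≤ |(η.1 : ℝ)| := by exact_mod_cast Int.one_le_abs h1
  have hm : (1 : ℝ) ≤ |(ξ.1 : ℝ) - η.1| := by exact_mod_cast Int.one_le_abs h2
  refine ⟨?_, ?_⟩
  · have : |(ξ.1 : ℝ)| ≤ |(η.1 : ℝ)| + |(ξ.1 : ℝ) - η.1| := by
      have := abs_add_le (η.1 : ℝ) ((ξ.1 : ℝ) - η.1)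
      simpa using this
    nlinarith
  · have h3 := resonance_three hj ξ.1 η.1
    have h4 : (ξ.1 : ℝ) ^ (2 * j + 1) - (η.1 : ℝ) ^ (2 * j + 1)
        - ((ξ.1 : ℝ) - η.1) ^ (2 * j + 1) = modul j η + modul j (ξ - η) - modul j ξ := by
      simp [modul]; ring
    rw [h4] at h3
    have h5 : |modul j η + modul j (ξ - η) - modul j ξ|
        ≤ |modul j η| + |modul j (ξ - η)| + |modul j ξ| :=
      (abs_sub _ _).trans (by gcongr; exact abs_add_le _ _)
    rw [← mul_assoc |(ξ.1 : ℝ)|]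
    linarith

lemma le_sqrt_of_sq_le_ofReal {x w : ℝ} (hx : 0 ≤ x) (h : x ^ 2 ≤ w) :
    ENNReal.ofReal x ≤ ENNReal.ofReal w ^ (1 / 2 : ℝ) := by
  rw [← sq_rpow_half (ENNReal.ofReal x), ← ENNReal.ofReal_pow hx]
  exact ENNReal.rpow_le_rpow (ENNReal.ofReal_le_ofReal h) (by norm_num)

lemma ofReal_abs_le_wt {j : ℕ} (hj : 1 ≤ j) {M : ℝ} (hM : 1 ≤ M) {ξ η : ℤ × ℝ}
    (h1 : η.1 ≠ 0) (h2 : ξ.1 - η.1 ≠ 0) :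
    ENNReal.ofReal |(ξ.1 : ℝ)| ≤ 2 * (wt j M ξ ^ (1 / 2 : ℝ) + wt j M η ^ (1 / 2 : ℝ)
      + wt j M (ξ - η) ^ (1 / 2 : ℝ)) := by
  obtain ⟨h3, h4⟩ := abs_sq_le_resonance hj hM h1 h2
  set x := |(ξ.1 : ℝ)|
  set y := |(η.1 : ℝ)| * |(ξ.1 : ℝ) - η.1|
  have hx : 0 ≤ x := abs_nonneg _
  have h2x : ENNReal.ofReal x = 2 * ENNReal.ofReal (x / 2) := by
    rw [show (2 : ℝ≥0∞) = ENNReal.ofReal 2 by norm_num, ← ENNReal.ofReal_mul (by norm_num)]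
    congr 1; ring
  rw [h2x]
  have h5 : 3 * x ^ 2 ≤ 2 * ((M + |modul j ξ|) + (M + |modul j η|) + (M + |modul j (ξ - η)|)) := by
    nlinarith
  have h6 : (x / 2) ^ 2 ≤ M + |modul j ξ| ∨ (x / 2) ^ 2 ≤ M + |modul j η| ∨
      (x / 2) ^ 2 ≤ M + |modul j (ξ - η)| := by
    by_contra! hcon
    obtain ⟨u1, u2, u3⟩ := hcon
    nlinarith [sq_nonneg x]
  gcongr
  rcases h6 with h | h | h
  · exact (le_sqrt_of_sq_le_ofReal (by positivity) h).trans (le_self_add.trans le_self_add)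
  · exact (le_sqrt_of_sq_le_ofReal (by positivity) h).trans (le_add_self.trans le_self_add)
  · exact (le_sqrt_of_sq_le_ofReal (by positivity) h).trans le_add_self

/-- The weight `|l| ^ (-3/4)`, which is square summable. -/
noncomputable def lowWt (l : ℤ) : ℝ≥0∞ := ENNReal.ofReal (|(l : ℝ)| ^ (-(3 / 4) : ℝ))

lemma nrm_lowWt_lt_top : nrm Measure.count lowWt < ⊤ := by
  rw [nrm_count_eq]
  refine ENNReal.rpow_lt_top_of_nonneg (by norm_num) (ne_of_lt ?_)
  have h1 : Summable fun q : ℤ => |(q : ℝ)| ^ (-(3 / 2) : ℝ) :=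
    Real.summable_abs_int_rpow (by norm_num)
  have h2 : ∀ q : ℤ, lowWt q ^ 2 = ENNReal.ofReal (|(q : ℝ)| ^ (-(3 / 2) : ℝ)) := by
    intro q
    rw [lowWt, ← ENNReal.ofReal_pow (by positivity), ← Real.rpow_natCast,
      ← Real.rpow_mul (abs_nonneg _)]
    norm_num
  simp only [h2]
  rw [← ENNReal.ofReal_tsum_of_nonneg (fun q => by positivity) h1]
  exact ENNReal.ofReal_lt_top

lemma lowWt_le_one (l : ℤ) : lowWt l ≤ 1 := by
  rw [lowWt, ENNReal.ofReal_le_one]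
  rcases eq_or_ne l 0 with rfl | h
  · simp [Real.zero_rpow]
  · exact Real.rpow_le_one_of_one_le_of_nonpos (by exact_mod_cast Int.one_le_abs h) (by norm_num)

lemma div_le_of_resonant {M x y w : ℝ} (hM : 1 ≤ M) (hx : 0 ≤ x) (hy : 1 ≤ y) (hxy : x ≤ 2 * y)
    (hw : M ≤ w) (h : x * y ≤ w) :
    w ^ (-1 : ℝ) * x ≤ 2 * (M ^ (-(1 / 16) : ℝ) * y ^ (-(3 / 4) : ℝ)) := by
  have hw0 : 0 < w := by linarith
  have hy0 : 0 < y := by linarith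
  rcases eq_or_lt_of_le hx with rfl | hx0
  · simp; positivity
  have e1 : w ^ (-1 : ℝ) = w ^ (-(1 / 8) : ℝ) * w ^ (-(7 / 8) : ℝ) := by
    rw [← Real.rpow_add hw0]; norm_num
  have e2 : w ^ (-(1 / 8) : ℝ) ≤ M ^ (-(1 / 16) : ℝ) :=
    (Real.rpow_le_rpow_of_nonpos (by linarith) hw (by norm_num)).trans
      (Real.rpow_le_rpow_of_exponent_le hM (by norm_num))
  have e3 : w ^ (-(7 / 8) : ℝ) ≤ (x * y) ^ (-(7 / 8) : ℝ) :=
    Real.rpow_le_rpow_of_nonpos (by positivity) h (by norm_num)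
  have e4 : (x * y) ^ (-(7 / 8) : ℝ) * x = x ^ (1 / 8 : ℝ) * y ^ (-(7 / 8) : ℝ) := by
    rw [Real.mul_rpow hx hy0.le]
    have : x ^ (1 / 8 : ℝ) = x ^ (-(7 / 8) : ℝ) * x := by
      nth_rewrite 3 [← Real.rpow_one x]
      rw [← Real.rpow_add hx0]; norm_num
    rw [this]; ring
  have e5 : x ^ (1 / 8 : ℝ) ≤ 2 * y ^ (1 / 8 : ℝ) := by
    calc x ^ (1 / 8 : ℝ) ≤ (2 * y) ^ (1 / 8 : ℝ) := Real.rpow_le_rpow hx hxy (by norm_num)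
      _ = 2 ^ (1 / 8 : ℝ) * y ^ (1 / 8 : ℝ) := Real.mul_rpow (by norm_num) hy0.le
      _ ≤ 2 ^ (1 : ℝ) * y ^ (1 / 8 : ℝ) := by
          gcongr
          · norm_num
          · norm_num
      _ = _ := by norm_num
  have e6 : y ^ (1 / 8 : ℝ) * y ^ (-(7 / 8) : ℝ) = y ^ (-(3 / 4) : ℝ) := by
    rw [← Real.rpow_add hy0]; norm_num
  calc w ^ (-1 : ℝ) * x = w ^ (-(1 / 8) : ℝ) * (w ^ (-(7 / 8) : ℝ) * x) := by rw [e1]; ring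
    _ ≤ M ^ (-(1 / 16) : ℝ) * ((x * y) ^ (-(7 / 8) : ℝ) * x) := by gcongr
    _ ≤ M ^ (-(1 / 16) : ℝ) * (2 * y ^ (1 / 8 : ℝ) * y ^ (-(7 / 8) : ℝ)) := by
        rw [e4]; gcongr
    _ = _ := by rw [← e6]; ring

lemma wt_inv_mul_abs_le {j : ℕ} (hj : 1 ≤ j) {M : ℝ} (hM : 1 ≤ M) {ξ η : ℤ × ℝ}
    (h1 : η.1 ≠ 0) (h2 : ξ.1 - η.1 ≠ 0) :
    wt j M ξ ^ (-1 : ℝ) * ENNReal.ofReal |(ξ.1 : ℝ)|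
      ≤ 2 * (gain M * (lowWt η.1 * lowWt (ξ.1 - η.1))
        + wt j M ξ ^ (-1 : ℝ) * wt j M η ^ (1 / 2 : ℝ)
        + wt j M ξ ^ (-1 : ℝ) * wt j M (ξ - η) ^ (1 / 2 : ℝ)) := by
  obtain ⟨h3, h4⟩ := abs_sq_le_resonance hj hM h1 h2
  have hl : (1 : ℝ) ≤ |(η.1 : ℝ)| := by exact_mod_cast Int.one_le_abs h1
  have hm : (1 : ℝ) ≤ |(ξ.1 : ℝ) - η.1| := by exact_mod_cast Int.one_le_abs h2
  have hw := abs_nonneg (modul j ξ)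
  by_cases hcase : |(ξ.1 : ℝ)| * (|(η.1 : ℝ)| * |(ξ.1 : ℝ) - η.1|) ≤ M + |modul j ξ|
  · have h5 := div_le_of_resonant hM (abs_nonneg _) (one_le_mul_of_one_le_of_one_le hl hm) h3
      (by linarith) hcase
    refine le_trans ?_ (mul_le_mul_right (le_self_add.trans le_self_add) 2)
    rw [gain, lowWt, lowWt, wt, ENNReal.ofReal_rpow_of_pos (by linarith),
      ← ENNReal.ofReal_mul (by positivity), ← ENNReal.ofReal_mul (by positivity),
      ← ENNReal.ofReal_mul (by positivity),
      show (2 : ℝ≥0∞) = ENNReal.ofReal 2 by norm_num, ← ENNReal.ofReal_mul (by norm_num)]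
    refine ENNReal.ofReal_le_ofReal (h5.trans_eq ?_)
    rw [Int.cast_sub, Real.mul_rpow (by positivity) (by positivity)]
  · set x := |(ξ.1 : ℝ)|
    set y := |(η.1 : ℝ)| * |(ξ.1 : ℝ) - η.1|
    have hx : 0 ≤ x := abs_nonneg _
    have hy : 1 ≤ y := one_le_mul_of_one_le_of_one_le hl hm
    have h2x : ENNReal.ofReal x = 2 * ENNReal.ofReal (x / 2) := by
      rw [show (2 : ℝ≥0∞) = ENNReal.ofReal 2 by norm_num, ← ENNReal.ofReal_mul (by norm_num)]
      congr 1; ring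
    have h6 : (x / 2) ^ 2 ≤ M + |modul j η| ∨ (x / 2) ^ 2 ≤ M + |modul j (ξ - η)| := by
      by_contra! hcon
      obtain ⟨u2, u3⟩ := hcon
      have : x ^ 2 ≤ 2 * (x * y) := by nlinarith
      nlinarith [sq_nonneg x]
    rw [h2x, mul_left_comm]
    refine mul_le_mul_right ?_ 2
    rcases h6 with h | h
    · refine le_trans ?_ (le_add_self.trans le_self_add)
      gcongr
      exact le_sqrt_of_sq_le_ofReal (by positivity) h
    · refine le_trans ?_ le_add_self
      gcongr
      exact le_sqrt_of_sq_le_ofReal (by positivity) h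

lemma nrm_count_conv_le (p z : ℤ → ℝ≥0∞) :
    nrm Measure.count (fun k => ∑' l : ℤ, p l * z (k - l))
      ≤ (∑' l, p l) * nrm Measure.count z := by
  have h := nrm_lintegral_le (μ := (Measure.count : Measure ℤ)) (ν := (Measure.count : Measure ℤ))
    (p := p) (F := fun l k => z (k - l)) (A := nrm Measure.count z) (measurable_of_countable _)
    (measurable_of_countable _) (fun l => le_of_eq ?_)
  · simpa only [lintegral_count] using h
  · rw [nrm_count_eq, nrm_count_eq]
    congr 1
    exact (Equiv.subRight l).tsum_eq (fun k => z k ^ 2)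

lemma mul_abs_cv_le {j : ℕ} {M : ℝ} {a b : ℤ × ℝ → ℝ≥0∞}
    (ha : Measurable a) (hb : Measurable b) (ha0 : ∀ τ, a (0, τ) = 0) (hb0 : ∀ τ, b (0, τ) = 0)
    (ξ : ℤ × ℝ) {v c₀ c₁ : ℝ≥0∞} {r : ℤ → ℝ≥0∞}
    (h : ∀ η : ℤ × ℝ, η.1 ≠ 0 → ξ.1 - η.1 ≠ 0 → v ≤ 2 * (c₀ * (r η.1 * r (ξ.1 - η.1))
        + c₁ * wt j M η ^ (1 / 2 : ℝ) + c₁ * wt j M (ξ - η) ^ (1 / 2 : ℝ))) :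
    v * cv a b ξ ≤ 2 * (c₀ * cv (fun η => r η.1 * a η) (fun η => r η.1 * b η) ξ
      + c₁ * cv (fun η => wt j M η ^ (1 / 2 : ℝ) * a η) b ξ
      + c₁ * cv a (fun η => wt j M η ^ (1 / 2 : ℝ) * b η) ξ) := by
  have hr : Measurable fun η : ℤ × ℝ => r η.1 := (measurable_of_countable r).comp measurable_fst
  have hr' : Measurable fun η : ℤ × ℝ => r (ξ - η).1 :=
    (measurable_of_countable r).comp (measurable_fst.comp (measurable_const.sub measurable_id))
  unfold cv
  rw [← lintegral_const_mul _ (by fun_prop), ← lintegral_const_mul _ (by fun_prop),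
    ← lintegral_const_mul _ (by fun_prop), ← lintegral_const_mul _ (by fun_prop),
    ← lintegral_add_left (by fun_prop), ← lintegral_add_left (by fun_prop),
    ← lintegral_const_mul _ (by fun_prop)]
  refine lintegral_mono fun η => ?_
  by_cases h1 : η.1 = 0
  · obtain ⟨l, τ⟩ := η
    simp only at h1; subst h1
    simp [ha0]
  by_cases h2 : ξ.1 - η.1 = 0
  · have : b (ξ - η) = 0 := by
      rw [show ξ - η = (0, ξ.2 - η.2) from Prod.ext h2 rfl, hb0]
    simp [this]
  calc v * (a η * b (ξ - η)) ≤ 2 * (c₀ * (r η.1 * r (ξ.1 - η.1))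
        + c₁ * wt j M η ^ (1 / 2 : ℝ) + c₁ * wt j M (ξ - η) ^ (1 / 2 : ℝ)) * (a η * b (ξ - η)) := by
        gcongr; exact h η h1 h2
    _ = _ := by simp only [Prod.fst_sub]; ring

/-- The bilinear estimate: `∂ₓ(uv)` maps `Y_M × Y_M` to `Z_M`, with a gain for large `M`. -/
lemma exists_bilinear {j : ℕ} (hj : 1 ≤ j) : ∃ C : ℝ≥0, ∀ M : ℝ, 1 ≤ M →
    ∀ a b : ℤ × ℝ → ℝ≥0∞, Measurable a → Measurable b → (∀ τ, a (0, τ) = 0) →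
      (∀ τ, b (0, τ) = 0) →
      zn j M (fun ξ => ENNReal.ofReal |(ξ.1 : ℝ)| * cv a b ξ)
        ≤ C * gain M * yn j M a * yn j M b := by
  obtain ⟨C, hC1, hC2⟩ := exists_strichartz hj
  obtain ⟨D, hD⟩ := nrm_lintegral_wt_le
  set R := (nrm Measure.count lowWt).toNNReal
  have hR : (R : ℝ≥0∞) = nrm Measure.count lowWt := ENNReal.coe_toNNReal nrm_lowWt_lt_top.ne
  refine ⟨2 * (3 * C) + 2 * (R + 2 * (D * C)), fun M hM a b ha hb ha0 hb0 => ?_⟩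
  set A := yn j M a with hA
  set B := yn j M b with hB
  set a₁ : ℤ × ℝ → ℝ≥0∞ := fun η => wt j M η ^ (1 / 2 : ℝ) * a η with ha₁
  set b₁ : ℤ × ℝ → ℝ≥0∞ := fun η => wt j M η ^ (1 / 2 : ℝ) * b η with hb₁
  have ha₁m : Measurable a₁ := by fun_prop
  have hb₁m : Measurable b₁ := by fun_prop
  have ha₁0 : ∀ τ, a₁ (0, τ) = 0 := by simp [ha₁, ha0]
  have hb₁0 : ∀ τ, b₁ (0, τ) = 0 := by simp [hb₁, hb0]
  have hA1 : nrm freqMeasure a₁ ≤ A := le_self_add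
  have hB1 : nrm freqMeasure b₁ ≤ B := le_self_add
  have hA2 : nrm Measure.count (fun k => ∫⁻ τ : ℝ, a (k, τ)) ≤ A := le_add_self
  have hB2 : nrm Measure.count (fun k => ∫⁻ τ : ℝ, b (k, τ)) ≤ B := le_add_self
  have hA3 : nrm freqMeasure (fun ξ => wt j 1 ξ ^ (7 / 16 : ℝ) * a ξ) ≤ gain M * A :=
    (nrm_wt_one_le j hM ha).trans (by gcongr)
  have hB3 : nrm freqMeasure (fun ξ => wt j 1 ξ ^ (7 / 16 : ℝ) * b ξ) ≤ gain M * B :=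
    (nrm_wt_one_le j hM hb).trans (by gcongr)
  have hg := gain_le_one hM
  have s0 : nrm freqMeasure (fun ξ => if ξ.1 = 0 then 0 else cv a b ξ) ≤ C * (gain M * A * B) := by
    calc _ ≤ C * (gain M * A) * (gain M * B) := (hC1 a b ha hb).trans (by gcongr)
      _ = C * (gain M * A * B) * gain M := by ring
      _ ≤ C * (gain M * A * B) * 1 := by gcongr
      _ = _ := mul_one _
  have s1 : nrm freqMeasure (fun ξ => wt j 1 ξ ^ (-(7 / 16) : ℝ) * cv a₁ b ξ)
      ≤ C * (gain M * A * B) := by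
    calc _ ≤ C * A * (gain M * B) := (hC2 a₁ b ha₁m hb ha₁0).trans (by gcongr)
      _ = _ := by ring
  have s2 : nrm freqMeasure (fun ξ => wt j 1 ξ ^ (-(7 / 16) : ℝ) * cv a b₁ ξ)
      ≤ C * (gain M * A * B) := by
    rw [cv_comm a b₁]
    calc _ ≤ C * B * (gain M * A) := (hC2 b₁ a hb₁m ha hb₁0).trans (by gcongr)
      _ = _ := by ring
  -- the square mean part of the norm
  have p1 : nrm freqMeasure (fun ξ => wt j M ξ ^ (-(1 / 2) : ℝ)
      * (ENNReal.ofReal |(ξ.1 : ℝ)| * cv a b ξ)) ≤ 2 * (3 * C) * (gain M * A * B) := by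
    calc _ ≤ nrm freqMeasure (fun ξ => ((2 : ℝ≥0) : ℝ≥0∞) * ((if ξ.1 = 0 then 0 else cv a b ξ)
            + wt j 1 ξ ^ (-(7 / 16) : ℝ) * cv a₁ b ξ
            + wt j 1 ξ ^ (-(7 / 16) : ℝ) * cv a b₁ ξ)) := by
          refine nrm_mono fun ξ => ?_
          split_ifs with h0
          · simp [h0]
          have h1 := mul_abs_cv_le (j := j) (M := M) ha hb ha0 hb0 ξ
            (v := wt j M ξ ^ (-(1 / 2) : ℝ) * ENNReal.ofReal |(ξ.1 : ℝ)|) (c₀ := 1)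
            (c₁ := wt j 1 ξ ^ (-(7 / 16) : ℝ)) (r := fun _ => 1) (fun η h1 h2 => ?_)
          · simpa only [one_mul, mul_assoc, ENNReal.coe_ofNat] using h1
          · have hq : wt j M ξ ^ (-(1 / 2) : ℝ) ≤ wt j 1 ξ ^ (-(7 / 16) : ℝ) :=
              wt_neg_rpow_le j hM ξ (by norm_num) (by norm_num)
            calc _ ≤ wt j M ξ ^ (-(1 / 2) : ℝ) * (2 * (wt j M ξ ^ (1 / 2 : ℝ)
                  + wt j M η ^ (1 / 2 : ℝ) + wt j M (ξ - η) ^ (1 / 2 : ℝ))) := by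
                  gcongr; exact ofReal_abs_le_wt hj hM h1 h2
              _ = 2 * (wt j M ξ ^ (-(1 / 2) : ℝ) * wt j M ξ ^ (1 / 2 : ℝ)
                  + wt j M ξ ^ (-(1 / 2) : ℝ) * wt j M η ^ (1 / 2 : ℝ)
                  + wt j M ξ ^ (-(1 / 2) : ℝ) * wt j M (ξ - η) ^ (1 / 2 : ℝ)) := by ring
              _ ≤ _ := by
                  rw [wt_rpow_mul_cancel j hM, mul_one, mul_one]
                  gcongr
      _ ≤ 2 * (C * (gain M * A * B) + C * (gain M * A * B) + C * (gain M * A * B)) := by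
          have hcv := measurable_cv ha hb
          have h0 : Measurable fun ξ : ℤ × ℝ => if ξ.1 = 0 then 0 else cv a b ξ :=
            Measurable.ite (measurable_fst (measurableSet_singleton 0)) measurable_const hcv
          refine (nrm_const_mul_le _ _).trans ?_
          gcongr
          · norm_num
          refine (nrm_add_le (by fun_prop) (by fun_prop)).trans ?_
          gcongr
          exact (nrm_add_le (by fun_prop) (by fun_prop)).trans (by gcongr)
      _ = _ := by ring
  -- the `ℓ²L¹` part
  have p2 : nrm Measure.count (fun k => ∫⁻ τ : ℝ, wt j M (k, τ) ^ (-1 : ℝ)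
      * (ENNReal.ofReal |(k : ℝ)| * cv a b (k, τ)))
      ≤ 2 * (R + 2 * (D * C)) * (gain M * A * B) := by
    have q0 : nrm Measure.count (fun k => ∫⁻ τ : ℝ,
        cv (fun η => lowWt η.1 * a η) (fun η => lowWt η.1 * b η) (k, τ)) ≤ R * (A * B) := by
      have hw : Measurable fun η : ℤ × ℝ => lowWt η.1 :=
        (measurable_of_countable lowWt).comp measurable_fst
      have e1 : ∀ k, ∫⁻ τ : ℝ, cv (fun η => lowWt η.1 * a η) (fun η => lowWt η.1 * b η) (k, τ)
          ≤ ∑' l : ℤ, (lowWt l * ∫⁻ τ : ℝ, a (l, τ)) * ∫⁻ τ : ℝ, b (k - l, τ) := by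
        intro k
        rw [lintegral_cv _ _ (by fun_prop) (by fun_prop)]
        refine ENNReal.tsum_le_tsum fun l => ?_
        simp only []
        rw [lintegral_const_mul _ (by fun_prop), lintegral_const_mul _ (by fun_prop)]
        gcongr
        exact mul_le_of_le_one_left' (lowWt_le_one _)
      refine (nrm_mono e1).trans ((nrm_count_conv_le (fun l => lowWt l * ∫⁻ τ : ℝ, a (l, τ))
        (fun l => ∫⁻ τ : ℝ, b (l, τ))).trans ?_)
      rw [← mul_assoc]
      gcongr
      rw [← lintegral_count, hR]
      exact (lintegral_mul_le_nrm (measurable_of_countable _).aemeasurable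
        (measurable_of_countable _).aemeasurable).trans (by gcongr)
    have q1 := (hD j M hM (cv a₁ b) (by fun_prop)).trans (mul_le_mul_right s1 (D : ℝ≥0∞))
    have q2 := (hD j M hM (cv a b₁) (by fun_prop)).trans (mul_le_mul_right s2 (D : ℝ≥0∞))
    calc _ ≤ nrm Measure.count (fun k : ℤ => ((2 : ℝ≥0) : ℝ≥0∞) * (gain M * (∫⁻ τ : ℝ,
            cv (fun η => lowWt η.1 * a η) (fun η => lowWt η.1 * b η) (k, τ))
            + (∫⁻ τ : ℝ, wt j M (k, τ) ^ (-1 : ℝ) * cv a₁ b (k, τ))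
            + ∫⁻ τ : ℝ, wt j M (k, τ) ^ (-1 : ℝ) * cv a b₁ (k, τ))) := by
          refine nrm_mono fun k => ?_
          have hw : Measurable fun η : ℤ × ℝ => lowWt η.1 :=
            (measurable_of_countable lowWt).comp measurable_fst
          have m0 : Measurable (cv (fun η => lowWt η.1 * a η) (fun η => lowWt η.1 * b η)) := by
            fun_prop
          rw [← lintegral_const_mul _ (by fun_prop), ← lintegral_add_left (by fun_prop),
            ← lintegral_add_left (by fun_prop), ← lintegral_const_mul _ (by fun_prop)]
          refine lintegral_mono fun τ => ?_
          rw [← mul_assoc]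
          exact mul_abs_cv_le (j := j) (M := M) ha hb ha0 hb0 (k, τ)
            (fun η h1 h2 => wt_inv_mul_abs_le hj hM h1 h2)
      _ ≤ 2 * (gain M * (R * (A * B)) + D * (C * (gain M * A * B))
            + D * (C * (gain M * A * B))) := by
          refine (nrm_const_mul_le _ _).trans ?_
          gcongr
          · norm_num
          refine (nrm_add_le (measurable_of_countable _).aemeasurable
            (measurable_of_countable _).aemeasurable).trans ?_
          gcongr
          refine (nrm_add_le (measurable_of_countable _).aemeasurable
            (measurable_of_countable _).aemeasurable).trans ?_
          gcongr
          rw [nrm_const_mul _ (measurable_of_countable _).aemeasurable]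
          gcongr
      _ = _ := by ring
  calc _ ≤ 2 * (3 * C) * (gain M * A * B) + 2 * (R + 2 * (D * C)) * (gain M * A * B) :=
        add_le_add p1 p2
    _ = _ := by push_cast; ring

/-! ### Smooth cutoffs in time, on the Fourier side -/

/-- `P` is the Fourier density of the cutoff function `φ`, with quantitative decay. -/
structure IsCutoff (φ P : ℝ → ℂ) (C : ℝ) : Prop where
  nonneg : 0 ≤ C
  cont : Continuous P
  bound : ∀ σ, ‖P σ‖ ≤ C / (1 + σ ^ 2)
  lip : ∀ σ s, |s| ≤ 1 → ‖P (σ - s) - P σ‖ ≤ C * |s| / (1 + σ ^ 2)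
  inversion : ∀ t : ℝ, ∫ σ : ℝ, Complex.exp (Complex.I * t * σ) * P σ = φ t

lemma schwartz_bound (ψ : SchwartzMap ℝ ℂ) : ∃ C : ℝ, 0 ≤ C ∧ (∀ σ, ‖ψ σ‖ ≤ C / (1 + σ ^ 2)) ∧
    ∀ σ, ‖deriv ψ σ‖ ≤ C / (1 + σ ^ 2) := by
  have key : ∀ n : ℕ, ∃ C : ℝ, 0 ≤ C ∧ ∀ σ, ‖iteratedFDeriv ℝ n ψ σ‖ ≤ C / (1 + σ ^ 2) := by
    intro n
    obtain ⟨C0, h0, hC0⟩ := ψ.decay 0 n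
    obtain ⟨C2, h2, hC2⟩ := ψ.decay 2 n
    refine ⟨C0 + C2, by positivity, fun σ => ?_⟩
    rw [le_div_iff₀ (by positivity)]
    have a := hC0 σ
    have b := hC2 σ
    simp only [pow_zero, one_mul, Real.norm_eq_abs, sq_abs] at a b
    linarith
  obtain ⟨C0, h0, hC0⟩ := key 0
  obtain ⟨C1, h1, hC1⟩ := key 1
  refine ⟨C0 + C1, by positivity, fun σ => ?_, fun σ => ?_⟩
  · have := hC0 σ
    rw [norm_iteratedFDeriv_zero] at this
    refine this.trans ?_
    gcongr; linarith
  · have := hC1 σ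
    rw [norm_iteratedFDeriv_one, ← norm_deriv_eq_norm_fderiv] at this
    refine this.trans ?_
    gcongr; linarith

lemma exists_isCutoff {φ : ℝ → ℂ} (h1 : HasCompactSupport φ) (h2 : ContDiff ℝ ∞ φ) :
    ∃ P C, IsCutoff φ P C := by
  set f : SchwartzMap ℝ ℂ := h1.toSchwartzMap h2 with hf
  set ψ : SchwartzMap ℝ ℂ := FourierTransform.fourier f with hψ
  obtain ⟨C, hC, hb, hd⟩ := schwartz_bound ψ
  have h2pi : (0 : ℝ) < 2 * Real.pi := Real.two_pi_pos
  have h2pi1 : (1 : ℝ) ≤ 2 * Real.pi := by linarith [Real.pi_gt_three]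
  -- the Fourier transform of Mathlib has `2π` in the exponent, hence the rescaling by `a`
  set a : ℝ := (2 * Real.pi)⁻¹ with ha
  have ha0 : 0 < a := by positivity
  have ha1 : a ≤ 1 := inv_le_one_of_one_le₀ h2pi1
  set D : ℝ := C * (2 * Real.pi) ^ 2 with hD
  have hdec : ∀ σ : ℝ, C / (1 + (a * σ) ^ 2) ≤ D / (1 + σ ^ 2) := by
    intro σ
    rw [div_le_div_iff₀ (by positivity) (by positivity), hD, mul_assoc]
    gcongr
    have : 2 * Real.pi * a = 1 := by rw [ha]; field_simp
    have h3 : (2 * Real.pi) ^ 2 * (1 + (a * σ) ^ 2) = (2 * Real.pi) ^ 2 + σ ^ 2 := by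
      have : (2 * Real.pi) ^ 2 * (1 + (a * σ) ^ 2)
        = (2 * Real.pi) ^ 2 + (2 * Real.pi * a) ^ 2 * σ ^ 2 := by ring
      rw [this, ‹2 * Real.pi * a = 1›]; ring
    rw [h3]
    nlinarith
  have hD0 : 0 ≤ D := by positivity
  set P : ℝ → ℂ := fun σ => (a : ℂ) * ψ (a * σ) with hP
  have hder : ∀ σ, HasDerivAt P ((a : ℂ) * (a • deriv ψ (a * σ))) σ := by
    intro σ
    have e1 : HasDerivAt ψ (deriv ψ (a * σ)) (a * σ) := ψ.differentiable.differentiableAt.hasDerivAt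
    have e2 : HasDerivAt (fun σ : ℝ => a * σ) a σ := by
      simpa using (hasDerivAt_id σ).const_mul a
    exact (e1.scomp σ e2).const_mul _
  have hderb : ∀ σ, ‖(a : ℂ) * (a • deriv ψ (a * σ))‖ ≤ D / (1 + σ ^ 2) := by
    intro σ
    rw [norm_mul, norm_smul, Complex.norm_real, Real.norm_of_nonneg ha0.le]
    calc a * (a * ‖deriv ψ (a * σ)‖) ≤ 1 * (1 * ‖deriv ψ (a * σ)‖) := by gcongr
      _ ≤ C / (1 + (a * σ) ^ 2) := by rw [one_mul, one_mul]; exact hd _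
      _ ≤ _ := hdec σ
  -- The factor `3` absorbs the shift: `1 + σ² ≤ 3 (1 + x²)` if `|x - σ| ≤ 1`.
  refine ⟨P, 3 * D, by positivity, ?_, fun σ => ?_, fun σ s hs => ?_, fun t => ?_⟩
  · exact continuous_iff_continuousAt.2 fun σ => (hder σ).continuousAt
  · rw [hP, norm_mul, Complex.norm_real, Real.norm_of_nonneg ha0.le]
    calc a * ‖ψ (a * σ)‖ ≤ 1 * ‖ψ (a * σ)‖ := by gcongr
      _ ≤ C / (1 + (a * σ) ^ 2) := by rw [one_mul]; exact hb _
      _ ≤ D / (1 + σ ^ 2) := hdec σ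
      _ ≤ _ := by gcongr; linarith
  · have h5 := (convex_segment (𝕜 := ℝ) σ (σ - s)).norm_image_sub_le_of_norm_hasDerivWithin_le
      (f := P) (C := 3 * D / (1 + σ ^ 2)) (fun x _ => (hder x).hasDerivWithinAt)
      (fun x hx => ?_) (left_mem_segment ℝ _ _) (right_mem_segment ℝ _ _)
    · calc _ ≤ 3 * D / (1 + σ ^ 2) * ‖σ - s - σ‖ := h5
        _ = _ := by
          rw [show σ - s - σ = -s by ring, norm_neg, Real.norm_eq_abs]; ring
    · refine (hderb x).trans ?_
      have hx' : |x - σ| ≤ 1 := by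
        rw [segment_eq_uIcc] at hx
        have := abs_sub_left_of_mem_uIcc hx
        rw [show σ - s - σ = -s by ring, abs_neg] at this
        linarith
      rw [div_le_div_iff₀ (by positivity) (by positivity), mul_comm 3 D, mul_assoc D 3]
      refine mul_le_mul_of_nonneg_left ?_ hD0
      have h6 : (x - σ) ^ 2 ≤ 1 := by
        rw [← sq_abs]; exact pow_le_one₀ (abs_nonneg _) hx'
      nlinarith [sq_nonneg (2 * x - σ)]
  · have h6 : FourierTransformInv.fourierInv ψ = f := by simp [hψ]
    have h7 : (FourierTransformInv.fourierInv ψ : SchwartzMap ℝ ℂ) t = φ t := by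
      rw [h6]; rfl
    rw [SchwartzMap.fourierInv_coe, Real.fourierInv_eq'] at h7
    rw [← h7]
    have h8 := Measure.integral_comp_mul_left
      (fun v : ℝ => Complex.exp (Complex.I * t * (2 * Real.pi * v)) * ψ v) a
    rw [abs_of_pos (inv_pos.2 ha0)] at h8
    have h9 : ∫ v : ℝ, Complex.exp (Complex.I * t * (2 * Real.pi * v)) * ψ v
        = a • ∫ x : ℝ, Complex.exp (Complex.I * t * (2 * Real.pi * ((a * x : ℝ) : ℂ)))
          * ψ (a * x) := by
      rw [h8, smul_smul, mul_inv_cancel₀ ha0.ne', one_smul]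
    rw [← integral_smul] at h9
    have h10 : ∀ x : ℝ, (2 * Real.pi * ((a * x : ℝ) : ℂ)) = x := by
      intro x
      rw [ha]; push_cast
      have : (Real.pi : ℂ) ≠ 0 := by exact_mod_cast Real.pi_ne_zero
      field_simp
    simp only [h10] at h9
    calc ∫ σ : ℝ, Complex.exp (Complex.I * t * σ) * P σ
        = ∫ x : ℝ, a • (Complex.exp (Complex.I * t * x) * ψ (a * x)) := by
          refine integral_congr_ae (Eventually.of_forall fun x => ?_)
          simp only [hP, Complex.real_smul]; ring
      _ = _ := by
          rw [← h9]
          refine integral_congr_ae (Eventually.of_forall fun x => ?_)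
          simp only [smul_eq_mul, Real.inner_apply]
          congr 2
          push_cast; ring

lemma exists_smooth_bump (b : ℝ) {r R : ℝ} (hr : 0 < r) (hR : r < R) :
    ∃ φ : ℝ → ℂ, (∃ P C, IsCutoff φ P C) ∧ (∀ t, |t - b| ≤ r → φ t = 1) ∧
      ∀ t, R ≤ |t - b| → φ t = 0 := by
  let f : ContDiffBump b := ⟨r, R, hr, hR⟩
  have hs : HasCompactSupport fun t => ((f t : ℝ) : ℂ) :=
    f.hasCompactSupport.comp_left (g := fun x : ℝ => (x : ℂ)) Complex.ofReal_zero
  refine ⟨fun t => ((f t : ℝ) : ℂ), exists_isCutoff hs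
    (Complex.ofRealCLM.contDiff.comp f.contDiff), fun t ht => ?_, fun t ht => ?_⟩
  · simp only []
    rw [f.one_of_mem_closedBall (by rwa [Metric.mem_closedBall, Real.dist_eq])]; rfl
  · simp only []
    rw [f.zero_of_le_dist (by rwa [Real.dist_eq])]; rfl

/-! ### Integration in time -/

/-- The Fourier density `σ ↦ P (σ / M) / M` of the cutoff `φ (M t)`. -/
noncomputable def scaled (P : ℝ → ℂ) (M σ : ℝ) : ℂ := (M⁻¹ : ℝ) * P (σ / M)

/-- The profile `M / (M² + σ²)` that bounds `scaled P M`. -/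
noncomputable def cauchyProfile (M σ : ℝ) : ℝ := M / (M ^ 2 + σ ^ 2)

lemma cauchyProfile_nonneg {M : ℝ} (hM : 0 ≤ M) (σ : ℝ) : 0 ≤ cauchyProfile M σ := by
  unfold cauchyProfile; positivity

lemma cauchyProfile_eq {M : ℝ} (hM : 0 < M) (σ : ℝ) :
    cauchyProfile M σ = M⁻¹ * (1 + (σ / M) ^ 2)⁻¹ := by
  unfold cauchyProfile; field_simp

lemma integrable_cauchyProfile {M : ℝ} (hM : 0 < M) : Integrable (cauchyProfile M) := by
  have h : cauchyProfile M = fun σ => M⁻¹ * (1 + (σ / M) ^ 2)⁻¹ := by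
    ext σ; exact cauchyProfile_eq hM σ
  rw [h]
  exact (integrable_inv_one_add_sq.comp_div hM.ne').const_mul _

lemma lintegral_cauchyProfile {M : ℝ} (hM : 0 < M) :
    ∫⁻ σ, ENNReal.ofReal (cauchyProfile M σ) = ENNReal.ofReal Real.pi := by
  rw [← ofReal_integral_eq_lintegral_ofReal (integrable_cauchyProfile hM)
    (Eventually.of_forall fun σ => cauchyProfile_nonneg hM.le σ)]
  congr 1
  simp only [cauchyProfile_eq hM]
  rw [integral_const_mul, Measure.integral_comp_div (fun σ : ℝ => (1 + σ ^ 2)⁻¹),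
    integral_univ_inv_one_add_sq, abs_of_pos hM, smul_eq_mul, ← mul_assoc, inv_mul_cancel₀ hM.ne',
    one_mul]

@[fun_prop]
lemma measurable_cauchyProfile (M : ℝ) : Measurable (cauchyProfile M) := by
  unfold cauchyProfile; fun_prop

lemma add_abs_mul_cauchyProfile_sq_le {M : ℝ} (hM : 0 < M) (σ : ℝ) :
    (M + |σ|) * cauchyProfile M σ ^ 2 ≤ 2 * cauchyProfile M σ := by
  have h1 : (M + |σ|) * cauchyProfile M σ ≤ 2 := by
    rw [cauchyProfile, ← mul_div_assoc, div_le_iff₀ (by positivity)]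
    nlinarith [sq_nonneg (M - |σ|), sq_abs σ, abs_nonneg σ]
  have h2 := cauchyProfile_nonneg hM.le σ
  calc _ = (M + |σ|) * cauchyProfile M σ * cauchyProfile M σ := by ring
    _ ≤ _ := by gcongr

namespace IsCutoff

variable {φ P : ℝ → ℂ} {C : ℝ}

lemma norm_scaled_le (hP : IsCutoff φ P C) {M : ℝ} (hM : 0 < M) (σ : ℝ) :
    ‖scaled P M σ‖ ≤ C * cauchyProfile M σ := by
  rw [scaled, norm_mul, Complex.norm_real, Real.norm_of_nonneg (inv_pos.2 hM).le,
    cauchyProfile_eq hM]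
  calc M⁻¹ * ‖P (σ / M)‖ ≤ M⁻¹ * (C / (1 + (σ / M) ^ 2)) := by gcongr; exact hP.bound _
    _ = _ := by rw [div_eq_mul_inv]; ring

lemma continuous_scaled (hP : IsCutoff φ P C) (M : ℝ) : Continuous (scaled P M) := by
  have := hP.cont
  unfold scaled; fun_prop

lemma integrable_scaled (hP : IsCutoff φ P C) {M : ℝ} (hM : 0 < M) :
    Integrable (scaled P M) :=
  ((integrable_cauchyProfile hM).const_mul C).mono' (hP.continuous_scaled M).aestronglyMeasurable
    (Eventually.of_forall fun σ => hP.norm_scaled_le hM σ)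

lemma integral_scaled (hP : IsCutoff φ P C) {M : ℝ} (hM : 0 < M) (t : ℝ) :
    ∫ σ : ℝ, Complex.exp (Complex.I * t * σ) * scaled P M σ = φ (M * t) := by
  rw [← hP.inversion (M * t)]
  have h := Measure.integral_comp_div
    (fun σ : ℝ => Complex.exp (Complex.I * (M * t : ℝ) * σ) * P σ) M
  rw [abs_of_pos hM, eq_comm, ← eq_inv_smul_iff₀ hM.ne', ← integral_smul] at h
  rw [h]
  refine integral_congr_ae (Eventually.of_forall fun σ => ?_)
  have hM' : (M : ℂ) ≠ 0 := by exact_mod_cast hM.ne'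
  simp only [scaled, Complex.real_smul]
  rw [show Complex.I * ((M * t : ℝ) : ℂ) * ((σ / M : ℝ) : ℂ) = Complex.I * t * σ by
    push_cast; field_simp]
  ring

end IsCutoff

lemma norm_exp_I_mul (t σ : ℝ) : ‖Complex.exp (Complex.I * t * σ)‖ = 1 := by
  rw [show Complex.I * t * σ = ((t * σ : ℝ) : ℂ) * Complex.I by push_cast; ring,
    Complex.norm_exp_ofReal_mul_I]

lemma continuous_exp_I_mul (t : ℝ) : Continuous fun σ : ℝ => Complex.exp (Complex.I * t * σ) := by
  fun_prop

lemma integrable_exp_mul {f : ℝ → ℂ} (hf : Integrable f) (t : ℝ) :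
    Integrable fun σ : ℝ => Complex.exp (Complex.I * t * σ) * f σ :=
  hf.bdd_mul (c := 1) (continuous_exp_I_mul t).aestronglyMeasurable
    (Eventually.of_forall fun σ => (norm_exp_I_mul t σ).le)

/-- The kernel of the localised integration in time, without its singular high frequency part. -/
noncomputable def duhKer (P : ℝ → ℂ) (M σ σ₁ : ℝ) : ℂ :=
  if |σ₁| ≤ M then (scaled P M (σ - σ₁) - scaled P M σ) / (Complex.I * σ₁)
    else -scaled P M σ / (Complex.I * σ₁)

/-- On the Fourier side, the primitive `∫₀ᵗ`, altered outside the time interval `[-1/M, 1/M]` so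
that it gains a full power of `M + |σ|`. High frequencies are divided by `iσ`, up to a constant of
integration which is cut off in time, and the primitives of low frequencies are cut off in time. -/
noncomputable def duh (P : ℝ → ℂ) (M : ℝ) (F : ℝ → ℂ) (σ : ℝ) : ℂ :=
  (if |σ| ≤ M then 0 else F σ / (Complex.I * σ)) + ∫ σ₁, F σ₁ * duhKer P M σ σ₁

namespace IsCutoff

variable {φ P : ℝ → ℂ} {C : ℝ}

lemma measurable_duhKer (hP : IsCutoff φ P C) (M : ℝ) :
    Measurable (Function.uncurry (duhKer P M)) := by
  have h := (hP.continuous_scaled M).measurable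
  unfold duhKer
  refine Measurable.ite (measurableSet_le (by fun_prop) measurable_const) ?_ ?_
  · have h1 : Measurable fun z : ℝ × ℝ => scaled P M (z.1 - z.2) :=
      h.comp (measurable_fst.sub measurable_snd)
    have h2 : Measurable fun z : ℝ × ℝ => scaled P M z.1 := h.comp measurable_fst
    exact (h1.sub h2).div (by fun_prop)
  · have h2 : Measurable fun z : ℝ × ℝ => scaled P M z.1 := h.comp measurable_fst
    exact h2.neg.div (by fun_prop)

lemma norm_duhKer_le (hP : IsCutoff φ P C) {M : ℝ} (hM : 0 < M) (σ σ₁ : ℝ) :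
    ‖duhKer P M σ σ₁‖ ≤ 2 * C * cauchyProfile M σ * (M + |σ₁|)⁻¹ := by
  have hC := hP.nonneg
  have hB := cauchyProfile_nonneg hM.le σ
  have habs := abs_nonneg σ₁
  rcases eq_or_ne σ₁ 0 with rfl | h0
  · simp [duhKer, hM.le]; positivity
  have h0' : 0 < |σ₁| := abs_pos.2 h0
  unfold duhKer
  split_ifs with h
  · have h1 : ‖scaled P M (σ - σ₁) - scaled P M σ‖ ≤ C * cauchyProfile M σ * (|σ₁| / M) := by
      rw [scaled, scaled, ← mul_sub, norm_mul, Complex.norm_real,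
        Real.norm_of_nonneg (inv_pos.2 hM).le, cauchyProfile_eq hM, sub_div]
      have h2 : |σ₁ / M| ≤ 1 := by rw [abs_div, abs_of_pos hM, div_le_one hM]; exact h
      have h3 := hP.lip (σ / M) (σ₁ / M) h2
      rw [abs_div, abs_of_pos hM] at h3
      calc _ ≤ M⁻¹ * (C * (|σ₁| / M) / (1 + (σ / M) ^ 2)) := by gcongr
        _ = _ := by rw [div_eq_mul_inv]; ring
    rw [norm_div, norm_mul, Complex.norm_I, one_mul, Complex.norm_real, Real.norm_eq_abs,
      div_le_iff₀ h0']
    refine h1.trans ?_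
    have h4 : M⁻¹ ≤ 2 * (M + |σ₁|)⁻¹ := by
      rw [inv_eq_one_div, ← div_eq_mul_inv, div_le_div_iff₀ hM (by positivity)]; linarith
    calc C * cauchyProfile M σ * (|σ₁| / M) = C * cauchyProfile M σ * |σ₁| * M⁻¹ := by
          rw [div_eq_mul_inv]; ring
      _ ≤ C * cauchyProfile M σ * |σ₁| * (2 * (M + |σ₁|)⁻¹) := by gcongr
      _ = _ := by ring
  · rw [norm_div, norm_neg, norm_mul, Complex.norm_I, one_mul, Complex.norm_real, Real.norm_eq_abs,
      div_eq_mul_inv]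
    have h4 : |σ₁|⁻¹ ≤ 2 * (M + |σ₁|)⁻¹ := by
      push Not at h
      rw [inv_eq_one_div, ← div_eq_mul_inv, div_le_div_iff₀ h0' (by positivity)]; linarith
    calc _ ≤ C * cauchyProfile M σ * (2 * (M + |σ₁|)⁻¹) := by
          gcongr; exact hP.norm_scaled_le hM σ
      _ = _ := by ring

lemma norm_duhKer_le' (hP : IsCutoff φ P C) {M : ℝ} (hM : 0 < M) (σ σ₁ : ℝ) :
    ‖duhKer P M σ σ₁‖ ≤ 2 * C * cauchyProfile M σ * M⁻¹ := by
  refine (hP.norm_duhKer_le hM σ σ₁).trans ?_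
  have hC := hP.nonneg
  have hB := cauchyProfile_nonneg hM.le σ
  gcongr
  linarith [abs_nonneg σ₁]

lemma integrable_mul_duhKer (hP : IsCutoff φ P C) {M : ℝ} (hM : 0 < M) {F : ℝ → ℂ}
    (hF : Integrable F) (σ : ℝ) : Integrable fun σ₁ => F σ₁ * duhKer P M σ σ₁ :=
  hF.mul_bdd (c := 2 * C * cauchyProfile M σ * M⁻¹)
    ((hP.measurable_duhKer M).comp measurable_prodMk_left).aestronglyMeasurable
    (Eventually.of_forall fun σ₁ => hP.norm_duhKer_le' hM σ σ₁)

lemma duh_sub (hP : IsCutoff φ P C) {M : ℝ} (hM : 0 < M) {F G : ℝ → ℂ}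
    (hF : Integrable F) (hG : Integrable G) (σ : ℝ) :
    duh P M (fun σ => F σ - G σ) σ = duh P M F σ - duh P M G σ := by
  unfold duh
  simp only [sub_mul]
  rw [integral_sub (hP.integrable_mul_duhKer hM hF σ) (hP.integrable_mul_duhKer hM hG σ)]
  split_ifs <;> ring

lemma measurable_duh (hP : IsCutoff φ P C) (M : ℝ) {F : ℝ → ℂ} (hF : Measurable F) :
    Measurable (duh P M F) := by
  unfold duh
  refine Measurable.add ?_ ?_
  · exact Measurable.ite (measurableSet_le (by fun_prop) measurable_const) measurable_const
      (hF.div (by fun_prop))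
  · have h : StronglyMeasurable (fun z : ℝ × ℝ => F z.2 * duhKer P M z.1 z.2) :=
      ((hF.comp measurable_snd).mul (hP.measurable_duhKer M)).stronglyMeasurable
    exact h.integral_prod_right.measurable

lemma enorm_duh_le (hP : IsCutoff φ P C) {M : ℝ} (hM : 0 < M) {F : ℝ → ℂ} (σ : ℝ) :
    ‖duh P M F σ‖ₑ ≤ 2 * ((ENNReal.ofReal (M + |σ|))⁻¹ * ‖F σ‖ₑ)
      + ENNReal.ofReal (2 * C) * ENNReal.ofReal (cauchyProfile M σ)
        * ∫⁻ σ₁, (ENNReal.ofReal (M + |σ₁|))⁻¹ * ‖F σ₁‖ₑ := by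
  have hC := hP.nonneg
  have hB := cauchyProfile_nonneg hM.le σ
  refine (enorm_add_le _ _).trans (add_le_add ?_ ?_)
  · split_ifs with h
    · simp
    · push Not at h
      have h0 : 0 < |σ| := hM.trans h
      rw [← ofReal_norm, ← ofReal_norm, norm_div, norm_mul, Complex.norm_I, one_mul,
        Complex.norm_real, Real.norm_eq_abs, ← ENNReal.ofReal_inv_of_pos (by positivity),
        ← ENNReal.ofReal_mul (by positivity), show (2 : ℝ≥0∞) = ENNReal.ofReal 2 by norm_num,
        ← ENNReal.ofReal_mul (by norm_num)]
      refine ENNReal.ofReal_le_ofReal ?_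
      rw [div_eq_mul_inv, mul_comm, ← mul_assoc]
      gcongr
      rw [inv_eq_one_div, ← div_eq_mul_inv, div_le_div_iff₀ h0 (by positivity)]; linarith
  · refine (enorm_integral_le_lintegral_enorm _).trans ?_
    rw [← lintegral_const_mul' _ _ (ENNReal.mul_ne_top ENNReal.ofReal_ne_top
      ENNReal.ofReal_ne_top)]
    refine lintegral_mono fun σ₁ => ?_
    rw [enorm_mul, mul_comm, ← mul_assoc]
    gcongr
    rw [← ofReal_norm, ← ENNReal.ofReal_inv_of_pos (by positivity),
      ← ENNReal.ofReal_mul (by positivity), ← ENNReal.ofReal_mul (by positivity)]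
    exact ENNReal.ofReal_le_ofReal (hP.norm_duhKer_le hM σ σ₁)

lemma integrable_high {M : ℝ} (hM : 0 < M) {F : ℝ → ℂ} (hF : Integrable F) :
    Integrable fun σ : ℝ => if |σ| ≤ M then 0 else F σ / (Complex.I * σ) := by
  have hms : MeasurableSet {σ : ℝ | |σ| ≤ M} :=
    measurableSet_le (by fun_prop) measurable_const
  have hm : Measurable fun σ : ℝ => if |σ| ≤ M then (0 : ℂ) else (Complex.I * σ)⁻¹ :=
    Measurable.ite hms measurable_const (by fun_prop)
  refine (hF.mul_bdd (c := M⁻¹) hm.aestronglyMeasurable (Eventually.of_forall fun σ => ?_)).congr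
    (Eventually.of_forall fun σ => ?_)
  · split_ifs with h
    · simp; positivity
    · push Not at h
      rw [norm_inv, norm_mul, Complex.norm_I, one_mul, Complex.norm_real, Real.norm_eq_abs]
      gcongr
  · simp only []
    split_ifs <;> simp [div_eq_mul_inv]

lemma integrable_kernel_prod (hP : IsCutoff φ P C) {M : ℝ} (hM : 0 < M) {F : ℝ → ℂ}
    (hF : Integrable F) (t : ℝ) :
    Integrable (Function.uncurry fun σ σ₁ : ℝ =>
      Complex.exp (Complex.I * t * σ) * (F σ₁ * duhKer P M σ σ₁))
      ((volume : Measure ℝ).prod (volume : Measure ℝ)) := by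
  have h1 := ((integrable_cauchyProfile hM).const_mul (2 * C * M⁻¹)).mul_prod hF.norm
  refine h1.mono' ?_ (Eventually.of_forall fun z => ?_)
  · refine ((continuous_exp_I_mul t).comp continuous_fst).aestronglyMeasurable.mul
      (AEStronglyMeasurable.mul ?_ (hP.measurable_duhKer M).aestronglyMeasurable)
    exact hF.aestronglyMeasurable.comp_snd
  · simp only [Function.uncurry, norm_mul, norm_exp_I_mul, one_mul]
    calc ‖F z.2‖ * ‖duhKer P M z.1 z.2‖ ≤ ‖F z.2‖ * (2 * C * cauchyProfile M z.1 * M⁻¹) := by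
          gcongr; exact hP.norm_duhKer_le' hM _ _
      _ = _ := by ring

lemma integrable_duh (hP : IsCutoff φ P C) {M : ℝ} (hM : 0 < M) {F : ℝ → ℂ}
    (hF : Integrable F) : Integrable (duh P M F) := by
  refine (integrable_high hM hF).add ?_
  have := (hP.integrable_kernel_prod hM hF 0).integral_prod_left
  simpa using this

/-- `duh` represents integration in time on `[-1/M, 1/M]`. -/
lemma integral_exp_duh (hP : IsCutoff φ P C) (hφ : ∀ t, |t| ≤ 1 → φ t = 1) {M : ℝ} (hM : 0 < M)
    {F : ℝ → ℂ} (hF : Integrable F) {t : ℝ} (ht : |M * t| ≤ 1) :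
    ∫ σ : ℝ, Complex.exp (Complex.I * t * σ) * duh P M F σ
      = ∫ r in (0 : ℝ)..t, ∫ σ : ℝ, Complex.exp (Complex.I * r * σ) * F σ := by
  -- The time integral of the kernel, at times at which the cutoff equals `1`. Low frequencies
  -- integrate to `(exp (itσ₁) - 1) / (iσ₁)`; of the high ones only the term `-1 / (iσ₁)` is cut off.
  have hker : ∀ σ₁ : ℝ, σ₁ ≠ 0 → ∫ σ : ℝ, Complex.exp (Complex.I * t * σ) * duhKer P M σ σ₁
      = if |σ₁| ≤ M then (Complex.exp (Complex.I * t * σ₁) - 1) / (Complex.I * σ₁)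
        else -1 / (Complex.I * σ₁) := by
    intro σ₁ h0
    have hs := hP.integral_scaled hM t
    rw [hφ _ ht] at hs
    have hi := integrable_exp_mul (hP.integrable_scaled hM) t
    unfold duhKer
    split_ifs with h
    · have e1 : ∀ σ : ℝ, Complex.exp (Complex.I * t * σ)
          * ((scaled P M (σ - σ₁) - scaled P M σ) / (Complex.I * σ₁))
          = (Complex.exp (Complex.I * t * σ₁) * (Complex.exp (Complex.I * t * (σ - σ₁ : ℝ))
            * scaled P M (σ - σ₁)) - Complex.exp (Complex.I * t * σ) * scaled P M σ)
            * (Complex.I * σ₁)⁻¹ := by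
        intro σ
        rw [← mul_assoc (Complex.exp (Complex.I * t * σ₁)), ← Complex.exp_add,
          show Complex.I * t * σ₁ + Complex.I * t * (σ - σ₁ : ℝ) = Complex.I * t * σ by
            push_cast; ring, div_eq_mul_inv]
        ring
      simp only [e1]
      rw [integral_mul_const, integral_sub ((hi.comp_sub_right σ₁).const_mul _) hi,
        integral_const_mul, integral_sub_right_eq_self
          (fun σ : ℝ => Complex.exp (Complex.I * t * σ) * scaled P M σ) σ₁, hs, mul_one,
        div_eq_mul_inv]
    · have e1 : ∀ σ : ℝ, Complex.exp (Complex.I * t * σ) * (-scaled P M σ / (Complex.I * σ₁))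
          = Complex.exp (Complex.I * t * σ) * scaled P M σ * (-(Complex.I * σ₁)⁻¹) := by
        intro σ; rw [div_eq_mul_inv]; ring
      simp only [e1]
      rw [integral_mul_const, hs, one_mul, neg_div, one_div]
  have hne : ∀ᵐ σ : ℝ, σ ≠ 0 := by
    simp [ae_iff, measure_singleton]
  have hprod := hP.integrable_kernel_prod hM hF t
  have hlow : ∫ σ : ℝ, Complex.exp (Complex.I * t * σ) * ∫ σ₁, F σ₁ * duhKer P M σ σ₁
      = ∫ σ₁ : ℝ, F σ₁ * ∫ σ : ℝ, Complex.exp (Complex.I * t * σ) * duhKer P M σ σ₁ := by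
    simp only [← integral_const_mul]
    rw [integral_integral_swap hprod]
    refine integral_congr_ae (Eventually.of_forall fun σ₁ =>
      integral_congr_ae (Eventually.of_forall fun σ => ?_))
    simp only []; ring
  have hL1 : Integrable fun σ : ℝ => Complex.exp (Complex.I * t * σ)
      * ∫ σ₁, F σ₁ * duhKer P M σ σ₁ := by
    have := hprod.integral_prod_left
    refine this.congr (Eventually.of_forall fun σ => ?_)
    simp only [Function.uncurry_apply_pair, integral_const_mul]
  have hL2 : Integrable fun σ₁ : ℝ => F σ₁ * ∫ σ : ℝ, Complex.exp (Complex.I * t * σ)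
      * duhKer P M σ σ₁ := by
    have := hprod.integral_prod_right
    refine this.congr (Eventually.of_forall fun σ₁ => ?_)
    simp only [Function.uncurry_apply_pair, ← integral_const_mul]
    refine integral_congr_ae (Eventually.of_forall fun σ => ?_)
    simp only []; ring
  have hH := integrable_exp_mul (integrable_high hM hF) t
  calc _ = ∫ σ : ℝ, (Complex.exp (Complex.I * t * σ) * (if |σ| ≤ M then 0 else F σ / (Complex.I * σ))
        + Complex.exp (Complex.I * t * σ) * ∫ σ₁, F σ₁ * duhKer P M σ σ₁) := by
        refine integral_congr_ae (Eventually.of_forall fun σ => ?_)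
        simp only [duh]; ring
    _ = ∫ σ : ℝ, (Complex.exp (Complex.I * t * σ) * (if |σ| ≤ M then 0 else F σ / (Complex.I * σ))
        + F σ * ∫ σ₁ : ℝ, Complex.exp (Complex.I * t * σ₁) * duhKer P M σ₁ σ) := by
        rw [integral_add hH hL1, integral_add hH hL2, hlow]
    _ = ∫ σ : ℝ, ∫ r in (0 : ℝ)..t, Complex.exp (Complex.I * r * σ) * F σ := by
        refine integral_congr_ae ?_
        filter_upwards [hne] with σ hσ
        have hc : Complex.I * (σ : ℂ) ≠ 0 :=
          mul_ne_zero Complex.I_ne_zero (by exact_mod_cast hσ)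
        have e2 : ∫ r in (0 : ℝ)..t, Complex.exp (Complex.I * r * σ) * F σ
            = (Complex.exp (Complex.I * t * σ) - 1) / (Complex.I * σ) * F σ := by
          rw [intervalIntegral.integral_mul_const]
          congr 1
          have := integral_exp_mul_complex (a := 0) (b := t) hc
          simp only [Complex.ofReal_zero, mul_zero, Complex.exp_zero] at this
          rw [show Complex.I * t * σ = Complex.I * σ * t by ring, ← this]
          refine intervalIntegral.integral_congr fun r _ => ?_
          congr 1; ring
        rw [e2, hker σ hσ]
        split_ifs with h
        · ring
        · field_simp; ring
    _ = _ := by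
        rw [← intervalIntegral_integral_swap]
        have h1 : Integrable (fun _ : ℝ => (1 : ℂ)) (volume.restrict (uIoc 0 t)) := by
          rw [← IntegrableOn, integrableOn_const_iff]
          right; rw [uIoc]; exact measure_Ioc_lt_top
        refine (h1.mul_prod hF).bdd_mul (c := 1) (f := fun z : ℝ × ℝ =>
          Complex.exp (Complex.I * z.1 * z.2)) ?_ (Eventually.of_forall fun z =>
            (norm_exp_I_mul z.1 z.2).le) |>.congr (Eventually.of_forall fun z => ?_)
        · exact Continuous.aestronglyMeasurable (by fun_prop)
        · simp [Function.uncurry]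

end IsCutoff

/-! ### Space-time Fourier transforms -/

/-- The Fourier coefficients at time `t` of the function with space-time Fourier transform `U`. -/
noncomputable def ev (U : ℤ × ℝ → ℂ) (t : ℝ) (k : ℤ) : ℂ :=
  ∫ τ : ℝ, Complex.exp (Complex.I * t * τ) * U (k, τ)

/-- The `L¹` norm in time frequency of the `k`-th mode. -/
noncomputable def modeNorm (U : ℤ × ℝ → ℂ) (k : ℤ) : ℝ≥0∞ := ∫⁻ τ : ℝ, ‖U (k, τ)‖ₑ

lemma enorm_ev_le (U : ℤ × ℝ → ℂ) (t : ℝ) (k : ℤ) : ‖ev U t k‖ₑ ≤ modeNorm U k := by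
  refine (enorm_integral_le_lintegral_enorm _).trans (le_of_eq ?_)
  refine lintegral_congr fun τ => ?_
  rw [enorm_mul, ← ofReal_norm (Complex.exp _), norm_exp_I_mul]
  simp

lemma measurable_mode {U : ℤ × ℝ → ℂ} (hU : Measurable U) (k : ℤ) :
    Measurable fun τ : ℝ => U (k, τ) := hU.comp measurable_prodMk_left

lemma integrable_mode {U : ℤ × ℝ → ℂ} (hU : Measurable U) {k : ℤ} (h : modeNorm U k < ⊤) :
    Integrable fun τ : ℝ => U (k, τ) :=
  ⟨(measurable_mode hU k).aestronglyMeasurable, h⟩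

lemma ev_sub {U V : ℤ × ℝ → ℂ} {k : ℤ} (hU : Integrable fun τ : ℝ => U (k, τ))
    (hV : Integrable fun τ : ℝ => V (k, τ)) (t : ℝ) :
    ev (fun ξ => U ξ - V ξ) t k = ev U t k - ev V t k := by
  simp only [ev, mul_sub]
  exact integral_sub (integrable_exp_mul hU t) (integrable_exp_mul hV t)

lemma ev_add {U V : ℤ × ℝ → ℂ} {k : ℤ} (hU : Integrable fun τ : ℝ => U (k, τ))
    (hV : Integrable fun τ : ℝ => V (k, τ)) (t : ℝ) :
    ev (fun ξ => U ξ + V ξ) t k = ev U t k + ev V t k := by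
  simp only [ev, mul_add]
  exact integral_add (integrable_exp_mul hU t) (integrable_exp_mul hV t)

lemma continuous_ev {U : ℤ × ℝ → ℂ} {k : ℤ} (hU : Integrable fun τ : ℝ => U (k, τ)) :
    Continuous fun t => ev U t k := by
  refine continuous_of_dominated (fun t => (integrable_exp_mul hU t).aestronglyMeasurable)
    (bound := fun τ => ‖U (k, τ)‖) (fun t => Eventually.of_forall fun τ => ?_) hU.norm
    (Eventually.of_forall fun τ => by fun_prop)
  rw [norm_mul, norm_exp_I_mul, one_mul]

lemma lt_top_of_nrm_count_lt_top {z : ℤ → ℝ≥0∞} (h : nrm Measure.count z < ⊤) (k : ℤ) :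
    z k < ⊤ := by
  have h1 : z k ^ 2 ≤ nrm Measure.count z ^ 2 := by
    rw [nrm_count_sq]; exact ENNReal.le_tsum k
  have h2 : z k ^ 2 < ⊤ := h1.trans_lt (ENNReal.pow_lt_top h)
  exact (ENNReal.pow_lt_top_iff (n := 2)).1 h2 |>.resolve_right (by norm_num)

/-- The operator `duh` in all modes: the Duhamel integral, altered outside `[-1/M, 1/M]`. -/
noncomputable def Duh (P : ℝ → ℂ) (j : ℕ) (M : ℝ) (F : ℤ × ℝ → ℂ) (ξ : ℤ × ℝ) : ℂ :=
  duh P M (fun σ => F (ξ.1, σ + (ξ.1 : ℝ) ^ (2 * j + 1))) (modul j ξ)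

/-- The free evolution of the initial datum `x`, cut off in time at scale `1/M`. -/
noncomputable def freeEv (P : ℝ → ℂ) (j : ℕ) (M : ℝ) (x : ℤ → ℂ) (ξ : ℤ × ℝ) : ℂ :=
  x ξ.1 * scaled P M (modul j ξ)

lemma phase_eq (j : ℕ) (t : ℝ) (k : ℤ) :
    phase j t k = Complex.exp (Complex.I * t * ((k : ℝ) ^ (2 * j + 1) : ℝ)) := by
  simp [phase]

lemma phase_add (j : ℕ) (t r : ℝ) (k : ℤ) : phase j (t + r) k = phase j t k * phase j r k := by
  simp only [phase, ← Complex.exp_add]; congr 1; push_cast; ring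

lemma phase_zero (j : ℕ) (k : ℤ) : phase j 0 k = 1 := by simp [phase]

lemma continuous_phase (j : ℕ) (k : ℤ) : Continuous fun t => phase j t k := by
  unfold phase; fun_prop


lemma measurable_Duh {φ P : ℝ → ℂ} {C : ℝ} (hP : IsCutoff φ P C) (j : ℕ) (M : ℝ)
    {F : ℤ × ℝ → ℂ} (hF : Measurable F) : Measurable (Duh P j M F) := by
  refine measurable_of_int_prod fun k => ?_
  have h1 : Measurable fun σ : ℝ => F (k, σ + (k : ℝ) ^ (2 * j + 1)) :=
    (measurable_mode hF k).comp (by fun_prop)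
  exact (hP.measurable_duh M h1).comp (by unfold modul; fun_prop)

lemma integrable_Duh {φ P : ℝ → ℂ} {C : ℝ} (hP : IsCutoff φ P C) (j : ℕ) {M : ℝ} (hM : 0 < M)
    {F : ℤ × ℝ → ℂ} {k : ℤ} (hF : Integrable fun τ : ℝ => F (k, τ)) :
    Integrable fun τ : ℝ => Duh P j M F (k, τ) :=
  (hP.integrable_duh hM (hF.comp_add_right ((k : ℝ) ^ (2 * j + 1)))).comp_sub_right
    ((k : ℝ) ^ (2 * j + 1))

lemma exp_shift (t τ c : ℝ) : Complex.exp (Complex.I * t * τ)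
    = Complex.exp (Complex.I * t * c) * Complex.exp (Complex.I * t * (τ - c : ℝ)) := by
  rw [← Complex.exp_add]; congr 1; push_cast; ring

lemma integral_exp_shift (f : ℝ → ℂ) (t c : ℝ) :
    ∫ τ : ℝ, Complex.exp (Complex.I * t * τ) * f (τ - c)
      = Complex.exp (Complex.I * t * c) * ∫ τ : ℝ, Complex.exp (Complex.I * t * τ) * f τ := by
  rw [← integral_const_mul, ← integral_sub_right_eq_self (fun τ : ℝ =>
    Complex.exp (Complex.I * t * c) * (Complex.exp (Complex.I * t * τ) * f τ)) c]
  refine integral_congr_ae (Eventually.of_forall fun τ => ?_)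
  simp only []
  rw [exp_shift t τ c]; ring

lemma ev_Duh {φ P : ℝ → ℂ} {C : ℝ} (hP : IsCutoff φ P C) (hφ : ∀ t, |t| ≤ 1 → φ t = 1) (j : ℕ)
    {M : ℝ} (hM : 0 < M) {F : ℤ × ℝ → ℂ} {k : ℤ} (hF : Integrable fun τ : ℝ => F (k, τ))
    {t : ℝ} (ht : |M * t| ≤ 1) :
    ev (Duh P j M F) t k = ∫ r in (0 : ℝ)..t, phase j (t - r) k * ev F r k := by
  set c : ℝ := (k : ℝ) ^ (2 * j + 1) with hc
  have h1 := hP.integral_exp_duh hφ hM (hF.comp_add_right c) ht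
  have h2 : ev (Duh P j M F) t k = Complex.exp (Complex.I * t * c)
      * ∫ τ : ℝ, Complex.exp (Complex.I * t * τ) * duh P M (fun σ => F (k, σ + c)) τ :=
    integral_exp_shift (duh P M (fun σ => F (k, σ + c))) t c
  rw [h2, h1, ← intervalIntegral.integral_const_mul]
  refine intervalIntegral.integral_congr fun r _ => ?_
  have h3 := integral_exp_shift (fun σ => F (k, σ + c)) r c
  simp only [sub_add_cancel] at h3
  simp only [ev, h3]
  rw [← mul_assoc, phase_eq, ← Complex.exp_add]
  congr 2
  push_cast [hc]; ring

lemma ev_freeEv {φ P : ℝ → ℂ} {C : ℝ} (hP : IsCutoff φ P C) (hφ : ∀ t, |t| ≤ 1 → φ t = 1) (j : ℕ)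
    {M : ℝ} (hM : 0 < M) (x : ℤ → ℂ) (k : ℤ) {t : ℝ} (ht : |M * t| ≤ 1) :
    ev (freeEv P j M x) t k = phase j t k * x k := by
  have h1 := integral_exp_shift (scaled P M) t ((k : ℝ) ^ (2 * j + 1))
  rw [hP.integral_scaled hM, hφ _ ht, mul_one, ← phase_eq] at h1
  rw [← h1, ← integral_mul_const]
  refine integral_congr_ae (Eventually.of_forall fun τ => ?_)
  simp only [freeEv, modul]; ring

lemma measurable_freeEv {φ P : ℝ → ℂ} {C : ℝ} (hP : IsCutoff φ P C) (j : ℕ) (M : ℝ) (x : ℤ → ℂ) :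
    Measurable (freeEv P j M x) := by
  refine measurable_of_int_prod fun k => ?_
  have h := (hP.continuous_scaled M).measurable
  have h2 : Measurable fun τ : ℝ => modul j (k, τ) := by unfold modul; fun_prop
  exact (measurable_const (a := x k)).mul (h.comp h2)

lemma integrable_freeEv {φ P : ℝ → ℂ} {C : ℝ} (hP : IsCutoff φ P C) (j : ℕ) {M : ℝ} (hM : 0 < M)
    (x : ℤ → ℂ) (k : ℤ) : Integrable fun τ : ℝ => freeEv P j M x (k, τ) :=
  ((hP.integrable_scaled hM).comp_sub_right ((k : ℝ) ^ (2 * j + 1))).const_mul (x k)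

lemma Duh_sub {φ P : ℝ → ℂ} {C : ℝ} (hP : IsCutoff φ P C) (j : ℕ) {M : ℝ} (hM : 0 < M)
    {F G : ℤ × ℝ → ℂ} (hF : ∀ k, Integrable fun τ : ℝ => F (k, τ))
    (hG : ∀ k, Integrable fun τ : ℝ => G (k, τ)) (ξ : ℤ × ℝ) :
    Duh P j M (fun ξ => F ξ - G ξ) ξ = Duh P j M F ξ - Duh P j M G ξ :=
  hP.duh_sub hM ((hF ξ.1).comp_add_right _) ((hG ξ.1).comp_add_right _) _

/-- A function dominated by the Cauchy profile around each dispersion curve lies in `Y_M`. -/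
lemma yn_profile_le (j : ℕ) {M : ℝ} (hM : 1 ≤ M) (z : ℤ → ℝ≥0∞) :
    yn j M (fun ξ => ENNReal.ofReal (cauchyProfile M (modul j ξ)) * z ξ.1)
      ≤ 8 * nrm Measure.count z := by
  have hM0 : 0 < M := by linarith
  have hz : Measurable fun ξ : ℤ × ℝ => z ξ.1 := (measurable_of_countable z).comp measurable_fst
  have hshift : ∀ k : ℤ, ∫⁻ τ : ℝ, ENNReal.ofReal (cauchyProfile M (modul j (k, τ)))
      = ENNReal.ofReal Real.pi := by
    intro k
    rw [← lintegral_cauchyProfile hM0]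
    exact lintegral_sub_right_eq_self (fun σ => ENNReal.ofReal (cauchyProfile M σ))
      ((k : ℝ) ^ (2 * j + 1))
  have hpi : ENNReal.ofReal Real.pi ≤ 4 := by
    rw [show (4 : ℝ≥0∞) = ENNReal.ofReal 4 by norm_num]
    exact ENNReal.ofReal_le_ofReal Real.pi_le_four
  have h1 : nrm freqMeasure (fun ξ => wt j M ξ ^ (1 / 2 : ℝ)
      * (ENNReal.ofReal (cauchyProfile M (modul j ξ)) * z ξ.1)) ≤ 4 * nrm Measure.count z := by
    refine nrm_le_of_sq_le ?_
    rw [mul_pow, nrm_count_sq, lintegral_int_prod (by fun_prop), ← ENNReal.tsum_mul_left]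
    refine ENNReal.tsum_le_tsum fun k => ?_
    calc _ ≤ ∫⁻ τ : ℝ, (2 * z k ^ 2) * ENNReal.ofReal (cauchyProfile M (modul j (k, τ))) := by
          refine lintegral_mono fun τ => ?_
          simp only [mul_pow, rpow_half_sq]
          have h2 := ENNReal.ofReal_le_ofReal
            (add_abs_mul_cauchyProfile_sq_le hM0 (modul j (k, τ)))
          rw [ENNReal.ofReal_mul (by positivity), ENNReal.ofReal_pow
            (cauchyProfile_nonneg hM0.le _), ENNReal.ofReal_mul (by norm_num)] at h2
          rw [← mul_assoc]
          refine (mul_le_mul_left h2 _).trans (le_of_eq ?_)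
          norm_num; ring
      _ = 2 * z k ^ 2 * ENNReal.ofReal Real.pi := by
          rw [lintegral_const_mul _ (by fun_prop), hshift]
      _ ≤ 2 * z k ^ 2 * 4 := by gcongr
      _ = 8 * z k ^ 2 := by ring
      _ ≤ _ := by gcongr; norm_num
  have h2 : nrm Measure.count (fun k => ∫⁻ τ : ℝ,
      ENNReal.ofReal (cauchyProfile M (modul j (k, τ))) * z k) ≤ 4 * nrm Measure.count z := by
    rw [← nrm_const_mul _ (measurable_of_countable z).aemeasurable]
    refine nrm_mono fun k => ?_
    rw [lintegral_mul_const _ (by fun_prop), hshift]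
    gcongr
  calc _ ≤ 4 * nrm Measure.count z + 4 * nrm Measure.count z := add_le_add h1 h2
    _ = _ := by ring

lemma yn_mono (j : ℕ) (M : ℝ) {a b : ℤ × ℝ → ℝ≥0∞} (h : ∀ ξ, a ξ ≤ b ξ) : yn j M a ≤ yn j M b := by
  unfold yn
  refine add_le_add (nrm_mono fun ξ => ?_) (nrm_mono fun k => lintegral_mono fun τ => h _)
  gcongr
  exact h ξ

lemma yn_add_le (j : ℕ) (M : ℝ) {a b : ℤ × ℝ → ℝ≥0∞} (ha : Measurable a) (hb : Measurable b) :
    yn j M (fun ξ => a ξ + b ξ) ≤ yn j M a + yn j M b := by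
  unfold yn
  simp only [mul_add]
  have h1 := nrm_add_le (μ := freqMeasure) (f := fun ξ => wt j M ξ ^ (1 / 2 : ℝ) * a ξ)
    (g := fun ξ => wt j M ξ ^ (1 / 2 : ℝ) * b ξ) (by fun_prop) (by fun_prop)
  have h2 := nrm_add_le (μ := Measure.count) (f := fun k : ℤ => ∫⁻ τ : ℝ, a (k, τ))
    (g := fun k : ℤ => ∫⁻ τ : ℝ, b (k, τ)) (measurable_of_countable _).aemeasurable
    (measurable_of_countable _).aemeasurable
  have h3 : ∀ k : ℤ, ∫⁻ τ : ℝ, (a (k, τ) + b (k, τ))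
      = (∫⁻ τ : ℝ, a (k, τ)) + ∫⁻ τ : ℝ, b (k, τ) := fun k => lintegral_add_left (by fun_prop) _
  simp only [h3]
  calc _ ≤ _ := add_le_add h1 h2
    _ = _ := by ring

lemma yn_const_mul_le (j : ℕ) (M : ℝ) (c : ℝ≥0) (a : ℤ × ℝ → ℝ≥0∞) :
    yn j M (fun ξ => c * a ξ) ≤ c * yn j M a := by
  unfold yn
  rw [mul_add]
  simp only [mul_left_comm _ (c : ℝ≥0∞)]
  refine add_le_add (nrm_const_mul_le c _) ?_
  refine le_trans (le_of_eq ?_) (nrm_const_mul_le c _)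
  congr 1; ext k
  rw [lintegral_const_mul' _ _ (by simp)]

lemma zn_mono (j : ℕ) (M : ℝ) {a b : ℤ × ℝ → ℝ≥0∞} (h : ∀ ξ, a ξ ≤ b ξ) : zn j M a ≤ zn j M b := by
  unfold zn
  refine add_le_add (nrm_mono fun ξ => ?_) (nrm_mono fun k => lintegral_mono fun τ => ?_)
  · gcongr; exact h ξ
  · gcongr; exact h _

lemma zn_add_le (j : ℕ) (M : ℝ) {a b : ℤ × ℝ → ℝ≥0∞} (ha : Measurable a) (hb : Measurable b) :
    zn j M (fun ξ => a ξ + b ξ) ≤ zn j M a + zn j M b := by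
  unfold zn
  simp only [mul_add]
  have h1 := nrm_add_le (μ := freqMeasure) (f := fun ξ => wt j M ξ ^ (-(1 / 2) : ℝ) * a ξ)
    (g := fun ξ => wt j M ξ ^ (-(1 / 2) : ℝ) * b ξ) (by fun_prop) (by fun_prop)
  have h2 := nrm_add_le (μ := Measure.count)
    (f := fun k : ℤ => ∫⁻ τ : ℝ, wt j M (k, τ) ^ (-1 : ℝ) * a (k, τ))
    (g := fun k : ℤ => ∫⁻ τ : ℝ, wt j M (k, τ) ^ (-1 : ℝ) * b (k, τ))
    (measurable_of_countable _).aemeasurable (measurable_of_countable _).aemeasurable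
  have h3 : ∀ k : ℤ, ∫⁻ τ : ℝ, (wt j M (k, τ) ^ (-1 : ℝ) * a (k, τ)
      + wt j M (k, τ) ^ (-1 : ℝ) * b (k, τ)) = (∫⁻ τ : ℝ, wt j M (k, τ) ^ (-1 : ℝ) * a (k, τ))
      + ∫⁻ τ : ℝ, wt j M (k, τ) ^ (-1 : ℝ) * b (k, τ) :=
    fun k => lintegral_add_left (by fun_prop) _
  simp only [h3]
  calc _ ≤ _ := add_le_add h1 h2
    _ = _ := by ring

lemma zn_const_mul_le (j : ℕ) (M : ℝ) (c : ℝ≥0) (a : ℤ × ℝ → ℝ≥0∞) :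
    zn j M (fun ξ => c * a ξ) ≤ c * zn j M a := by
  unfold zn
  rw [mul_add]
  simp only [mul_left_comm _ (c : ℝ≥0∞)]
  refine add_le_add (nrm_const_mul_le c _) ?_
  refine le_trans (le_of_eq ?_) (nrm_const_mul_le c _)
  congr 1; ext k
  rw [lintegral_const_mul' _ _ (by simp)]

/-- Integration in time maps `Z_M` to `Y_M`, uniformly in `M` and for every weight in the space
frequency. -/
lemma yn_Duh_le {φ P : ℝ → ℂ} {C : ℝ} (hP : IsCutoff φ P C) : ∃ D : ℝ≥0, ∀ (j : ℕ) (M : ℝ),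
    1 ≤ M → ∀ (v : ℤ → ℝ≥0∞) (F : ℤ × ℝ → ℂ), Measurable F →
      yn j M (fun ξ => v ξ.1 * ‖Duh P j M F ξ‖ₑ) ≤ D * zn j M (fun ξ => v ξ.1 * ‖F ξ‖ₑ) := by
  refine ⟨2 + (2 * C).toNNReal * 8, fun j M hM v F hF => ?_⟩
  have hM0 : 0 < M := by linarith
  have hC := hP.nonneg
  set z : ℤ → ℝ≥0∞ := fun k => ∫⁻ τ : ℝ, wt j M (k, τ) ^ (-1 : ℝ) * (v k * ‖F (k, τ)‖ₑ) with hz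
  have hvm : Measurable fun ξ : ℤ × ℝ => v ξ.1 := (measurable_of_countable v).comp measurable_fst
  have hzm : Measurable fun ξ : ℤ × ℝ => z ξ.1 := (measurable_of_countable z).comp measurable_fst
  have hFe : Measurable fun ξ => ‖F ξ‖ₑ := hF.enorm
  have hz2 : nrm Measure.count z ≤ zn j M (fun ξ => v ξ.1 * ‖F ξ‖ₑ) := le_add_self
  have hpt : ∀ ξ : ℤ × ℝ, v ξ.1 * ‖Duh P j M F ξ‖ₑ
      ≤ ((2 : ℝ≥0) : ℝ≥0∞) * (wt j M ξ ^ (-1 : ℝ) * (v ξ.1 * ‖F ξ‖ₑ))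
        + ((2 * C).toNNReal : ℝ≥0∞)
          * (ENNReal.ofReal (cauchyProfile M (modul j ξ)) * z ξ.1) := by
    rintro ⟨k, τ⟩
    have h1 := hP.enorm_duh_le hM0 (F := fun σ => F (k, σ + (k : ℝ) ^ (2 * j + 1)))
      (modul j (k, τ))
    have h2 : (∫⁻ σ₁ : ℝ, (ENNReal.ofReal (M + |σ₁|))⁻¹ * ‖F (k, σ₁ + (k : ℝ) ^ (2 * j + 1))‖ₑ)
        = ∫⁻ τ : ℝ, wt j M (k, τ) ^ (-1 : ℝ) * ‖F (k, τ)‖ₑ := by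
      rw [← lintegral_sub_right_eq_self _ ((k : ℝ) ^ (2 * j + 1))]
      refine lintegral_congr fun τ => ?_
      simp [wt, modul, ENNReal.rpow_neg_one]
    have h3 : modul j (k, τ) + (k : ℝ) ^ (2 * j + 1) = τ := by simp [modul]
    simp only [h3] at h1
    rw [h2] at h1
    have hzk : z k = v k * ∫⁻ τ : ℝ, wt j M (k, τ) ^ (-1 : ℝ) * ‖F (k, τ)‖ₑ := by
      rw [← lintegral_const_mul _ (by fun_prop)]
      exact lintegral_congr fun τ => by ring
    calc v k * ‖Duh P j M F (k, τ)‖ₑ ≤ v k * _ := mul_le_mul_right h1 _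
      _ = _ := by
        simp only [hzk, wt, ENNReal.rpow_neg_one, ENNReal.ofReal, ENNReal.coe_ofNat]
        ring
  refine (yn_mono j M hpt).trans ((yn_add_le j M (by fun_prop) (by fun_prop)).trans ?_)
  push_cast
  rw [add_mul]
  refine add_le_add ((yn_const_mul_le j M 2 _).trans ?_) ((yn_const_mul_le j M _ _).trans ?_)
  · push_cast
    gcongr
    refine add_le_add (nrm_mono fun ξ => ?_) le_rfl
    rw [← mul_assoc, ← wt_rpow_add j hM]
    norm_num
  · rw [mul_assoc]
    gcongr
    exact (yn_profile_le j hM z).trans (by gcongr)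

lemma yn_freeEv_le {φ P : ℝ → ℂ} {C : ℝ} (hP : IsCutoff φ P C) : ∃ D : ℝ≥0, ∀ (j : ℕ) (M : ℝ),
    1 ≤ M → ∀ (v : ℤ → ℝ≥0∞) (x : ℤ → ℂ),
      yn j M (fun ξ => v ξ.1 * ‖freeEv P j M x ξ‖ₑ)
        ≤ D * nrm Measure.count (fun k => v k * ‖x k‖ₑ) := by
  refine ⟨C.toNNReal * 8, fun j M hM v x => ?_⟩
  have hM0 : 0 < M := by linarith
  have hC := hP.nonneg
  push_cast
  rw [mul_assoc]
  refine le_trans (yn_mono j M (b := fun ξ => (C.toNNReal : ℝ≥0∞)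
    * (ENNReal.ofReal (cauchyProfile M (modul j ξ)) * (v ξ.1 * ‖x ξ.1‖ₑ))) fun ξ => ?_) ?_
  · rw [freeEv, enorm_mul]
    have : ‖scaled P M (modul j ξ)‖ₑ ≤ C.toNNReal * ENNReal.ofReal (cauchyProfile M (modul j ξ)) := by
      rw [← ofReal_norm]
      refine (ENNReal.ofReal_le_ofReal (hP.norm_scaled_le hM0 _)).trans_eq ?_
      rw [ENNReal.ofReal_mul hC]; rfl
    calc _ ≤ v ξ.1 * (‖x ξ.1‖ₑ * (C.toNNReal * ENNReal.ofReal (cauchyProfile M (modul j ξ)))) := by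
          gcongr
      _ = _ := by ring
  · refine (yn_const_mul_le j M _ _).trans ?_
    gcongr
    exact yn_profile_le j hM fun k => v k * ‖x k‖ₑ

/-! ### The forcing terms on the Fourier side -/

lemma tsum_eq_integral_count {ι : Type*} [Countable ι] [MeasurableSpace ι]
    [MeasurableSingletonClass ι] (f : ι → ℂ) : ∑' l, f l = ∫ l, f l ∂Measure.count := by
  by_cases h : Summable f
  · have hi : Integrable f Measure.count := integrable_count_iff.2 h.norm
    rw [integral_countable hi]
    simp
  · rw [tsum_eq_zero_of_not_summable h, integral_undef]
    rw [integrable_count_iff]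
    exact fun h' => h h'.of_norm

lemma measurable_tsum_complex {ι : Type*} [Countable ι] [MeasurableSpace ι]
    [MeasurableSingletonClass ι] {α : Type*} [MeasurableSpace α] {f : ι → α → ℂ}
    (h : ∀ l, Measurable (f l)) : Measurable fun a => ∑' l, f l a := by
  simp only [tsum_eq_integral_count]
  have h1 : StronglyMeasurable fun z : α × ι => f z.2 z.1 :=
    (measurable_from_prod_countable_left fun l => h l).stronglyMeasurable
  exact h1.integral_prod_right.measurable

/-- Convolution on the group of space-time frequencies. -/
noncomputable def cconv (U V : ℤ × ℝ → ℂ) (ξ : ℤ × ℝ) : ℂ := ∫ η, U η * V (ξ - η) ∂freqMeasure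

lemma measurable_cconv {U V : ℤ × ℝ → ℂ} (hU : Measurable U) (hV : Measurable V) :
    Measurable (cconv U V) := by
  have h : StronglyMeasurable fun z : (ℤ × ℝ) × (ℤ × ℝ) => U z.2 * V (z.1 - z.2) :=
    Measurable.stronglyMeasurable (by fun_prop)
  exact h.integral_prod_right.measurable

lemma enorm_cconv_le (U V : ℤ × ℝ → ℂ) (ξ : ℤ × ℝ) :
    ‖cconv U V ξ‖ₑ ≤ cv (fun η => ‖U η‖ₑ) (fun η => ‖V η‖ₑ) ξ := by
  refine (enorm_integral_le_lintegral_enorm _).trans (le_of_eq ?_)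
  simp only [enorm_mul, cv]

lemma tsum_mul_le_nrm (a b : ℤ → ℝ≥0∞) :
    ∑' l, a l * b l ≤ nrm Measure.count a * nrm Measure.count b := by
  rw [← lintegral_count]
  exact lintegral_mul_le_nrm (measurable_of_countable _).aemeasurable
    (measurable_of_countable _).aemeasurable

lemma nrm_count_reflect (b : ℤ → ℝ≥0∞) (k : ℤ) :
    nrm Measure.count (fun l => b (k - l)) = nrm Measure.count b := by
  rw [nrm_count_eq, nrm_count_eq]
  congr 1
  exact (Equiv.subLeft k).tsum_eq fun l => b l ^ 2

lemma tsum_conv_lt_top {a b : ℤ → ℝ≥0∞} (ha : nrm Measure.count a < ⊤)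
    (hb : nrm Measure.count b < ⊤) (k : ℤ) : ∑' l, a l * b (k - l) < ⊤ :=
  (tsum_mul_le_nrm a fun l => b (k - l)).trans_lt
    (ENNReal.mul_lt_top ha ((nrm_count_reflect b k).trans_lt hb))

lemma integrable_cconv_prod {U V : ℤ × ℝ → ℂ} (hU : Measurable U) (hV : Measurable V)
    (hU' : nrm Measure.count (modeNorm U) < ⊤) (hV' : nrm Measure.count (modeNorm V) < ⊤)
    (t : ℝ) (k : ℤ) :
    Integrable (Function.uncurry fun (τ : ℝ) (η : ℤ × ℝ) =>
      Complex.exp (Complex.I * t * τ) * (U η * V ((k, τ) - η))) (volume.prod freqMeasure) := by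
  have hm : Measurable (Function.uncurry fun (τ : ℝ) (η : ℤ × ℝ) =>
      Complex.exp (Complex.I * t * τ) * (U η * V ((k, τ) - η))) := by
    unfold Function.uncurry
    fun_prop
  refine ⟨hm.aestronglyMeasurable, ?_⟩
  rw [hasFiniteIntegral_iff_enorm, lintegral_prod _ hm.enorm.aemeasurable]
  have h1 : ∫⁻ (τ : ℝ), ∫⁻ (η : ℤ × ℝ), ‖(Function.uncurry fun (τ : ℝ) (η : ℤ × ℝ) =>
      Complex.exp (Complex.I * t * τ) * (U η * V ((k, τ) - η))) (τ, η)‖ₑ ∂freqMeasure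
      = ∫⁻ τ : ℝ, cv (fun η => ‖U η‖ₑ) (fun η => ‖V η‖ₑ) (k, τ) := by
    refine lintegral_congr fun τ => lintegral_congr fun η => ?_
    simp only [Function.uncurry_apply_pair, enorm_mul]
    rw [← ofReal_norm (Complex.exp _), norm_exp_I_mul]
    simp
  rw [h1, lintegral_cv _ _ hU.enorm hV.enorm]
  exact tsum_conv_lt_top hU' hV' k

lemma integrable_cconv {U V : ℤ × ℝ → ℂ} (hU : Measurable U) (hV : Measurable V)
    (hU' : nrm Measure.count (modeNorm U) < ⊤) (hV' : nrm Measure.count (modeNorm V) < ⊤)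
    (k : ℤ) : Integrable fun τ : ℝ => cconv U V (k, τ) := by
  have := (integrable_cconv_prod hU hV hU' hV' 0 k).integral_prod_left
  simpa [cconv] using this

lemma ev_cconv {U V : ℤ × ℝ → ℂ} (hU : Measurable U) (hV : Measurable V)
    (hU' : nrm Measure.count (modeNorm U) < ⊤) (hV' : nrm Measure.count (modeNorm V) < ⊤)
    (t : ℝ) (k : ℤ) : ev (cconv U V) t k = ∑' l, ev U t l * ev V t (k - l) := by
  have hi := integrable_cconv_prod hU hV hU' hV' t k
  have h1 : ∀ η : ℤ × ℝ, ∫ τ : ℝ, Complex.exp (Complex.I * t * τ) * (U η * V ((k, τ) - η))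
      = Complex.exp (Complex.I * t * η.2) * U η * ev V t (k - η.1) := by
    intro η
    have h2 := integral_exp_shift (fun τ => V (k - η.1, τ)) t η.2
    calc _ = U η * ∫ τ : ℝ, Complex.exp (Complex.I * t * τ) * V (k - η.1, τ - η.2) := by
          rw [← integral_const_mul]
          refine integral_congr_ae (Eventually.of_forall fun τ => ?_)
          change _ * (U η * V (k - η.1, τ - η.2)) = _
          ring
      _ = _ := by rw [h2, ev]; ring
  calc ev (cconv U V) t k
      = ∫ τ : ℝ, ∫ η, Complex.exp (Complex.I * t * τ) * (U η * V ((k, τ) - η)) ∂freqMeasure := by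
        simp only [ev, cconv, integral_const_mul]
    _ = ∫ η, Complex.exp (Complex.I * t * η.2) * U η * ev V t (k - η.1) ∂freqMeasure := by
        rw [integral_integral_swap hi]
        simp only [h1]
    _ = _ := by
        have hi2 : Integrable (fun η : ℤ × ℝ => Complex.exp (Complex.I * t * η.2) * U η
            * ev V t (k - η.1)) freqMeasure := by
          refine hi.integral_prod_right.congr (Eventually.of_forall fun η => ?_)
          simp only [Function.uncurry_apply_pair, h1]
        rw [integral_prod _ hi2, tsum_eq_integral_count]
        refine integral_congr_ae (Eventually.of_forall fun l => ?_)
        simp only [ev, ← integral_mul_const]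

/-- The weight `⟨k⟩ ^ s`. -/
noncomputable def sobWt (s : ℝ) (k : ℤ) : ℝ≥0∞ := ENNReal.ofReal (bracket k ^ s)

/-- The norm of `H^s` on sequences of Fourier coefficients. -/
noncomputable def seqNorm (s : ℝ) (x : ℤ → ℂ) : ℝ≥0∞ :=
  nrm Measure.count (fun k => sobWt s k * ‖x k‖ₑ)

lemma one_le_bracket (x : ℝ) : 1 ≤ bracket x := by
  rw [bracket, Real.one_le_sqrt]; nlinarith [sq_nonneg x]

lemma abs_le_bracket (x : ℝ) : |x| ≤ bracket x := by
  rw [bracket, ← Real.sqrt_sq_eq_abs]; exact Real.sqrt_le_sqrt (by linarith)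

lemma bracket_le (x : ℝ) : bracket x ≤ 1 + |x| := by
  rw [bracket, Real.sqrt_le_left (by positivity)]
  nlinarith [sq_abs x, abs_nonneg x]

lemma sobWt_zero (k : ℤ) : sobWt 0 k = 1 := by simp [sobWt]

lemma sobWt_ne_top (s : ℝ) (k : ℤ) : sobWt s k ≠ ⊤ := ENNReal.ofReal_ne_top

lemma one_le_sobWt {s : ℝ} (hs : 0 ≤ s) (k : ℤ) : 1 ≤ sobWt s k := by
  rw [sobWt, ENNReal.one_le_ofReal]; exact Real.one_le_rpow (one_le_bracket _) hs

lemma bracket_add_le (x y : ℝ) : bracket (x + y) ≤ bracket x + bracket y := by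
  have hx := one_le_bracket x
  have hy := one_le_bracket y
  rw [bracket, Real.sqrt_le_left (by linarith)]
  have h1 : bracket x ^ 2 = 1 + x ^ 2 := Real.sq_sqrt (by positivity)
  have h2 : bracket y ^ 2 = 1 + y ^ 2 := Real.sq_sqrt (by positivity)
  have h3 := abs_le_bracket x
  have h4 := abs_le_bracket y
  have h5 : |x| * |y| ≤ bracket x * bracket y := by gcongr
  rw [← abs_mul] at h5
  nlinarith [le_abs_self (x * y)]

/-- The weight `⟨k⟩ ^ s` is, up to a constant, subadditive. -/
lemma exists_sobWt_le (s : ℝ) (hs : 0 ≤ s) : ∃ C : ℝ≥0, ∀ k l : ℤ,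
    sobWt s k ≤ C * (sobWt s l + sobWt s (k - l)) := by
  refine ⟨((2 : ℝ) ^ s).toNNReal, fun k l => ?_⟩
  have hl := one_le_bracket l
  have hk := one_le_bracket ((k - l : ℤ) : ℝ)
  have h0 : bracket k ≤ bracket l + bracket ((k - l : ℤ) : ℝ) := by
    have := bracket_add_le (l : ℝ) ((k - l : ℤ) : ℝ)
    push_cast at this ⊢
    rwa [add_sub_cancel] at this
  unfold sobWt
  rw [← ENNReal.ofReal_add (by positivity) (by positivity)]
  change _ ≤ ENNReal.ofReal (2 ^ s) * _
  rw [← ENNReal.ofReal_mul (by positivity)]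
  refine ENNReal.ofReal_le_ofReal ?_
  have hb : 0 ≤ bracket (k : ℝ) := by linarith [one_le_bracket (k : ℝ)]
  rcases le_total (bracket (l : ℝ)) (bracket ((k - l : ℤ) : ℝ)) with h | h
  · calc bracket k ^ s ≤ (2 * bracket ((k - l : ℤ) : ℝ)) ^ s :=
          Real.rpow_le_rpow hb (by linarith) hs
      _ = 2 ^ s * bracket ((k - l : ℤ) : ℝ) ^ s := Real.mul_rpow (by norm_num) (by linarith)
      _ ≤ _ := by
          have : 0 ≤ bracket (l : ℝ) ^ s := by positivity
          gcongr; linarith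
  · calc bracket k ^ s ≤ (2 * bracket l) ^ s := Real.rpow_le_rpow hb (by linarith) hs
      _ = 2 ^ s * bracket l ^ s := Real.mul_rpow (by norm_num) (by linarith)
      _ ≤ _ := by
          have : 0 ≤ bracket ((k - l : ℤ) : ℝ) ^ s := by positivity
          gcongr; linarith

/-- The properties of the matrix of the feedback operator on Fourier coefficients that the
nonlinear theory uses. -/
structure FeedbackMatrix (κ : ℤ → ℤ → ℂ) : Prop where
  row : ∀ k, nrm Measure.count (fun l => ‖κ k l‖ₑ) < ⊤
  bdd : ∀ s, 0 ≤ s → ∃ C : ℝ≥0, ∀ x : ℤ → ℂ, nrm Measure.count (fun l => ‖x l‖ₑ) < ⊤ →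
    seqNorm s (fun k => ∑' l, κ k l * x l) ≤ C * seqNorm s x
  zero_row : ∀ l, κ 0 l = 0
  conj : ∀ k l, κ (-k) (-l) = (starRingEnd ℂ) (κ k l)

/-- The feedback operator on the Fourier side. -/
noncomputable def applyK (κ : ℤ → ℤ → ℂ) (U : ℤ × ℝ → ℂ) (ξ : ℤ × ℝ) : ℂ :=
  ∑' l, κ ξ.1 l * U (l, ξ.2)

lemma measurable_applyK (κ : ℤ → ℤ → ℂ) {U : ℤ × ℝ → ℂ} (hU : Measurable U) :
    Measurable (applyK κ U) :=
  measurable_of_int_prod fun k => measurable_tsum_complex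
    (f := fun l τ => κ k l * U (l, τ)) fun l => (measurable_mode hU l).const_mul (κ k l)

lemma nrm_freqMeasure_eq {f : ℤ × ℝ → ℝ≥0∞} (hf : Measurable f) :
    nrm freqMeasure f ^ 2 = ∫⁻ τ : ℝ, nrm Measure.count (fun k => f (k, τ)) ^ 2 := by
  simp only [nrm_sq]
  exact lintegral_prod_symm _ (hf.pow_const 2).aemeasurable

lemma measurable_sobWt (s : ℝ) : Measurable fun ξ : ℤ × ℝ => sobWt s ξ.1 :=
  (measurable_of_countable (sobWt s)).comp measurable_fst

lemma nrm_applyK_le {κ : ℤ → ℤ → ℂ} {s : ℝ} {C : ℝ≥0}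
    (hC : ∀ x : ℤ → ℂ, nrm Measure.count (fun l => ‖x l‖ₑ) < ⊤ →
      seqNorm s (fun k => ∑' l, κ k l * x l) ≤ C * seqNorm s x)
    {U : ℤ × ℝ → ℂ} (hU : Measurable U) (hU' : nrm freqMeasure (fun ξ => ‖U ξ‖ₑ) < ⊤) :
    nrm freqMeasure (fun ξ => sobWt s ξ.1 * ‖applyK κ U ξ‖ₑ)
      ≤ C * nrm freqMeasure (fun ξ => sobWt s ξ.1 * ‖U ξ‖ₑ) := by
  have hs := measurable_sobWt s
  have hK := (measurable_applyK κ hU).enorm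
  have hUe := hU.enorm
  refine nrm_le_of_sq_le ?_
  rw [← nrm_sq, mul_pow, nrm_freqMeasure_eq (by fun_prop), nrm_freqMeasure_eq (by fun_prop),
    ← lintegral_const_mul' _ _ (by simp)]
  have hfin : ∀ᵐ τ : ℝ, nrm Measure.count (fun k => ‖U (k, τ)‖ₑ) < ⊤ := by
    have h1 : ∫⁻ τ : ℝ, nrm Measure.count (fun k => ‖U (k, τ)‖ₑ) ^ 2 ≠ ⊤ := by
      rw [← nrm_freqMeasure_eq hUe]
      exact (ENNReal.pow_lt_top hU').ne
    have h2 : AEMeasurable fun τ : ℝ => nrm Measure.count (fun k => ‖U (k, τ)‖ₑ) ^ 2 := by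
      simp only [nrm_count_sq]
      exact (Measurable.tsum fun k =>
        (measurable_mode hU k).enorm.pow_const 2).aemeasurable
    filter_upwards [ae_lt_top' h2 h1] with τ hτ
    exact ((ENNReal.pow_lt_top_iff (n := 2)).1 hτ).resolve_right (by norm_num)
  refine lintegral_mono_ae ?_
  filter_upwards [hfin] with τ hτ
  rw [← mul_pow]
  gcongr
  exact hC (fun l => U (l, τ)) hτ

lemma modeNorm_applyK_le (κ : ℤ → ℤ → ℂ) {U : ℤ × ℝ → ℂ} (hU : Measurable U) (k : ℤ) :
    modeNorm (applyK κ U) k ≤ ∑' l, ‖κ k l‖ₑ * modeNorm U l := by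
  calc modeNorm (applyK κ U) k ≤ ∫⁻ τ : ℝ, ∑' l, ‖κ k l‖ₑ * ‖U (l, τ)‖ₑ := by
        refine lintegral_mono fun τ => ?_
        refine enorm_tsum_le_tsum_enorm.trans (le_of_eq ?_)
        simp only [enorm_mul]
    _ = _ := by
        rw [lintegral_tsum fun l => ((measurable_mode hU l).enorm.const_mul _).aemeasurable]
        refine tsum_congr fun l => ?_
        rw [lintegral_const_mul _ (measurable_mode hU l).enorm, modeNorm]

lemma tsum_row_lt_top {κ : ℤ → ℤ → ℂ} (hκ : FeedbackMatrix κ) {U : ℤ × ℝ → ℂ}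
    (hU' : nrm Measure.count (modeNorm U) < ⊤) (k : ℤ) :
    ∑' l, ‖κ k l‖ₑ * modeNorm U l < ⊤ :=
  (tsum_mul_le_nrm _ _).trans_lt (ENNReal.mul_lt_top (hκ.row k) hU')

lemma integrable_applyK {κ : ℤ → ℤ → ℂ} (hκ : FeedbackMatrix κ) {U : ℤ × ℝ → ℂ}
    (hU : Measurable U) (hU' : nrm Measure.count (modeNorm U) < ⊤) (k : ℤ) :
    Integrable fun τ : ℝ => applyK κ U (k, τ) :=
  integrable_mode (measurable_applyK κ hU)
    ((modeNorm_applyK_le κ hU k).trans_lt (tsum_row_lt_top hκ hU' k))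

lemma ev_applyK {κ : ℤ → ℤ → ℂ} (hκ : FeedbackMatrix κ) {U : ℤ × ℝ → ℂ}
    (hU : Measurable U) (hU' : nrm Measure.count (modeNorm U) < ⊤) (t : ℝ) (k : ℤ) :
    ev (applyK κ U) t k = ∑' l, κ k l * ev U t l := by
  have h1 := integral_tsum (μ := (volume : Measure ℝ))
    (f := fun (l : ℤ) (τ : ℝ) => Complex.exp (Complex.I * t * τ) * (κ k l * U (l, τ)))
    (fun l => ((continuous_exp_I_mul t).measurable.mul
      ((measurable_mode hU l).const_mul _)).aestronglyMeasurable) ?_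
  · simp only [ev, applyK, ← tsum_mul_left]
    rw [h1]
    refine tsum_congr fun l => ?_
    rw [← integral_const_mul]
    refine integral_congr_ae (Eventually.of_forall fun τ => ?_)
    simp only []; ring
  · refine ne_of_lt (lt_of_le_of_lt (ENNReal.tsum_le_tsum fun l => le_of_eq ?_)
      (tsum_row_lt_top hκ hU' k))
    rw [modeNorm, ← lintegral_const_mul _ (measurable_mode hU l).enorm]
    refine lintegral_congr fun τ => ?_
    rw [enorm_mul, enorm_mul, ← ofReal_norm (Complex.exp _), norm_exp_I_mul]
    simp

/-- The polarised forcing term: the feedback of `V` and the interactions of `V` with `U₁`, `U₂`. -/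
noncomputable def dforcing (κ : ℤ → ℤ → ℂ) (U₁ U₂ V : ℤ × ℝ → ℂ) (ξ : ℤ × ℝ) : ℂ :=
  applyK κ V ξ + (Complex.I * ξ.1 / 2) * (cconv V U₁ ξ + cconv U₂ V ξ)

/-- The forcing term `K u + ∂ₓ(u²)/2` on the Fourier side. -/
noncomputable def forcing (κ : ℤ → ℤ → ℂ) (U : ℤ × ℝ → ℂ) (ξ : ℤ × ℝ) : ℂ :=
  applyK κ U ξ + (Complex.I * ξ.1 / 2) * cconv U U ξ

/-- The forcing term `K u + ∂ₓ(u²)/2` on Fourier coefficients in space. -/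
noncomputable def forceCoeff (κ : ℤ → ℤ → ℂ) (x : ℤ → ℂ) (k : ℤ) : ℂ :=
  (∑' l, κ k l * x l) + (Complex.I * k / 2) * ∑' l, x l * x (k - l)

lemma measurable_int_fun {U : ℤ → ℂ} : Measurable fun ξ : ℤ × ℝ => U ξ.1 :=
  (measurable_of_countable U).comp measurable_fst

lemma measurable_dforcing (κ : ℤ → ℤ → ℂ) {U₁ U₂ V : ℤ × ℝ → ℂ} (h1 : Measurable U₁)
    (h2 : Measurable U₂) (hV : Measurable V) : Measurable (dforcing κ U₁ U₂ V) :=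
  (measurable_applyK κ hV).add ((measurable_int_fun (U := fun k => Complex.I * k / 2)).mul
    ((measurable_cconv hV h1).add (measurable_cconv h2 hV)))

lemma measurable_forcing (κ : ℤ → ℤ → ℂ) {U : ℤ × ℝ → ℂ} (hU : Measurable U) :
    Measurable (forcing κ U) :=
  (measurable_applyK κ hU).add ((measurable_int_fun (U := fun k => Complex.I * k / 2)).mul
    (measurable_cconv hU hU))

lemma forcing_eq_dforcing (κ : ℤ → ℤ → ℂ) (U : ℤ × ℝ → ℂ) :
    forcing κ U = dforcing κ U (fun _ => 0) U := by
  ext ξ; simp [forcing, dforcing, cconv]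

lemma integrable_forcing {κ : ℤ → ℤ → ℂ} (hκ : FeedbackMatrix κ) {U : ℤ × ℝ → ℂ}
    (hU : Measurable U) (hU' : nrm Measure.count (modeNorm U) < ⊤) (k : ℤ) :
    Integrable fun τ : ℝ => forcing κ U (k, τ) :=
  (integrable_applyK hκ hU hU' k).add ((integrable_cconv hU hU hU' hU' k).const_mul (Complex.I * k / 2))

lemma integrable_dforcing {κ : ℤ → ℤ → ℂ} (hκ : FeedbackMatrix κ) {U₁ U₂ V : ℤ × ℝ → ℂ}
    (h1 : Measurable U₁) (h2 : Measurable U₂) (hV : Measurable V)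
    (h1' : nrm Measure.count (modeNorm U₁) < ⊤) (h2' : nrm Measure.count (modeNorm U₂) < ⊤)
    (hV' : nrm Measure.count (modeNorm V) < ⊤) (k : ℤ) :
    Integrable fun τ : ℝ => dforcing κ U₁ U₂ V (k, τ) :=
  (integrable_applyK hκ hV hV' k).add (((integrable_cconv hV h1 hV' h1' k).add
    (integrable_cconv h2 hV h2' hV' k)).const_mul (Complex.I * k / 2))

lemma ev_forcing {κ : ℤ → ℤ → ℂ} (hκ : FeedbackMatrix κ) {U : ℤ × ℝ → ℂ}
    (hU : Measurable U) (hU' : nrm Measure.count (modeNorm U) < ⊤) (t : ℝ) (k : ℤ) :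
    ev (forcing κ U) t k = forceCoeff κ (ev U t) k := by
  rw [forceCoeff, ← ev_applyK hκ hU hU', ← ev_cconv hU hU hU' hU']
  have h1 := ev_add (integrable_applyK hκ hU hU' k)
    ((integrable_cconv hU hU hU' hU' k).const_mul (Complex.I * k / 2))
    (V := fun ξ => (Complex.I * ξ.1 / 2) * cconv U U ξ) t
  refine h1.trans ?_
  congr 1
  simp only [ev, ← integral_const_mul]
  refine integral_congr_ae (Eventually.of_forall fun τ => ?_)
  simp only []; ring

/-- The polarised forcing term is bounded from `Y_M` to `Z_M` with a gain, and tamely in `H^s`. -/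
lemma exists_zn_dforcing_le {j : ℕ} (hj : 1 ≤ j) {κ : ℤ → ℤ → ℂ} (hκ : FeedbackMatrix κ) {s : ℝ}
    (hs : 0 ≤ s) : ∃ C : ℝ≥0, ∀ M : ℝ, 1 ≤ M → ∀ U₁ U₂ V : ℤ × ℝ → ℂ,
      Measurable U₁ → Measurable U₂ → Measurable V →
      (∀ τ, U₁ (0, τ) = 0) → (∀ τ, U₂ (0, τ) = 0) → (∀ τ, V (0, τ) = 0) →
      yn j M (fun ξ => ‖V ξ‖ₑ) < ⊤ →
      zn j M (fun ξ => sobWt s ξ.1 * ‖dforcing κ U₁ U₂ V ξ‖ₑ)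
        ≤ C * gain M * (yn j M (fun ξ => sobWt s ξ.1 * ‖V ξ‖ₑ)
            * (1 + yn j M (fun ξ => ‖U₁ ξ‖ₑ) + yn j M (fun ξ => ‖U₂ ξ‖ₑ))
          + yn j M (fun ξ => ‖V ξ‖ₑ) * (yn j M (fun ξ => sobWt s ξ.1 * ‖U₁ ξ‖ₑ)
            + yn j M (fun ξ => sobWt s ξ.1 * ‖U₂ ξ‖ₑ))) := by
  obtain ⟨B, hB⟩ := exists_bilinear hj
  obtain ⟨A, hA⟩ := hκ.bdd s hs
  obtain ⟨E, hE⟩ := exists_sobWt_le s hs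
  obtain ⟨D, hD⟩ := nrm_lintegral_wt_le
  refine ⟨(1 + D) * A + E * B, fun M hM U₁ U₂ V h1 h2 hV h10 h20 hV0 hfin => ?_⟩
  have hg := gain_le_one hM
  have hsm := measurable_sobWt s
  set u₁ : ℤ × ℝ → ℝ≥0∞ := fun ξ => ‖U₁ ξ‖ₑ with hu₁
  set u₂ : ℤ × ℝ → ℝ≥0∞ := fun ξ => ‖U₂ ξ‖ₑ with hu₂
  set v : ℤ × ℝ → ℝ≥0∞ := fun ξ => ‖V ξ‖ₑ with hv
  have m1 : Measurable u₁ := h1.enorm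
  have m2 : Measurable u₂ := h2.enorm
  have mv : Measurable v := hV.enorm
  set su₁ : ℤ × ℝ → ℝ≥0∞ := fun ξ => sobWt s ξ.1 * u₁ ξ with hsu₁
  set su₂ : ℤ × ℝ → ℝ≥0∞ := fun ξ => sobWt s ξ.1 * u₂ ξ with hsu₂
  set sv : ℤ × ℝ → ℝ≥0∞ := fun ξ => sobWt s ξ.1 * v ξ with hsv
  have ms1 : Measurable su₁ := hsm.mul m1
  have ms2 : Measurable su₂ := hsm.mul m2
  have msv : Measurable sv := hsm.mul mv
  have z1 : ∀ τ, u₁ (0, τ) = 0 := fun τ => by simp [hu₁, h10]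
  have z2 : ∀ τ, u₂ (0, τ) = 0 := fun τ => by simp [hu₂, h20]
  have zv : ∀ τ, v (0, τ) = 0 := fun τ => by simp [hv, hV0]
  have zs1 : ∀ τ, su₁ (0, τ) = 0 := fun τ => by simp [hsu₁, z1]
  have zs2 : ∀ τ, su₂ (0, τ) = 0 := fun τ => by simp [hsu₂, z2]
  have zsv : ∀ τ, sv (0, τ) = 0 := fun τ => by simp [hsv, zv]
  -- an `L²` bound with a gain
  have hL2 : ∀ a : ℤ × ℝ → ℝ≥0∞, Measurable a → nrm freqMeasure a ≤ gain M * yn j M a := by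
    intro a ha
    refine le_trans (nrm_mono fun ξ => ?_) ((nrm_wt_one_le j hM ha).trans
      (mul_le_mul_right le_self_add _))
    exact le_mul_of_one_le_left' (ENNReal.one_le_rpow (one_le_wt j le_rfl ξ) (by norm_num))
  have hVfin : nrm freqMeasure v < ⊤ := by
    refine (hL2 v mv).trans_lt (ENNReal.mul_lt_top (hg.trans_lt (by simp)) hfin)
  -- The feedback loses no derivative, so that the `L²` bound, which has the gain, suffices.
  have hK : zn j M (fun ξ => sobWt s ξ.1 * ‖applyK κ V ξ‖ₑ)
      ≤ ((1 + D) * A) * gain M * yn j M sv := by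
    have mK := (measurable_applyK κ hV).enorm
    have e1 : ∀ (M' : ℝ), 1 ≤ M' → ∀ (p : ℝ), 0 ≤ p → ∀ f : ℤ × ℝ → ℝ≥0∞,
        nrm freqMeasure (fun ξ => wt j M' ξ ^ (-p) * f ξ) ≤ nrm freqMeasure f := by
      intro M' hM' p hp f
      refine nrm_mono fun ξ => mul_le_of_le_one_left' ?_
      have := wt_neg_rpow_le j hM' ξ (le_refl (0 : ℝ)) hp
      simpa using this
    have e2 := hD j M hM (fun ξ => sobWt s ξ.1 * ‖applyK κ V ξ‖ₑ) (by fun_prop)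
    calc _ ≤ nrm freqMeasure (fun ξ => sobWt s ξ.1 * ‖applyK κ V ξ‖ₑ)
          + D * nrm freqMeasure (fun ξ => sobWt s ξ.1 * ‖applyK κ V ξ‖ₑ) :=
          add_le_add (e1 M hM _ (by norm_num) _)
            (e2.trans (mul_le_mul_right (e1 1 le_rfl _ (by norm_num) _) _))
      _ = (1 + D) * nrm freqMeasure (fun ξ => sobWt s ξ.1 * ‖applyK κ V ξ‖ₑ) := by ring
      _ ≤ (1 + D) * (A * (gain M * yn j M sv)) := by
          gcongr
          exact (nrm_applyK_le hA hV hVfin).trans (by gcongr; exact hL2 sv msv)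
      _ = _ := by ring
  -- the `s` derivatives fall on one of the two factors
  have hcv : ∀ a b : ℤ × ℝ → ℝ≥0∞, Measurable a → Measurable b → ∀ ξ : ℤ × ℝ,
      sobWt s ξ.1 * cv a b ξ ≤ E * (cv (fun η => sobWt s η.1 * a η) b ξ
        + cv a (fun η => sobWt s η.1 * b η) ξ) := by
    intro a b ha hb ξ
    unfold cv
    rw [← lintegral_add_left (by fun_prop), ← lintegral_const_mul _ (by fun_prop),
      ← lintegral_const_mul _ (by fun_prop)]
    refine lintegral_mono fun η => ?_
    calc _ ≤ E * (sobWt s η.1 + sobWt s (ξ.1 - η.1)) * (a η * b (ξ - η)) := by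
          gcongr; exact hE _ _
      _ = _ := by simp only [Prod.fst_sub]; ring
  set n : ℤ × ℝ → ℝ≥0∞ := fun ξ => ENNReal.ofReal |(ξ.1 : ℝ)| with hn
  have mn : Measurable n := (measurable_of_countable
    (fun k : ℤ => ENNReal.ofReal |(k : ℝ)|)).comp measurable_fst
  have mc : ∀ a b : ℤ × ℝ → ℝ≥0∞, Measurable a → Measurable b →
      Measurable fun ξ => n ξ * cv a b ξ := fun a b ha hb => mn.mul (measurable_cv ha hb)
  have hpt : ∀ ξ : ℤ × ℝ, sobWt s ξ.1 * ‖dforcing κ U₁ U₂ V ξ‖ₑ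
      ≤ sobWt s ξ.1 * ‖applyK κ V ξ‖ₑ + E * ((n ξ * cv sv u₁ ξ + n ξ * cv v su₁ ξ)
        + (n ξ * cv su₂ v ξ + n ξ * cv u₂ sv ξ)) := by
    intro ξ
    have hk : ‖(Complex.I * ξ.1 / 2 : ℂ)‖ₑ ≤ n ξ := by
      rw [← ofReal_norm]
      refine ENNReal.ofReal_le_ofReal ?_
      rw [norm_div, norm_mul, Complex.norm_I, one_mul, Complex.norm_intCast]
      have := abs_nonneg (ξ.1 : ℝ)
      norm_num
    calc _ ≤ sobWt s ξ.1 * (‖applyK κ V ξ‖ₑ + n ξ * (cv v u₁ ξ + cv u₂ v ξ)) := by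
          gcongr
          refine (enorm_add_le _ _).trans ?_
          gcongr
          rw [enorm_mul]
          gcongr
          exact (enorm_add_le _ _).trans (add_le_add (enorm_cconv_le _ _ _) (enorm_cconv_le _ _ _))
      _ = sobWt s ξ.1 * ‖applyK κ V ξ‖ₑ
          + n ξ * (sobWt s ξ.1 * cv v u₁ ξ + sobWt s ξ.1 * cv u₂ v ξ) := by ring
      _ ≤ sobWt s ξ.1 * ‖applyK κ V ξ‖ₑ + n ξ * (E * (cv sv u₁ ξ + cv v su₁ ξ)
          + E * (cv su₂ v ξ + cv u₂ sv ξ)) := by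
          exact add_le_add le_rfl (mul_le_mul_right (add_le_add (hcv v u₁ mv m1 ξ)
            (hcv u₂ v m2 mv ξ)) _)
      _ = _ := by ring
  have mK := (measurable_applyK κ hV).enorm
  have c1 := mc sv u₁ msv m1
  have c2 := mc v su₁ mv ms1
  have c3 := mc su₂ v ms2 mv
  have c4 := mc u₂ sv m2 msv
  have b1 := hB M hM sv u₁ msv m1 zsv z1
  have b2 := hB M hM v su₁ mv ms1 zv zs1
  have b3 := hB M hM su₂ v ms2 mv zs2 zv
  have b4 := hB M hM u₂ sv m2 msv z2 zsv
  calc _ ≤ zn j M (fun ξ => sobWt s ξ.1 * ‖applyK κ V ξ‖ₑ)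
        + E * ((zn j M (fun ξ => n ξ * cv sv u₁ ξ) + zn j M (fun ξ => n ξ * cv v su₁ ξ))
        + (zn j M (fun ξ => n ξ * cv su₂ v ξ) + zn j M (fun ξ => n ξ * cv u₂ sv ξ))) := by
        refine (zn_mono j M hpt).trans ((zn_add_le j M (by fun_prop) (by fun_prop)).trans ?_)
        gcongr
        refine (zn_const_mul_le j M E _).trans ?_
        gcongr
        refine (zn_add_le j M (by fun_prop) (by fun_prop)).trans ?_
        exact add_le_add (zn_add_le j M c1 c2) (zn_add_le j M c3 c4)
    _ ≤ ((1 + D) * A) * gain M * yn j M sv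
        + E * ((B * gain M * yn j M sv * yn j M u₁ + B * gain M * yn j M v * yn j M su₁)
        + (B * gain M * yn j M su₂ * yn j M v + B * gain M * yn j M u₂ * yn j M sv)) := by
        gcongr
    _ = ((1 + D) * A) * gain M * (yn j M sv)
        + E * B * gain M * (yn j M sv * (yn j M u₁ + yn j M u₂)
          + yn j M v * (yn j M su₁ + yn j M su₂)) := by ring
    _ ≤ ((1 + D) * A) * gain M * (yn j M sv * (1 + yn j M u₁ + yn j M u₂)
          + yn j M v * (yn j M su₁ + yn j M su₂))
        + E * B * gain M * (yn j M sv * (1 + yn j M u₁ + yn j M u₂)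
          + yn j M v * (yn j M su₁ + yn j M su₂)) := by
        gcongr
        · calc yn j M sv = yn j M sv * 1 := (mul_one _).symm
            _ ≤ yn j M sv * (1 + yn j M u₁ + yn j M u₂) := by
                gcongr; rw [add_assoc]; exact le_self_add
            _ ≤ _ := le_self_add
        · rw [add_comm (1 : ℝ≥0∞)]; exact le_self_add
    _ = _ := by push_cast; ring

/-! ### Solutions on short time intervals -/

lemma ae_mode {p : ℤ × ℝ → Prop} (h : ∀ᵐ ξ ∂freqMeasure, p ξ) (k : ℤ) :
    ∀ᵐ τ : ℝ, p (k, τ) := by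
  have h1 := Measure.ae_ae_of_ae_prod h
  have h2 := (Measure.ae_count_iff).1 h1
  exact h2 k

lemma ae_of_ae_mode {p : ℤ × ℝ → Prop} (hp : MeasurableSet {ξ | p ξ})
    (h : ∀ k : ℤ, ∀ᵐ τ : ℝ, p (k, τ)) : ∀ᵐ ξ ∂freqMeasure, p ξ := by
  rw [Measure.ae_prod_iff_ae_ae hp]
  exact Eventually.of_forall h

lemma yn_mono_ae (j : ℕ) (M : ℝ) {a b : ℤ × ℝ → ℝ≥0∞} (h : ∀ᵐ ξ ∂freqMeasure, a ξ ≤ b ξ) :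
    yn j M a ≤ yn j M b := by
  unfold yn
  refine add_le_add (nrm_mono_ae ?_) (nrm_mono fun k => lintegral_mono_ae (ae_mode h k))
  filter_upwards [h] with ξ hξ
  gcongr

lemma zn_mono_ae (j : ℕ) (M : ℝ) {a b : ℤ × ℝ → ℝ≥0∞} (h : ∀ᵐ ξ ∂freqMeasure, a ξ ≤ b ξ) :
    zn j M a ≤ zn j M b := by
  unfold zn
  refine add_le_add (nrm_mono_ae ?_) (nrm_mono fun k => lintegral_mono_ae ?_)
  · filter_upwards [h] with ξ hξ
    gcongr
  · filter_upwards [ae_mode h k] with τ hτ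
    gcongr

lemma yn_tsum_le (j : ℕ) (M : ℝ) {a : ℕ → ℤ × ℝ → ℝ≥0∞} (ha : ∀ n, Measurable (a n)) :
    yn j M (fun ξ => ∑' n, a n ξ) ≤ ∑' n, yn j M (a n) := by
  unfold yn
  rw [ENNReal.tsum_add]
  refine add_le_add ?_ ?_
  · simp only [← ENNReal.tsum_mul_left]
    exact nrm_tsum_le fun n => by have := ha n; fun_prop
  · have h1 : ∀ k : ℤ, ∫⁻ τ : ℝ, ∑' n, a n (k, τ) = ∑' n, ∫⁻ τ : ℝ, a n (k, τ) := fun k =>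
      lintegral_tsum fun n => ((ha n).comp measurable_prodMk_left).aemeasurable
    simp only [h1]
    exact nrm_tsum_le fun n => measurable_of_countable _

/-- Fatou's lemma for the norm of `Y_M`. -/
lemma yn_le_of_tendsto (j : ℕ) (M : ℝ) {f : ℕ → ℤ × ℝ → ℝ≥0∞} {g : ℤ × ℝ → ℝ≥0∞} {A : ℝ≥0∞}
    (hf : ∀ n, Measurable (f n)) (h : ∀ᵐ ξ ∂freqMeasure, Tendsto (fun n => f n ξ) atTop (𝓝 (g ξ)))
    (hA : ∀ n, yn j M (f n) ≤ A) : yn j M g ≤ 2 * A := by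
  rw [two_mul]
  refine add_le_add ?_ ?_
  · refine nrm_le_of_forall_liminf (f := fun n ξ => wt j M ξ ^ (1 / 2 : ℝ) * f n ξ)
      (fun n => by have := hf n; fun_prop) ?_ (fun n => le_trans le_self_add (hA n))
    filter_upwards [h] with ξ hξ
    exact (ENNReal.Tendsto.const_mul hξ (Or.inr (ENNReal.rpow_ne_top_of_nonneg (by norm_num)
      (wt_ne_top j M ξ)))).liminf_eq.ge
  · refine nrm_le_of_forall_liminf (f := fun n k => ∫⁻ τ : ℝ, f n (k, τ))
      (fun n => measurable_of_countable _) (Eventually.of_forall fun k => ?_)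
      (fun n => le_trans le_add_self (hA n))
    refine le_trans (le_of_eq (lintegral_congr_ae ?_))
      (lintegral_liminf_le fun n => (hf n).comp measurable_prodMk_left)
    filter_upwards [ae_mode h k] with τ hτ
    exact hτ.liminf_eq.symm

lemma ae_lt_top_of_yn_lt_top {j : ℕ} {M : ℝ} (hM : 1 ≤ M) {a : ℤ × ℝ → ℝ≥0∞} (ha : Measurable a)
    (h : yn j M a < ⊤) : ∀ᵐ ξ ∂freqMeasure, a ξ < ⊤ := by
  have h1 : nrm freqMeasure (fun ξ => wt j M ξ ^ (1 / 2 : ℝ) * a ξ) < ⊤ :=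
    lt_of_le_of_lt le_self_add h
  have h2 : nrm freqMeasure a < ⊤ := by
    refine lt_of_le_of_lt (nrm_mono fun ξ => ?_) h1
    exact le_mul_of_one_le_left' (ENNReal.one_le_rpow (one_le_wt j hM ξ) (by norm_num))
  have h3 : ∫⁻ ξ, a ξ ^ 2 ∂freqMeasure ≠ ⊤ := by
    rw [← nrm_sq]; exact (ENNReal.pow_lt_top h2).ne
  filter_upwards [ae_lt_top (ha.pow_const 2) h3] with ξ hξ
  exact ((ENNReal.pow_lt_top_iff (n := 2)).1 hξ).resolve_right (by norm_num)

lemma ae_eq_zero_of_yn_eq_zero {j : ℕ} {M : ℝ} (hM : 1 ≤ M) {a : ℤ × ℝ → ℝ≥0∞} (ha : Measurable a)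
    (h : yn j M a = 0) : ∀ᵐ ξ ∂freqMeasure, a ξ = 0 := by
  have h1 : nrm freqMeasure (fun ξ => wt j M ξ ^ (1 / 2 : ℝ) * a ξ) = 0 :=
    le_antisymm (le_trans le_self_add h.le) bot_le
  have h2 : nrm freqMeasure a = 0 := by
    refine le_antisymm (le_trans (nrm_mono fun ξ => ?_) h1.le) bot_le
    exact le_mul_of_one_le_left' (ENNReal.one_le_rpow (one_le_wt j hM ξ) (by norm_num))
  have h3 : ∫⁻ ξ, a ξ ^ 2 ∂freqMeasure = 0 := by
    rw [← nrm_sq, h2]; simp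
  rw [lintegral_eq_zero_iff (ha.pow_const 2)] at h3
  filter_upwards [h3] with ξ hξ
  simpa using hξ

/-- The `Y_M` norm with `s` derivatives. -/
noncomputable def ys (j : ℕ) (M s : ℝ) (U : ℤ × ℝ → ℂ) : ℝ≥0∞ :=
  yn j M (fun ξ => sobWt s ξ.1 * ‖U ξ‖ₑ)

lemma ys_zero (j : ℕ) (M : ℝ) (U : ℤ × ℝ → ℂ) : ys j M 0 U = yn j M (fun ξ => ‖U ξ‖ₑ) := by
  simp [ys, sobWt_zero]

lemma ys_zero_le (j : ℕ) (M : ℝ) {s : ℝ} (hs : 0 ≤ s) (U : ℤ × ℝ → ℂ) :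
    ys j M 0 U ≤ ys j M s U := by
  rw [ys_zero]
  exact yn_mono j M fun ξ => le_mul_of_one_le_left' (one_le_sobWt hs _)

lemma measurable_ys_fun (s : ℝ) {U : ℤ × ℝ → ℂ} (hU : Measurable U) :
    Measurable fun ξ : ℤ × ℝ => sobWt s ξ.1 * ‖U ξ‖ₑ :=
  (measurable_sobWt s).mul hU.enorm

lemma ys_mono_ae (j : ℕ) (M s : ℝ) {U V : ℤ × ℝ → ℂ} (h : ∀ᵐ ξ ∂freqMeasure, ‖U ξ‖ₑ ≤ ‖V ξ‖ₑ) :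
    ys j M s U ≤ ys j M s V :=
  yn_mono_ae j M (by filter_upwards [h] with ξ hξ; gcongr)

lemma ys_add_le (j : ℕ) (M s : ℝ) {U V : ℤ × ℝ → ℂ} (hU : Measurable U) (hV : Measurable V) :
    ys j M s (fun ξ => U ξ + V ξ) ≤ ys j M s U + ys j M s V := by
  refine (yn_mono j M fun ξ => ?_).trans
    (yn_add_le j M (measurable_ys_fun s hU) (measurable_ys_fun s hV))
  rw [← mul_add]
  gcongr
  exact enorm_add_le _ _

lemma ys_sub_le (j : ℕ) (M s : ℝ) {U V : ℤ × ℝ → ℂ} (hU : Measurable U) (hV : Measurable V) :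
    ys j M s (fun ξ => U ξ - V ξ) ≤ ys j M s U + ys j M s V := by
  refine (yn_mono j M fun ξ => ?_).trans
    (yn_add_le j M (measurable_ys_fun s hU) (measurable_ys_fun s hV))
  rw [← mul_add]
  gcongr
  exact enorm_sub_le

lemma ys_zero_fun (j : ℕ) (M s : ℝ) : ys j M s (fun _ => 0) = 0 := by
  simp [ys, yn]

lemma ys_sub_comm (j : ℕ) (M s : ℝ) (U V : ℤ × ℝ → ℂ) :
    ys j M s (fun ξ => U ξ - V ξ) = ys j M s (fun ξ => V ξ - U ξ) := by
  simp only [ys, enorm_sub_rev]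

lemma nrm_modeNorm_le (j : ℕ) (M : ℝ) (U : ℤ × ℝ → ℂ) :
    nrm Measure.count (modeNorm U) ≤ ys j M 0 U := by
  rw [ys_zero]; exact le_add_self

lemma seqNorm_ev_le (j : ℕ) (M s : ℝ) {U : ℤ × ℝ → ℂ} (hU : Measurable U) (t : ℝ) :
    seqNorm s (ev U t) ≤ ys j M s U := by
  refine (nrm_mono fun k => ?_).trans (le_add_self : _ ≤ ys j M s U)
  change _ ≤ ∫⁻ τ : ℝ, sobWt s k * ‖U (k, τ)‖ₑ
  rw [lintegral_const_mul _ (measurable_mode hU k).enorm]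
  gcongr
  exact enorm_ev_le U t k

lemma integrable_of_ys {j : ℕ} {M : ℝ} {U : ℤ × ℝ → ℂ} (hU : Measurable U) (h : ys j M 0 U < ⊤)
    (k : ℤ) : Integrable fun τ : ℝ => U (k, τ) :=
  integrable_mode hU (lt_top_of_nrm_count_lt_top ((nrm_modeNorm_le j M U).trans_lt h) k)

lemma ae_cv_lt_top {a b : ℤ × ℝ → ℝ≥0∞} (ha : Measurable a) (hb : Measurable b)
    (ha' : nrm Measure.count (fun k => ∫⁻ τ : ℝ, a (k, τ)) < ⊤)
    (hb' : nrm Measure.count (fun k => ∫⁻ τ : ℝ, b (k, τ)) < ⊤) :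
    ∀ᵐ ξ ∂freqMeasure, cv a b ξ < ⊤ := by
  have hm := measurable_cv ha hb
  refine ae_of_ae_mode (measurableSet_lt hm measurable_const) fun k => ?_
  refine ae_lt_top (hm.comp measurable_prodMk_left) ?_
  have := lintegral_cv a b ha hb k
  exact (this.trans_lt (tsum_conv_lt_top ha' hb' k)).ne

lemma ae_integrable_cconv {U V : ℤ × ℝ → ℂ} (hU : Measurable U) (hV : Measurable V)
    (hU' : nrm Measure.count (modeNorm U) < ⊤) (hV' : nrm Measure.count (modeNorm V) < ⊤) :
    ∀ᵐ ξ ∂freqMeasure, Integrable (fun η => U η * V (ξ - η)) freqMeasure := by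
  filter_upwards [ae_cv_lt_top hU.enorm hV.enorm hU' hV'] with ξ hξ
  refine ⟨(by fun_prop : Measurable fun η => U η * V (ξ - η)).aestronglyMeasurable, ?_⟩
  rw [hasFiniteIntegral_iff_enorm]
  simpa only [enorm_mul, cv] using hξ

lemma ae_summable_applyK {κ : ℤ → ℤ → ℂ} (hκ : FeedbackMatrix κ) {U : ℤ × ℝ → ℂ}
    (hU : Measurable U) (hU' : nrm Measure.count (modeNorm U) < ⊤) :
    ∀ᵐ ξ : ℤ × ℝ ∂freqMeasure, Summable fun l => κ ξ.1 l * U (l, ξ.2) := by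
  have h1 : ∀ᵐ ξ : ℤ × ℝ ∂freqMeasure, ∑' l, ‖κ ξ.1 l‖ₑ * ‖U (l, ξ.2)‖ₑ < ⊤ := by
    have hm : Measurable fun ξ : ℤ × ℝ => ∑' l, ‖κ ξ.1 l‖ₑ * ‖U (l, ξ.2)‖ₑ :=
      measurable_of_int_prod fun k => Measurable.tsum fun l =>
        (measurable_mode hU l).enorm.const_mul ‖κ k l‖ₑ
    refine ae_of_ae_mode (measurableSet_lt hm measurable_const) fun k => ?_
    refine ae_lt_top (hm.comp measurable_prodMk_left) (ne_of_lt (lt_of_le_of_lt (le_of_eq ?_)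
      (tsum_row_lt_top hκ hU' k)))
    change ∫⁻ τ : ℝ, ∑' l, ‖κ k l‖ₑ * ‖U (l, τ)‖ₑ = _
    rw [lintegral_tsum fun l => ((measurable_mode hU l).enorm.const_mul _).aemeasurable]
    refine tsum_congr fun l => ?_
    rw [lintegral_const_mul _ (measurable_mode hU l).enorm, modeNorm]
  filter_upwards [h1] with ξ hξ
  refine Summable.of_enorm ?_
  simpa only [enorm_mul] using hξ.ne

lemma forcing_sub_ae {κ : ℤ → ℤ → ℂ} (hκ : FeedbackMatrix κ) {U V : ℤ × ℝ → ℂ}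
    (hU : Measurable U) (hV : Measurable V) (hU' : nrm Measure.count (modeNorm U) < ⊤)
    (hV' : nrm Measure.count (modeNorm V) < ⊤) :
    ∀ᵐ ξ ∂freqMeasure, forcing κ U ξ - forcing κ V ξ
      = dforcing κ U V (fun ξ => U ξ - V ξ) ξ := by
  filter_upwards [ae_summable_applyK hκ hU hU', ae_summable_applyK hκ hV hV',
    ae_integrable_cconv hU hU hU' hU', ae_integrable_cconv hV hU hV' hU',
    ae_integrable_cconv hV hV hV' hV'] with ξ s1 s2 i1 i2 i3
  have e1 : applyK κ (fun ξ => U ξ - V ξ) ξ = applyK κ U ξ - applyK κ V ξ := by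
    simp only [applyK, mul_sub]
    exact s1.tsum_sub s2
  have e2 : cconv (fun ξ => U ξ - V ξ) U ξ = cconv U U ξ - cconv V U ξ := by
    simp only [cconv, sub_mul]
    exact integral_sub i1 i2
  have e3 : cconv V (fun ξ => U ξ - V ξ) ξ = cconv V U ξ - cconv V V ξ := by
    simp only [cconv, mul_sub]
    exact integral_sub i2 i3
  rw [dforcing, e1, e2, e3, forcing, forcing]
  ring

/-! ### The Picard iteration -/

/-- Restriction to the spatial frequencies in `S`. -/
noncomputable def trunc (S : Set ℤ) (U : ℤ × ℝ → ℂ) (ξ : ℤ × ℝ) : ℂ :=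
  S.indicator (fun k => U (k, ξ.2)) ξ.1

lemma measurable_trunc (S : Set ℤ) {U : ℤ × ℝ → ℂ} (hU : Measurable U) :
    Measurable (trunc S U) := by
  refine measurable_of_int_prod fun k => ?_
  by_cases hk : k ∈ S
  · simpa [trunc, hk] using measurable_mode hU k
  · simp [trunc, hk]

lemma enorm_trunc_le (S : Set ℤ) (U : ℤ × ℝ → ℂ) (ξ : ℤ × ℝ) : ‖trunc S U ξ‖ₑ ≤ ‖U ξ‖ₑ := by
  by_cases hk : ξ.1 ∈ S <;> simp [trunc, hk]

lemma ys_trunc_le (j : ℕ) (M s : ℝ) (S : Set ℤ) (U : ℤ × ℝ → ℂ) :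
    ys j M s (trunc S U) ≤ ys j M s U :=
  ys_mono_ae j M s (Eventually.of_forall fun ξ => enorm_trunc_le S U ξ)

lemma ev_trunc (S : Set ℤ) (U : ℤ × ℝ → ℂ) (t : ℝ) (k : ℤ) :
    ev (trunc S U) t k = S.indicator (ev U t) k := by
  by_cases hk : k ∈ S <;> simp [ev, trunc, hk]

lemma trunc_sub (S : Set ℤ) (U V : ℤ × ℝ → ℂ) (ξ : ℤ × ℝ) :
    trunc S (fun ξ => U ξ - V ξ) ξ = trunc S U ξ - trunc S V ξ := by
  by_cases hk : ξ.1 ∈ S <;> simp [trunc, hk]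

lemma trunc_univ (U : ℤ × ℝ → ℂ) : trunc univ U = U := by
  ext ξ; simp [trunc]

lemma dforcing_zero_mode {κ : ℤ → ℤ → ℂ} (hκ : FeedbackMatrix κ) (U₁ U₂ V : ℤ × ℝ → ℂ) (τ : ℝ) :
    dforcing κ U₁ U₂ V (0, τ) = 0 := by
  simp [dforcing, applyK, hκ.zero_row]

lemma Duh_zero_mode (P : ℝ → ℂ) (j : ℕ) (M : ℝ) {F : ℤ × ℝ → ℂ} (hF : ∀ τ, F (0, τ) = 0) (τ : ℝ) :
    Duh P j M F (0, τ) = 0 := by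
  simp [Duh, duh, hF]

/-- A choice of the time cutoff, equal to `1` on `[-1, 1]` and to `0` outside `(-2, 2)`. -/
lemma exists_unit_cutoff : ∃ (φ P : ℝ → ℂ) (C : ℝ), IsCutoff φ P C ∧ (∀ t, |t| ≤ 1 → φ t = 1) := by
  obtain ⟨φ, ⟨P, C, h⟩, h1, -⟩ := exists_smooth_bump 0 one_pos one_lt_two
  exact ⟨φ, P, C, h, by simpa using h1⟩

/-- The fixed point map for the integral equation on `[-1/M, 1/M]`, restricted to the spatial
frequencies in `S`. -/
noncomputable def picard (P : ℝ → ℂ) (j : ℕ) (M : ℝ) (κ : ℤ → ℤ → ℂ) (S : Set ℤ) (x : ℤ → ℂ)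
    (U : ℤ × ℝ → ℂ) : ℤ × ℝ → ℂ :=
  trunc S (fun ξ => freeEv P j M x ξ - Duh P j M (forcing κ U) ξ)

section Picard

variable {φ P : ℝ → ℂ} {Cφ : ℝ} {j : ℕ} {κ : ℤ → ℤ → ℂ}

lemma measurable_picard (hP : IsCutoff φ P Cφ) (M : ℝ) (S : Set ℤ) (x : ℤ → ℂ) {U : ℤ × ℝ → ℂ}
    (hU : Measurable U) : Measurable (picard P j M κ S x U) :=
  measurable_trunc S ((measurable_freeEv hP j M x).sub
    (measurable_Duh hP j M (measurable_forcing κ hU)))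

lemma picard_zero_mode (hκ : FeedbackMatrix κ) (M : ℝ) (S : Set ℤ) {x : ℤ → ℂ} (hx : x 0 = 0)
    (U : ℤ × ℝ → ℂ) (τ : ℝ) : picard P j M κ S x U (0, τ) = 0 := by
  have h1 : Duh P j M (forcing κ U) (0, τ) = 0 :=
    Duh_zero_mode P j M (fun τ => by rw [forcing_eq_dforcing, dforcing_zero_mode hκ]) τ
  by_cases h0 : (0 : ℤ) ∈ S <;> simp [picard, trunc, h0, h1, freeEv, hx]

/-- Short time gain of the integrated polarised forcing. -/
lemma exists_ys_Duh_dforcing_le (hP : IsCutoff φ P Cφ) (hj : 1 ≤ j) (hκ : FeedbackMatrix κ) {s : ℝ}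
    (hs : 0 ≤ s) : ∃ A : ℝ≥0, ∀ M : ℝ, 1 ≤ M → ∀ U₁ U₂ V : ℤ × ℝ → ℂ,
      Measurable U₁ → Measurable U₂ → Measurable V →
      (∀ τ, U₁ (0, τ) = 0) → (∀ τ, U₂ (0, τ) = 0) → (∀ τ, V (0, τ) = 0) →
      ys j M 0 V < ⊤ → ∀ F : ℤ × ℝ → ℂ, Measurable F →
      (∀ᵐ ξ ∂freqMeasure, F ξ = dforcing κ U₁ U₂ V ξ) →
      ys j M s (Duh P j M F)
        ≤ A * gain M * (ys j M s V * (1 + ys j M 0 U₁ + ys j M 0 U₂)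
          + ys j M 0 V * (ys j M s U₁ + ys j M s U₂)) := by
  obtain ⟨C, hC⟩ := exists_zn_dforcing_le hj hκ hs
  obtain ⟨D, hD⟩ := yn_Duh_le hP
  refine ⟨D * C, fun M hM U₁ U₂ V h1 h2 hV z1 z2 zV hfin F hF hFe => ?_⟩
  rw [ys_zero] at hfin
  have h3 := hC M hM U₁ U₂ V h1 h2 hV z1 z2 zV hfin
  simp only [ys_zero]
  have h4 : zn j M (fun ξ => sobWt s ξ.1 * ‖F ξ‖ₑ)
      ≤ zn j M (fun ξ => sobWt s ξ.1 * ‖dforcing κ U₁ U₂ V ξ‖ₑ) :=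
    zn_mono_ae j M (by filter_upwards [hFe] with ξ hξ; rw [hξ])
  refine (hD j M hM (sobWt s) F hF).trans ((mul_le_mul_right (h4.trans h3) _).trans (le_of_eq ?_))
  push_cast
  simp only [ys]
  ring

lemma exists_gain_mul_le (c : ℝ≥0) : ∃ M₀ : ℝ, 1 ≤ M₀ ∧ ∀ M, M₀ ≤ M → c * gain M ≤ 1 / 2 := by
  have h1 : Tendsto (fun M : ℝ => (c : ℝ) * M ^ (-(1 / 16) : ℝ)) atTop (𝓝 ((c : ℝ) * 0)) :=
    (tendsto_rpow_neg_atTop (by norm_num)).const_mul _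
  rw [mul_zero] at h1
  obtain ⟨M₀, hM₀⟩ := eventually_atTop.1 (h1.eventually_le_const (by norm_num : (0 : ℝ) < 1 / 2))
  refine ⟨max M₀ 1, le_max_right _ _, fun M hM => ?_⟩
  have h2 := hM₀ M ((le_max_left _ _).trans hM)
  rw [gain, ← ENNReal.ofReal_coe_nnreal, ← ENNReal.ofReal_mul (NNReal.coe_nonneg c)]
  refine (ENNReal.ofReal_le_ofReal h2).trans (le_of_eq ?_)
  rw [ENNReal.ofReal_div_of_pos (by norm_num)]; simp

/-- On short time intervals the Picard map is a contraction on balls of `Y_M`, and it preserves the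
bound on `s` derivatives. -/
lemma exists_picard_bounds (hP : IsCutoff φ P Cφ) (hj : 1 ≤ j) (hκ : FeedbackMatrix κ) {s : ℝ}
    (hs : 0 ≤ s) : ∃ D : ℝ≥0, ∀ B : ℝ≥0, ∃ M₀ : ℝ, 1 ≤ M₀ ∧ ∀ M, M₀ ≤ M →
      (∀ (S : Set ℤ) (x : ℤ → ℂ) (U : ℤ × ℝ → ℂ), Measurable U → (∀ τ, U (0, τ) = 0) →
        ys j M 0 U ≤ B →
          ys j M 0 (picard P j M κ S x U) ≤ D * seqNorm 0 x + 1 / 2 * ys j M 0 U ∧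
          ys j M s (picard P j M κ S x U) ≤ D * seqNorm s x + 1 / 2 * ys j M s U) ∧
      (∀ (S S' : Set ℤ) (x : ℤ → ℂ) (U V : ℤ × ℝ → ℂ), Measurable U → Measurable V →
        (∀ τ, U (0, τ) = 0) → (∀ τ, V (0, τ) = 0) → ys j M 0 U ≤ B → ys j M 0 V ≤ B →
          ys j M 0 (trunc S' fun ξ => picard P j M κ S x U ξ - picard P j M κ S x V ξ)
            ≤ 1 / 2 * ys j M 0 (fun ξ => U ξ - V ξ)) := by
  obtain ⟨A, hA⟩ := exists_ys_Duh_dforcing_le hP hj hκ hs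
  obtain ⟨A', hA'⟩ := exists_ys_Duh_dforcing_le hP hj hκ le_rfl
  obtain ⟨D, hD⟩ := yn_freeEv_le hP
  refine ⟨D, fun B => ?_⟩
  -- `M₀` is so large that the gain beats the Lipschitz constants on the ball of radius `B`
  obtain ⟨M₀, hM₀, hg⟩ := exists_gain_mul_le ((A + A') * (1 + 4 * B))
  refine ⟨M₀, hM₀, fun M hMM => ?_⟩
  have hM : 1 ≤ M := hM₀.trans hMM
  have hM0 : 0 < M := by linarith
  replace hg := hg M hMM
  have key : ∀ a a' : ℝ≥0∞, a ≤ A + A' → a' ≤ 1 + 4 * B → a * gain M * a' ≤ 1 / 2 := by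
    intro a a' h h'
    calc a * gain M * a' ≤ (A + A') * gain M * (1 + 4 * B) := by gcongr
      _ = (((A + A') * (1 + 4 * B) : ℝ≥0) : ℝ≥0∞) * gain M := by push_cast; ring
      _ ≤ _ := hg
  refine ⟨fun S x U hU zU hUB => ?_, fun S S' x U V hU hV zU zV hUB hVB => ?_⟩
  · have hfin : ys j M 0 U < ⊤ := hUB.trans_lt (by simp)
    have mF := measurable_forcing κ hU
    have main : ∀ (s' : ℝ) (a : ℝ≥0), (a : ℝ≥0∞) ≤ A + A' →
        (ys j M s' (Duh P j M (forcing κ U)) ≤ a * gain M * (ys j M s' U *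
          (1 + ys j M 0 U + ys j M 0 (fun _ => 0)) + ys j M 0 U *
          (ys j M s' U + ys j M s' (fun _ => 0)))) →
        ys j M s' (picard P j M κ S x U) ≤ D * seqNorm s' x + 1 / 2 * ys j M s' U := by
      intro s' a ha h
      refine (ys_trunc_le j M s' S _).trans ((ys_sub_le j M s' (measurable_freeEv hP j M x)
        (measurable_Duh hP j M mF)).trans (add_le_add (hD j M hM (sobWt s') x) (h.trans ?_)))
      rw [ys_zero_fun, ys_zero_fun]
      calc _ = a * gain M * (1 + 2 * ys j M 0 U) * ys j M s' U := by ring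
        _ ≤ 1 / 2 * ys j M s' U := by
            gcongr
            refine key _ _ ha ?_
            gcongr
            norm_num
    have e : ∀ᵐ ξ ∂freqMeasure, forcing κ U ξ = dforcing κ U (fun _ => 0) U ξ :=
      Eventually.of_forall fun ξ => by rw [forcing_eq_dforcing]
    exact ⟨main 0 A' le_add_self (hA' M hM U _ U hU measurable_const hU zU (by simp) zU hfin _ mF e),
      main s A le_self_add (hA M hM U _ U hU measurable_const hU zU (by simp) zU hfin _ mF e)⟩
  · have hUf : ys j M 0 U < ⊤ := hUB.trans_lt (by simp)
    have hVf : ys j M 0 V < ⊤ := hVB.trans_lt (by simp)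
    have hU' := (nrm_modeNorm_le j M U).trans_lt hUf
    have hV' := (nrm_modeNorm_le j M V).trans_lt hVf
    have mF := measurable_forcing κ hU
    have mG := measurable_forcing κ hV
    have hW : ys j M 0 (fun ξ => U ξ - V ξ) < ⊤ :=
      (ys_sub_le j M 0 hU hV).trans_lt (ENNReal.add_lt_top.2 ⟨hUf, hVf⟩)
    have h1 := hA' M hM U V (fun ξ => U ξ - V ξ) hU hV (hU.sub hV) zU zV (by simp [zU, zV]) hW
      (fun ξ => forcing κ U ξ - forcing κ V ξ) (mF.sub mG) (forcing_sub_ae hκ hU hV hU' hV')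
    have h2 : ∀ ξ, picard P j M κ S x U ξ - picard P j M κ S x V ξ
        = -trunc S (Duh P j M (fun ξ => forcing κ U ξ - forcing κ V ξ)) ξ := by
      intro ξ
      have h3 := Duh_sub hP j hM0 (integrable_forcing hκ hU hU') (integrable_forcing hκ hV hV')
      by_cases hk : ξ.1 ∈ S
      · simp [picard, trunc, hk, h3]
      · simp [picard, trunc, hk]
    refine (ys_trunc_le j M 0 S' _).trans ?_
    simp only [h2]
    refine (ys_mono_ae (V := trunc S (Duh P j M fun ξ => forcing κ U ξ - forcing κ V ξ)) j M 0
      (Eventually.of_forall fun ξ => by simp)).trans ((ys_trunc_le j M 0 S _).trans (h1.trans ?_))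
    calc _ = A' * gain M * (1 + 2 * ys j M 0 U + 2 * ys j M 0 V)
          * ys j M 0 (fun ξ => U ξ - V ξ) := by ring
      _ ≤ 1 / 2 * ys j M 0 (fun ξ => U ξ - V ξ) := by
          gcongr
          refine key _ _ le_add_self ?_
          calc _ ≤ 1 + 2 * (B : ℝ≥0∞) + 2 * B := by gcongr
            _ = _ := by ring

/-- Existence on a short time interval whose length only depends on the size of the datum in
`L²`. -/
lemma exists_fixed_point {s : ℝ} {D B : ℝ≥0} {M : ℝ} (hM : 1 ≤ M) (hP : IsCutoff φ P Cφ)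
    (hκ : FeedbackMatrix κ)
    (h1 : ∀ (S : Set ℤ) (x : ℤ → ℂ) (U : ℤ × ℝ → ℂ), Measurable U → (∀ τ, U (0, τ) = 0) →
        ys j M 0 U ≤ B →
          ys j M 0 (picard P j M κ S x U) ≤ D * seqNorm 0 x + 1 / 2 * ys j M 0 U ∧
          ys j M s (picard P j M κ S x U) ≤ D * seqNorm s x + 1 / 2 * ys j M s U)
    (h2 : ∀ (S S' : Set ℤ) (x : ℤ → ℂ) (U V : ℤ × ℝ → ℂ), Measurable U → Measurable V →
        (∀ τ, U (0, τ) = 0) → (∀ τ, V (0, τ) = 0) → ys j M 0 U ≤ B → ys j M 0 V ≤ B →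
          ys j M 0 (trunc S' fun ξ => picard P j M κ S x U ξ - picard P j M κ S x V ξ)
            ≤ 1 / 2 * ys j M 0 (fun ξ => U ξ - V ξ))
    (S : Set ℤ) {x : ℤ → ℂ} (hx0 : x 0 = 0) (hx : 4 * D * seqNorm 0 x ≤ B) :
    ∃ U : ℤ × ℝ → ℂ, Measurable U ∧ (∀ τ, U (0, τ) = 0) ∧
      ys j M 0 U ≤ 4 * D * seqNorm 0 x ∧ ys j M s U ≤ 4 * D * seqNorm s x ∧
      ∀ᵐ ξ ∂freqMeasure, U ξ = picard P j M κ S x U ξ := by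
  have half_add : ∀ a : ℝ≥0∞, a + 1 / 2 * (2 * a) = 2 * a := by
    intro a
    rw [← mul_assoc, one_div, ENNReal.inv_mul_cancel (by norm_num) (by norm_num), one_mul, two_mul]
  -- the Picard iterates stay in balls of twice the size of the linear part
  let u : ℕ → ℤ × ℝ → ℂ := fun n => (picard P j M κ S x)^[n] fun _ => 0
  have hu : ∀ n, u (n + 1) = picard P j M κ S x (u n) := fun n =>
    Function.iterate_succ_apply' _ _ _
  have hB2 : 2 * (D * seqNorm 0 x) ≤ B := by
    refine le_trans ?_ hx
    rw [← mul_assoc]; gcongr; norm_num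
  have hprop : ∀ n, Measurable (u n) ∧ (∀ τ, u n (0, τ) = 0) ∧
      ys j M 0 (u n) ≤ 2 * (D * seqNorm 0 x) ∧ ys j M s (u n) ≤ 2 * (D * seqNorm s x) := by
    intro n
    induction n with
    | zero =>
      refine ⟨measurable_const, fun τ => rfl, ?_, ?_⟩ <;>
      · change ys j M _ (fun _ => 0) ≤ _
        rw [ys_zero_fun]; exact bot_le
    | succ n ih =>
      obtain ⟨m, z, b0, bs⟩ := ih
      rw [hu]
      obtain ⟨c0, cs⟩ := h1 S x (u n) m z (b0.trans hB2)
      refine ⟨measurable_picard hP M S x m, picard_zero_mode hκ M S hx0 _, ?_, ?_⟩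
      · refine c0.trans (le_trans ?_ (half_add _).le); gcongr
      · refine cs.trans (le_trans ?_ (half_add _).le); gcongr
  have hm := fun n => (hprop n).1
  have hz := fun n => (hprop n).2.1
  have hb := fun n => (hprop n).2.2.1.trans hB2
  let v : ℕ → ℤ × ℝ → ℂ := fun n ξ => u (n + 1) ξ - u n ξ
  have hvm : ∀ n, Measurable (v n) := fun n => (hm (n + 1)).sub (hm n)
  have hv : ∀ n, ys j M 0 (v n) ≤ (1 / 2) ^ n * B := by
    intro n
    induction n with
    | zero =>
      have : v 0 = u 1 := by
        ext ξ; change u 1 ξ - 0 = _; simp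
      rw [this, pow_zero, one_mul]
      exact hb 1
    | succ n ih =>
      have h3 := h2 S univ x (u (n + 1)) (u n) (hm _) (hm _) (hz _) (hz _) (hb _) (hb _)
      rw [trunc_univ, ← hu, ← hu] at h3
      refine h3.trans ?_
      rw [pow_succ', mul_assoc]
      gcongr
  have hgeo : ∀ n : ℕ, ∑' m, ((1 / 2 : ℝ≥0∞) ^ (m + n) * B) = (1 / 2) ^ n * (2 * B) := by
    intro n
    simp only [pow_add, one_div, ENNReal.tsum_mul_right, ENNReal.tsum_geometric]
    rw [ENNReal.one_sub_inv_two, inv_inv]; ring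
  have hfin : ∀ᵐ ξ ∂freqMeasure, ∑' n, ‖v n ξ‖ₑ < ⊤ := by
    refine ae_lt_top_of_yn_lt_top (j := j) hM (Measurable.tsum fun n => (hvm n).enorm) ?_
    refine (yn_tsum_le j M fun n => (hvm n).enorm).trans_lt ?_
    simp only [← ys_zero]
    refine (ENNReal.tsum_le_tsum hv).trans_lt ?_
    have := hgeo 0
    simp only [add_zero] at this
    rw [this]
    simp [ENNReal.mul_lt_top]
  -- The limit is the sum of the telescoping series, which makes it measurable everywhere.
  let U : ℤ × ℝ → ℂ := fun ξ => ∑' n, v n ξ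
  have hUm : Measurable U := measurable_tsum_complex hvm
  have hUz : ∀ τ, U (0, τ) = 0 := fun τ => by simp [U, v, hz]
  have hsum : ∀ n ξ, ∑ i ∈ Finset.range n, v i ξ = u n ξ := by
    intro n ξ
    rw [Finset.sum_range_sub (fun n => u n ξ)]
    change u n ξ - 0 = _; simp
  have hlim : ∀ᵐ ξ ∂freqMeasure, Tendsto (fun n => u n ξ) atTop (𝓝 (U ξ)) := by
    filter_upwards [hfin] with ξ hξ
    have := (Summable.of_enorm hξ.ne).hasSum.tendsto_sum_nat
    simpa only [hsum] using this
  have hlim' : ∀ s' : ℝ, ∀ᵐ ξ ∂freqMeasure, Tendsto (fun n => sobWt s' ξ.1 * ‖u n ξ‖ₑ) atTop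
      (𝓝 (sobWt s' ξ.1 * ‖U ξ‖ₑ)) := by
    intro s'
    filter_upwards [hlim] with ξ hξ
    exact ENNReal.Tendsto.const_mul hξ.enorm (Or.inr (sobWt_ne_top _ _))
  have four : ∀ a : ℝ≥0∞, 2 * (2 * (D * a)) = 4 * D * a := fun a => by ring
  have hU0 : ys j M 0 U ≤ 4 * D * seqNorm 0 x := by
    rw [← four]
    exact yn_le_of_tendsto j M (fun n => measurable_ys_fun 0 (hm n)) (hlim' 0)
      fun n => (hprop n).2.2.1
  have hUs : ys j M s U ≤ 4 * D * seqNorm s x := by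
    rw [← four]
    exact yn_le_of_tendsto j M (fun n => measurable_ys_fun s (hm n)) (hlim' s)
      fun n => (hprop n).2.2.2
  refine ⟨U, hUm, hUz, hU0, hUs, ?_⟩
  have hUB := hU0.trans hx
  have htail : ∀ n, ys j M 0 (fun ξ => U ξ - u n ξ) ≤ (1 / 2) ^ n * (2 * B) := by
    intro n
    rw [ys_zero, ← hgeo n]
    refine le_trans (yn_mono_ae j M (b := fun ξ => ∑' m, ‖v (m + n) ξ‖ₑ) ?_)
      ((yn_tsum_le j M fun m => (hvm _).enorm).trans (ENNReal.tsum_le_tsum fun m => ?_))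
    · filter_upwards [hfin] with ξ hξ
      have hs' := Summable.of_enorm hξ.ne
      have h4 := hs'.sum_add_tsum_nat_add n
      rw [hsum] at h4
      have h5 : U ξ - u n ξ = ∑' m, v (m + n) ξ := by
        rw [sub_eq_iff_eq_add, add_comm]; exact h4.symm
      rw [h5]
      exact enorm_tsum_le_tsum_enorm
    · rw [← ys_zero]; exact hv _
  have mp := measurable_picard (j := j) (κ := κ) hP M S x hUm
  -- comparison of `U` with the next iterate, and of the latter with the Picard map at `U`
  have hdiff : ∀ n, ys j M 0 (fun ξ => U ξ - picard P j M κ S x U ξ) ≤ (1 / 2) ^ n * (4 * B) := by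
    intro n
    have e1 := htail (n + 1)
    have e2 := h2 S univ x (u n) U (hm n) hUm (hz n) hUz (hb n) hUB
    rw [trunc_univ, ← hu] at e2
    have e3 : ys j M 0 (fun ξ => U ξ - picard P j M κ S x U ξ)
        ≤ ys j M 0 (fun ξ => U ξ - u (n + 1) ξ)
          + ys j M 0 (fun ξ => u (n + 1) ξ - picard P j M κ S x U ξ) := by
      have := ys_add_le (U := fun ξ => U ξ - u (n + 1) ξ)
        (V := fun ξ => u (n + 1) ξ - picard P j M κ S x U ξ) j M 0 (hUm.sub (hm (n + 1)))
        ((hm (n + 1)).sub mp)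
      simpa only [sub_add_sub_cancel] using this
    refine e3.trans ?_
    rw [ys_sub_comm j M 0 (u n) U] at e2
    calc _ ≤ (1 / 2) ^ (n + 1) * (2 * (B : ℝ≥0∞)) + 1 / 2 * ((1 / 2) ^ n * (2 * B)) :=
          add_le_add e1 (e2.trans (mul_le_mul_right (htail n) _))
      _ = (1 / 2 * 2) * ((1 / 2) ^ n * (2 * B)) := by ring
      _ = (1 / 2) ^ n * (2 * B) := by
          rw [one_div, ENNReal.inv_mul_cancel (by norm_num) (by norm_num), one_mul]
      _ ≤ _ := by gcongr; norm_num
  have hzero : ys j M 0 (fun ξ => U ξ - picard P j M κ S x U ξ) = 0 := by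
    refine le_antisymm (ge_of_tendsto' (x := atTop) (f := fun n : ℕ => (1 / 2 : ℝ≥0∞) ^ n * (4 * B))
      ?_ hdiff) bot_le
    have h5 : Tendsto (fun n : ℕ => (1 / 2 : ℝ≥0∞) ^ n * (4 * B)) atTop (𝓝 (0 * (4 * B))) := by
      refine ENNReal.Tendsto.mul_const (ENNReal.tendsto_pow_atTop_nhds_zero_of_lt_one ?_) (Or.inr ?_)
      · simp
      · finiteness
    simpa using h5
  rw [ys_zero] at hzero
  filter_upwards [ae_eq_zero_of_yn_eq_zero hM (hUm.sub mp).enorm hzero] with ξ hξ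
  exact sub_eq_zero.1 (enorm_eq_zero.1 hξ)

end Picard

/-! ### Time cutoffs and translations in time -/

/-- Multiplication by the time cutoff at scale `1/M`, on the Fourier side. -/
noncomputable def cut (P : ℝ → ℂ) (M : ℝ) (U : ℤ × ℝ → ℂ) (ξ : ℤ × ℝ) : ℂ :=
  ∫ τ : ℝ, scaled P M (ξ.2 - τ) * U (ξ.1, τ)

/-- Translation in time, on the Fourier side. -/
noncomputable def tshift (t₀ : ℝ) (U : ℤ × ℝ → ℂ) (ξ : ℤ × ℝ) : ℂ :=
  Complex.exp (Complex.I * t₀ * ξ.2) * U ξ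

lemma measurable_tshift (t₀ : ℝ) {U : ℤ × ℝ → ℂ} (hU : Measurable U) :
    Measurable (tshift t₀ U) := by
  unfold tshift; fun_prop

lemma ev_tshift (t₀ : ℝ) (U : ℤ × ℝ → ℂ) (t : ℝ) : ev (tshift t₀ U) t = ev U (t₀ + t) := by
  ext k
  refine integral_congr_ae (Eventually.of_forall fun τ => ?_)
  simp only [tshift]
  rw [← mul_assoc, ← Complex.exp_add]
  congr 2
  push_cast; ring

lemma enorm_tshift (t₀ : ℝ) (U : ℤ × ℝ → ℂ) (ξ : ℤ × ℝ) : ‖tshift t₀ U ξ‖ₑ = ‖U ξ‖ₑ := by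
  rw [tshift, enorm_mul, ← ofReal_norm (Complex.exp _), norm_exp_I_mul]; simp

lemma ys_tshift (j : ℕ) (M s t₀ : ℝ) (U : ℤ × ℝ → ℂ) : ys j M s (tshift t₀ U) = ys j M s U := by
  simp only [ys, enorm_tshift]

lemma nrm_count_nrm {f : ℤ × ℝ → ℝ≥0∞} (hf : Measurable f) :
    nrm freqMeasure f = nrm Measure.count (fun k => nrm volume (fun τ : ℝ => f (k, τ))) := by
  rw [nrm_count_eq, nrm, lintegral_int_prod (hf.pow_const 2)]
  simp only [nrm_sq]

section Cut

variable {φ P : ℝ → ℂ} {C : ℝ}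

lemma measurable_cut (hP : IsCutoff φ P C) (M : ℝ) {U : ℤ × ℝ → ℂ} (hU : Measurable U) :
    Measurable (cut P M U) := by
  refine measurable_of_int_prod fun k => ?_
  have h1 := (hP.continuous_scaled M).measurable
  have h : StronglyMeasurable fun z : ℝ × ℝ => scaled P M (z.1 - z.2) * U (k, z.2) :=
    ((h1.comp (measurable_fst.sub measurable_snd)).mul
      ((measurable_mode hU k).comp measurable_snd)).stronglyMeasurable
  exact h.integral_prod_right.measurable

lemma integrable_cut_prod (hP : IsCutoff φ P C) {M : ℝ} (hM : 0 < M) {f : ℝ → ℂ}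
    (hf : Integrable f) :
    Integrable (fun z : ℝ × ℝ => scaled P M (z.1 - z.2) * f z.2)
      ((volume : Measure ℝ).prod volume) := by
  have h := (hf.convolution_integrand (ContinuousLinearMap.mul ℂ ℂ) (hP.integrable_scaled hM))
  refine h.congr (Eventually.of_forall fun z => ?_)
  simp [mul_comm]

lemma integrable_cut (hP : IsCutoff φ P C) {M : ℝ} (hM : 0 < M) {U : ℤ × ℝ → ℂ} {k : ℤ}
    (hU : Integrable fun τ : ℝ => U (k, τ)) : Integrable fun τ : ℝ => cut P M U (k, τ) :=
  (integrable_cut_prod hP hM hU).integral_prod_left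

lemma ev_cut (hP : IsCutoff φ P C) {M : ℝ} (hM : 0 < M) {U : ℤ × ℝ → ℂ} {k : ℤ}
    (hU : Integrable fun τ : ℝ => U (k, τ)) (t : ℝ) :
    ev (cut P M U) t k = φ (M * t) * ev U t k := by
  have h1 : Integrable (Function.uncurry fun τ τ' : ℝ =>
      Complex.exp (Complex.I * t * τ) * (scaled P M (τ - τ') * U (k, τ')))
      ((volume : Measure ℝ).prod volume) := by
    refine (integrable_cut_prod hP hM hU).bdd_mul (c := 1)
      (f := fun z : ℝ × ℝ => Complex.exp (Complex.I * t * z.1)) ?_ ?_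
    · exact (by fun_prop : Continuous fun z : ℝ × ℝ =>
        Complex.exp (Complex.I * t * z.1)).aestronglyMeasurable
    · exact Eventually.of_forall fun z => (norm_exp_I_mul t z.1).le
  simp only [ev, cut, ← integral_const_mul]
  rw [integral_integral_swap h1]
  refine integral_congr_ae (Eventually.of_forall fun τ' => ?_)
  have h2 := integral_exp_shift (scaled P M) t τ'
  rw [hP.integral_scaled hM] at h2
  calc ∫ τ : ℝ, Complex.exp (Complex.I * t * τ) * (scaled P M (τ - τ') * U (k, τ'))
      = (∫ τ : ℝ, Complex.exp (Complex.I * t * τ) * scaled P M (τ - τ')) * U (k, τ') := by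
        rw [← integral_mul_const]
        exact integral_congr_ae (Eventually.of_forall fun τ => by simp only []; ring)
    _ = _ := by rw [h2]; ring

lemma cut_zero_mode (M : ℝ) {U : ℤ × ℝ → ℂ} (hU : ∀ τ, U (0, τ) = 0) (τ : ℝ) :
    cut P M U (0, τ) = 0 := by simp [cut, hU]

/-- Time cutoffs at any scale `1/M` are bounded from `Y_1` to `Y_M`, uniformly in `M`. -/
lemma exists_ys_cut_le (hP : IsCutoff φ P C) : ∃ D : ℝ≥0, ∀ (j : ℕ) (M s : ℝ), 1 ≤ M →
    ∀ U : ℤ × ℝ → ℂ, Measurable U → ys j M s (cut P M U) ≤ D * ys j 1 s U := by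
  have hC := hP.nonneg
  refine ⟨(C.toNNReal * (Real.pi.toNNReal + 8)), fun j M s hM U hU => ?_⟩
  have hM0 : 0 < M := by linarith
  set b : ℝ → ℝ≥0∞ := fun σ => ENNReal.ofReal (cauchyProfile M σ) with hb
  have hbm : Measurable b := (measurable_cauchyProfile M).ennreal_ofReal
  have hbi : ∫⁻ σ, b σ = ENNReal.ofReal Real.pi := lintegral_cauchyProfile hM0
  set a : ℤ × ℝ → ℝ≥0∞ := fun ξ => sobWt s ξ.1 * ‖U ξ‖ₑ with ha
  have ham : Measurable a := measurable_ys_fun s hU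
  have hak : ∀ k : ℤ, Measurable fun τ : ℝ => a (k, τ) := fun k => ham.comp measurable_prodMk_left
  set q : ℝ → ℝ≥0∞ := fun σ => ENNReal.ofReal (M + |σ|) ^ (1 / 2 : ℝ) * b σ with hq
  have hqm : Measurable q := by fun_prop
  have hq2 : nrm volume q ≤ 8 := by
    refine nrm_le_of_sq_le ?_
    calc ∫⁻ σ, q σ ^ 2 ≤ ∫⁻ σ, 2 * b σ := by
          refine lintegral_mono fun σ => ?_
          simp only [hq, hb, mul_pow, rpow_half_sq]
          rw [← ENNReal.ofReal_pow (cauchyProfile_nonneg hM0.le σ), ← ENNReal.ofReal_mul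
            (by positivity)]
          refine (ENNReal.ofReal_le_ofReal (add_abs_mul_cauchyProfile_sq_le hM0 σ)).trans ?_
          rw [ENNReal.ofReal_mul (by norm_num)]
          simp
      _ = 2 * ENNReal.ofReal Real.pi := by rw [lintegral_const_mul _ hbm, hbi]
      _ ≤ 2 * ENNReal.ofReal 4 := by gcongr; exact Real.pi_le_four
      _ ≤ 8 ^ 2 := by norm_num
  -- the cut off function is dominated by a convolution with the profile
  set c : ℤ × ℝ → ℝ≥0∞ := fun ξ => ∫⁻ τ : ℝ, a (ξ.1, τ) * b (ξ.2 - τ) with hc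
  have hcm : Measurable c := by
    refine measurable_of_int_prod fun k => ?_
    exact Measurable.lintegral_prod_right'
      (f := fun z : ℝ × ℝ => a (k, z.2) * b (z.1 - z.2)) (by have := hak k; fun_prop)
  have hdom : ∀ ξ, sobWt s ξ.1 * ‖cut P M U ξ‖ₑ ≤ (C.toNNReal : ℝ≥0∞) * c ξ := by
    intro ξ
    rw [hc, ← lintegral_const_mul' _ _ (by simp)]
    calc sobWt s ξ.1 * ‖cut P M U ξ‖ₑ
        ≤ sobWt s ξ.1 * ∫⁻ τ : ℝ, ‖scaled P M (ξ.2 - τ) * U (ξ.1, τ)‖ₑ := by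
          gcongr; exact enorm_integral_le_lintegral_enorm _
      _ = ∫⁻ τ : ℝ, sobWt s ξ.1 * ‖scaled P M (ξ.2 - τ) * U (ξ.1, τ)‖ₑ :=
          (lintegral_const_mul' _ _ (sobWt_ne_top _ _)).symm
      _ ≤ _ := by
          refine lintegral_mono fun τ => ?_
          rw [enorm_mul]
          have : ‖scaled P M (ξ.2 - τ)‖ₑ ≤ C.toNNReal * b (ξ.2 - τ) := by
            rw [← ofReal_norm]
            refine (ENNReal.ofReal_le_ofReal (hP.norm_scaled_le hM0 _)).trans ?_
            rw [ENNReal.ofReal_mul hC]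
            rfl
          calc _ ≤ sobWt s ξ.1 * (C.toNNReal * b (ξ.2 - τ) * ‖U (ξ.1, τ)‖ₑ) := by gcongr
            _ = _ := by simp only [ha]; ring
  have hc1 : ∀ k : ℤ, ∫⁻ τ : ℝ, c (k, τ) = ENNReal.ofReal Real.pi * ∫⁻ τ : ℝ, a (k, τ) := by
    intro k
    simp only [hc]
    rw [lintegral_lintegral_swap (by have := hak k; fun_prop)]
    have h3 : ∀ τ' : ℝ, ∫⁻ τ : ℝ, a (k, τ') * b (τ - τ') = a (k, τ') * ENNReal.ofReal Real.pi := by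
      intro τ'
      rw [lintegral_const_mul _ (by fun_prop), lintegral_sub_right_eq_self b τ', hbi]
    simp only [h3]
    rw [lintegral_mul_const _ (hak k), mul_comm]
  have hL1 : nrm Measure.count (fun k => ∫⁻ τ : ℝ, c (k, τ))
      ≤ ENNReal.ofReal Real.pi * nrm Measure.count (fun k => ∫⁻ τ : ℝ, a (k, τ)) := by
    simp only [hc1]
    exact nrm_const_mul_le Real.pi.toNNReal _
  set w : ℤ × ℝ → ℝ≥0∞ := fun ξ => wt j 1 ξ ^ (1 / 2 : ℝ) * a ξ with hw
  have hwm : Measurable w := by fun_prop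
  have hwk : ∀ k : ℤ, Measurable fun τ : ℝ => w (k, τ) := fun k => hwm.comp measurable_prodMk_left
  -- the weight at `τ` is shared between the profile, at `τ - τ'`, and the function, at `τ'`
  have hweight : ∀ (k : ℤ) (τ τ' : ℝ), wt j M (k, τ) ^ (1 / 2 : ℝ)
      ≤ ENNReal.ofReal (M + |τ - τ'|) ^ (1 / 2 : ℝ) + wt j 1 (k, τ') ^ (1 / 2 : ℝ) := by
    intro k τ τ'
    refine le_trans (ENNReal.rpow_le_rpow ?_ (by norm_num))
      (ENNReal.rpow_add_le_add_rpow _ _ (by norm_num) (by norm_num))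
    rw [wt, wt, ← ENNReal.ofReal_add (by positivity) (by positivity)]
    refine ENNReal.ofReal_le_ofReal ?_
    have h4 : modul j (k, τ) = (τ - τ') + modul j (k, τ') := by simp [modul]
    have := abs_add_le (τ - τ') (modul j (k, τ'))
    rw [h4]; linarith
  have hpt : ∀ ξ : ℤ × ℝ, wt j M ξ ^ (1 / 2 : ℝ) * c ξ
      ≤ (∫⁻ τ : ℝ, a (ξ.1, τ) * q (ξ.2 - τ)) + ∫⁻ τ : ℝ, b τ * w (ξ.1, ξ.2 - τ) := by
    rintro ⟨k, τ⟩
    have h5 : ∫⁻ τ' : ℝ, b τ' * w (k, τ - τ') = ∫⁻ τ' : ℝ, b (τ - τ') * w (k, τ') := by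
      rw [← lintegral_sub_left_eq_self _ τ]
      simp only [sub_sub_cancel]
    rw [h5, ← lintegral_add_left (by have := hak k; fun_prop), ← lintegral_const_mul'
      _ _ (ENNReal.rpow_ne_top_of_nonneg (by norm_num) (wt_ne_top j M _))]
    refine lintegral_mono fun τ' => ?_
    calc wt j M (k, τ) ^ (1 / 2 : ℝ) * (a (k, τ') * b (τ - τ'))
        ≤ (ENNReal.ofReal (M + |τ - τ'|) ^ (1 / 2 : ℝ) + wt j 1 (k, τ') ^ (1 / 2 : ℝ))
          * (a (k, τ') * b (τ - τ')) := by gcongr; exact hweight k τ τ'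
      _ = _ := by simp only [hq, hw]; ring
  have m1 : Measurable fun ξ : ℤ × ℝ => ∫⁻ τ : ℝ, a (ξ.1, τ) * q (ξ.2 - τ) :=
    measurable_of_int_prod fun k => Measurable.lintegral_prod_right'
      (f := fun z : ℝ × ℝ => a (k, z.2) * q (z.1 - z.2)) (by have := hak k; fun_prop)
  have m2 : Measurable fun ξ : ℤ × ℝ => ∫⁻ τ : ℝ, b τ * w (ξ.1, ξ.2 - τ) :=
    measurable_of_int_prod fun k => Measurable.lintegral_prod_right'
      (f := fun z : ℝ × ℝ => b z.2 * w (k, z.1 - z.2)) (by have := hwk k; fun_prop)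
  have hA1 : nrm freqMeasure (fun ξ : ℤ × ℝ => ∫⁻ τ : ℝ, a (ξ.1, τ) * q (ξ.2 - τ))
      ≤ 8 * nrm Measure.count (fun k => ∫⁻ τ : ℝ, a (k, τ)) := by
    rw [nrm_count_nrm m1]
    refine le_trans (nrm_mono fun k => ?_) (nrm_const_mul_le 8 _)
    rw [mul_comm]
    refine nrm_lintegral_le (F := fun y x => q (x - y)) (hak k)
      (by unfold Function.uncurry; fun_prop) fun y => ?_
    refine le_trans (le_of_eq ?_) hq2
    rw [nrm, nrm, lintegral_sub_right_eq_self (fun x => q x ^ 2) y]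
  have hA2 : nrm freqMeasure (fun ξ : ℤ × ℝ => ∫⁻ τ : ℝ, b τ * w (ξ.1, ξ.2 - τ))
      ≤ ENNReal.ofReal Real.pi * nrm freqMeasure w := by
    rw [nrm_count_nrm m2, nrm_count_nrm hwm]
    refine le_trans (nrm_mono fun k => ?_) (nrm_const_mul_le Real.pi.toNNReal _)
    change _ ≤ ENNReal.ofReal Real.pi * _
    rw [← hbi]
    refine nrm_lintegral_le (F := fun y x => w (k, x - y)) hbm
      (by have := hwk k; unfold Function.uncurry; fun_prop) fun y => ?_
    refine le_of_eq ?_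
    rw [nrm, nrm, lintegral_sub_right_eq_self (fun x => w (k, x) ^ 2) y]
  have hfinal : yn j M c ≤ (Real.pi.toNNReal + 8 : ℝ≥0) * yn j 1 a := by
    have hA3 := (nrm_mono hpt).trans ((nrm_add_le (μ := freqMeasure) m1.aemeasurable
      m2.aemeasurable).trans (add_le_add hA1 hA2))
    refine (add_le_add hA3 hL1).trans ?_
    change _ ≤ _ * (nrm freqMeasure w + nrm Measure.count fun k => ∫⁻ τ : ℝ, a (k, τ))
    rw [ENNReal.coe_add]
    change _ ≤ (ENNReal.ofReal Real.pi + 8) * _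
    calc _ = ENNReal.ofReal Real.pi * (nrm freqMeasure w
          + nrm Measure.count fun k => ∫⁻ τ : ℝ, a (k, τ))
          + 8 * nrm Measure.count (fun k => ∫⁻ τ : ℝ, a (k, τ)) := by ring
      _ ≤ ENNReal.ofReal Real.pi * (nrm freqMeasure w
          + nrm Measure.count fun k => ∫⁻ τ : ℝ, a (k, τ))
          + 8 * (nrm freqMeasure w + nrm Measure.count fun k => ∫⁻ τ : ℝ, a (k, τ)) := by
          gcongr; exact le_add_self
      _ = _ := by ring
  calc ys j M s (cut P M U) ≤ yn j M (fun ξ => (C.toNNReal : ℝ≥0∞) * c ξ) := yn_mono j M hdom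
    _ ≤ C.toNNReal * yn j M c := yn_const_mul_le j M _ c
    _ ≤ C.toNNReal * ((Real.pi.toNNReal + 8 : ℝ≥0) * yn j 1 a) := by gcongr
    _ = _ := by rw [ENNReal.coe_mul, mul_assoc]; rfl

end Cut

/-! ### Uniqueness and concatenation -/

/-- The integral equation on `[0, T]` for the Fourier coefficients in space, restricted to the
frequencies in `S`. The full equation is the case `S = univ`, and finite sets `S` give its Galerkin
approximations. -/
def CoeffSolution (j : ℕ) (κ : ℤ → ℤ → ℂ) (S : Set ℤ) (T : ℝ) (x₀ : ℤ → ℂ) (x : ℝ → ℤ → ℂ) :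
    Prop :=
  ∀ t ∈ Icc 0 T, ∀ k, x t k = S.indicator (fun k => phase j t k * x₀ k
    - ∫ r in (0 : ℝ)..t, phase j (t - r) k * forceCoeff κ (x r) k) k

lemma enorm_le_seqNorm {s : ℝ} (hs : 0 ≤ s) (x : ℤ → ℂ) (k : ℤ) : ‖x k‖ₑ ≤ seqNorm s x := by
  have h1 : ‖x k‖ₑ ^ 2 ≤ seqNorm s x ^ 2 := by
    rw [seqNorm, nrm_count_sq]
    refine le_trans ?_ (ENNReal.le_tsum k)
    gcongr
    exact le_mul_of_one_le_left' (one_le_sobWt hs k)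
  exact (ENNReal.pow_le_pow_left_iff (by norm_num)).1 h1

lemma ev_congr_ae {U V : ℤ × ℝ → ℂ} (h : ∀ᵐ ξ ∂freqMeasure, U ξ = V ξ) : ev U = ev V := by
  ext t k
  refine integral_congr_ae ?_
  filter_upwards [ae_mode h k] with τ hτ
  rw [hτ]

section Equation

variable {j : ℕ} {κ : ℤ → ℤ → ℂ} {S : Set ℤ} {T : ℝ} {x₀ : ℤ → ℂ}

lemma CoeffSolution.mono {x : ℝ → ℤ → ℂ} (h : CoeffSolution j κ S T x₀ x) {T' : ℝ} (hT : T' ≤ T) :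
    CoeffSolution j κ S T' x₀ x := fun t ht => h t ⟨ht.1, ht.2.trans hT⟩

lemma CoeffSolution.congr {x y : ℝ → ℤ → ℂ} (h : CoeffSolution j κ S T x₀ x)
    (hxy : ∀ t ∈ Icc 0 T, x t = y t) : CoeffSolution j κ S T x₀ y := by
  intro t ht k
  rw [← hxy t ht, h t ht k]
  have h1 : ∀ k, ∫ r in (0 : ℝ)..t, phase j (t - r) k * forceCoeff κ (x r) k
      = ∫ r in (0 : ℝ)..t, phase j (t - r) k * forceCoeff κ (y r) k := by
    intro k
    refine intervalIntegral.integral_congr fun r hr => ?_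
    rw [uIcc_of_le ht.1] at hr
    simp only [hxy r ⟨hr.1, hr.2.trans ht.2⟩]
  simp only [h1]

lemma continuous_forceCoeff (hκ : FeedbackMatrix κ) {U : ℤ × ℝ → ℂ} (hU : Measurable U)
    (hU' : nrm Measure.count (modeNorm U) < ⊤) (k : ℤ) :
    Continuous fun r => forceCoeff κ (ev U r) k := by
  simp only [← ev_forcing hκ hU hU']
  exact continuous_ev (integrable_forcing hκ hU hU' k)

lemma intervalIntegrable_phase_mul {f : ℝ → ℂ} (hf : Continuous f) (k : ℤ) (t a b : ℝ) :
    IntervalIntegrable (fun r => phase j (t - r) k * f r) volume a b := by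
  have := continuous_phase j k
  exact Continuous.intervalIntegrable (by fun_prop) a b

/-- The semigroup identity for the Duhamel integral. -/
lemma integral_phase_add {f : ℝ → ℂ} (hf : Continuous f) (k : ℤ) (t₀ t : ℝ) :
    ∫ r in (0 : ℝ)..(t₀ + t), phase j (t₀ + t - r) k * f r
      = phase j t k * (∫ r in (0 : ℝ)..t₀, phase j (t₀ - r) k * f r)
        + ∫ r in (0 : ℝ)..t, phase j (t - r) k * f (t₀ + r) := by
  rw [← intervalIntegral.integral_add_adjacent_intervals
    (intervalIntegrable_phase_mul hf k (t₀ + t) 0 t₀)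
    (intervalIntegrable_phase_mul hf k (t₀ + t) t₀ (t₀ + t)),
    ← intervalIntegral.integral_const_mul]
  congr 1
  · refine intervalIntegral.integral_congr fun r _ => ?_
    rw [← mul_assoc, ← phase_add]
    congr 2; ring
  · have h := intervalIntegral.integral_comp_add_left
      (fun r => phase j (t₀ + t - r) k * f r) t₀ (a := 0) (b := t)
    rw [add_zero] at h
    rw [← h]
    refine intervalIntegral.integral_congr fun r _ => ?_
    congr 2; ring

lemma CoeffSolution.shift {x : ℝ → ℤ → ℂ} (hx : ∀ k, Continuous fun r => forceCoeff κ (x r) k)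
    (h : CoeffSolution j κ S T x₀ x) {t₀ : ℝ} (ht₀ : 0 ≤ t₀) :
    CoeffSolution j κ S (T - t₀) (x t₀) fun t => x (t₀ + t) := by
  intro t ht k
  by_cases hk : k ∈ S
  · have h1 := h (t₀ + t) ⟨by linarith [ht.1], by linarith [ht.2]⟩ k
    have h2 := h t₀ ⟨ht₀, by linarith [ht.1, ht.2]⟩ k
    simp only [hk, indicator_of_mem] at h1 h2 ⊢
    rw [h1, h2, integral_phase_add (hx k), add_comm t₀ t, phase_add]
    ring
  · have h1 := h (t₀ + t) ⟨by linarith [ht.1], by linarith [ht.2]⟩ k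
    simpa only [hk, not_false_eq_true, indicator_of_notMem] using h1

lemma CoeffSolution.concat {x : ℝ → ℤ → ℂ} (hx : ∀ k, Continuous fun r => forceCoeff κ (x r) k)
    {t₀ : ℝ} (ht₀ : 0 ≤ t₀) (h : CoeffSolution j κ S t₀ x₀ x)
    (h' : CoeffSolution j κ S T (x t₀) fun t => x (t₀ + t)) :
    CoeffSolution j κ S (t₀ + T) x₀ x := by
  intro t ht k
  rcases le_total t t₀ with h1 | h1
  · exact h t ⟨ht.1, h1⟩ k
  · have h2 := h' (t - t₀) ⟨by linarith, by linarith [ht.2]⟩ k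
    have h3 := h t₀ ⟨ht₀, le_rfl⟩ k
    simp only [add_sub_cancel] at h2
    by_cases hk : k ∈ S
    · simp only [hk, indicator_of_mem] at h2 h3 ⊢
      have h4 := integral_phase_add (j := j) (hx k) k t₀ (t - t₀)
      simp only [add_sub_cancel] at h4
      have h5 : phase j t k = phase j (t - t₀) k * phase j t₀ k := by
        rw [← phase_add, sub_add_cancel]
      rw [h2, h3, h4, h5]
      ring
    · simpa only [hk, not_false_eq_true, indicator_of_notMem] using h2

/-- A fixed point of the Picard map solves the integral equation on `[0, 1/M]`. -/
lemma coeffSolution_of_fixed_point {φ P : ℝ → ℂ} {C : ℝ} (hP : IsCutoff φ P C)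
    (hφ : ∀ t, |t| ≤ 1 → φ t = 1) (hκ : FeedbackMatrix κ) {M : ℝ} (hM : 0 < M)
    {U : ℤ × ℝ → ℂ} (hU : Measurable U) (hU' : nrm Measure.count (modeNorm U) < ⊤)
    (h : ∀ᵐ ξ ∂freqMeasure, U ξ = picard P j M κ S x₀ U ξ) :
    CoeffSolution j κ S (1 / M) x₀ (ev U) := by
  intro t ht k
  have hMt : |M * t| ≤ 1 := by
    rw [abs_of_nonneg (mul_nonneg hM.le ht.1)]
    have := (le_div_iff₀ hM).1 ht.2
    linarith
  rw [ev_congr_ae h, picard, ev_trunc]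
  congr 1
  ext k
  have hF := integrable_forcing hκ hU hU' k
  rw [ev_sub (integrable_freeEv hP j hM x₀ k) (integrable_Duh hP j hM hF) t,
    ev_freeEv hP hφ j hM x₀ k hMt, ev_Duh hP hφ j hM hF hMt]
  simp only [ev_forcing hκ hU hU']
  have h2 : ev U = ev (picard P j M κ S x₀ U) := ev_congr_ae h
  rw [picard] at h2
  rw [← h2]

end Equation

lemma ev_dforcing_congr {κ : ℤ → ℤ → ℂ} (hκ : FeedbackMatrix κ) {U₁ U₂ V V' : ℤ × ℝ → ℂ}
    (h1 : Measurable U₁) (h2 : Measurable U₂) (hV : Measurable V) (hV' : Measurable V')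
    (f1 : nrm Measure.count (modeNorm U₁) < ⊤) (f2 : nrm Measure.count (modeNorm U₂) < ⊤)
    (fV : nrm Measure.count (modeNorm V) < ⊤) (fV' : nrm Measure.count (modeNorm V') < ⊤)
    {t : ℝ} (h : ev V t = ev V' t) (k : ℤ) :
    ev (dforcing κ U₁ U₂ V) t k = ev (dforcing κ U₁ U₂ V') t k := by
  have key : ∀ W : ℤ × ℝ → ℂ, Measurable W → nrm Measure.count (modeNorm W) < ⊤ →
      ev (dforcing κ U₁ U₂ W) t k = (∑' l, κ k l * ev W t l) + (Complex.I * k / 2)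
        * ((∑' l, ev W t l * ev U₁ t (k - l)) + ∑' l, ev U₂ t l * ev W t (k - l)) := by
    intro W hW fW
    have i1 := integrable_cconv hW h1 fW f1 k
    have i2 := integrable_cconv h2 hW f2 fW k
    rw [← ev_applyK hκ hW fW, ← ev_cconv hW h1 fW f1, ← ev_cconv h2 hW f2 fW, ← ev_add i1 i2]
    refine (ev_add (integrable_applyK hκ hW fW k) ((i1.add i2).const_mul (Complex.I * k / 2))
      (V := fun ξ => (Complex.I * ξ.1 / 2) * (cconv W U₁ ξ + cconv U₂ W ξ)) t).trans ?_
    congr 1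
    simp only [ev, ← integral_const_mul]
    refine integral_congr_ae (Eventually.of_forall fun τ => ?_)
    simp only []; ring
  rw [key V hV fV, key V' hV' fV', h]

/-- Uniqueness on a short time interval: the difference of two solutions, cut off in time, is
reproduced by a map that halves its norm. -/
lemma exists_unique_short {j : ℕ} (hj : 1 ≤ j) {κ : ℤ → ℤ → ℂ} (hκ : FeedbackMatrix κ) (B : ℝ≥0) :
    ∃ M : ℝ, 1 ≤ M ∧ ∀ (S : Set ℤ) (T : ℝ) (x₀ : ℤ → ℂ) (U₁ U₂ : ℤ × ℝ → ℂ),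
      Measurable U₁ → Measurable U₂ → (∀ τ, U₁ (0, τ) = 0) → (∀ τ, U₂ (0, τ) = 0) →
      ys j 1 0 U₁ ≤ B → ys j 1 0 U₂ ≤ B →
      CoeffSolution j κ S T x₀ (ev U₁) → CoeffSolution j κ S T x₀ (ev U₂) →
      ∀ t ∈ Icc 0 T, t ≤ 1 / M → ev U₁ t = ev U₂ t := by
  obtain ⟨φ, P, C, hP, hφ⟩ := exists_unit_cutoff
  obtain ⟨D, hD⟩ := exists_ys_cut_le hP
  obtain ⟨A, hA⟩ := exists_ys_Duh_dforcing_le hP hj hκ le_rfl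
  obtain ⟨M, hM, hg⟩ := exists_gain_mul_le (A * (1 + 4 * (D * B)))
  replace hg := hg M le_rfl
  refine ⟨M, hM, fun S T x₀ U₁ U₂ m1 m2 z1 z2 b1 b2 s1 s2 => ?_⟩
  have hM0 : 0 < M := by linarith
  have n1 : nrm Measure.count (modeNorm U₁) < ⊤ :=
    (nrm_modeNorm_le j 1 U₁).trans_lt (b1.trans_lt (by simp))
  have n2 : nrm Measure.count (modeNorm U₂) < ⊤ :=
    (nrm_modeNorm_le j 1 U₂).trans_lt (b2.trans_lt (by simp))
  have i1 := fun k => integrable_mode m1 (lt_top_of_nrm_count_lt_top n1 k)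
  have i2 := fun k => integrable_mode m2 (lt_top_of_nrm_count_lt_top n2 k)
  -- The solutions are replaced by their cut off versions, for which the norm `Y_M` is bounded
  -- uniformly in `M`; nothing changes on `[0, 1/M]`.
  set W₁ := cut P M U₁ with hW₁
  set W₂ := cut P M U₂ with hW₂
  have mW1 : Measurable W₁ := measurable_cut hP M m1
  have mW2 : Measurable W₂ := measurable_cut hP M m2
  have bW1 : ys j M 0 W₁ ≤ D * B := (hD j M 0 hM U₁ m1).trans (by gcongr)
  have bW2 : ys j M 0 W₂ ≤ D * B := (hD j M 0 hM U₂ m2).trans (by gcongr)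
  have hDB : (D * B : ℝ≥0∞) < ⊤ := by finiteness
  have nW1 := (nrm_modeNorm_le j M W₁).trans_lt (bW1.trans_lt hDB)
  have nW2 := (nrm_modeNorm_le j M W₂).trans_lt (bW2.trans_lt hDB)
  have iW1 := fun k => integrable_mode mW1 (lt_top_of_nrm_count_lt_top nW1 k)
  have iW2 := fun k => integrable_mode mW2 (lt_top_of_nrm_count_lt_top nW2 k)
  have zW1 : ∀ τ, W₁ (0, τ) = 0 := cut_zero_mode M z1
  have zW2 : ∀ τ, W₂ (0, τ) = 0 := cut_zero_mode M z2
  have hMt : ∀ t : ℝ, 0 ≤ t → t ≤ 1 / M → |M * t| ≤ 1 := by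
    intro t h0 ht
    rw [abs_of_nonneg (mul_nonneg hM0.le h0)]
    have := (le_div_iff₀ hM0).1 ht
    linarith
  have e1 : ∀ t : ℝ, 0 ≤ t → t ≤ 1 / M → ev W₁ t = ev U₁ t := by
    intro t h0 ht; ext k
    rw [hW₁, ev_cut hP hM0 (i1 k), hφ _ (hMt t h0 ht), one_mul]
  have e2 : ∀ t : ℝ, 0 ≤ t → t ≤ 1 / M → ev W₂ t = ev U₂ t := by
    intro t h0 ht; ext k
    rw [hW₂, ev_cut hP hM0 (i2 k), hφ _ (hMt t h0 ht), one_mul]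
  let V₀ : ℤ × ℝ → ℂ := fun ξ => W₁ ξ - W₂ ξ
  have mV0 : Measurable V₀ := mW1.sub mW2
  let R : (ℤ × ℝ → ℂ) → ℤ × ℝ → ℂ := fun V =>
    trunc S fun ξ => -Duh P j M (dforcing κ W₁ W₂ V) ξ
  -- Every application of `R` to a representation of the difference on `[0, 1/M]` gives another
  -- one, of half the norm.
  have key : ∀ n : ℕ, ∃ V : ℤ × ℝ → ℂ, Measurable V ∧ (∀ τ, V (0, τ) = 0) ∧
      ys j M 0 V ≤ (1 / 2) ^ n * (2 * (D * B)) ∧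
      ∀ t ∈ Icc 0 T, t ≤ 1 / M → ∀ k, ev V t k = ev U₁ t k - ev U₂ t k := by
    intro n
    induction n with
    | zero =>
      refine ⟨V₀, mV0, by simp [V₀, zW1, zW2], ?_, fun t ht htM k => ?_⟩
      · rw [pow_zero, one_mul, two_mul]
        exact (ys_sub_le j M 0 mW1 mW2).trans (add_le_add bW1 bW2)
      · rw [ev_sub (iW1 k) (iW2 k), e1 t ht.1 htM, e2 t ht.1 htM]
    | succ n ih =>
      obtain ⟨V, mV, zV, bV, eV⟩ := ih
      have fV : ys j M 0 V < ⊤ := bV.trans_lt (by finiteness)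
      have nV := (nrm_modeNorm_le j M V).trans_lt fV
      have mF := measurable_dforcing κ mW1 mW2 mV
      have mD := measurable_Duh hP j M mF
      refine ⟨R V, measurable_trunc S mD.neg, fun τ => ?_, ?_, fun t ht htM k => ?_⟩
      · have h0 : Duh P j M (dforcing κ W₁ W₂ V) (0, τ) = 0 :=
          Duh_zero_mode P j M (fun τ => dforcing_zero_mode hκ _ _ _ τ) τ
        by_cases h : (0 : ℤ) ∈ S <;> simp [R, trunc, h, h0]
      · have h3 := hA M hM W₁ W₂ V mW1 mW2 mV zW1 zW2 zV fV _ mF (Eventually.of_forall fun ξ => rfl)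
        have h4 : ys j M 0 (R V) ≤ ys j M 0 (Duh P j M (dforcing κ W₁ W₂ V)) :=
          (ys_trunc_le j M 0 S _).trans (ys_mono_ae j M 0 (Eventually.of_forall fun ξ => by simp))
        refine h4.trans (h3.trans ?_)
        calc _ = A * gain M * (1 + 2 * ys j M 0 W₁ + 2 * ys j M 0 W₂) * ys j M 0 V := by ring
          _ ≤ A * gain M * (1 + 2 * (D * B) + 2 * (D * B)) * ((1 / 2) ^ n * (2 * (D * B))) := by
              gcongr
          _ = ((A * (1 + 4 * (D * B)) : ℝ≥0) : ℝ≥0∞) * gain M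
              * ((1 / 2) ^ n * (2 * (D * B))) := by push_cast; ring
          _ ≤ 1 / 2 * ((1 / 2) ^ n * (2 * (D * B))) := by gcongr
          _ = _ := by rw [pow_succ']; ring
      · have iF := integrable_dforcing hκ mW1 mW2 mV nW1 nW2 nV
        rw [ev_trunc, s1 t ht k, s2 t ht k]
        by_cases hk : k ∈ S
        swap
        · simp [hk]
        simp only [hk, indicator_of_mem]
        have c1 := continuous_forceCoeff hκ m1 n1 k
        have c2 := continuous_forceCoeff hκ m2 n2 k
        have h5 : ev (fun ξ => -Duh P j M (dforcing κ W₁ W₂ V) ξ) t k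
            = -ev (Duh P j M (dforcing κ W₁ W₂ V)) t k := by
          simp only [ev, mul_neg, integral_neg]
        have h6 : ∀ r ∈ uIcc 0 t, phase j (t - r) k * ev (dforcing κ W₁ W₂ V) r k
            = phase j (t - r) k * forceCoeff κ (ev U₁ r) k
              - phase j (t - r) k * forceCoeff κ (ev U₂ r) k := by
          intro r hr
          rw [uIcc_of_le ht.1] at hr
          have hr' : r ≤ 1 / M := hr.2.trans htM
          have nV0 : nrm Measure.count (modeNorm V₀) < ⊤ :=
            (nrm_modeNorm_le j M V₀).trans_lt ((ys_sub_le j M 0 mW1 mW2).trans_lt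
              (ENNReal.add_lt_top.2 ⟨bW1.trans_lt hDB, bW2.trans_lt hDB⟩))
          have h7 : ev V r = ev V₀ r := by
            ext k
            rw [eV r ⟨hr.1, hr.2.trans ht.2⟩ hr' k, ev_sub (iW1 k) (iW2 k), e1 r hr.1 hr',
              e2 r hr.1 hr']
          rw [ev_dforcing_congr hκ mW1 mW2 mV mV0 nW1 nW2 nV nV0 h7,
            ← ev_congr_ae (forcing_sub_ae hκ mW1 mW2 nW1 nW2),
            ev_sub (integrable_forcing hκ mW1 nW1 k) (integrable_forcing hκ mW2 nW2 k),
            ev_forcing hκ mW1 nW1, ev_forcing hκ mW2 nW2, e1 r hr.1 hr', e2 r hr.1 hr', mul_sub]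
        rw [h5, ev_Duh hP hφ j hM0 (iF k) (hMt t ht.1 htM),
          intervalIntegral.integral_congr h6,
          intervalIntegral.integral_sub (intervalIntegrable_phase_mul c1 k t 0 t)
            (intervalIntegrable_phase_mul c2 k t 0 t)]
        ring
  intro t ht htM
  ext k
  have hle : ∀ n : ℕ, ‖ev U₁ t k - ev U₂ t k‖ₑ ≤ (1 / 2) ^ n * (2 * (D * B)) := by
    intro n
    obtain ⟨V, mV, -, bV, eV⟩ := key n
    rw [← eV t ht htM k]
    exact (enorm_le_seqNorm le_rfl _ k).trans ((seqNorm_ev_le j M 0 mV t).trans bV)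
  have h0 : ‖ev U₁ t k - ev U₂ t k‖ₑ ≤ 0 := by
    refine ge_of_tendsto' (x := atTop)
      (f := fun n : ℕ => (1 / 2 : ℝ≥0∞) ^ n * (2 * (D * B))) ?_ hle
    have h5 : Tendsto (fun n : ℕ => (1 / 2 : ℝ≥0∞) ^ n * (2 * (D * B))) atTop
        (𝓝 (0 * (2 * (D * B)))) := by
      refine ENNReal.Tendsto.mul_const (ENNReal.tendsto_pow_atTop_nhds_zero_of_lt_one ?_) (Or.inr ?_)
      · simp
      · finiteness
    simpa using h5
  exact sub_eq_zero.1 (enorm_eq_zero.1 (le_antisymm h0 bot_le))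

/-- Uniqueness of solutions with a representation in `Y`. -/
theorem CoeffSolution.unique {j : ℕ} (hj : 1 ≤ j) {κ : ℤ → ℤ → ℂ} (hκ : FeedbackMatrix κ)
    {S : Set ℤ} {T : ℝ} {x₀ : ℤ → ℂ} {U₁ U₂ : ℤ × ℝ → ℂ} (m1 : Measurable U₁) (m2 : Measurable U₂)
    (z1 : ∀ τ, U₁ (0, τ) = 0) (z2 : ∀ τ, U₂ (0, τ) = 0) (b1 : ys j 1 0 U₁ < ⊤)
    (b2 : ys j 1 0 U₂ < ⊤) (s1 : CoeffSolution j κ S T x₀ (ev U₁))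
    (s2 : CoeffSolution j κ S T x₀ (ev U₂)) : ∀ t ∈ Icc 0 T, ev U₁ t = ev U₂ t := by
  obtain ⟨M, hM, h⟩ := exists_unique_short hj hκ (ys j 1 0 U₁ + ys j 1 0 U₂).toNNReal
  have hB : ((ys j 1 0 U₁ + ys j 1 0 U₂).toNNReal : ℝ≥0∞) = ys j 1 0 U₁ + ys j 1 0 U₂ :=
    ENNReal.coe_toNNReal (ENNReal.add_lt_top.2 ⟨b1, b2⟩).ne
  have hM0 : 0 < M := by linarith
  have n1 := (nrm_modeNorm_le j 1 U₁).trans_lt b1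
  have n2 := (nrm_modeNorm_le j 1 U₂).trans_lt b2
  have key : ∀ n : ℕ, ∀ t ∈ Icc 0 T, t ≤ n * (1 / M) → ev U₁ t = ev U₂ t := by
    intro n
    induction n with
    | zero =>
      intro t ht htn
      refine h S T x₀ U₁ U₂ m1 m2 z1 z2 (by rw [hB]; exact le_self_add)
        (by rw [hB]; exact le_add_self) s1 s2 t ht ?_
      have : 0 < 1 / M := by positivity
      simp only [Nat.cast_zero, zero_mul] at htn
      linarith
    | succ n ih =>
      intro t ht htn
      rcases le_total t (n * (1 / M)) with h1 | h1
      · exact ih t ht h1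
      set t₀ : ℝ := n * (1 / M) with ht₀
      have ht₀0 : 0 ≤ t₀ := by positivity
      have e0 : ev U₁ t₀ = ev U₂ t₀ := ih t₀ ⟨ht₀0, h1.trans ht.2⟩ le_rfl
      have s1' := s1.shift (continuous_forceCoeff hκ m1 n1) ht₀0
      have s2' := s2.shift (continuous_forceCoeff hκ m2 n2) ht₀0
      simp only [← ev_tshift] at s1' s2'
      rw [← e0] at s2'
      have h2 := h S (T - t₀) (ev U₁ t₀) (tshift t₀ U₁) (tshift t₀ U₂) (measurable_tshift _ m1)
        (measurable_tshift _ m2) (by simp [tshift, z1]) (by simp [tshift, z2])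
        (by rw [hB, ys_tshift]; exact le_self_add) (by rw [hB, ys_tshift]; exact le_add_self)
        s1' s2' (t - t₀) ⟨by linarith, by linarith [ht.2]⟩ (by push_cast at htn; linarith)
      rw [ev_tshift, ev_tshift] at h2
      simpa using h2
  intro t ht
  obtain ⟨n, hn⟩ := exists_nat_ge (t * M)
  refine key n t ht ?_
  rw [mul_one_div, le_div_iff₀ hM0]
  exact hn

/-! ### Real-valued solutions -/

/-- Complex conjugation of the function, on the Fourier side. -/
noncomputable def reflect (U : ℤ × ℝ → ℂ) (ξ : ℤ × ℝ) : ℂ := (starRingEnd ℂ) (U (-ξ))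

lemma measurable_reflect {U : ℤ × ℝ → ℂ} (hU : Measurable U) : Measurable (reflect U) :=
  Complex.continuous_conj.measurable.comp (hU.comp measurable_neg)

lemma ev_reflect (U : ℤ × ℝ → ℂ) (t : ℝ) (k : ℤ) :
    ev (reflect U) t k = (starRingEnd ℂ) (ev U t (-k)) := by
  simp only [ev]
  rw [← integral_conj, ← integral_neg_eq_self]
  refine integral_congr_ae (Eventually.of_forall fun τ => ?_)
  simp only [reflect, Prod.neg_mk, map_mul, neg_neg, ← Complex.exp_conj, Complex.conj_I,
    Complex.conj_ofReal, Complex.ofReal_neg]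
  congr 2
  ring

lemma ys_zero_reflect (j : ℕ) (M : ℝ) (U : ℤ × ℝ → ℂ) :
    ys j M 0 (reflect U) = ys j M 0 U := by
  have h1 : ∀ ξ, ‖reflect U ξ‖ₑ = ‖U (-ξ)‖ₑ := fun ξ => by
    rw [reflect, ← ofReal_norm, ← ofReal_norm, RCLike.norm_conj]
  rw [ys_zero, ys_zero]
  simp only [h1, yn]
  congr 1
  · rw [nrm, nrm, ← lintegral_neg_eq_self (μ := freqMeasure)]
    simp only [wt_neg, neg_neg]
  · rw [nrm_count_eq, nrm_count_eq, ← (Equiv.neg ℤ).tsum_eq]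
    congr 1
    refine tsum_congr fun k => ?_
    rw [← lintegral_neg_eq_self (μ := (volume : Measure ℝ))]
    simp

lemma phase_neg_int (j : ℕ) (t : ℝ) (k : ℤ) :
    phase j t (-k) = (starRingEnd ℂ) (phase j t k) := by
  have : Odd (2 * j + 1) := ⟨j, rfl⟩
  rw [phase_eq, phase_eq, ← Complex.exp_conj]
  simp [this.neg_pow]

lemma forceCoeff_reflect {κ : ℤ → ℤ → ℂ} (hκ : FeedbackMatrix κ) (x : ℤ → ℂ) (k : ℤ) :
    forceCoeff κ (fun k => (starRingEnd ℂ) (x (-k))) k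
      = (starRingEnd ℂ) (forceCoeff κ x (-k)) := by
  simp only [forceCoeff, map_add, map_mul, Complex.conj_tsum, map_div₀, Complex.conj_I]
  congr 1
  · rw [← (Equiv.neg ℤ).tsum_eq]
    refine tsum_congr fun l => ?_
    have := hκ.conj (-k) l
    simp only [neg_neg] at this
    simp [this]
  · congr 1
    · simp [map_ofNat]
    · rw [← (Equiv.neg ℤ).tsum_eq]
      refine tsum_congr fun l => ?_
      simp only [Equiv.neg_apply, neg_neg]
      congr 3
      ring

/-- A solution with a real-valued datum is real-valued, by uniqueness. -/
theorem CoeffSolution.real {j : ℕ} (hj : 1 ≤ j) {κ : ℤ → ℤ → ℂ} (hκ : FeedbackMatrix κ)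
    {S : Set ℤ} (hS : ∀ k, -k ∈ S ↔ k ∈ S) {T : ℝ} {x₀ : ℤ → ℂ}
    (hx₀ : ∀ k, x₀ (-k) = (starRingEnd ℂ) (x₀ k)) {U : ℤ × ℝ → ℂ} (m : Measurable U)
    (z : ∀ τ, U (0, τ) = 0) (b : ys j 1 0 U < ⊤) (h : CoeffSolution j κ S T x₀ (ev U)) :
    ∀ t ∈ Icc 0 T, ∀ k, ev U t (-k) = (starRingEnd ℂ) (ev U t k) := by
  have h' : CoeffSolution j κ S T x₀ (ev (reflect U)) := by
    intro t ht k
    have h1 := h t ht (-k)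
    rw [ev_reflect, h1]
    by_cases hk : k ∈ S
    · simp only [hk, (hS k).2 hk, indicator_of_mem, map_sub, map_mul, hx₀, phase_neg_int,
        Complex.conj_conj]
      congr 1
      rw [intervalIntegral.integral_of_le ht.1, intervalIntegral.integral_of_le ht.1,
        ← integral_conj]
      refine integral_congr_ae (Eventually.of_forall fun r => ?_)
      have h2 : ev (reflect U) r = fun k => (starRingEnd ℂ) (ev U r (-k)) := by
        ext k; exact ev_reflect U r k
      simp only [map_mul, Complex.conj_conj]
      rw [h2, forceCoeff_reflect hκ]
    · have hk' : -k ∉ S := fun h => hk ((hS k).1 h)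
      simp [hk, hk']
  intro t ht k
  have h3 := h.unique hj hκ m (measurable_reflect m) z (fun τ => by simp [reflect, z]) b
    (by rwa [ys_zero_reflect]) h' t ht
  have h4 := congrFun h3 (-k)
  rw [ev_reflect, neg_neg] at h4
  exact h4

/-! ### The energy estimate for Galerkin approximations -/

/-- The nonlinear term does not contribute to the energy balance: the sum over triads
`-k, l, k - l` is symmetric, and the three frequencies add up to zero. -/
lemma energy_cancellation {S : Finset ℤ} {x : ℤ → ℂ} (hx : ∀ k, k ∉ S → x k = 0)
    (hreal : ∀ k, x (-k) = (starRingEnd ℂ) (x k)) :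
    ∑ k ∈ S, (starRingEnd ℂ) (x k) * ((Complex.I * k / 2) * ∑' l, x l * x (k - l)) = 0 := by
  set p : ℤ × ℤ → ℂ := fun z => x (-z.1) * x z.2 * x (z.1 - z.2) with hp
  have hsupp : ∀ c : ℤ × ℤ → ℂ, Summable fun z => c z * p z := by
    intro c
    refine summable_of_hasFiniteSupport (Set.Finite.subset (S ×ˢ S).finite_toSet ?_)
    rintro ⟨k, l⟩ hz
    simp only [Function.mem_support, hp, hreal k, ne_eq, mul_eq_zero, not_or, map_eq_zero] at hz
    simp only [Finset.coe_product, mem_prod, Finset.mem_coe]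
    exact ⟨by_contra fun h => hz.2.1.1 (hx k h), by_contra fun h => hz.2.1.2 (hx l h)⟩
  set Q := ∑' z : ℤ × ℤ, (z.1 : ℂ) * p z with hQ
  set R := ∑' z : ℤ × ℤ, (z.2 : ℂ) * p z with hR
  have h1 : Q = -R := by
    let e : ℤ × ℤ ≃ ℤ × ℤ :=
      ⟨fun z => (-z.2, -z.1), fun z => (-z.2, -z.1), fun z => by simp, fun z => by simp⟩
    rw [hQ, hR, ← e.tsum_eq, ← tsum_neg]
    refine tsum_congr fun z => ?_
    simp only [e, hp, Equiv.coe_fn_mk, neg_neg]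
    rw [show -z.2 - -z.1 = z.1 - z.2 by ring]
    push_cast
    ring
  have h2 : R = Q - R := by
    let e : ℤ × ℤ ≃ ℤ × ℤ :=
      ⟨fun z => (z.1, z.1 - z.2), fun z => (z.1, z.1 - z.2), fun z => by simp, fun z => by simp⟩
    calc R = ∑' z : ℤ × ℤ, (((e z).2 : ℤ) : ℂ) * p (e z) :=
          (e.tsum_eq fun z : ℤ × ℤ => (z.2 : ℂ) * p z).symm
      _ = ∑' z : ℤ × ℤ, ((z.1 : ℂ) * p z - (z.2 : ℂ) * p z) := by
          refine tsum_congr fun z => ?_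
          simp only [e, hp, Equiv.coe_fn_mk, sub_sub_cancel]
          push_cast
          ring
      _ = Q - R := (hsupp fun z => z.1).tsum_sub (hsupp fun z => z.2)
  have hQ0 : Q = 0 := by
    have h3 : 3 * Q = 0 := by linear_combination (2 : ℂ) * h1 - h2
    simpa using h3
  have h4 : Q = ∑' k : ℤ, (k : ℂ) * (starRingEnd ℂ) (x k) * ∑' l, x l * x (k - l) := by
    rw [hQ, (hsupp fun z => z.1).tsum_prod' fun k => (hsupp fun z => z.1).prod_factor k]
    refine tsum_congr fun k => ?_
    rw [← tsum_mul_left]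
    refine tsum_congr fun l => ?_
    simp only [hp, hreal k]
    ring
  rw [tsum_eq_sum (s := S) (fun k hk => by simp [hx k hk])] at h4
  have h5 : ∑ k ∈ S, (starRingEnd ℂ) (x k) * ((Complex.I * k / 2) * ∑' l, x l * x (k - l))
      = Complex.I / 2 * Q := by
    rw [h4, Finset.mul_sum]
    refine Finset.sum_congr rfl fun k _ => ?_
    ring
  rw [h5, hQ0, mul_zero]

lemma seqNorm_zero_sq {S : Finset ℤ} {x : ℤ → ℂ} (hx : ∀ k, k ∉ S → x k = 0) :
    seqNorm 0 x ^ 2 = ENNReal.ofReal (∑ k ∈ S, ‖x k‖ ^ 2) := by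
  rw [seqNorm, nrm_count_sq, tsum_eq_sum (s := S) (fun k hk => by simp [hx k hk]),
    ENNReal.ofReal_sum_of_nonneg fun k _ => by positivity]
  refine Finset.sum_congr rfl fun k _ => ?_
  rw [sobWt_zero, one_mul, ENNReal.ofReal_pow (norm_nonneg _), ofReal_norm]

/-- The energy estimate for a finite set of frequencies: the feedback can let the `L²` norm grow at
most exponentially. -/
lemma galerkin_energy {j : ℕ} {κ : ℤ → ℤ → ℂ} {A : ℝ≥0}
    (hA : ∀ x : ℤ → ℂ, nrm Measure.count (fun l => ‖x l‖ₑ) < ⊤ →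
      seqNorm 0 (fun k => ∑' l, κ k l * x l) ≤ A * seqNorm 0 x)
    {S : Finset ℤ} {T : ℝ} {x₀ : ℤ → ℂ} {x : ℝ → ℤ → ℂ}
    (hc : ∀ k, Continuous fun r => forceCoeff κ (x r) k) (h : CoeffSolution j κ S T x₀ x)
    (hreal : ∀ t ∈ Icc 0 T, ∀ k, x t (-k) = (starRingEnd ℂ) (x t k)) {t : ℝ} (ht : t ∈ Icc 0 T) :
    seqNorm 0 (x t) ≤ ENNReal.ofReal (Real.exp (A * t)) * seqNorm 0 x₀ := by
  have hsupp : ∀ t ∈ Icc 0 T, ∀ k, k ∉ S → x t k = 0 := by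
    intro t ht k hk
    rw [h t ht k]
    simp [hk]
  -- the profile of the solution, with the free evolution removed
  set y : ℤ → ℝ → ℂ := fun k t =>
    x₀ k - ∫ r in (0 : ℝ)..t, phase j (0 - r) k * forceCoeff κ (x r) k with hy
  have hyd : ∀ k t, HasDerivAt (y k) (-(phase j (0 - t) k * forceCoeff κ (x t) k)) t := by
    intro k t
    have h1 : Continuous fun r => phase j (0 - r) k * forceCoeff κ (x r) k := by
      have := continuous_phase j k
      have := hc k
      fun_prop
    exact (intervalIntegral.integral_hasDerivAt_right (h1.intervalIntegrable _ _)
      h1.stronglyMeasurable.stronglyMeasurableAtFilter h1.continuousAt).const_sub _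
  have hxy : ∀ t ∈ Icc 0 T, ∀ k ∈ S, x t k = phase j t k * y k t := by
    intro t ht k hk
    rw [h t ht k, indicator_of_mem (Finset.mem_coe.2 hk)]
    simp only [hy, mul_sub]
    congr 1
    rw [← intervalIntegral.integral_const_mul]
    refine intervalIntegral.integral_congr fun r _ => ?_
    rw [← mul_assoc, ← phase_add]
    congr 2; ring
  set E : ℝ → ℝ := fun t => ∑ k ∈ S, ‖y k t‖ ^ 2 with hE
  have hxE : ∀ t ∈ Icc 0 T, ∑ k ∈ S, ‖x t k‖ ^ 2 = E t := by
    intro t ht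
    refine Finset.sum_congr rfl fun k hk => ?_
    rw [hxy t ht k hk, norm_mul, norm_phase, one_mul]
  have hEd : ∀ t, HasDerivAt E (∑ k ∈ S, 2 * inner ℝ (y k t)
      (-(phase j (0 - t) k * forceCoeff κ (x t) k))) t := by
    intro t
    have := HasDerivAt.fun_sum (u := S) (A := fun k t => ‖y k t‖ ^ 2) fun k _ => (hyd k t).norm_sq
    simpa using this
  -- the nonlinear term drops out of the energy balance, and the feedback is bounded by `A`
  have hbound : ∀ t ∈ Icc 0 T, ∑ k ∈ S, 2 * inner ℝ (y k t)
      (-(phase j (0 - t) k * forceCoeff κ (x t) k)) ≤ 2 * A * E t := by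
    intro t ht
    have e1 : ∀ k ∈ S, 2 * inner ℝ (y k t) (-(phase j (0 - t) k * forceCoeff κ (x t) k))
        = -2 * ((starRingEnd ℂ) (x t k) * ∑' l, κ k l * x t l).re
          - 2 * ((starRingEnd ℂ) (x t k) * ((Complex.I * k / 2) * ∑' l, x t l * x t (k - l))).re := by
      intro k hk
      have e2 : phase j (0 - t) k = (starRingEnd ℂ) (phase j t k) := by
        rw [phase_eq, phase_eq, ← Complex.exp_conj]
        congr 1
        simp
      have e3 : (starRingEnd ℂ) (y k t) * -(phase j (0 - t) k *
          ((∑' l, κ k l * x t l) + Complex.I * k / 2 * ∑' l, x t l * x t (k - l)))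
          = -((starRingEnd ℂ) (x t k) * ∑' l, κ k l * x t l)
            - (starRingEnd ℂ) (x t k) * (Complex.I * k / 2 * ∑' l, x t l * x t (k - l)) := by
        rw [e2, hxy t ht k hk, map_mul]
        ring
      rw [Complex.inner, forceCoeff, mul_comm _ ((starRingEnd ℂ) (y k t)), e3, Complex.sub_re, Complex.neg_re]
      ring
    rw [Finset.sum_congr rfl e1, Finset.sum_sub_distrib, ← Finset.mul_sum, ← Finset.mul_sum,
      ← Complex.re_sum, ← Complex.re_sum, energy_cancellation (hsupp t ht) (hreal t ht)]
    have e4 : ‖∑ k ∈ S, (starRingEnd ℂ) (x t k) * ∑' l, κ k l * x t l‖ ≤ A * E t := by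
      have hfin : nrm Measure.count (fun l => ‖x t l‖ₑ) < ⊤ := by
        have := seqNorm_zero_sq (hsupp t ht)
        simp only [seqNorm, sobWt_zero, one_mul] at this
        have h2 : nrm Measure.count (fun l => ‖x t l‖ₑ) ^ 2 < ⊤ := by
          rw [this]; exact ENNReal.ofReal_lt_top
        exact ((ENNReal.pow_lt_top_iff (n := 2)).1 h2).resolve_right (by norm_num)
      have e5 : ENNReal.ofReal ‖∑ k ∈ S, (starRingEnd ℂ) (x t k) * ∑' l, κ k l * x t l‖
          ≤ ENNReal.ofReal (A * E t) := by
        rw [ofReal_norm]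
        calc _ ≤ ∑ k ∈ S, ‖(starRingEnd ℂ) (x t k) * ∑' l, κ k l * x t l‖ₑ := enorm_sum_le _ _
          _ ≤ ∑' k, ‖x t k‖ₑ * ‖∑' l, κ k l * x t l‖ₑ := by
              refine le_trans (le_of_eq (Finset.sum_congr rfl fun k _ => ?_)) (ENNReal.sum_le_tsum S)
              rw [enorm_mul, ← ofReal_norm, RCLike.norm_conj, ofReal_norm]
          _ ≤ seqNorm 0 (x t) * seqNorm 0 (fun k => ∑' l, κ k l * x t l) := by
              refine (tsum_mul_le_nrm _ _).trans (le_of_eq ?_)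
              simp only [seqNorm, sobWt_zero, one_mul]
          _ ≤ seqNorm 0 (x t) * (A * seqNorm 0 (x t)) := by gcongr; exact hA _ hfin
          _ = A * seqNorm 0 (x t) ^ 2 := by ring
          _ = _ := by
              rw [seqNorm_zero_sq (hsupp t ht), hxE t ht, ENNReal.ofReal_mul (NNReal.coe_nonneg A),
                ENNReal.ofReal_coe_nnreal]
      exact (ENNReal.ofReal_le_ofReal_iff (mul_nonneg A.2
        (Finset.sum_nonneg fun k _ => by positivity))).1 e5
    have e6 := (Complex.abs_re_le_norm _).trans e4
    have e7 := (abs_le.1 e6).1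
    simp only [Complex.zero_re, mul_zero, sub_zero]
    linarith
  -- Gronwall's inequality
  have hanti : AntitoneOn (fun t => Real.exp (-(2 * A * t)) * E t) (Icc 0 T) := by
    have hd : ∀ t, HasDerivAt (fun t => Real.exp (-(2 * A * t)) * E t)
        (Real.exp (-(2 * A * t)) * (-(2 * A)) * E t + Real.exp (-(2 * A * t)) *
          ∑ k ∈ S, 2 * inner ℝ (y k t) (-(phase j (0 - t) k * forceCoeff κ (x t) k))) t := by
      intro t
      have h1 : HasDerivAt (fun t : ℝ => -(2 * A * t)) (-(2 * (A : ℝ))) t := by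
        simpa using ((hasDerivAt_id t).const_mul (2 * (A : ℝ))).fun_neg
      exact h1.exp.mul (hEd t)
    refine antitoneOn_of_deriv_nonpos (convex_Icc 0 T)
      (fun t _ => (hd t).continuousAt.continuousWithinAt)
      (fun t _ => (hd t).differentiableAt.differentiableWithinAt) fun t ht => ?_
    rw [(hd t).deriv]
    have h2 := hbound t (interior_subset ht)
    have h3 := Real.exp_pos (-(2 * A * t))
    have h4 := mul_le_mul_of_nonneg_left h2 h3.le
    linarith
  have hle := hanti ⟨le_rfl, ht.1.trans ht.2⟩ ht ht.1
  simp only [mul_zero, neg_zero, Real.exp_zero, one_mul] at hle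
  have hE0 : ENNReal.ofReal (E 0) ≤ seqNorm 0 x₀ ^ 2 := by
    rw [seqNorm, nrm_count_sq, hE, ENNReal.ofReal_sum_of_nonneg fun k _ => by positivity]
    refine le_trans (le_of_eq (Finset.sum_congr rfl fun k _ => ?_)) (ENNReal.sum_le_tsum S)
    simp only [hy, intervalIntegral.integral_same, sub_zero, sobWt_zero, one_mul]
    rw [ENNReal.ofReal_pow (norm_nonneg _), ofReal_norm]
  have hfin : seqNorm 0 (x t) ^ 2 ≤ (ENNReal.ofReal (Real.exp (A * t)) * seqNorm 0 x₀) ^ 2 := by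
    rw [seqNorm_zero_sq (hsupp t ht), hxE t ht, mul_pow]
    have h5 : E t ≤ Real.exp (A * t) ^ 2 * E 0 := by
      have h6 : Real.exp (A * t) ^ 2 * Real.exp (-(2 * A * t)) = 1 := by
        rw [← Real.exp_nat_mul, ← Real.exp_add]; simp; ring
      calc E t = Real.exp (A * t) ^ 2 * (Real.exp (-(2 * A * t)) * E t) := by
            rw [← mul_assoc, h6, one_mul]
        _ ≤ _ := by gcongr
    refine (ENNReal.ofReal_le_ofReal h5).trans ?_
    rw [ENNReal.ofReal_mul (by positivity), ENNReal.ofReal_pow (Real.exp_pos _).le]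
    gcongr
  exact (ENNReal.pow_le_pow_left_iff (by norm_num)).1 hfin

/-! ### Convergence of the Galerkin approximations and global solutions -/

lemma ys_mono_scale (j : ℕ) (s : ℝ) {M M' : ℝ} (h : M ≤ M') (U : ℤ × ℝ → ℂ) :
    ys j M s U ≤ ys j M' s U := by
  unfold ys yn
  refine add_le_add_left (nrm_mono fun ξ => ?_) _
  gcongr
  exact wt_mono j h ξ

/-- The frequencies `|k| ≤ N` of the `N`-th Galerkin approximation. -/
noncomputable def galerkinSet (N : ℕ) : Finset ℤ := Finset.Icc (-(N : ℤ)) N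

lemma galerkinSet_neg (N : ℕ) (k : ℤ) :
    -k ∈ (galerkinSet N : Set ℤ) ↔ k ∈ (galerkinSet N : Set ℤ) := by
  simp only [galerkinSet, Finset.coe_Icc, mem_Icc]
  omega

lemma eventually_mem_galerkinSet (k : ℤ) : ∀ᶠ N in atTop, k ∈ (galerkinSet N : Set ℤ) := by
  filter_upwards [eventually_ge_atTop k.natAbs] with N hN
  simp only [galerkinSet, Finset.coe_Icc, mem_Icc]
  omega

lemma tendsto_nrm_of_eventually_zero {α : Type*} [MeasurableSpace α] {μ : Measure α}
    {f : ℕ → α → ℝ≥0∞} {g : α → ℝ≥0∞} (hf : ∀ n, Measurable (f n)) (hfg : ∀ n x, f n x ≤ g x)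
    (hg : nrm μ g < ⊤) (h0 : ∀ x, ∀ᶠ n in atTop, f n x = 0) :
    Tendsto (fun n => nrm μ (f n)) atTop (𝓝 0) := by
  have h1 : Tendsto (fun n => ∫⁻ x, f n x ^ 2 ∂μ) atTop (𝓝 (∫⁻ _, 0 ∂μ)) := by
    refine tendsto_lintegral_of_dominated_convergence (fun x => g x ^ 2)
      (fun n => (hf n).pow_const 2)
      (fun n => Eventually.of_forall fun x => by have := hfg n x; simp only []; gcongr) ?_
      (Eventually.of_forall fun x => ?_)
    · rw [← nrm_sq]; exact (ENNReal.pow_lt_top hg).ne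
    · refine tendsto_const_nhds.congr' ?_
      filter_upwards [h0 x] with n hn
      simp [hn]
  rw [lintegral_zero] at h1
  have h2 := (ENNReal.continuous_rpow_const (y := 1 / 2)).tendsto 0 |>.comp h1
  simpa [nrm, Function.comp_def] using h2

lemma tendsto_ys_sub_trunc {j : ℕ} {M s : ℝ} {U : ℤ × ℝ → ℂ} (hU : Measurable U)
    (h : ys j M s U < ⊤) :
    Tendsto (fun N : ℕ => ys j M s (fun ξ => U ξ - trunc (galerkinSet N) U ξ)) atTop (𝓝 0) := by
  have hle : ∀ (N : ℕ) ξ, ‖U ξ - trunc (galerkinSet N) U ξ‖ₑ ≤ ‖U ξ‖ₑ := by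
    intro N ξ
    by_cases hk : ξ.1 ∈ (galerkinSet N : Set ℤ)
    · simp only [trunc, hk, indicator_of_mem, sub_self, enorm_zero]; exact bot_le
    · simp only [trunc, hk, not_false_eq_true, indicator_of_notMem, sub_zero]; exact le_rfl
  have hz : ∀ k : ℤ, ∀ᶠ N : ℕ in atTop, ∀ τ, U (k, τ) - trunc (galerkinSet N) U (k, τ) = 0 := by
    intro k
    filter_upwards [eventually_mem_galerkinSet k] with N hN τ
    simp [trunc, hN]
  have hm : ∀ N : ℕ, Measurable fun ξ => sobWt s ξ.1 * ‖U ξ - trunc (galerkinSet N) U ξ‖ₑ :=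
    fun N => measurable_ys_fun s (hU.sub (measurable_trunc _ hU))
  rw [← add_zero (0 : ℝ≥0∞)]
  unfold ys yn
  refine Tendsto.add ?_ ?_
  · refine tendsto_nrm_of_eventually_zero
      (g := fun ξ => wt j M ξ ^ (1 / 2 : ℝ) * (sobWt s ξ.1 * ‖U ξ‖ₑ))
      (fun N => by have := hm N; fun_prop) (fun N ξ => ?_) (lt_of_le_of_lt le_self_add h)
      (fun ξ => ?_)
    · have := hle N ξ
      change _ * (_ * _) ≤ _
      gcongr
    · filter_upwards [hz ξ.1] with N hN
      simp [hN ξ.2]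
  · refine tendsto_nrm_of_eventually_zero
      (g := fun k => ∫⁻ τ : ℝ, sobWt s k * ‖U (k, τ)‖ₑ)
      (fun N => measurable_of_countable _) (fun N k => lintegral_mono fun τ => ?_)
      (lt_of_le_of_lt le_add_self h) (fun k => ?_)
    · have := hle N (k, τ)
      simp only []
      gcongr
    · filter_upwards [hz k] with N hN
      simp [hN]

lemma seqNorm_zero_add_le (x y : ℤ → ℂ) :
    seqNorm 0 (fun k => x k + y k) ≤ seqNorm 0 x + seqNorm 0 y := by
  simp only [seqNorm, sobWt_zero, one_mul]
  exact (nrm_mono fun k => enorm_add_le _ _).trans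
    (nrm_add_le (measurable_of_countable _).aemeasurable (measurable_of_countable _).aemeasurable)

/-- Short time existence, with the exponential bound for the `L²` norm inherited from the Galerkin
approximations. The length of the time interval only depends on the size of the datum in `L²`. -/
lemma exists_local_solution {j : ℕ} (hj : 1 ≤ j) {κ : ℤ → ℤ → ℂ} (hκ : FeedbackMatrix κ) {s : ℝ}
    (hs : 0 ≤ s) {A : ℝ≥0}
    (hA : ∀ x : ℤ → ℂ, nrm Measure.count (fun l => ‖x l‖ₑ) < ⊤ →
      seqNorm 0 (fun k => ∑' l, κ k l * x l) ≤ A * seqNorm 0 x) :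
    ∃ D : ℝ≥0, ∀ R : ℝ≥0, ∃ M : ℝ, 1 ≤ M ∧ ∀ x : ℤ → ℂ, x 0 = 0 →
      (∀ k, x (-k) = (starRingEnd ℂ) (x k)) → seqNorm 0 x ≤ R →
      ∃ U : ℤ × ℝ → ℂ, Measurable U ∧ (∀ τ, U (0, τ) = 0) ∧ ys j 1 0 U < ⊤ ∧
        ys j 1 s U ≤ D * seqNorm s x ∧ CoeffSolution j κ univ (1 / M) x (ev U) ∧
        ∀ t ∈ Icc 0 (1 / M),
          seqNorm 0 (ev U t) ≤ ENNReal.ofReal (Real.exp (A * t)) * seqNorm 0 x := by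
  obtain ⟨φ, P, C, hP, hφ⟩ := exists_unit_cutoff
  obtain ⟨D, hD⟩ := exists_picard_bounds hP hj hκ hs
  refine ⟨4 * D, fun R => ?_⟩
  obtain ⟨M, hM, hb⟩ := hD (4 * D * R)
  obtain ⟨h1, h2⟩ := hb M le_rfl
  have hM0 : 0 < M := by linarith
  refine ⟨M, hM, fun x hx0 hxr hxR => ?_⟩
  have hxB : 4 * D * seqNorm 0 x ≤ (4 * D * R : ℝ≥0) := by push_cast; gcongr
  obtain ⟨U, mU, zU, bU, bUs, fU⟩ := exists_fixed_point hM hP hκ h1 h2 univ hx0 hxB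
  have bU' : ys j M 0 U < ⊤ := (bU.trans hxB).trans_lt ENNReal.coe_lt_top
  have nU := (nrm_modeNorm_le j M U).trans_lt bU'
  refine ⟨U, mU, zU, (ys_mono_scale j 0 hM U).trans_lt bU',
    ((ys_mono_scale j s hM U).trans bUs).trans (by push_cast; exact le_rfl),
    coeffSolution_of_fixed_point hP hφ hκ hM0 mU nU fU, fun t ht => ?_⟩
  have hN : ∀ N : ℕ, seqNorm 0 (ev U t) ≤ ENNReal.ofReal (Real.exp (A * t)) * seqNorm 0 x
      + 2 * ys j M 0 (fun ξ => U ξ - trunc (galerkinSet N) U ξ) := by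
    intro N
    obtain ⟨V, mV, zV, bV, -, fV⟩ := exists_fixed_point hM hP hκ h1 h2 (galerkinSet N) hx0 hxB
    have bV' : ys j M 0 V < ⊤ := (bV.trans hxB).trans_lt ENNReal.coe_lt_top
    have nV := (nrm_modeNorm_le j M V).trans_lt bV'
    have sV := coeffSolution_of_fixed_point hP hφ hκ hM0 mV nV fV
    have rV := sV.real hj hκ (galerkinSet_neg N) hxr mV zV
      ((ys_mono_scale j 0 hM V).trans_lt bV')
    have eV := galerkin_energy hA (continuous_forceCoeff hκ mV nV) sV rV ht
    have mT := measurable_trunc (galerkinSet N : Set ℤ) mU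
    have mp := measurable_picard (j := j) (κ := κ) hP M univ x mU
    have mp' := measurable_picard (j := j) (κ := κ) hP M univ x mV
    -- the error of the Galerkin approximation is controlled by the tail of the solution
    have hdiff : ys j M 0 (fun ξ => U ξ - V ξ)
        ≤ ys j M 0 (fun ξ => U ξ - trunc (galerkinSet N) U ξ)
          + 1 / 2 * ys j M 0 (fun ξ => U ξ - V ξ) := by
      have h3 := h2 univ (galerkinSet N) x U V mU mV zU zV (bU.trans hxB) (bV.trans hxB)
      refine le_trans ?_ (add_le_add_right h3 _)
      refine le_trans (ys_mono_ae j M 0 ?_) (ys_add_le j M 0 (mU.sub mT)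
        (measurable_trunc (galerkinSet N : Set ℤ) (mp.sub mp')))
      filter_upwards [fU, fV] with ξ e1 e2
      have e3 : V ξ = trunc (galerkinSet N) (picard P j M κ univ x V) ξ := by
        rw [e2]
        by_cases hk : ξ.1 ∈ (galerkinSet N : Set ℤ) <;> simp [picard, trunc, hk]
      have e4 : trunc (galerkinSet N) U ξ = trunc (galerkinSet N) (picard P j M κ univ x U) ξ := by
        by_cases hk : ξ.1 ∈ (galerkinSet N : Set ℤ)
        · simp only [trunc, hk, indicator_of_mem]; exact e1
        · simp [trunc, hk]
      rw [trunc_sub, ← e3, ← e4]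
      simp
    have hfin : ys j M 0 (fun ξ => U ξ - V ξ) ≠ ⊤ :=
      ((ys_sub_le j M 0 mU mV).trans_lt (ENNReal.add_lt_top.2 ⟨bU', bV'⟩)).ne
    have hdiff' : ys j M 0 (fun ξ => U ξ - V ξ)
        ≤ 2 * ys j M 0 (fun ξ => U ξ - trunc (galerkinSet N) U ξ) := by
      set a := ys j M 0 (fun ξ => U ξ - V ξ)
      set b := ys j M 0 (fun ξ => U ξ - trunc (galerkinSet N) U ξ)
      have h4 : 1 / 2 * a + 1 / 2 * a ≤ b + 1 / 2 * a := by
        rw [← add_mul, ENNReal.add_halves, one_mul]; exact hdiff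
      have h5 : 1 / 2 * a ≤ b := (ENNReal.add_le_add_iff_right (by finiteness)).1 h4
      calc a = 2 * (1 / 2 * a) := by
            rw [← mul_assoc, one_div, ENNReal.mul_inv_cancel (by norm_num) (by norm_num), one_mul]
        _ ≤ _ := by gcongr
    have e5 : ev U t = fun k => ev V t k + ev (fun ξ => U ξ - V ξ) t k := by
      ext k
      rw [ev_sub (integrable_of_ys mU bU' k) (integrable_of_ys mV bV' k)]; ring
    rw [e5]
    exact (seqNorm_zero_add_le _ _).trans
      (add_le_add eV ((seqNorm_ev_le j M 0 (mU.sub mV) t).trans hdiff'))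
  refine ge_of_tendsto' (x := atTop) ?_ hN
  have h6 := (ENNReal.Tendsto.const_mul (a := 2) (tendsto_ys_sub_trunc mU bU')
    (Or.inr (by norm_num))).const_add (ENNReal.ofReal (Real.exp (A * t)) * seqNorm 0 x)
  simpa using h6

/-- Global existence on the Fourier side, by repeated continuation. Consecutive local solutions
overlap, agree on the overlap by uniqueness, and are glued there with a cutoff. -/
theorem exists_global_solution {j : ℕ} (hj : 1 ≤ j) {κ : ℤ → ℤ → ℂ} (hκ : FeedbackMatrix κ) {s : ℝ}
    (hs : 0 ≤ s) {T : ℝ} (hT : 0 < T) (R : ℝ≥0) :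
    ∃ D : ℝ≥0, ∀ x : ℤ → ℂ, x 0 = 0 → (∀ k, x (-k) = (starRingEnd ℂ) (x k)) → seqNorm 0 x ≤ R →
      seqNorm s x < ⊤ →
      ∃ U : ℤ × ℝ → ℂ, Measurable U ∧ (∀ τ, U (0, τ) = 0) ∧
        ys j 1 s U ≤ D * seqNorm s x ∧ CoeffSolution j κ univ T x (ev U) := by
  obtain ⟨A, hA⟩ := hκ.bdd 0 le_rfl
  obtain ⟨D, hD⟩ := exists_local_solution hj hκ hs hA
  -- the step size serves all data that the exponential bound allows up to time `T + 1`
  obtain ⟨M, hM, hloc⟩ := hD ((Real.exp (A * (T + 1))).toNNReal * R)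
  have hM0 : 0 < M := by linarith
  set δ : ℝ := 1 / M with hδ
  have hδ0 : 0 < δ := by positivity
  have hδ1 : δ ≤ 1 := by rw [hδ, div_le_one hM0]; exact hM
  -- steps of length `δ / 2`, where a local solution exists for a time `δ`
  have key : ∀ n : ℕ, (n + 1) * (δ / 2) ≤ T + 1 → ∃ D' : ℝ≥0, ∀ x : ℤ → ℂ, x 0 = 0 →
      (∀ k, x (-k) = (starRingEnd ℂ) (x k)) → seqNorm 0 x ≤ R → seqNorm s x < ⊤ →
      ∃ U : ℤ × ℝ → ℂ, Measurable U ∧ (∀ τ, U (0, τ) = 0) ∧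
        ys j 1 s U ≤ D' * seqNorm s x ∧ CoeffSolution j κ univ ((n + 1) * (δ / 2)) x (ev U) ∧
        ∀ t ∈ Icc 0 ((n + 1) * (δ / 2)),
          seqNorm 0 (ev U t) ≤ ENNReal.ofReal (Real.exp (A * t)) * seqNorm 0 x := by
    have hexp : ∀ t, t ≤ T + 1 → ∀ x : ℤ → ℂ, seqNorm 0 x ≤ R →
        ENNReal.ofReal (Real.exp (A * t)) * seqNorm 0 x
          ≤ ((Real.exp (A * (T + 1))).toNNReal * R : ℝ≥0) := by
      intro t ht x hx
      rw [ENNReal.coe_mul]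
      change _ ≤ ENNReal.ofReal (Real.exp (A * (T + 1))) * _
      gcongr
    intro n
    induction n with
    | zero =>
      intro _
      refine ⟨D, fun x hx0 hxr hxR hxs => ?_⟩
      have hxR' := hexp 0 (by linarith) x hxR
      simp only [mul_zero, Real.exp_zero, ENNReal.ofReal_one, one_mul] at hxR'
      obtain ⟨U, mU, zU, -, bU, sU, eU⟩ := hloc x hx0 hxr hxR'
      have hle : ((0 : ℕ) + 1 : ℝ) * (δ / 2) ≤ δ := by push_cast; linarith
      exact ⟨U, mU, zU, bU, sU.mono hle, fun t ht => eU t ⟨ht.1, ht.2.trans hle⟩⟩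
    | succ n ih =>
      intro hn
      push_cast at hn
      set t₁ : ℝ := n * (δ / 2) with ht₁
      have ht₁0 : 0 ≤ t₁ := by positivity
      have hTn : (n + 1) * (δ / 2) = t₁ + δ / 2 := by rw [ht₁]; ring
      have hTn1 : (((n + 1 : ℕ) : ℝ) + 1) * (δ / 2) = t₁ + δ := by rw [ht₁]; push_cast; ring
      rw [hTn1]
      have hle : t₁ + δ / 2 ≤ T + 1 := by rw [← hTn]; linarith
      obtain ⟨D₁, hD₁⟩ := ih (by rw [hTn]; exact hle)
      -- The cutoff drops from `1` to `0` inside the overlap `[t₁, t₁ + δ/2]`.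
      obtain ⟨φ, ⟨P, C, hP⟩, hφ1, hφ0⟩ := exists_smooth_bump 0
        (show (0 : ℝ) < t₁ + δ / 8 by linarith) (show t₁ + δ / 8 < t₁ + δ / 2 by linarith)
      simp only [sub_zero] at hφ1 hφ0
      obtain ⟨E, hE⟩ := exists_ys_cut_le hP
      refine ⟨D * D₁ + E * (D₁ + D * D₁), fun x hx0 hxr hxR hxs => ?_⟩
      obtain ⟨U₁, m1, z1, b1, s1, e1⟩ := hD₁ x hx0 hxr hxR hxs
      rw [hTn] at s1 e1
      have f1 : ys j 1 0 U₁ < ⊤ :=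
        ((ys_zero_le j 1 hs U₁).trans b1).trans_lt (by finiteness)
      have n1 := (nrm_modeNorm_le j 1 U₁).trans_lt f1
      have ht₁m : t₁ ∈ Icc 0 (t₁ + δ / 2) := ⟨ht₁0, by linarith⟩
      set x₁ := ev U₁ t₁ with hx₁
      have hx₁0 : x₁ 0 = 0 := by simp [hx₁, ev, z1]
      have hx₁r : ∀ k, x₁ (-k) = (starRingEnd ℂ) (x₁ k) :=
        s1.real hj hκ (by simp) hxr m1 z1 f1 t₁ ht₁m
      have hx₁R := (e1 t₁ ht₁m).trans (hexp t₁ (by linarith) x hxR)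
      obtain ⟨V, mV, zV, fV, bV, sV, eV⟩ := hloc x₁ hx₁0 hx₁r hx₁R
      have hx₁s : seqNorm s x₁ ≤ D₁ * seqNorm s x := (seqNorm_ev_le j 1 s m1 t₁).trans b1
      set U₂ := tshift (-t₁) V with hU₂
      have m2 : Measurable U₂ := measurable_tshift _ mV
      have z2 : ∀ τ, U₂ (0, τ) = 0 := fun τ => by simp [hU₂, tshift, zV]
      have f2 : ys j 1 0 U₂ < ⊤ := by rw [hU₂, ys_tshift]; exact fV
      have b2 : ys j 1 s U₂ ≤ D * D₁ * seqNorm s x := by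
        rw [hU₂, ys_tshift, mul_assoc]
        exact bV.trans (by gcongr)
      have ev2 : ∀ t, ev U₂ (t₁ + t) = ev V t := by
        intro t; rw [hU₂, ev_tshift]; congr 1; ring
      -- the two solutions agree on the overlap
      have hover : ∀ t ∈ Icc 0 (δ / 2), ev U₁ (t₁ + t) = ev V t := by
        have sh := s1.shift (continuous_forceCoeff hκ m1 n1) ht₁0
        rw [add_sub_cancel_left] at sh
        simp only [← ev_tshift] at sh
        intro t ht
        rw [← ev_tshift]
        exact sh.unique hj hκ (measurable_tshift _ m1) mV (by simp [tshift, z1]) zV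
          (by rwa [ys_tshift]) fV (sV.mono (by linarith)) t ht
      set X : ℤ × ℝ → ℂ := fun ξ => U₁ ξ - U₂ ξ with hX
      have mX : Measurable X := m1.sub m2
      set W : ℤ × ℝ → ℂ := fun ξ => U₂ ξ + cut P 1 X ξ with hW
      have mcX : Measurable (cut P 1 X) := measurable_cut hP 1 mX
      have mW : Measurable W := m2.add mcX
      have i1 := fun k => integrable_of_ys m1 f1 k
      have i2 := fun k => integrable_of_ys m2 f2 k
      have evW : ∀ t k, ev W t k = ev U₂ t k + φ t * (ev U₁ t k - ev U₂ t k) := by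
        intro t k
        rw [hW, ev_add (i2 k) (integrable_cut hP one_pos ((i1 k).sub (i2 k))),
          ev_cut hP one_pos ((i1 k).sub (i2 k)), one_mul, ev_sub (i1 k) (i2 k)]
      have evW1 : ∀ t ∈ Icc 0 t₁, ev W t = ev U₁ t := by
        intro t ht; ext k
        rw [evW, hφ1 t (by rw [abs_of_nonneg ht.1]; linarith [ht.2])]; ring
      have evW2 : ∀ t ∈ Icc 0 δ, ev W (t₁ + t) = ev V t := by
        intro t ht; ext k
        rw [evW, ev2]
        rcases le_total t (δ / 2) with h | h
        · rw [hover t ⟨ht.1, h⟩]; ring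
        · rw [hφ0 _ (by rw [abs_of_nonneg (by linarith [ht.1])]; linarith)]; ring
      have bW : ys j 1 s W ≤ (D * D₁ + E * (D₁ + D * D₁) : ℝ≥0) * seqNorm s x := by
        refine (ys_add_le j 1 s m2 mcX).trans ?_
        calc _ ≤ D * D₁ * seqNorm s x + E * (D₁ * seqNorm s x + D * D₁ * seqNorm s x) := by
              refine add_le_add b2 ((hE j 1 s le_rfl X mX).trans ?_)
              gcongr
              exact (ys_sub_le j 1 s m1 m2).trans (add_le_add b1 b2)
          _ = _ := by push_cast; ring
      have fW : ys j 1 0 W < ⊤ := ((ys_zero_le j 1 hs W).trans bW).trans_lt (by finiteness)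
      refine ⟨W, mW, fun τ => ?_, bW, ?_, fun t ht => ?_⟩
      · simp only [hW, z2, zero_add]
        exact cut_zero_mode 1 (by simp [hX, z1, z2]) τ
      · refine CoeffSolution.concat (continuous_forceCoeff hκ mW ((nrm_modeNorm_le j 1 W).trans_lt fW))
          ht₁0 ((s1.mono (by linarith)).congr fun t ht => (evW1 t ht).symm) ?_
        rw [evW1 t₁ ⟨ht₁0, le_rfl⟩]
        exact sV.congr fun t ht => (evW2 t ht).symm
      · rcases le_total t t₁ with h | h
        · rw [evW1 t ⟨ht.1, h⟩]
          exact e1 t ⟨ht.1, by linarith⟩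
        · have h3 := evW2 (t - t₁) ⟨by linarith, by linarith [ht.2]⟩
          rw [add_sub_cancel] at h3
          rw [h3]
          refine (eV (t - t₁) ⟨by linarith, by linarith [ht.2]⟩).trans ?_
          refine (mul_le_mul_right (e1 t₁ ht₁m) _).trans (le_of_eq ?_)
          rw [← mul_assoc, ← ENNReal.ofReal_mul (Real.exp_pos _).le, ← Real.exp_add]
          congr 3
          ring
  have hn1 := Nat.le_ceil (T / (δ / 2))
  have hn2 := Nat.ceil_lt_add_one (show 0 ≤ T / (δ / 2) by positivity)
  set n := ⌈T / (δ / 2)⌉₊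
  rw [div_le_iff₀ (by positivity)] at hn1
  have h4 : (n : ℝ) * (δ / 2) < T + δ / 2 := by
    have := mul_lt_mul_of_pos_right hn2 (show 0 < δ / 2 by positivity)
    rwa [add_mul, div_mul_cancel₀ _ (by positivity), one_mul] at this
  obtain ⟨D', hD'⟩ := key n (by linarith)
  refine ⟨D', fun x hx0 hxr hxR hxs => ?_⟩
  obtain ⟨U, mU, zU, bU, sU, -⟩ := hD' x hx0 hxr hxR hxs
  exact ⟨U, mU, zU, bU, sU.mono (by linarith)⟩

/-! ### Fourier coefficients of square integrable functions -/

/-- The `k`-th Fourier coefficient, for the normalised measure, as a functional on `L²`. -/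
noncomputable def coef (k : ℤ) : L2 →L[ℂ] ℂ :=
  innerSL ℂ ((fourierBasis (T := 2 * Real.pi) : HilbertBasis ℤ ℂ L2) k)

lemma coef_eq_repr (k : ℤ) (f : L2) :
    coef k f = (fourierBasis (T := 2 * Real.pi)).repr f k := by
  rw [HilbertBasis.repr_apply_apply]; rfl

lemma coef_eq (k : ℤ) (f : L2) : coef k f = fourierCoeff f k := by
  rw [coef_eq_repr, fourierBasis_repr]

lemma hat_eq_coef (f : L2) (k : ℤ) : hat f k = (Real.sqrt (2 * Real.pi) : ℂ) * coef k f := by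
  rw [hat_eq, coef_eq]

lemma ext_coef {f h : L2} (H : ∀ k, coef k f = coef k h) : f = h := by
  apply (fourierBasis (T := 2 * Real.pi)).repr.injective
  ext k
  rw [← coef_eq_repr, ← coef_eq_repr, H]

/-- The exponential `e^{ilx}` as an element of `L²`. -/
noncomputable def expo (l : ℤ) : L2 := (fourierBasis (T := 2 * Real.pi) : HilbertBasis ℤ ℂ L2) l

lemma coef_expo (k l : ℤ) : coef k (expo l) = if k = l then 1 else 0 := by
  have h := (fourierBasis (T := 2 * Real.pi)).orthonormal
  rw [orthonormal_iff_ite] at h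
  exact h k l

lemma hasSum_coef (f : L2) : HasSum (fun l => coef l f • expo l) f := by
  simp only [coef_eq_repr]
  exact (fourierBasis (T := 2 * Real.pi)).hasSum_repr f

lemma coef_W (j : ℕ) (t : ℝ) (f : L2) (k : ℤ) : coef k (W j t f) = phase j t k * coef k f := by
  have h := hat_W j t f k
  rw [hat_eq_coef, hat_eq_coef] at h
  have hs : (Real.sqrt (2 * Real.pi) : ℂ) ≠ 0 := by
    exact_mod_cast (Real.sqrt_pos.2 Real.two_pi_pos).ne'
  refine mul_left_cancel₀ hs ?_
  rw [h]; ring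

lemma meanZero_iff (f : L2) : MeanZero f ↔ coef 0 f = 0 := by
  have hs : (Real.sqrt (2 * Real.pi) : ℂ) ≠ 0 := by
    exact_mod_cast (Real.sqrt_pos.2 Real.two_pi_pos).ne'
  have h := hat_eq_coef f 0
  simp only [hat, neg_zero, fourier_zero, one_mul] at h
  rw [MeanZero]
  constructor
  · intro h0
    rw [h0, mul_zero] at h
    exact (mul_eq_zero.1 h.symm).resolve_left hs
  · intro h0
    rw [h0, mul_zero] at h
    exact (mul_eq_zero.1 h).resolve_left (one_div_ne_zero hs)

lemma seqNorm_coef (f : L2) : seqNorm 0 (fun k => coef k f) = ‖f‖ₑ := by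
  have h1 : ‖f‖ ^ 2 = ∑' k, ‖coef k f‖ ^ 2 := by
    have h2 := lp.norm_rpow_eq_tsum (p := 2) (by norm_num) ((fourierBasis (T := 2 * Real.pi)).repr f)
    rw [LinearIsometryEquiv.norm_map] at h2
    simp only [← coef_eq_repr] at h2
    exact_mod_cast h2
  have h3 : Summable fun k => ‖coef k f‖ ^ 2 := by
    have h2 := lp.memℓp ((fourierBasis (T := 2 * Real.pi)).repr f)
    rw [memℓp_gen_iff (by norm_num)] at h2
    simp only [← coef_eq_repr] at h2
    exact_mod_cast h2
  have h4 : seqNorm 0 (fun k => coef k f) ^ 2 = ‖f‖ₑ ^ 2 := by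
    rw [seqNorm, nrm_count_sq, ← ofReal_norm, ← ENNReal.ofReal_pow (norm_nonneg _), h1,
      ENNReal.ofReal_tsum_of_nonneg (fun k => by positivity) h3]
    refine tsum_congr fun k => ?_
    rw [sobWt_zero, one_mul, ENNReal.ofReal_pow (norm_nonneg _), ofReal_norm]
  exact (ENNReal.pow_right_strictMono (by norm_num : (2 : ℕ) ≠ 0)).injective h4

lemma memlp_of_seqNorm {x : ℤ → ℂ} (h : seqNorm 0 x < ⊤) : Memℓp x 2 := by
  rw [memℓp_gen_iff (by norm_num)]
  have h1 : ∑' k, ‖x k‖ₑ ^ 2 ≠ ⊤ := by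
    have := (ENNReal.pow_lt_top (n := 2) h).ne
    rw [seqNorm, nrm_count_sq] at this
    simpa only [sobWt_zero, one_mul] using this
  have h2 : ∑' k, ENNReal.ofReal (‖x k‖ ^ 2) ≠ ⊤ := by
    simpa only [ENNReal.ofReal_pow (norm_nonneg _), ofReal_norm] using h1
  have h3 := ENNReal.summable_toReal h2
  simp only [ENNReal.toReal_ofReal (sq_nonneg _)] at h3
  exact_mod_cast h3

open Classical in
/-- The function with a given square summable sequence of Fourier coefficients (and `0` if the
sequence is not square summable). -/
noncomputable def synth (x : ℤ → ℂ) : L2 :=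
  if h : Memℓp x 2 then (fourierBasis (T := 2 * Real.pi)).repr.symm ⟨x, h⟩ else 0

lemma coef_synth {x : ℤ → ℂ} (h : seqNorm 0 x < ⊤) (k : ℤ) : coef k (synth x) = x k := by
  rw [synth, dif_pos (memlp_of_seqNorm h), coef_eq_repr, LinearIsometryEquiv.apply_symm_apply]

lemma seqNorm_mono {s s' : ℝ} (h : s ≤ s') (x : ℤ → ℂ) : seqNorm s x ≤ seqNorm s' x := by
  refine nrm_mono fun k => ?_
  unfold sobWt
  gcongr
  exact one_le_bracket _

lemma seqNorm_add_le (s : ℝ) (x y : ℤ → ℂ) :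
    seqNorm s (fun k => x k + y k) ≤ seqNorm s x + seqNorm s y := by
  refine le_trans (nrm_mono fun k => ?_) (nrm_add_le (measurable_of_countable _).aemeasurable
    (measurable_of_countable _).aemeasurable)
  rw [← mul_add]
  gcongr
  exact enorm_add_le _ _

lemma seqNorm_const_mul (s : ℝ) (c : ℂ) (x : ℤ → ℂ) :
    seqNorm s (fun k => c * x k) = ‖c‖ₑ * seqNorm s x := by
  rw [seqNorm, seqNorm, ← nrm_const_mul _ (measurable_of_countable _).aemeasurable]
  congr 1
  ext k
  rw [enorm_mul]; ring

/-! ### Operators as matrices -/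

/-- The matrix of an operator in the basis of exponentials. -/
noncomputable def mat (A : L2 →L[ℂ] L2) (k l : ℤ) : ℂ := coef k (A (expo l))

lemma hasSum_mat (A : L2 →L[ℂ] L2) (f : L2) (k : ℤ) :
    HasSum (fun l => mat A k l * coef l f) (coef k (A f)) := by
  have h := (((coef k).comp A).hasSum (hasSum_coef f))
  have e : (fun l => mat A k l * coef l f) = fun l => (coef k).comp A (coef l f • expo l) := by
    ext l
    rw [map_smul, smul_eq_mul, mul_comm]
    rfl
  rw [e]
  exact h

lemma ext_mat {A B : L2 →L[ℂ] L2} (h : ∀ k l, mat A k l = mat B k l) : A = B := by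
  ext1 f
  refine ext_coef fun k => (hasSum_mat A f k).unique ?_
  simp only [h]
  exact hasSum_mat B f k

lemma mat_adjoint (A : L2 →L[ℂ] L2) (k l : ℤ) :
    mat A.adjoint k l = (starRingEnd ℂ) (mat A l k) := by
  change inner ℂ (expo k) (A.adjoint (expo l)) = (starRingEnd ℂ) (inner ℂ (expo l) (A (expo k)))
  rw [ContinuousLinearMap.adjoint_inner_right, inner_conj_symm]

lemma nrm_row_lt_top (A : L2 →L[ℂ] L2) (k : ℤ) :
    nrm Measure.count (fun l => ‖mat A k l‖ₑ) < ⊤ := by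
  have h1 : ∀ l, ‖mat A k l‖ₑ = ‖coef l (A.adjoint (expo k))‖ₑ := by
    intro l
    have h2 := mat_adjoint A l k
    rw [mat] at h2
    rw [h2, ← ofReal_norm, ← ofReal_norm, RCLike.norm_conj]
  have h3 := seqNorm_coef (A.adjoint (expo k))
  simp only [seqNorm, sobWt_zero, one_mul] at h3
  simp only [h1, h3]
  exact enorm_lt_top

/-- Complex conjugation on `L²`, through its action on Fourier coefficients. -/
noncomputable def conjL2 (f : L2) : L2 := synth fun k => (starRingEnd ℂ) (coef (-k) f)

lemma coef_conjL2 (f : L2) (k : ℤ) : coef k (conjL2 f) = (starRingEnd ℂ) (coef (-k) f) := by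
  refine coef_synth ?_ k
  have h1 : seqNorm 0 (fun k => (starRingEnd ℂ) (coef (-k) f)) = seqNorm 0 fun k => coef k f := by
    rw [seqNorm, seqNorm, nrm_count_eq, nrm_count_eq, ← (Equiv.neg ℤ).tsum_eq]
    congr 1
    refine tsum_congr fun k => ?_
    simp only [sobWt_zero, one_mul, Equiv.neg_apply, neg_neg]
    rw [← ofReal_norm, ← ofReal_norm, RCLike.norm_conj]
  rw [h1, seqNorm_coef]
  exact enorm_lt_top

/-- Operators that commute with complex conjugation. -/
def IsRealOp (A : L2 →L[ℂ] L2) : Prop := ∀ f, A (conjL2 f) = conjL2 (A f)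

lemma isRealOp_of_mat {A : L2 →L[ℂ] L2}
    (h : ∀ k l, mat A (-k) (-l) = (starRingEnd ℂ) (mat A k l)) : IsRealOp A := by
  intro f
  refine ext_coef fun k => ?_
  rw [coef_conjL2]
  refine (hasSum_mat A (conjL2 f) k).unique ?_
  have h1 := (hasSum_mat A f (-k)).map (starRingEnd ℂ) Complex.continuous_conj
  rw [← (Equiv.neg ℤ).hasSum_iff] at h1
  have e : (fun l => mat A k l * coef l (conjL2 f))
      = ((starRingEnd ℂ) ∘ fun l => mat A (-k) l * coef l f) ∘ Equiv.neg ℤ := by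
    ext l
    have h2 := h k l
    simp only [Function.comp_apply, Equiv.neg_apply, map_mul, coef_conjL2, h2, Complex.conj_conj]
  rw [e]
  exact h1

lemma IsRealOp.mat_neg {A : L2 →L[ℂ] L2} (h : IsRealOp A) (k l : ℤ) :
    mat A (-k) (-l) = (starRingEnd ℂ) (mat A k l) := by
  have h1 : expo (-l) = conjL2 (expo l) := by
    refine ext_coef fun k => ?_
    rw [coef_conjL2, coef_expo, coef_expo]
    by_cases hk : k = -l
    · simp [hk]
    · have : -k ≠ l := fun h => hk (by omega)
      simp [hk, this]
  rw [mat, h1, h, coef_conjL2, neg_neg, mat]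

lemma IsRealOp.comp {A B : L2 →L[ℂ] L2} (hA : IsRealOp A) (hB : IsRealOp B) :
    IsRealOp (A.comp B) := fun f => by
  rw [ContinuousLinearMap.comp_apply, ContinuousLinearMap.comp_apply, hB, hA]

/-! ### Rapidly decaying sequences and smoothing matrices -/

/-- Sequences that decay faster than every power. -/
def RapidDecay (c : ℤ → ℂ) : Prop := ∀ n : ℕ, ∃ C : ℝ, ∀ k : ℤ, (1 + |(k : ℝ)|) ^ n * ‖c k‖ ≤ C

/-- The Fourier coefficients of a smooth periodic function decay rapidly, by repeated integration by
parts. -/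
lemma exists_bound_periodic_coeff (n : ℕ) : ∀ f : ℝ → ℂ, ContDiff ℝ ∞ f →
    Function.Periodic f (2 * Real.pi) → ∃ C : ℝ, ∀ k : ℤ,
      |(k : ℝ)| ^ n * ‖∫ x in (0 : ℝ)..2 * Real.pi, Complex.exp (-(Complex.I * k * x)) * f x‖ ≤ C := by
  have hexp : ∀ (k : ℤ) (x : ℝ), ‖Complex.exp (-(Complex.I * k * x))‖ = 1 := by
    intro k x
    have : -(Complex.I * k * x) = ((-(k * x) : ℝ) : ℂ) * Complex.I := by push_cast; ring
    rw [this, Complex.norm_exp_ofReal_mul_I]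
  induction n with
  | zero =>
    intro f hf hp
    obtain ⟨C, hC⟩ := (isCompact_Icc (a := (0 : ℝ)) (b := 2 * Real.pi)).exists_bound_of_continuousOn
      hf.continuous.continuousOn
    refine ⟨C * |2 * Real.pi - 0|, fun k => ?_⟩
    rw [pow_zero, one_mul]
    refine intervalIntegral.norm_integral_le_of_norm_le_const fun x hx => ?_
    rw [uIoc_of_le Real.two_pi_pos.le] at hx
    rw [norm_mul, hexp, one_mul]
    exact hC x ⟨hx.1.le, hx.2⟩
  | succ n ih =>
    intro f hf hp
    have hf' : ContDiff ℝ ∞ (deriv f) := hf.iterate_deriv 1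
    have hp' : Function.Periodic (deriv f) (2 * Real.pi) := by
      intro x
      rw [← deriv_comp_add_const]
      congr 1
      ext y
      exact hp y
    obtain ⟨C, hC⟩ := ih _ hf' hp'
    refine ⟨C, fun k => ?_⟩
    have hper : Complex.exp (-(Complex.I * k * (2 * Real.pi : ℝ))) = 1 := by
      rw [Complex.exp_eq_one_iff]
      exact ⟨-k, by push_cast; ring⟩
    have hd : ∀ x : ℝ, HasDerivAt (fun x : ℝ => Complex.exp (-(Complex.I * k * x)))
        (-(Complex.I * k) * Complex.exp (-(Complex.I * k * x))) x := by
      intro x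
      have h1 : HasDerivAt (fun x : ℝ => -(Complex.I * k * (x : ℂ))) (-(Complex.I * k)) x := by
        have := ((hasDerivAt_id x).ofReal_comp.const_mul (Complex.I * k)).neg
        rw [Complex.ofReal_one, mul_one] at this
        exact this
      exact h1.cexp.congr_deriv (mul_comm _ _)
    have h := intervalIntegral.integral_mul_deriv_eq_deriv_mul (a := 0) (b := 2 * Real.pi)
      (fun x _ => hd x) (fun x _ => (hf.differentiable (by simp) x).hasDerivAt)
      ((by fun_prop : Continuous fun x : ℝ =>
        -(Complex.I * k) * Complex.exp (-(Complex.I * k * x))).intervalIntegrable _ _)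
      (hf'.continuous.intervalIntegrable _ _)
    have h0 : f (2 * Real.pi) = f 0 := by simpa using hp 0
    rw [hper, h0] at h
    simp only [Complex.ofReal_zero, mul_zero, neg_zero, Complex.exp_zero, sub_self, zero_sub,
      mul_assoc (-(Complex.I * (k : ℂ)))] at h
    rw [intervalIntegral.integral_const_mul] at h
    have h2 := hC k
    rw [h, norm_neg, norm_mul, norm_neg, norm_mul, Complex.norm_I, one_mul, Complex.norm_intCast,
      ← mul_assoc, ← pow_succ] at h2
    exact h2

lemma rapidDecay_fourierCoeff (p : C(Torus, ℝ)) (hp : ContDiff ℝ ∞ (fun x : ℝ => p (x : Torus))) :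
    RapidDecay (fourierCoeff fun x => (p x : ℂ)) := by
  intro n
  have hf : ContDiff ℝ ∞ (fun x : ℝ => ((p (x : Torus) : ℝ) : ℂ)) :=
    Complex.ofRealCLM.contDiff.comp hp
  have hper : Function.Periodic (fun x : ℝ => ((p (x : Torus) : ℝ) : ℂ)) (2 * Real.pi) := by
    intro x
    simp only [AddCircle.coe_add_period]
  have hc : ∀ k, ‖fourierCoeff (fun x => (p x : ℂ)) k‖ ≤
      ‖∫ x in (0 : ℝ)..2 * Real.pi,
        Complex.exp (-(Complex.I * k * x)) * ((p (x : Torus) : ℝ) : ℂ)‖ := by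
    intro k
    rw [fourierCoeff_eq_intervalIntegral _ _ 0, norm_smul, zero_add]
    have h1 : ‖(1 / (2 * Real.pi) : ℝ)‖ ≤ 1 := by
      rw [Real.norm_of_nonneg (by positivity), div_le_one Real.two_pi_pos]
      linarith [Real.pi_gt_three]
    refine (mul_le_of_le_one_left (norm_nonneg _) h1).trans (le_of_eq ?_)
    congr 1
    refine intervalIntegral.integral_congr fun x _ => ?_
    simp only [fourier_coe_apply, smul_eq_mul]
    congr 2
    push_cast
    have : (Real.pi : ℂ) ≠ 0 := by exact_mod_cast Real.pi_ne_zero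
    field_simp
  obtain ⟨C₀, h0⟩ := exists_bound_periodic_coeff 0 _ hf hper
  obtain ⟨C₁, h1⟩ := exists_bound_periodic_coeff n _ hf hper
  refine ⟨2 ^ n * (C₀ + C₁), fun k => ?_⟩
  have h2 : (1 + |(k : ℝ)|) ^ n ≤ 2 ^ n * (1 + |(k : ℝ)| ^ n) := by
    rcases le_total |(k : ℝ)| 1 with h | h
    · calc (1 + |(k : ℝ)|) ^ n ≤ 2 ^ n := by gcongr; linarith
        _ ≤ _ := le_mul_of_one_le_right (by positivity) (by linarith [pow_nonneg (abs_nonneg (k : ℝ)) n])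
    · calc (1 + |(k : ℝ)|) ^ n ≤ (2 * |(k : ℝ)|) ^ n := by gcongr; linarith
        _ = 2 ^ n * |(k : ℝ)| ^ n := mul_pow _ _ _
        _ ≤ _ := by gcongr; linarith
  calc (1 + |(k : ℝ)|) ^ n * ‖fourierCoeff (fun x => (p x : ℂ)) k‖
      ≤ (2 ^ n * (1 + |(k : ℝ)| ^ n)) * _ := mul_le_mul h2 (hc k) (norm_nonneg _) (by positivity)
    _ ≤ _ := by
        have h3 := h0 k
        have h4 := h1 k
        rw [pow_zero, one_mul] at h3
        rw [mul_assoc, add_mul, one_mul]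
        gcongr

/-- Infinite matrices with rapid decay off the diagonal and decay of order `p` along it: the
corresponding operators gain `p` derivatives. -/
def Smoothing (p : ℕ) (A : ℤ → ℤ → ℂ) : Prop :=
  ∀ n : ℕ, ∃ C : ℝ, ∀ k l : ℤ, (1 + |((k - l : ℤ) : ℝ)|) ^ n * (1 + |(l : ℝ)|) ^ p * ‖A k l‖ ≤ C

lemma Smoothing.add {p : ℕ} {A B : ℤ → ℤ → ℂ} (hA : Smoothing p A) (hB : Smoothing p B) :
    Smoothing p fun k l => A k l + B k l := by
  intro n
  obtain ⟨C, hC⟩ := hA n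
  obtain ⟨D, hD⟩ := hB n
  refine ⟨C + D, fun k l => ?_⟩
  calc _ ≤ (1 + |((k - l : ℤ) : ℝ)|) ^ n * (1 + |(l : ℝ)|) ^ p * (‖A k l‖ + ‖B k l‖) := by
        gcongr
        exact norm_add_le _ _
    _ ≤ _ := by rw [mul_add]; exact add_le_add (hC k l) (hD k l)

lemma Smoothing.mono {p : ℕ} {A B : ℤ → ℤ → ℂ} {c : ℝ} (hA : Smoothing p A)
    (h : ∀ k l, ‖B k l‖ ≤ c * ‖A k l‖) (hc : 0 ≤ c) : Smoothing p B := by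
  intro n
  obtain ⟨C, hC⟩ := hA n
  refine ⟨c * C, fun k l => ?_⟩
  calc _ ≤ (1 + |((k - l : ℤ) : ℝ)|) ^ n * (1 + |(l : ℝ)|) ^ p * (c * ‖A k l‖) := by
        gcongr
        exact h k l
    _ = c * ((1 + |((k - l : ℤ) : ℝ)|) ^ n * (1 + |(l : ℝ)|) ^ p * ‖A k l‖) := by ring
    _ ≤ _ := by gcongr; exact hC k l

lemma RapidDecay.smoothing {c : ℤ → ℂ} (hc : RapidDecay c) : Smoothing 0 fun k l => c (k - l) := by
  intro n
  obtain ⟨C, hC⟩ := hc n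
  exact ⟨C, fun k l => by simpa using hC (k - l)⟩

lemma RapidDecay.smoothing_mul {c d : ℤ → ℂ} (hc : RapidDecay c) (hd : RapidDecay d) (p : ℕ) :
    Smoothing p fun k l => c k * d (-l) := by
  intro n
  obtain ⟨C, hC⟩ := hc n
  obtain ⟨D, hD⟩ := hd (n + p)
  have hC0 : 0 ≤ C := le_trans (by positivity) (hC 0)
  refine ⟨C * D, fun k l => ?_⟩
  have h1 : (1 + |((k - l : ℤ) : ℝ)|) ^ n ≤ (1 + |(k : ℝ)|) ^ n * (1 + |(l : ℝ)|) ^ n := by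
    rw [← mul_pow]
    gcongr
    push_cast
    nlinarith [abs_sub (k : ℝ) l, abs_nonneg (k : ℝ), abs_nonneg (l : ℝ)]
  have h2 := hD (-l)
  rw [Int.cast_neg, abs_neg] at h2
  calc _ ≤ ((1 + |(k : ℝ)|) ^ n * (1 + |(l : ℝ)|) ^ n) * (1 + |(l : ℝ)|) ^ p * ‖c k * d (-l)‖ := by
        gcongr
    _ = ((1 + |(k : ℝ)|) ^ n * ‖c k‖) * ((1 + |(l : ℝ)|) ^ (n + p) * ‖d (-l)‖) := by
        rw [norm_mul]; ring
    _ ≤ _ := mul_le_mul (hC k) h2 (by positivity) hC0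

/-- Peetre's inequality: the weights at `k` and `l` differ at most by a power of `|k - l|`. -/
lemma bracket_rpow_le {r : ℝ} (hr : 0 ≤ r) (k l : ℤ) :
    bracket k ^ r ≤ (2 * (1 + |((k - l : ℤ) : ℝ)|)) ^ r * bracket l ^ r := by
  have hb := one_le_bracket (l : ℝ)
  rw [← Real.mul_rpow (by positivity) (by linarith)]
  have h1 : bracket k ≤ 2 * (1 + |((k - l : ℤ) : ℝ)|) * bracket l := by
    have h2 := bracket_add_le ((k - l : ℤ) : ℝ) l
    have h3 := bracket_le ((k - l : ℤ) : ℝ)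
    rw [show ((k - l : ℤ) : ℝ) + l = k by push_cast; ring] at h2
    nlinarith [abs_nonneg ((k - l : ℤ) : ℝ)]
  exact Real.rpow_le_rpow (by linarith [one_le_bracket (k : ℝ)]) h1 hr

lemma tsum_inv_one_add_abs_sq_lt_top :
    ∑' n : ℤ, ENNReal.ofReal ((1 + |(n : ℝ)|) ^ 2)⁻¹ < ⊤ := by
  have h1 : Summable fun n : ℤ => ((1 + |(n : ℝ)|) ^ 2)⁻¹ := by
    refine Summable.of_nat_of_neg ?_ ?_ <;>
    · have h2 := (summable_nat_add_iff 1).2 (Real.summable_nat_pow_inv.2 (by norm_num : 1 < 2))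
      refine h2.congr fun n => ?_
      simp [add_comm]
  rw [← ENNReal.ofReal_tsum_of_nonneg (fun n => by positivity) h1]
  exact ENNReal.ofReal_lt_top

/-- A matrix of `Smoothing p` maps `H^s` to `H^{s+p}`. -/
lemma Smoothing.exists_bound {p : ℕ} {A : ℤ → ℤ → ℂ} (hA : Smoothing p A) {s : ℝ}
    (hs : 0 ≤ s + p) : ∃ C : ℝ≥0, ∀ x : ℤ → ℂ,
      seqNorm (s + p) (fun k => ∑' l, A k l * x l) ≤ C * seqNorm s x := by
  obtain ⟨N, hN⟩ := exists_nat_ge (s + p)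
  obtain ⟨C, hC⟩ := hA (N + 2)
  have hC0 : 0 ≤ C := le_trans (by positivity) (hC 0 0)
  set q : ℤ → ℝ≥0∞ := fun n => ENNReal.ofReal ((1 + |(n : ℝ)|) ^ 2)⁻¹ with hq
  have hkey : ∀ k l, sobWt (s + p) k * ‖A k l‖ₑ
      ≤ ENNReal.ofReal (2 ^ (s + p) * C) * (q (k - l) * sobWt s l) := by
    intro k l
    rw [sobWt, sobWt, hq, ← ofReal_norm,
      ← ENNReal.ofReal_mul (Real.rpow_nonneg (zero_le_one.trans (one_le_bracket _)) _),
      ← ENNReal.ofReal_mul (by positivity), ← ENNReal.ofReal_mul (by positivity)]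
    refine ENNReal.ofReal_le_ofReal ?_
    set d := 1 + |((k - l : ℤ) : ℝ)| with hd
    have hd1 : 1 ≤ d := by rw [hd]; linarith [abs_nonneg ((k - l : ℤ) : ℝ)]
    have hb := one_le_bracket (l : ℝ)
    have hbl : bracket l ^ (s + p) ≤ bracket l ^ s * (1 + |(l : ℝ)|) ^ p := by
      rw [Real.rpow_add (by linarith), Real.rpow_natCast]
      gcongr
      exact bracket_le _
    have hdN : d ^ (s + p) ≤ d ^ N := by
      rw [← Real.rpow_natCast]
      exact Real.rpow_le_rpow_of_exponent_le hd1 hN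
    have h1 := bracket_rpow_le hs k l
    rw [← hd, Real.mul_rpow (by norm_num) (by linarith)] at h1
    calc bracket k ^ (s + p) * ‖A k l‖
        ≤ (2 ^ (s + p) * d ^ N * (bracket l ^ s * (1 + |(l : ℝ)|) ^ p)) * ‖A k l‖ := by
          refine mul_le_mul_of_nonneg_right (h1.trans ?_) (norm_nonneg _)
          gcongr
      _ = 2 ^ (s + p) * ((d ^ (N + 2) * (1 + |(l : ℝ)|) ^ p * ‖A k l‖) * ((d ^ 2)⁻¹
            * bracket l ^ s)) := by
          field_simp
          ring
      _ ≤ 2 ^ (s + p) * (C * ((d ^ 2)⁻¹ * bracket l ^ s)) := by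
          gcongr
          exact hC k l
      _ = _ := by ring
  refine ⟨(ENNReal.ofReal (2 ^ (s + p) * C) * ∑' n, q n).toNNReal, fun x => ?_⟩
  rw [ENNReal.coe_toNNReal (ENNReal.mul_lt_top ENNReal.ofReal_lt_top
    tsum_inv_one_add_abs_sq_lt_top).ne, mul_assoc]
  have h2 : ∀ k, sobWt (s + p) k * ‖∑' l, A k l * x l‖ₑ
      ≤ ENNReal.ofReal (2 ^ (s + p) * C) * ∑' l, q l * (sobWt s (k - l) * ‖x (k - l)‖ₑ) := by
    intro k
    calc _ ≤ sobWt (s + p) k * ∑' l, ‖A k l * x l‖ₑ := by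
          gcongr
          exact enorm_tsum_le_tsum_enorm
      _ = ∑' l, sobWt (s + p) k * ‖A k l‖ₑ * ‖x l‖ₑ := by
          rw [← ENNReal.tsum_mul_left]
          simp only [enorm_mul, mul_assoc]
      _ ≤ ∑' l, ENNReal.ofReal (2 ^ (s + p) * C) * (q (k - l) * sobWt s l) * ‖x l‖ₑ :=
          ENNReal.tsum_le_tsum fun l => mul_le_mul_left (hkey k l) _
      _ = _ := by
          rw [← ENNReal.tsum_mul_left, ← (Equiv.subLeft k).tsum_eq]
          refine tsum_congr fun l => ?_
          simp only [Equiv.subLeft_apply, sub_sub_cancel]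
          ring
  refine (nrm_mono h2).trans ?_
  rw [nrm_const_mul _ (measurable_of_countable _).aemeasurable]
  gcongr
  exact nrm_count_conv_le q fun l => sobWt s l * ‖x l‖ₑ

/-! ### The matrix of the localised feedback -/

/-- The Fourier coefficients, for the normalised measure, of a real function. -/
noncomputable def gc (p : C(Torus, ℝ)) (k : ℤ) : ℂ := fourierCoeff (fun x => (p x : ℂ)) k

lemma gc_neg (p : C(Torus, ℝ)) (k : ℤ) : gc p (-k) = (starRingEnd ℂ) (gc p k) := by
  rw [gc, gc, fourierCoeff, fourierCoeff, ← integral_conj]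
  refine integral_congr_ae (Eventually.of_forall fun x => ?_)
  simp only [neg_neg, smul_eq_mul, map_mul, Complex.conj_ofReal, ← fourier_neg]

lemma coef_congr {f : L2} {h : Torus → ℂ} (H : f =ᵐ[AddCircle.haarAddCircle] h) (k : ℤ) :
    coef k f = fourierCoeff h k := by
  rw [coef_eq, fourierCoeff, fourierCoeff]
  refine integral_congr_ae ?_
  filter_upwards [H] with x hx
  rw [hx]

lemma coeFn_expo (l : ℤ) : expo l =ᵐ[AddCircle.haarAddCircle] fun x : Torus => fourier l x := by
  rw [expo, coe_fourierBasis]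
  exact coeFn_fourierLp 2 l

lemma fourierCoeff_mul_fourier (p : C(Torus, ℝ)) (l k : ℤ) :
    fourierCoeff (fun x => (p x : ℂ) * fourier l x) k = gc p (k - l) := by
  rw [gc, fourierCoeff, fourierCoeff]
  refine integral_congr_ae (Eventually.of_forall fun x => ?_)
  simp only [smul_eq_mul]
  rw [show -(k - l) = -k + l by ring, fourier_add]
  ring

lemma integral_mul_fourier (p : C(Torus, ℝ)) (l : ℤ) :
    ∫ x : Torus, (p x : ℂ) * fourier l x = 2 * Real.pi * gc p (-l) := by
  rw [← zero_sub, ← fourierCoeff_mul_fourier, fourierCoeff, AddCircle.integral_haarAddCircle,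
    Complex.real_smul]
  have : (Real.pi : ℂ) ≠ 0 := by exact_mod_cast Real.pi_ne_zero
  push_cast
  rw [← mul_assoc, mul_inv_cancel₀ (mul_ne_zero two_ne_zero this), one_mul]
  simp

lemma integral_ofReal_eq_gc (p : C(Torus, ℝ)) : ∫ x : Torus, (p x : ℂ) = 2 * Real.pi * gc p 0 := by
  simpa using integral_mul_fourier p 0

lemma integrable_continuous_torus {f : Torus → ℂ} (hf : Continuous f) (μ : Measure Torus)
    [IsFiniteMeasure μ] : Integrable f μ :=
  hf.integrable_of_hasCompactSupport (HasCompactSupport.of_compactSpace f)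

lemma fourierCoeff_sub_of_continuous {f h : Torus → ℂ} (hf : Continuous f) (hh : Continuous h)
    (k : ℤ) : fourierCoeff (fun x => f x - h x) k = fourierCoeff f k - fourierCoeff h k := by
  rw [fourierCoeff, fourierCoeff, fourierCoeff, ← integral_sub]
  · simp only [smul_sub]
  · exact integrable_continuous_torus (by fun_prop) _
  · exact integrable_continuous_torus (by fun_prop) _

lemma fourierCoeff_const_mul (f : Torus → ℂ) (c : ℂ) (k : ℤ) :
    fourierCoeff (fun x => c * f x) k = c * fourierCoeff f k := by
  rw [fourierCoeff, fourierCoeff, ← integral_const_mul]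
  simp only [smul_eq_mul, mul_left_comm]

lemma coeFn_G_of_ae (g : C(Torus, ℝ)) {f : L2} {h : Torus → ℂ}
    (H : f =ᵐ[AddCircle.haarAddCircle] h) :
    G g f =ᵐ[AddCircle.haarAddCircle]
      fun x => (g x : ℂ) * (h x - ∫ y : Torus, (g y : ℂ) * h y) := by
  have h1 : ∫ y : Torus, (g y : ℂ) * f y = ∫ y : Torus, (g y : ℂ) * h y := by
    refine integral_congr_ae ?_
    filter_upwards [ae_volume_of_haar H] with y hy
    rw [hy]
  filter_upwards [coeFn_G g f, H] with x hx hx'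
  rw [hx, hx', h1]

lemma mat_G (g : C(Torus, ℝ)) (k l : ℤ) :
    mat (G g) k l = gc g (k - l) - 2 * Real.pi * gc g (-l) * gc g k := by
  rw [mat, coef_congr (coeFn_G_of_ae g (coeFn_expo l)), integral_mul_fourier,
    ← fourierCoeff_mul_fourier]
  have e : (fun x : Torus => (g x : ℂ) * (fourier l x - 2 * Real.pi * gc g (-l)))
      = fun x : Torus => (g x : ℂ) * fourier l x - 2 * Real.pi * gc g (-l) * (g x : ℂ) := by
    ext x
    ring
  rw [e, fourierCoeff_sub_of_continuous (by fun_prop) (by fun_prop), fourierCoeff_const_mul]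
  rfl

lemma G_adjoint (g : C(Torus, ℝ)) : (G g).adjoint = G g := by
  refine ext_mat fun k l => ?_
  rw [mat_adjoint, mat_G, mat_G]
  have h2 : (starRingEnd ℂ) (2 * (Real.pi : ℂ)) = 2 * Real.pi := by
    rw [← Complex.ofReal_ofNat, ← Complex.ofReal_mul, Complex.conj_ofReal]
  simp only [map_sub, map_mul, ← gc_neg, neg_sub, neg_neg]
  rw [← map_mul, h2]
  ring

lemma gc_zero {g : C(Torus, ℝ)} (h : ∫ x : Torus, g x = 1) : 2 * Real.pi * gc g 0 = 1 := by
  rw [← integral_ofReal_eq_gc, integral_complex_ofReal, h, Complex.ofReal_one]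

lemma mat_G_zero {g : C(Torus, ℝ)} (h : ∫ x : Torus, g x = 1) (l : ℤ) : mat (G g) 0 l = 0 := by
  have := gc_zero h
  rw [mat_G, zero_sub]
  linear_combination -gc g (-l) * this

/-- The operator `G G^*`. -/
noncomputable def GG (g : C(Torus, ℝ)) : L2 →L[ℂ] L2 := (G g).comp (G g).adjoint

lemma GG_apply (g : C(Torus, ℝ)) (f : L2) : GG g f = G g (G g f) := by
  rw [GG, G_adjoint]; rfl

lemma coef_zero_G {g : C(Torus, ℝ)} (h : ∫ x : Torus, g x = 1) (f : L2) : coef 0 (G g f) = 0 := by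
  refine (hasSum_mat (G g) f 0).unique ?_
  simp only [mat_G_zero h, zero_mul]
  exact hasSum_zero

lemma mat_GG (g : C(Torus, ℝ)) (k l : ℤ) :
    mat (GG g) k l = gc (g * g) (k - l)
      + (-(2 * Real.pi) * (gc (g * g) k * gc g (-l))
        + -(2 * Real.pi) * (gc g k * (gc (g * g) (-l)
          - 2 * Real.pi * gc (g * g) 0 * gc g (-l)))) := by
  have h1 : ∫ y : Torus, (g y : ℂ) * ((g y : ℂ) * (fourier l y - 2 * Real.pi * gc g (-l)))
      = 2 * Real.pi * (gc (g * g) (-l) - 2 * Real.pi * gc (g * g) 0 * gc g (-l)) := by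
    rw [mul_sub (2 * (Real.pi : ℂ)), ← integral_mul_fourier (g * g)]
    have e : 2 * (Real.pi : ℂ) * (2 * Real.pi * gc (g * g) 0 * gc g (-l))
        = ∫ y : Torus, 2 * Real.pi * gc g (-l) * ((g * g) y : ℝ) := by
      rw [integral_const_mul, integral_ofReal_eq_gc]; ring
    rw [e, ← integral_sub (integrable_continuous_torus (by fun_prop) _)
      (integrable_continuous_torus (by fun_prop) _)]
    congr 1
    ext y
    simp only [ContinuousMap.mul_apply, Complex.ofReal_mul]
    ring
  rw [mat, GG_apply, coef_congr (coeFn_G_of_ae g (coeFn_G_of_ae g (coeFn_expo l))),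
    integral_mul_fourier, h1]
  have e1 := fourierCoeff_mul_fourier (g * g) l k
  rw [← e1]
  have e2 : (fun x : Torus => (g x : ℂ) * ((g x : ℂ) * (fourier l x - 2 * Real.pi * gc g (-l))
      - 2 * Real.pi * (gc (g * g) (-l) - 2 * Real.pi * gc (g * g) 0 * gc g (-l))))
      = fun x => (((g * g) x : ℝ) * fourier l x - 2 * Real.pi * gc g (-l) * ((g * g) x : ℝ))
        - 2 * Real.pi * (gc (g * g) (-l) - 2 * Real.pi * gc (g * g) 0 * gc g (-l)) * (g x : ℂ) := by
    ext x
    simp only [ContinuousMap.mul_apply, Complex.ofReal_mul]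
    ring
  rw [e2, fourierCoeff_sub_of_continuous (by fun_prop) (by fun_prop),
    fourierCoeff_sub_of_continuous (by fun_prop) (by fun_prop), fourierCoeff_const_mul,
    fourierCoeff_const_mul]
  change _ - _ * gc (g * g) k - _ * gc g k = _
  ring

lemma isRealOp_G (g : C(Torus, ℝ)) : IsRealOp (G g) := by
  refine isRealOp_of_mat fun k l => ?_
  have h2 : (starRingEnd ℂ) (2 * (Real.pi : ℂ)) = 2 * Real.pi := by
    rw [← Complex.ofReal_ofNat, ← Complex.ofReal_mul, Complex.conj_ofReal]
  rw [mat_G, mat_G, map_sub, map_mul, map_mul, h2, ← gc_neg, ← gc_neg, ← gc_neg, neg_sub_neg,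
    neg_sub, neg_neg]

lemma isRealOp_GG (g : C(Torus, ℝ)) : IsRealOp (GG g) := by
  rw [GG, G_adjoint]
  exact (isRealOp_G g).comp (isRealOp_G g)

lemma gc_rapidDecay {g : C(Torus, ℝ)} (hg : ContDiff ℝ ∞ (fun x : ℝ => g (x : Torus))) :
    RapidDecay (gc g) := rapidDecay_fourierCoeff g hg

lemma RapidDecay.add {c d : ℤ → ℂ} (hc : RapidDecay c) (hd : RapidDecay d) :
    RapidDecay fun k => c k + d k := by
  intro n
  obtain ⟨C, hC⟩ := hc n
  obtain ⟨D, hD⟩ := hd n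
  refine ⟨C + D, fun k => ?_⟩
  calc _ ≤ (1 + |(k : ℝ)|) ^ n * (‖c k‖ + ‖d k‖) := by gcongr; exact norm_add_le _ _
    _ ≤ _ := by rw [mul_add]; exact add_le_add (hC k) (hD k)

lemma RapidDecay.const_mul {c : ℤ → ℂ} (hc : RapidDecay c) (a : ℂ) :
    RapidDecay fun k => a * c k := by
  intro n
  obtain ⟨C, hC⟩ := hc n
  refine ⟨‖a‖ * C, fun k => ?_⟩
  rw [norm_mul, mul_left_comm]
  exact mul_le_mul_of_nonneg_left (hC k) (norm_nonneg _)

/-- The part of the matrix of `G G^*` coming from the rank one terms of `G`. -/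
noncomputable def rankPart (g : C(Torus, ℝ)) (k l : ℤ) : ℂ :=
  mat (GG g) k l - gc (g * g) (k - l)

lemma smoothing_rankPart {g : C(Torus, ℝ)} (hg : ContDiff ℝ ∞ (fun x : ℝ => g (x : Torus)))
    (p : ℕ) : Smoothing p (rankPart g) := by
  have h1 := gc_rapidDecay hg
  have h2 : RapidDecay (gc (g * g)) := gc_rapidDecay (hg.mul hg)
  have h3 := (h2.const_mul (-(2 * Real.pi))).smoothing_mul h1 p
  have h4 := (h1.const_mul (-(2 * Real.pi))).smoothing_mul
    (h2.add (h1.const_mul (-(2 * Real.pi * gc (g * g) 0)))) p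
  have h5 := h3.add h4
  refine h5.mono (c := 1) (fun k l => ?_) zero_le_one
  rw [one_mul, rankPart, mat_GG, add_sub_cancel_left]
  refine le_of_eq (congrArg norm ?_)
  ring

lemma smoothing_GG {g : C(Torus, ℝ)} (hg : ContDiff ℝ ∞ (fun x : ℝ => g (x : Torus))) :
    Smoothing 0 (mat (GG g)) := by
  have h2 : RapidDecay (gc (g * g)) := gc_rapidDecay (hg.mul hg)
  have h := h2.smoothing.add (smoothing_rankPart hg 0)
  have e : mat (GG g) = fun k l => gc (g * g) (k - l) + rankPart g k l := by
    ext k l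
    rw [rankPart]; ring
  rw [e]
  exact h

/-- The mean of `g²`, which is the limit of the diagonal of `G G^*`, is positive. -/
lemma gc_sq_zero_pos {g : C(Torus, ℝ)} (h : ∫ x : Torus, g x = 1) :
    ∃ a : ℝ, 0 < a ∧ gc (g * g) 0 = a := by
  refine ⟨(2 * Real.pi)⁻¹ * ∫ x : Torus, (g * g) x, ?_, ?_⟩
  · refine mul_pos (by positivity) ?_
    have h0 : ∃ x, g x ≠ 0 := by
      by_contra! h'
      simp [h'] at h
    obtain ⟨x, hx⟩ := h0
    refine Continuous.integral_pos_of_hasCompactSupport_nonneg_nonzero (x := x) (by fun_prop)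
      (HasCompactSupport.of_compactSpace _) (fun y => ?_) ?_
    · simp only [ContinuousMap.mul_apply]
      exact mul_self_nonneg _
    · simp only [ContinuousMap.mul_apply]
      exact (mul_self_pos.2 hx).ne'
  · have h1 := integral_ofReal_eq_gc (g * g)
    rw [integral_complex_ofReal] at h1
    have : (Real.pi : ℂ) ≠ 0 := by exact_mod_cast Real.pi_ne_zero
    rw [Complex.ofReal_mul, h1]
    push_cast
    field_simp

/-- No exponential other than the constants is annihilated by `G`: otherwise the coefficients of `g`
would have constant modulus along an arithmetic progression. -/
lemma G_expo_ne_zero {g : C(Torus, ℝ)} (hg : ContDiff ℝ ∞ (fun x : ℝ => g (x : Torus)))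
    (h : ∫ x : Torus, g x = 1) {l : ℤ} (hl : l ≠ 0) : G g (expo l) ≠ 0 := by
  intro h0
  have h1 : ∀ k, gc g (k - l) = 2 * Real.pi * gc g (-l) * gc g k := by
    intro k
    have := mat_G g k l
    rw [mat, h0, map_zero] at this
    exact (sub_eq_zero.1 this.symm)
  have hn : ∀ k, ‖gc g (-k)‖ = ‖gc g k‖ := fun k => by rw [gc_neg, RCLike.norm_conj]
  have hz := gc_zero h
  have h2 : ‖2 * Real.pi * gc g (-l)‖ = 1 := by
    have h3 := h1 l
    rw [sub_self] at h3
    have h4 : (2 * Real.pi * gc g (-l)) * (2 * Real.pi * gc g l) = 1 := by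
      rw [← hz, h3]; ring
    have h5 := congrArg norm h4
    rw [norm_mul, norm_one, norm_mul _ (gc g l), ← hn l, ← norm_mul] at h5
    nlinarith [norm_nonneg (2 * Real.pi * gc g (-l))]
  have h3 : ∀ n : ℕ, ‖gc g (-(n * l))‖ = ‖gc g 0‖ := by
    intro n
    induction n with
    | zero => simp
    | succ n ih =>
      rw [show -(((n + 1 : ℕ) : ℤ) * l) = -(n * l) - l by push_cast; ring, h1, norm_mul, h2, ih,
        one_mul]
  have h4 : 0 < ‖gc g 0‖ := by
    rw [norm_pos_iff]
    intro h5
    rw [h5, mul_zero] at hz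
    exact zero_ne_one hz
  obtain ⟨C, hC⟩ := gc_rapidDecay hg 1
  obtain ⟨n, hn'⟩ := exists_nat_gt (C / ‖gc g 0‖)
  have h5 := hC (-(n * l))
  rw [h3, pow_one] at h5
  rw [div_lt_iff₀ h4] at hn'
  have h6 : (n : ℝ) ≤ 1 + |((-(n * l) : ℤ) : ℝ)| := by
    have h7 : (1 : ℝ) ≤ |(l : ℝ)| := by exact_mod_cast Int.one_le_abs hl
    push_cast
    rw [abs_neg, abs_mul, Nat.abs_cast]
    nlinarith [(Nat.cast_nonneg n : (0 : ℝ) ≤ n)]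
  nlinarith

/-! ### The weighted Gramian of the unitary group -/

lemma norm_W (j : ℕ) (t : ℝ) (f : L2) : ‖W j t f‖ = ‖f‖ :=
  LinearIsometry.norm_map ((fourierBasis (T := 2 * Real.pi)).repr.symm.toLinearIsometry.comp
    ((phaseMul j t).comp (fourierBasis (T := 2 * Real.pi)).repr.toLinearIsometry)) f

lemma W_expo (j : ℕ) (t : ℝ) (l : ℤ) : W j t (expo l) = phase j t l • expo l := by
  refine ext_coef fun k => ?_
  rw [coef_W, map_smul, smul_eq_mul, coef_expo]
  by_cases h : k = l
  · rw [h]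
  · simp [h]

lemma continuous_W (j : ℕ) (f : L2) : Continuous fun t => W j t f := by
  have h1 : TendstoUniformly (fun (s : Finset ℤ) (t : ℝ) => W j t (∑ l ∈ s, coef l f • expo l))
      (fun t => W j t f) atTop := by
    rw [Metric.tendstoUniformly_iff]
    intro ε hε
    filter_upwards [Metric.tendsto_nhds.1 (hasSum_coef f) ε hε] with s hs t
    rw [dist_eq_norm, ← map_sub, norm_W, ← dist_eq_norm, dist_comm]
    simpa using hs
  refine h1.continuous (Frequently.of_forall fun s => ?_)
  simp only [map_sum, map_smul, W_expo]
  refine continuous_finsetSum _ fun l _ => ?_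
  have := continuous_phase j l
  fun_prop

lemma continuous_W_apply (j : ℕ) {f : ℝ → L2} (hf : Continuous f) :
    Continuous fun t => W j t (f t) := by
  rw [continuous_iff_continuousAt]
  intro t₀
  have h1 : Tendsto (fun t => W j t (f t - f t₀)) (𝓝 t₀) (𝓝 0) := by
    rw [tendsto_zero_iff_norm_tendsto_zero]
    simp only [norm_W]
    exact tendsto_iff_norm_sub_tendsto_zero.1 hf.continuousAt
  have h2 := h1.add ((continuous_W j (f t₀)).tendsto t₀)
  simpa [ContinuousAt] using h2

lemma conj_phase (j : ℕ) (t : ℝ) (k : ℤ) : (starRingEnd ℂ) (phase j t k) = phase j (-t) k := by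
  rw [phase, phase, ← Complex.exp_conj]
  simp

lemma W_adjoint (j : ℕ) (t : ℝ) : (W j t).adjoint = W j (-t) := by
  refine ext_mat fun k l => ?_
  rw [mat_adjoint, mat, mat, W_expo, W_expo, (coef l).map_smul, (coef k).map_smul, smul_eq_mul,
    smul_eq_mul, coef_expo, coef_expo, map_mul, conj_phase]
  by_cases h : k = l
  · simp [h]
  · simp [h, Ne.symm h]

lemma continuous_gram_integrand (j : ℕ) (g : C(Torus, ℝ)) (lam : ℝ) (f : L2) :
    Continuous fun τ : ℝ => (Real.exp (-2 * lam * τ) : ℂ) • W j (-τ) (GG g (W j τ f)) := by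
  have h1 : Continuous fun τ : ℝ => W j τ (GG g (W j (-τ) f)) :=
    continuous_W_apply j ((GG g).continuous.comp ((continuous_W j f).comp continuous_neg))
  have h2 := h1.comp continuous_neg
  simp only [Function.comp_def, neg_neg] at h2
  fun_prop

/-- The operator `∫_0^1 e^{-2 lam τ} W(-τ) G G^* W(τ) dτ`. -/
noncomputable def gram (j : ℕ) (g : C(Torus, ℝ)) {lam : ℝ} (hlam : 0 ≤ lam) : L2 →L[ℂ] L2 :=
  LinearMap.mkContinuous
    { toFun := fun f => ∫ τ in (0 : ℝ)..1,
        (Real.exp (-2 * lam * τ) : ℂ) • W j (-τ) (GG g (W j τ f))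
      map_add' := fun f h => by
        rw [← intervalIntegral.integral_add
          ((continuous_gram_integrand j g lam f).intervalIntegrable _ _)
          ((continuous_gram_integrand j g lam h).intervalIntegrable _ _)]
        simp only [map_add, smul_add]
      map_smul' := fun c f => by
        rw [RingHom.id_apply, ← intervalIntegral.integral_smul]
        simp only [map_smul, smul_comm c] }
    ‖GG g‖ (fun f => by
      refine (intervalIntegral.norm_integral_le_of_norm_le_const (C := ‖GG g‖ * ‖f‖)
        fun τ hτ => ?_).trans_eq (by simp)
      rw [uIoc_of_le zero_le_one] at hτ
      have h1 : ‖(Real.exp (-2 * lam * τ) : ℂ)‖ ≤ 1 := by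
        rw [Complex.norm_real, Real.norm_of_nonneg (Real.exp_pos _).le, Real.exp_le_one_iff]
        nlinarith [mul_nonneg hlam hτ.1.le]
      rw [norm_smul, norm_W]
      refine (mul_le_of_le_one_left (norm_nonneg _) h1).trans ?_
      refine ((GG g).le_opNorm _).trans_eq ?_
      rw [norm_W])

lemma gram_apply (j : ℕ) (g : C(Torus, ℝ)) {lam : ℝ} (hlam : 0 ≤ lam) (f : L2) :
    gram j g hlam f = ∫ τ in (0 : ℝ)..1,
      (Real.exp (-2 * lam * τ) : ℂ) • W j (-τ) (GG g (W j τ f)) := rfl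

lemma L_eq_gram (j : ℕ) (g : C(Torus, ℝ)) {lam : ℝ} (hlam : 0 ≤ lam) (h0 : lam ≠ 0) (f : L2) :
    L j g lam f = gram j g hlam f := by
  rw [L, if_neg h0, gram_apply]
  simp only [W_adjoint, neg_neg]
  rfl

/-- The Fourier multiplier entering the matrix of the Gramian. -/
noncomputable def gramWt (j : ℕ) (lam : ℝ) (k l : ℤ) : ℂ :=
  ∫ τ in (0 : ℝ)..1, (Real.exp (-2 * lam * τ) : ℂ) * (phase j (-τ) k * phase j τ l)

lemma mat_gram (j : ℕ) (g : C(Torus, ℝ)) {lam : ℝ} (hlam : 0 ≤ lam) (k l : ℤ) :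
    mat (gram j g hlam) k l = mat (GG g) k l * gramWt j lam k l := by
  rw [mat, gram_apply, ← ContinuousLinearMap.intervalIntegral_comp_comm _
    ((continuous_gram_integrand j g lam _).intervalIntegrable _ _), gramWt,
    ← intervalIntegral.integral_const_mul]
  refine intervalIntegral.integral_congr fun τ _ => ?_
  simp only [map_smul, coef_W, W_expo, smul_eq_mul]
  rw [mat]
  ring

lemma gramWt_eq (j : ℕ) (lam : ℝ) (k l : ℤ) : gramWt j lam k l
    = ∫ τ in (0 : ℝ)..1,
      Complex.exp ((-2 * lam - Complex.I * (k ^ (2 * j + 1) - l ^ (2 * j + 1))) * τ) := by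
  refine intervalIntegral.integral_congr fun τ _ => ?_
  simp only [phase]
  rw [Complex.ofReal_exp, ← Complex.exp_add, ← Complex.exp_add]
  congr 1
  push_cast
  ring

lemma gramWt_self (j : ℕ) (lam : ℝ) (k : ℤ) : gramWt j lam k k = gramWt j lam 0 0 := by
  simp only [gramWt_eq, sub_self]

lemma gramWt_zero_pos (j : ℕ) (lam : ℝ) : ∃ c : ℝ, 0 < c ∧ gramWt j lam 0 0 = c := by
  refine ⟨∫ τ in (0 : ℝ)..1, Real.exp (-2 * lam * τ), ?_, ?_⟩
  · exact intervalIntegral.intervalIntegral_pos_of_pos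
      ((by fun_prop : Continuous fun τ : ℝ => Real.exp (-2 * lam * τ)).intervalIntegrable _ _)
      (fun τ => Real.exp_pos _) zero_lt_one
  · rw [← intervalIntegral.integral_ofReal]
    simp [gramWt, phase]

lemma gramWt_neg (j : ℕ) (lam : ℝ) (k l : ℤ) :
    gramWt j lam (-k) (-l) = (starRingEnd ℂ) (gramWt j lam k l) := by
  rw [gramWt, gramWt, intervalIntegral.integral_of_le zero_le_one,
    intervalIntegral.integral_of_le zero_le_one, ← integral_conj]
  refine integral_congr_ae (Eventually.of_forall fun τ => ?_)
  simp only [map_mul, Complex.conj_ofReal, phase_neg_int]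

lemma add_one_pow_sub_ge {m : ℕ} (hm : 2 ≤ m) {q : ℤ} (hq : 0 ≤ q) :
    q + 1 ≤ (q + 1) ^ m - q ^ m := by
  obtain ⟨n, rfl⟩ : ∃ n, m = n + 2 := ⟨m - 2, by omega⟩
  have h1 : q ^ (n + 1) ≤ (q + 1) ^ (n + 1) := pow_le_pow_left₀ hq (by omega) _
  have h2 : 1 ≤ (q + 1) ^ n := one_le_pow₀ (by omega)
  have h3 := mul_le_mul_of_nonneg_left h1 hq
  have h4 : q + 1 ≤ (q + 1) ^ (n + 1) := by
    rw [pow_succ]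
    exact le_mul_of_one_le_left (by omega) h2
  have e1 : (q + 1) ^ (n + 2) = q * (q + 1) ^ (n + 1) + (q + 1) ^ (n + 1) := by ring
  have e2 : q ^ (n + 2) = q * q ^ (n + 1) := by ring
  rw [e1, e2]
  linarith

/-- Gap condition for the dispersion relation. -/
lemma one_add_abs_le_gap {j : ℕ} (hj : 1 ≤ j) {k l : ℤ} (h : k ≠ l) :
    1 + |l| ≤ 2 * |k ^ (2 * j + 1) - l ^ (2 * j + 1)| := by
  have hodd : Odd (2 * j + 1) := ⟨j, rfl⟩
  have hstep : ∀ l : ℤ, 1 + |l| ≤ 2 * ((l + 1) ^ (2 * j + 1) - l ^ (2 * j + 1)) := by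
    intro l
    rcases le_or_gt 0 l with h0 | h0
    · have := add_one_pow_sub_ge (m := 2 * j + 1) (by omega) h0
      rw [abs_of_nonneg h0]
      linarith
    · have := add_one_pow_sub_ge (m := 2 * j + 1) (by omega) (q := -(l + 1)) (by omega)
      rw [hodd.neg_pow, show -(l + 1) + 1 = -l by ring, hodd.neg_pow] at this
      rw [abs_of_neg h0]
      linarith
  have hmono : StrictMono fun x : ℤ => x ^ (2 * j + 1) := hodd.strictMono_pow
  rcases lt_or_gt_of_ne h with h1 | h1
  · have h2 := hstep (-l)
    rw [show -l + 1 = -(l - 1) by ring, hodd.neg_pow, hodd.neg_pow, abs_neg] at h2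
    have h3 : k ^ (2 * j + 1) ≤ (l - 1) ^ (2 * j + 1) := hmono.monotone (by omega)
    have h4 := neg_abs_le (k ^ (2 * j + 1) - l ^ (2 * j + 1))
    linarith
  · have h2 := hstep l
    have h3 : (l + 1) ^ (2 * j + 1) ≤ k ^ (2 * j + 1) := hmono.monotone (by omega)
    have h4 := le_abs_self (k ^ (2 * j + 1) - l ^ (2 * j + 1))
    linarith

lemma norm_gramWt_le {j : ℕ} (hj : 1 ≤ j) {lam : ℝ} (hlam : 0 ≤ lam) {k l : ℤ} (h : k ≠ l) :
    (1 + |(l : ℝ)|) * ‖gramWt j lam k l‖ ≤ 4 := by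
  set w : ℝ := ((k ^ (2 * j + 1) - l ^ (2 * j + 1) : ℤ) : ℝ) with hw
  have h1 : 1 + |(l : ℝ)| ≤ 2 * |w| := by
    rw [hw]; exact_mod_cast one_add_abs_le_gap hj h
  have hc : (-2 * lam - Complex.I * (k ^ (2 * j + 1) - l ^ (2 * j + 1)) : ℂ)
      = (-2 * lam : ℝ) - Complex.I * w := by
    rw [hw]; push_cast; ring
  have h2 : |w| ≤ ‖((-2 * lam : ℝ) - Complex.I * w : ℂ)‖ := by
    refine le_trans (le_of_eq ?_) (Complex.abs_im_le_norm _)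
    simp
  have hw0 : 0 < |w| := by linarith [abs_nonneg (l : ℝ)]
  have hne : ((-2 * lam : ℝ) - Complex.I * w : ℂ) ≠ 0 := norm_pos_iff.1 (hw0.trans_le h2)
  rw [gramWt_eq, hc, integral_exp_mul_complex hne, norm_div]
  have h3 : ‖Complex.exp (((-2 * lam : ℝ) - Complex.I * w) * (1 : ℝ))
      - Complex.exp (((-2 * lam : ℝ) - Complex.I * w) * (0 : ℝ))‖ ≤ 2 := by
    refine (norm_sub_le _ _).trans ?_
    have h4 : ‖Complex.exp (((-2 * lam : ℝ) - Complex.I * w) * (1 : ℝ))‖ ≤ 1 := by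
      rw [Complex.norm_exp, Real.exp_le_one_iff]
      simp
      linarith
    have h5 : ‖Complex.exp (((-2 * lam : ℝ) - Complex.I * w) * (0 : ℝ))‖ = 1 := by simp
    linarith
  have hd : 0 < ‖((-2 * lam : ℝ) - Complex.I * w : ℂ)‖ := hw0.trans_le h2
  calc _ ≤ (2 * ‖((-2 * lam : ℝ) - Complex.I * w : ℂ)‖)
        * (2 / ‖((-2 * lam : ℝ) - Complex.I * w : ℂ)‖) := by
        gcongr
        linarith
    _ = 4 := by rw [mul_div_assoc', mul_right_comm, mul_div_cancel_right₀ _ hd.ne']; norm_num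

/-- If the Gramian annihilates `f`, then `G` annihilates the orbit of `f` over `[0,1]`. -/
lemma G_W_eq_zero_of_gram {j : ℕ} {g : C(Torus, ℝ)} {lam : ℝ} (hlam : 0 ≤ lam) {f : L2}
    (h : gram j g hlam f = 0) : ∀ τ ∈ Icc (0 : ℝ) 1, G g (W j τ f) = 0 := by
  by_contra! hc
  obtain ⟨τ₀, hτ₀, hne⟩ := hc
  have hcont : Continuous fun τ : ℝ => Real.exp (-2 * lam * τ) * ‖G g (W j τ f)‖ ^ 2 := by
    have := (G g).continuous.comp (continuous_W j f)
    simp only [Function.comp_def] at this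
    fun_prop
  have hpos : 0 < ∫ τ in (0 : ℝ)..1, Real.exp (-2 * lam * τ) * ‖G g (W j τ f)‖ ^ 2 := by
    refine intervalIntegral.integral_pos zero_lt_one hcont.continuousOn
      (fun τ _ => by positivity) ⟨τ₀, hτ₀, ?_⟩
    have := norm_pos_iff.2 hne
    positivity
  have h1 : ⟪f, gram j g hlam f⟫_ℂ
      = ((∫ τ in (0 : ℝ)..1, Real.exp (-2 * lam * τ) * ‖G g (W j τ f)‖ ^ 2 : ℝ) : ℂ) := by
    rw [← intervalIntegral.integral_ofReal]
    refine (((innerSL ℂ f).intervalIntegral_comp_comm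
      ((continuous_gram_integrand j g lam f).intervalIntegrable _ _)).symm).trans ?_
    refine intervalIntegral.integral_congr fun τ _ => ?_
    have h2 : ⟪f, W j (-τ) (GG g (W j τ f))⟫_ℂ = (‖G g (W j τ f)‖ : ℂ) ^ 2 := by
      rw [← W_adjoint, ContinuousLinearMap.adjoint_inner_right, GG_apply]
      nth_rewrite 1 [← G_adjoint]
      rw [ContinuousLinearMap.adjoint_inner_right, inner_self_eq_norm_sq_to_K]
      rfl
    simp only [innerSL_apply_apply, inner_smul_right, h2]
    push_cast
    rfl
  rw [h, inner_zero_right] at h1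
  exact hpos.ne (by exact_mod_cast h1)

/-! ### Compactness of smoothing operators -/

lemma coef_eq_tsum_mat (A : L2 →L[ℂ] L2) (f : L2) :
    (fun k => coef k (A f)) = fun k => ∑' l, mat A k l * coef l f := by
  ext k
  exact (hasSum_mat A f k).tsum_eq.symm

/-- The orthogonal projection to the frequencies `|l| ≤ n`. -/
noncomputable def lowFreq (n : ℕ) : L2 →L[ℂ] L2 :=
  ∑ l ∈ Finset.Icc (-n : ℤ) n, (coef l).smulRight (expo l)

lemma coef_lowFreq (n : ℕ) (f : L2) (k : ℤ) :
    coef k (lowFreq n f) = if k ∈ Finset.Icc (-n : ℤ) n then coef k f else 0 := by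
  simp only [lowFreq, sum_apply, ContinuousLinearMap.smulRight_apply, map_sum,
    map_smul, smul_eq_mul, coef_expo, mul_ite, mul_one, mul_zero, Finset.sum_ite_eq]

lemma isCompactOperator_comp_lowFreq (A : L2 →L[ℂ] L2) (n : ℕ) :
    IsCompactOperator (A.comp (lowFreq n)) := by
  have h : A.comp (lowFreq n) = ∑ l ∈ Finset.Icc (-n : ℤ) n, (coef l).smulRight (A (expo l)) := by
    ext1 f
    simp [lowFreq]
  rw [h]
  refine Finset.sum_induction _ (fun T : L2 →L[ℂ] L2 => IsCompactOperator T)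
    (fun S T hS hT => hS.add hT) isCompactOperator_zero fun l _ => ?_
  have h1 : IsCompactOperator (id : ℂ → ℂ) := isCompactOperator_id
  exact (h1.clm_comp (ContinuousLinearMap.toSpanSingleton ℂ (A (expo l)))).comp_clm (coef l)

lemma Smoothing.isCompactOperator {A : L2 →L[ℂ] L2} (hA : Smoothing 1 (mat A)) :
    IsCompactOperator A := by
  obtain ⟨C, hC⟩ := hA.exists_bound (s := -1) (by norm_num)
  refine isCompactOperator_of_tendsto (l := atTop) (F := fun n : ℕ => A.comp (lowFreq n)) ?_
    (Eventually.of_forall (isCompactOperator_comp_lowFreq A))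
  rw [tendsto_iff_norm_sub_tendsto_zero]
  have hlim : Tendsto (fun n : ℕ => (C : ℝ) * (1 / ((n : ℝ) + 1))) atTop (𝓝 0) := by
    simpa using tendsto_one_div_add_atTop_nhds_zero_nat.const_mul (C : ℝ)
  refine squeeze_zero (fun _ => norm_nonneg _) (fun n => ?_) hlim
  refine ContinuousLinearMap.opNorm_le_bound _ (by positivity) fun f => ?_
  have h1 : (A.comp (lowFreq n) - A) f = A (lowFreq n f - f) := by simp
  have h2 : ‖A (lowFreq n f - f)‖ₑ ≤ C * seqNorm (-1) fun k => coef k (lowFreq n f - f) := by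
    have := hC fun k => coef k (lowFreq n f - f)
    rwa [← coef_eq_tsum_mat, Nat.cast_one, neg_add_cancel, seqNorm_coef] at this
  have h3 : seqNorm (-1) (fun k => coef k (lowFreq n f - f))
      ≤ ENNReal.ofReal (1 / ((n : ℝ) + 1)) * ‖f‖ₑ := by
    rw [← seqNorm_coef f, seqNorm, seqNorm,
      ← nrm_const_mul _ (measurable_of_countable _).aemeasurable]
    refine nrm_mono fun k => ?_
    rw [map_sub, coef_lowFreq, sobWt_zero, one_mul]
    split_ifs with hk
    · simp
    · rw [zero_sub, enorm_neg]
      gcongr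
      refine ENNReal.ofReal_le_ofReal ?_
      rw [Real.rpow_neg_one, one_div]
      have h4 : (n : ℝ) + 1 ≤ |(k : ℝ)| := by
        have h5 : ¬ |k| ≤ n := by
          rwa [abs_le, ← Finset.mem_Icc]
        have h6 : (n : ℤ) + 1 ≤ |k| := by omega
        exact_mod_cast h6
      gcongr
      exact h4.trans (abs_le_bracket _)
  have h4 : ‖A (lowFreq n f - f)‖ₑ ≤ ENNReal.ofReal (C * (1 / ((n : ℝ) + 1)) * ‖f‖) := by
    refine (h2.trans (mul_le_mul_right h3 _)).trans_eq ?_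
    rw [← ofReal_norm f, ← ENNReal.ofReal_mul (by positivity), ← ENNReal.ofReal_coe_nnreal,
      ← ENNReal.ofReal_mul (by positivity), mul_assoc]
  rw [← ofReal_norm, ENNReal.ofReal_le_ofReal_iff (by positivity)] at h4
  rw [h1]
  exact h4

/-! ### Invertibility of the Gramian -/

/-- The orthogonal projection to the constants. -/
noncomputable def constProj : L2 →L[ℂ] L2 := (coef 0).smulRight (expo 0)

lemma coef_constProj (f : L2) (k : ℤ) : coef k (constProj f) = if k = 0 then coef 0 f else 0 := by
  simp [constProj, coef_expo]

/-- The Gramian, completed by the identity on constants (which it annihilates). -/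
noncomputable def fullGram (j : ℕ) (g : C(Torus, ℝ)) {lam : ℝ} (hlam : 0 ≤ lam) : L2 →L[ℂ] L2 :=
  gram j g hlam + constProj

lemma mat_fullGram (j : ℕ) (g : C(Torus, ℝ)) {lam : ℝ} (hlam : 0 ≤ lam) (k l : ℤ) :
    mat (fullGram j g hlam) k l
      = mat (GG g) k l * gramWt j lam k l + if k = 0 ∧ l = 0 then 1 else 0 := by
  rw [← mat_gram j g hlam, mat, fullGram, add_apply, map_add, coef_constProj,
    coef_expo, mat]
  by_cases hk : k = 0 <;> by_cases hl : l = 0 <;> simp [hk, hl, eq_comm]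

/-- The constant `c > 0` such that the Gramian is a compact perturbation of `c`. -/
noncomputable def gramConst (j : ℕ) (g : C(Torus, ℝ)) (lam : ℝ) : ℂ :=
  gc (g * g) 0 * gramWt j lam 0 0

lemma gramConst_ne_zero (j : ℕ) {g : C(Torus, ℝ)} (h : ∫ x : Torus, g x = 1) (lam : ℝ) :
    gramConst j g lam ≠ 0 := by
  obtain ⟨a, ha, ha'⟩ := gc_sq_zero_pos h
  obtain ⟨c, hc, hc'⟩ := gramWt_zero_pos j lam
  rw [gramConst, ha', hc']
  exact_mod_cast (mul_pos ha hc).ne'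

/-- The compact part of the completed Gramian. -/
noncomputable def gramRem (j : ℕ) (g : C(Torus, ℝ)) {lam : ℝ} (hlam : 0 ≤ lam) : L2 →L[ℂ] L2 :=
  fullGram j g hlam - gramConst j g lam • ContinuousLinearMap.id ℂ L2

lemma fullGram_apply (j : ℕ) (g : C(Torus, ℝ)) {lam : ℝ} (hlam : 0 ≤ lam) (f : L2) :
    fullGram j g hlam f = gramConst j g lam • f + gramRem j g hlam f := by
  simp [gramRem]

/-- Off the diagonal the oscillation of the phases gains a derivative, and on the diagonal only the
rank one terms of `G` remain. -/
lemma smoothing_gramRem {j : ℕ} (hj : 1 ≤ j) {g : C(Torus, ℝ)}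
    (hg : ContDiff ℝ ∞ (fun x : ℝ => g (x : Torus))) {lam : ℝ} (hlam : 0 ≤ lam) :
    Smoothing 1 (mat (gramRem j g hlam)) := by
  have hm : ∀ k l, mat (gramRem j g hlam) k l = mat (GG g) k l * gramWt j lam k l
      + (if k = 0 ∧ l = 0 then 1 else 0) - gramConst j g lam * if k = l then 1 else 0 := by
    intro k l
    rw [← mat_fullGram j g hlam, mat, gramRem, sub_apply, map_sub,
      smul_apply, map_smul, ContinuousLinearMap.id_apply, coef_expo,
      smul_eq_mul, mat]
  intro n
  obtain ⟨C, hC⟩ := smoothing_GG hg n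
  obtain ⟨D, hD⟩ := smoothing_rankPart hg 1 n
  have hC0 : 0 ≤ C := le_trans (by positivity) (hC 0 0)
  have hD0 : 0 ≤ D := le_trans (by positivity) (hD 0 0)
  refine ⟨C * 4 + (D * ‖gramWt j lam 0 0‖ + 1), fun k l => ?_⟩
  rw [hm]
  by_cases h : k = l
  · subst h
    have h1 := hD k k
    simp only [sub_self, Int.cast_zero, abs_zero, add_zero, one_pow, one_mul, pow_one,
      and_self, if_true, mul_one] at h1 ⊢
    have e : mat (GG g) k k * gramWt j lam k k + (if k = 0 then 1 else 0) - gramConst j g lam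
        = rankPart g k k * gramWt j lam 0 0 + if k = 0 then 1 else 0 := by
      rw [gramWt_self j lam k, rankPart, gramConst, sub_self]; ring
    rw [e]
    have h2 : (1 + |(k : ℝ)|) * ‖(if k = 0 then 1 else 0 : ℂ)‖ ≤ 1 := by
      split_ifs with h0 <;> simp [h0]
    calc _ ≤ (1 + |(k : ℝ)|) * (‖rankPart g k k‖ * ‖gramWt j lam 0 0‖
          + ‖(if k = 0 then 1 else 0 : ℂ)‖) := by
          gcongr
          exact (norm_add_le _ _).trans_eq (by rw [norm_mul])
      _ = ((1 + |(k : ℝ)|) * ‖rankPart g k k‖) * ‖gramWt j lam 0 0‖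
          + (1 + |(k : ℝ)|) * ‖(if k = 0 then 1 else 0 : ℂ)‖ := by ring
      _ ≤ D * ‖gramWt j lam 0 0‖ + 1 := by gcongr
      _ ≤ _ := by linarith
  · have h0 : ¬ (k = 0 ∧ l = 0) := fun h' => h (h'.1.trans h'.2.symm)
    have h1 := hC k l
    have h2 := norm_gramWt_le hj hlam h
    rw [pow_zero, mul_one] at h1
    rw [if_neg h0, if_neg h, mul_zero, add_zero, sub_zero, norm_mul, pow_one]
    calc _ = ((1 + |((k - l : ℤ) : ℝ)|) ^ n * ‖mat (GG g) k l‖)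
          * ((1 + |(l : ℝ)|) * ‖gramWt j lam k l‖) := by ring
      _ ≤ C * 4 := by gcongr
      _ ≤ _ := by have : 0 ≤ D * ‖gramWt j lam 0 0‖ + 1 := by positivity
                  linarith

lemma coef_zero_gram (j : ℕ) {g : C(Torus, ℝ)} (h : ∫ x : Torus, g x = 1) {lam : ℝ}
    (hlam : 0 ≤ lam) (f : L2) : coef 0 (gram j g hlam f) = 0 := by
  refine (hasSum_mat _ f 0).unique ?_
  have h0 : ∀ l, mat (GG g) 0 l = 0 := fun l => by
    rw [mat, GG_apply, coef_zero_G h]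
  simp only [mat_gram, h0, zero_mul]
  exact hasSum_zero

lemma coef_zero_fullGram (j : ℕ) {g : C(Torus, ℝ)} (h : ∫ x : Torus, g x = 1) {lam : ℝ}
    (hlam : 0 ≤ lam) (f : L2) : coef 0 (fullGram j g hlam f) = coef 0 f := by
  rw [fullGram, add_apply, map_add, coef_zero_gram j h hlam, coef_constProj,
    if_pos rfl, zero_add]

lemma mem_ker_fullGram_iff (j : ℕ) {g : C(Torus, ℝ)} (h : ∫ x : Torus, g x = 1) {lam : ℝ}
    (hlam : 0 ≤ lam) (f : L2) : fullGram j g hlam f = 0 ↔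
      coef 0 f = 0 ∧ ∀ τ ∈ Icc (0 : ℝ) 1, G g (W j τ f) = 0 := by
  constructor
  · intro h1
    have h0 : coef 0 f = 0 := by rw [← coef_zero_fullGram j h hlam, h1, map_zero]
    refine ⟨h0, G_W_eq_zero_of_gram hlam ?_⟩
    rw [fullGram, add_apply, constProj] at h1
    simpa [h0] using h1
  · rintro ⟨h0, h1⟩
    rw [fullGram, add_apply, constProj]
    have h2 : gram j g hlam f = 0 := by
      rw [gram_apply]
      refine (intervalIntegral.integral_congr (g := fun _ => (0 : L2)) fun τ hτ => ?_).trans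
        (by simp)
      rw [uIcc_of_le zero_le_one] at hτ
      simp only [GG_apply, h1 τ hτ, map_zero, smul_zero]
    simp [h2, h0]

/-- Elements of the kernel are smooth, because they are reproduced by the compact part. -/
lemma seqNorm_lt_top_of_fullGram {j : ℕ} (hj : 1 ≤ j) {g : C(Torus, ℝ)}
    (hg : ContDiff ℝ ∞ (fun x : ℝ => g (x : Torus))) (h : ∫ x : Torus, g x = 1) {lam : ℝ}
    (hlam : 0 ≤ lam) {f : L2} (hf : fullGram j g hlam f = 0) (n : ℕ) :
    seqNorm n (fun k => coef k f) < ⊤ := by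
  induction n with
  | zero =>
    rw [Nat.cast_zero, seqNorm_coef]
    exact enorm_lt_top
  | succ n ih =>
    obtain ⟨C, hC⟩ := (smoothing_gramRem hj hg hlam).exists_bound (s := n) (by positivity)
    have h1 : (fun k => coef k f) = fun k => -(gramConst j g lam)⁻¹ * coef k (gramRem j g hlam f) := by
      ext k
      have h2 := congrArg (coef k) (fullGram_apply j g hlam f)
      rw [hf, map_zero, map_add, map_smul, smul_eq_mul] at h2
      have h3 := gramConst_ne_zero j h lam
      rw [eq_comm, add_eq_zero_iff_eq_neg] at h2
      field_simp
      rw [mul_comm, h2]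
    rw [h1, seqNorm_const_mul, coef_eq_tsum_mat]
    have h2 := hC fun k => coef k f
    push_cast at h2 ⊢
    exact ENNReal.mul_lt_top enorm_lt_top (h2.trans_lt (ENNReal.mul_lt_top ENNReal.coe_lt_top ih))

/-- The operator `f ↦ ∑ k^{2j+1} f_k e^{ikx}` (with junk values off its domain). -/
noncomputable def dispOp (j : ℕ) (f : L2) : L2 := synth fun k => (k : ℂ) ^ (2 * j + 1) * coef k f

lemma coef_dispOp {j : ℕ} {f : L2} (hf : seqNorm ((2 * j + 1 : ℕ) : ℝ) (fun k => coef k f) < ⊤)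
    (k : ℤ) : coef k (dispOp j f) = (k : ℂ) ^ (2 * j + 1) * coef k f := by
  refine coef_synth (lt_of_le_of_lt (nrm_mono fun k => ?_) hf) k
  rw [sobWt_zero, one_mul, enorm_mul, sobWt]
  gcongr
  rw [← ofReal_norm, norm_pow, Complex.norm_intCast, Real.rpow_natCast]
  exact ENNReal.ofReal_le_ofReal (pow_le_pow_left₀ (abs_nonneg _) (abs_le_bracket _) _)

/-- On the domain of the generator the group is differentiable in `L²`, being the primitive of a
continuous function. -/
lemma hasDerivAt_W {j : ℕ} {f : L2} (hf : seqNorm ((2 * j + 1 : ℕ) : ℝ) (fun k => coef k f) < ⊤)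
    (t : ℝ) : HasDerivAt (fun τ => W j τ f) (W j t (Complex.I • dispOp j f)) t := by
  have hcont := continuous_W j (Complex.I • dispOp j f)
  have h1 : ∀ τ : ℝ, W j τ f = f + ∫ r in (0 : ℝ)..τ, W j r (Complex.I • dispOp j f) := by
    intro τ
    refine ext_coef fun k => ?_
    rw [map_add, ← ContinuousLinearMap.intervalIntegral_comp_comm _
      (hcont.intervalIntegrable _ _)]
    simp only [coef_W, (coef k).map_smul, coef_dispOp hf, smul_eq_mul]
    have hd : ∀ r ∈ uIcc 0 τ, HasDerivAt (fun r : ℝ => phase j r k * coef k f)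
        (phase j r k * (Complex.I * ((k : ℂ) ^ (2 * j + 1) * coef k f))) r := by
      intro r _
      have h2 : HasDerivAt (fun r : ℝ => Complex.I * (r : ℂ) * (k : ℂ) ^ (2 * j + 1))
          (Complex.I * (k : ℂ) ^ (2 * j + 1)) r := by
        have := ((hasDerivAt_id r).ofReal_comp.const_mul Complex.I).mul_const
          ((k : ℂ) ^ (2 * j + 1))
        rw [Complex.ofReal_one, mul_one] at this
        exact this
      refine (h2.cexp.mul_const (coef k f)).congr_deriv ?_
      rw [phase]; ring
    have hc := continuous_phase j k
    rw [intervalIntegral.integral_eq_sub_of_hasDerivAt hd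
      ((by fun_prop : Continuous fun r : ℝ => phase j r k *
        (Complex.I * ((k : ℂ) ^ (2 * j + 1) * coef k f))).intervalIntegrable _ _)]
    simp only [phase_zero, one_mul]
    ring
  have h2 := (hcont.integral_hasStrictDerivAt 0 t).hasDerivAt.const_add f
  refine h2.congr_of_eventuallyEq (Eventually.of_forall h1)

lemma dispOp_mem_ker {j : ℕ} (hj : 1 ≤ j) {g : C(Torus, ℝ)}
    (hg : ContDiff ℝ ∞ (fun x : ℝ => g (x : Torus))) (h : ∫ x : Torus, g x = 1) {lam : ℝ}
    (hlam : 0 ≤ lam) {f : L2} (hf : fullGram j g hlam f = 0) :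
    fullGram j g hlam (dispOp j f) = 0 := by
  have hs := seqNorm_lt_top_of_fullGram hj hg h hlam hf (2 * j + 1)
  have h1 := (mem_ker_fullGram_iff j h hlam f).1 hf
  refine (mem_ker_fullGram_iff j h hlam _).2 ⟨by rw [coef_dispOp hs]; simp, ?_⟩
  have hopen : ∀ τ ∈ Ioo (0 : ℝ) 1, G g (W j τ (Complex.I • dispOp j f)) = 0 := by
    intro τ hτ
    have h2 : HasDerivAt (fun τ => G g (W j τ f)) (G g (W j τ (Complex.I • dispOp j f))) τ :=
      ((G g).restrictScalars ℝ).hasFDerivAt.comp_hasDerivAt τ (hasDerivAt_W hs τ)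
    have h3 : (fun τ => G g (W j τ f)) =ᶠ[𝓝 τ] fun _ => 0 := by
      filter_upwards [isOpen_Ioo.mem_nhds hτ] with r hr
      exact h1.2 r ⟨hr.1.le, hr.2.le⟩
    exact h2.unique ((hasDerivAt_const τ (0 : L2)).congr_of_eventuallyEq h3)
  have hclosed : IsClosed {τ : ℝ | G g (W j τ (Complex.I • dispOp j f)) = 0} :=
    isClosed_eq ((G g).continuous.comp (continuous_W j _)) continuous_const
  intro τ hτ
  have h4 : τ ∈ closure (Ioo (0 : ℝ) 1) := by rwa [closure_Ioo zero_ne_one]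
  have h5 : G g (W j τ (Complex.I • dispOp j f)) = 0 := closure_minimal hopen hclosed h4
  rw [map_smul, map_smul, smul_eq_zero] at h5
  exact h5.resolve_left Complex.I_ne_zero

/-- The kernel of the completed Gramian is finite dimensional and invariant under `∂_x^{2j+1}`, so
that it would contain a single exponential if it were not trivial. -/
lemma fullGram_injective {j : ℕ} (hj : 1 ≤ j) {g : C(Torus, ℝ)}
    (hg : ContDiff ℝ ∞ (fun x : ℝ => g (x : Torus))) (h : ∫ x : Torus, g x = 1) {lam : ℝ}
    (hlam : 0 ≤ lam) {f : L2} (hf : fullGram j g hlam f = 0) : f = 0 := by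
  by_contra hne
  set V : Submodule ℂ L2 := LinearMap.ker (fullGram j g hlam : L2 →ₗ[ℂ] L2) with hV
  have hmem : ∀ v, v ∈ V ↔ fullGram j g hlam v = 0 := fun v => LinearMap.mem_ker
  have hc := gramConst_ne_zero j h lam
  have hrem : ∀ v ∈ V, gramRem j g hlam v = (-gramConst j g lam) • v := by
    intro v hv
    have h1 := fullGram_apply j g hlam v
    rw [(hmem v).1 hv] at h1
    rw [neg_smul]
    exact (neg_eq_of_add_eq_zero_right h1.symm).symm
  -- on the kernel, the compact part is a nonzero multiple of the identity
  have hfin : FiniteDimensional ℂ V := by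
    refine FiniteDimensional.of_isCompactOperator_id ?_
    have hmaps : ∀ v ∈ V, (gramRem j g hlam : L2 →ₗ[ℂ] L2) v ∈ V := by
      intro v hv
      change gramRem j g hlam v ∈ V
      rw [hrem v hv]
      exact V.smul_mem _ hv
    have h1 : IsCompactOperator ((gramRem j g hlam : L2 →ₗ[ℂ] L2).restrict hmaps) :=
      IsCompactOperator.restrict (f := (gramRem j g hlam : L2 →ₗ[ℂ] L2))
        (smoothing_gramRem hj hg hlam).isCompactOperator hmaps
        (by
          have : (V : Set L2) = {v | fullGram j g hlam v = 0} := by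
            ext v; exact hmem v
          rw [this]
          exact isClosed_eq (fullGram j g hlam).continuous continuous_const)
    have h2 := h1.smul (-gramConst j g lam)⁻¹
    have e : (id : V → V) = (-gramConst j g lam)⁻¹ •
        ⇑((gramRem j g hlam : L2 →ₗ[ℂ] L2).restrict hmaps) := by
      refine funext fun v => Subtype.ext ?_
      change (v : L2) = (-gramConst j g lam)⁻¹ • gramRem j g hlam v
      rw [hrem v v.2, smul_smul, inv_mul_cancel₀ (neg_ne_zero.2 hc), one_smul]
    rw [e]
    exact h2
  have hs : ∀ v : V, seqNorm ((2 * j + 1 : ℕ) : ℝ) (fun k => coef k (v : L2)) < ⊤ := fun v =>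
    seqNorm_lt_top_of_fullGram hj hg h hlam ((hmem v).1 v.2) _
  -- the operator `∂_x^{2j+1}`, up to a constant, on the kernel, whose elements are smooth
  let D : Module.End ℂ V :=
    { toFun := fun v => ⟨dispOp j v, (hmem _).2 (dispOp_mem_ker hj hg h hlam ((hmem v).1 v.2))⟩
      map_add' := fun v w => by
        apply Subtype.ext
        refine ext_coef fun k => ?_
        change coef k (dispOp j (v + w : V)) = coef k (dispOp j v + dispOp j w)
        rw [map_add, coef_dispOp (hs _), coef_dispOp (hs _), coef_dispOp (hs _),
          Submodule.coe_add, map_add, mul_add]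
      map_smul' := fun c v => by
        apply Subtype.ext
        refine ext_coef fun k => ?_
        change coef k (dispOp j (c • v : V)) = coef k (c • dispOp j v)
        rw [map_smul, coef_dispOp (hs _), coef_dispOp (hs _), Submodule.coe_smul, map_smul,
          smul_eq_mul, smul_eq_mul, mul_left_comm] }
  have hnt : Nontrivial V := ⟨⟨⟨f, (hmem f).2 hf⟩, 0, fun h' => hne (congrArg Subtype.val h')⟩⟩
  obtain ⟨μ, hμ⟩ := Module.End.exists_eigenvalue D
  obtain ⟨v, hv⟩ := hμ.exists_hasEigenvector
  have hv0 : (v : L2) ≠ 0 := fun h' => hv.2 (Subtype.ext h')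
  have hev : ∀ k : ℤ, (k : ℂ) ^ (2 * j + 1) * coef k (v : L2) = μ * coef k (v : L2) := by
    intro k
    have h1 := congrArg (fun w : V => coef k (w : L2)) hv.apply_eq_smul
    change coef k (dispOp j v) = coef k (μ • (v : L2)) at h1
    rwa [coef_dispOp (hs v), map_smul, smul_eq_mul] at h1
  obtain ⟨l, hl⟩ : ∃ l, coef l (v : L2) ≠ 0 := by
    by_contra! h'
    exact hv0 (ext_coef fun k => by rw [h', map_zero])
  have hμl : (l : ℂ) ^ (2 * j + 1) = μ := mul_right_cancel₀ hl (hev l)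
  -- the integers `k ^ (2j+1)` are distinct, hence an eigenvector is a single exponential
  have hsing : (v : L2) = coef l (v : L2) • expo l := by
    refine ext_coef fun k => ?_
    rw [map_smul, coef_expo, smul_eq_mul]
    by_cases hk : k = l
    · simp [hk]
    · rw [if_neg hk, mul_zero]
      by_contra h'
      have h1 := mul_right_cancel₀ h' (hev k)
      rw [← hμl] at h1
      have h2 : k ^ (2 * j + 1) = l ^ (2 * j + 1) := by exact_mod_cast h1
      exact hk ((Odd.strictMono_pow ⟨j, rfl⟩).injective h2)
  have hker := (mem_ker_fullGram_iff j h hlam v).1 ((hmem v).1 v.2)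
  have hl0 : l ≠ 0 := fun h' => hl (by rw [h']; exact hker.1)
  refine G_expo_ne_zero hg h hl0 ?_
  have h1 := hker.2 0 ⟨le_rfl, zero_le_one⟩
  have h2 : W j 0 (v : L2) = v := ext_coef fun k => by rw [coef_W, phase_zero, one_mul]
  rw [h2, hsing, map_smul, smul_eq_zero] at h1
  exact h1.resolve_left hl

/-- The Fredholm alternative for a compact perturbation of a nonzero constant. -/
lemma isUnit_fullGram {j : ℕ} (hj : 1 ≤ j) {g : C(Torus, ℝ)}
    (hg : ContDiff ℝ ∞ (fun x : ℝ => g (x : Torus))) (h : ∫ x : Torus, g x = 1) {lam : ℝ}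
    (hlam : 0 ≤ lam) : IsUnit (fullGram j g hlam) := by
  have hc := gramConst_ne_zero j h lam
  rcases (smoothing_gramRem hj hg hlam).isCompactOperator.hasEigenvalue_or_mem_resolventSet
    (neg_ne_zero.2 hc) with h1 | h1
  · obtain ⟨v, hv⟩ := h1.exists_hasEigenvector
    have h2 : gramRem j g hlam v = -gramConst j g lam • v := hv.apply_eq_smul
    refine absurd (fullGram_injective hj hg h hlam (f := v) ?_) hv.2
    rw [fullGram_apply, h2, neg_smul, add_neg_cancel]
  · rw [spectrum.mem_resolventSet_iff] at h1
    have h2 : algebraMap ℂ (L2 →L[ℂ] L2) (-gramConst j g lam) - gramRem j g hlam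
        = -fullGram j g hlam := by
      ext1 f
      rw [neg_apply, fullGram_apply, sub_apply,
        Algebra.algebraMap_eq_smul_one, smul_apply,
        one_apply_eq_self, neg_smul]
      abel
    rw [h2] at h1
    simpa using h1

/-! ### The feedback operator on Fourier coefficients -/

/-- The inverse of the completed Gramian is bounded on every `H^s`: apply
`f = c^{-1} (h - R f)`, in which `R` gains a derivative, repeatedly. -/
lemma exists_bound_inverse {j : ℕ} (hj : 1 ≤ j) {g : C(Torus, ℝ)}
    (hg : ContDiff ℝ ∞ (fun x : ℝ => g (x : Torus))) (h : ∫ x : Torus, g x = 1) {lam : ℝ}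
    (hlam : 0 ≤ lam) {B : L2 →L[ℂ] L2} (hB : ∀ f, fullGram j g hlam (B f) = f) (n : ℕ) :
    ∀ s : ℝ, 0 ≤ s → s ≤ n → ∃ C : ℝ≥0, ∀ f : L2,
      seqNorm s (fun k => coef k (B f)) ≤ C * seqNorm s fun k => coef k f := by
  induction n with
  | zero =>
    intro s hs hs'
    obtain rfl : s = 0 := le_antisymm (by simpa using hs') hs
    refine ⟨‖B‖₊, fun f => ?_⟩
    rw [seqNorm_coef, seqNorm_coef]
    exact B.le_opENorm f
  | succ n ih =>
    intro s hs hs'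
    obtain ⟨D, hD⟩ := ih (max (s - 1) 0) (le_max_right _ _)
      (max_le (by push_cast at hs'; linarith) (by positivity))
    obtain ⟨C, hC⟩ := (smoothing_gramRem hj hg hlam).exists_bound (s := s - 1) (by simpa using hs)
    rw [Nat.cast_one, sub_add_cancel] at hC
    have hc := gramConst_ne_zero j h lam
    refine ⟨‖(gramConst j g lam)⁻¹‖₊ + ‖-(gramConst j g lam)⁻¹‖₊ * (C * D), fun f => ?_⟩
    have h1 : (fun k => coef k (B f)) = fun k => (gramConst j g lam)⁻¹ * coef k f
        + -(gramConst j g lam)⁻¹ * coef k (gramRem j g hlam (B f)) := by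
      ext k
      have h2 := congrArg (coef k) (fullGram_apply j g hlam (B f))
      rw [hB, map_add, map_smul, smul_eq_mul] at h2
      rw [h2]
      field_simp
      ring
    rw [h1]
    refine (seqNorm_add_le _ _ _).trans ?_
    rw [seqNorm_const_mul, seqNorm_const_mul]
    push_cast
    rw [add_mul]
    refine add_le_add le_rfl ?_
    rw [mul_assoc]
    refine mul_le_mul_right ?_ _
    calc seqNorm s (fun k => coef k (gramRem j g hlam (B f)))
        ≤ C * seqNorm (s - 1) fun k => coef k (B f) := by
          rw [coef_eq_tsum_mat]
          exact hC _
      _ ≤ C * seqNorm (max (s - 1) 0) fun k => coef k (B f) := by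
          gcongr
          exact seqNorm_mono (le_max_left _ _) _
      _ ≤ C * (D * seqNorm (max (s - 1) 0) fun k => coef k f) := by
          gcongr
          exact hD f
      _ ≤ C * (D * seqNorm s fun k => coef k f) := by
          gcongr
          exact seqNorm_mono (max_le (by linarith) hs) _
      _ = _ := by rw [mul_assoc]

lemma isRealOp_fullGram (j : ℕ) (g : C(Torus, ℝ)) {lam : ℝ} (hlam : 0 ≤ lam) :
    IsRealOp (fullGram j g hlam) := by
  refine isRealOp_of_mat fun k l => ?_
  rw [mat_fullGram, mat_fullGram, (isRealOp_GG g).mat_neg, gramWt_neg, map_add, map_mul]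
  congr 1
  simp only [neg_eq_zero]
  split_ifs <;> simp

lemma isRealOp_inverse {A B : L2 →L[ℂ] L2} (hA : IsRealOp A) (h1 : ∀ f, A (B f) = f)
    (h2 : ∀ f, B (A f) = f) : IsRealOp B := by
  intro f
  rw [← h2 (conjL2 (B f)), hA, h1]

lemma feedbackMatrix_of_inverse {g : C(Torus, ℝ)}
    (hg : ContDiff ℝ ∞ (fun x : ℝ => g (x : Torus))) (h : ∫ x : Torus, g x = 1)
    {B : L2 →L[ℂ] L2} (hreal : IsRealOp B)
    (hB : ∀ s : ℝ, 0 ≤ s → ∃ C : ℝ≥0, ∀ f : L2,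
      seqNorm s (fun k => coef k (B f)) ≤ C * seqNorm s fun k => coef k f) :
    FeedbackMatrix (mat ((GG g).comp B)) where
  row k := nrm_row_lt_top _ k
  bdd s hs := by
    obtain ⟨C, hC⟩ := hB s hs
    obtain ⟨D, hD⟩ := (smoothing_GG hg).exists_bound (s := s) (by simpa using hs)
    rw [Nat.cast_zero, add_zero] at hD
    refine ⟨D * C, fun x hx => ?_⟩
    have hx0 : seqNorm 0 x < ⊤ := by
      simpa only [seqNorm, sobWt_zero, one_mul] using hx
    have h1 : (fun k => ∑' l, mat ((GG g).comp B) k l * x l)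
        = fun k => ∑' l, mat (GG g) k l * coef l (B (synth x)) := by
      rw [← coef_eq_tsum_mat, ← ContinuousLinearMap.comp_apply, coef_eq_tsum_mat]
      simp only [coef_synth hx0]
    have h2 := hC (synth x)
    simp only [coef_synth hx0] at h2
    rw [h1, ENNReal.coe_mul, mul_assoc]
    exact (hD _).trans (mul_le_mul_right h2 _)
  zero_row l := by
    rw [mat, ContinuousLinearMap.comp_apply, GG_apply, coef_zero_G h]
  conj k l := ((isRealOp_GG g).comp hreal).mat_neg k l

lemma coef_zero_K (j : ℕ) {g : C(Torus, ℝ)} (h : ∫ x : Torus, g x = 1) (lam : ℝ) (f : L2) :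
    coef 0 (K j g lam f) = 0 := coef_zero_G h _

lemma LInv_zero (j : ℕ) (g : C(Torus, ℝ)) {f : L2} (hf : MeanZero f) : LInv j g 0 f = f := by
  have h1 : ∃ a ∈ {h : L2 | MeanZero h}, L j g 0 a = f := ⟨f, hf, by simp [L]⟩
  have h2 := Function.invFunOn_eq h1
  simp only [L, if_true] at h2
  exact h2

lemma LInv_eq {j : ℕ} {g : C(Torus, ℝ)} (h : ∫ x : Torus, g x = 1) {lam : ℝ}
    (hlam : 0 ≤ lam) (h0 : lam ≠ 0) {B : L2 →L[ℂ] L2} (hB : ∀ f, fullGram j g hlam (B f) = f)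
    (hB' : ∀ f, B (fullGram j g hlam f) = f) {f : L2} (hf : MeanZero f) :
    LInv j g lam f = B f := by
  have hgram : ∀ a : L2, MeanZero a → fullGram j g hlam a = L j g lam a := by
    intro a ha
    rw [L_eq_gram j g hlam h0, fullGram, add_apply, constProj,
      ContinuousLinearMap.smulRight_apply, (meanZero_iff a).1 ha, zero_smul, add_zero]
  have hm : MeanZero (B f) := by
    rw [meanZero_iff, ← coef_zero_fullGram j h hlam, hB, ← meanZero_iff]
    exact hf
  have h1 : ∃ a ∈ {h : L2 | MeanZero h}, L j g lam a = f := ⟨B f, hm, by rw [← hgram _ hm, hB]⟩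
  have h2 : L j g lam (LInv j g lam f) = f := Function.invFunOn_eq h1
  have h3 : MeanZero (LInv j g lam f) := Function.invFunOn_mem h1
  rw [← hgram _ h3] at h2
  rw [← hB' (LInv j g lam f), h2]

/-- On mean zero functions the feedback is given by a matrix that is real, bounded on every `H^s`,
and has values of mean zero. -/
theorem exists_feedbackMatrix {j : ℕ} (hj : 1 ≤ j) {g : C(Torus, ℝ)}
    (hg : ContDiff ℝ ∞ (fun x : ℝ => g (x : Torus))) (h : ∫ x : Torus, g x = 1) {lam : ℝ}
    (hlam : 0 ≤ lam) : ∃ κ : ℤ → ℤ → ℂ, FeedbackMatrix κ ∧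
      ∀ f : L2, MeanZero f → ∀ k, coef k (K j g lam f) = ∑' l, κ k l * coef l f := by
  suffices H : ∃ B : L2 →L[ℂ] L2, IsRealOp B ∧ (∀ s : ℝ, 0 ≤ s → ∃ C : ℝ≥0, ∀ f : L2,
      seqNorm s (fun k => coef k (B f)) ≤ C * seqNorm s fun k => coef k f) ∧
      ∀ f, MeanZero f → LInv j g lam f = B f by
    obtain ⟨B, h1, h2, h3⟩ := H
    refine ⟨_, feedbackMatrix_of_inverse hg h h1 h2, fun f hf k => ?_⟩
    rw [(hasSum_mat _ f k).tsum_eq, K, h3 f hf]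
    rfl
  by_cases h0 : lam = 0
  · subst h0
    exact ⟨ContinuousLinearMap.id ℂ L2, fun f => rfl, fun s _ => ⟨1, fun f => by simp⟩,
      fun f hf => LInv_zero j g hf⟩
  · obtain ⟨u, hu⟩ := isUnit_fullGram hj hg h hlam
    have hB : ∀ f, fullGram j g hlam ((u⁻¹ : (L2 →L[ℂ] L2)ˣ).1 f) = f := fun f => by
      rw [← hu, ← mul_apply_eq_comp, Units.mul_inv, one_apply_eq_self]
    have hB' : ∀ f, (u⁻¹ : (L2 →L[ℂ] L2)ˣ).1 (fullGram j g hlam f) = f := fun f => by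
      rw [← hu, ← mul_apply_eq_comp, Units.inv_mul, one_apply_eq_self]
    refine ⟨_, isRealOp_inverse (isRealOp_fullGram j g hlam) hB hB', fun s hs => ?_,
      fun f hf => LInv_eq h hlam h0 hB hB' hf⟩
    obtain ⟨n, hn⟩ := exists_nat_ge s
    exact exists_bound_inverse hj hg h hlam hB n s hs hn

/-! ### Real functions, squares, and the norms in terms of Fourier coefficients -/

lemma memLp_conj (f : L2) : MemLp (fun x => (starRingEnd ℂ) (f x)) 2
    (AddCircle.haarAddCircle : Measure Torus) :=
  (Lp.memLp f).of_le
    (Complex.continuous_conj.comp_aestronglyMeasurable (Lp.aestronglyMeasurable f))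
    (Eventually.of_forall fun x => by rw [RCLike.norm_conj])

lemma fourierCoeff_conj (f : Torus → ℂ) (k : ℤ) :
    fourierCoeff (fun x => (starRingEnd ℂ) (f x)) k = (starRingEnd ℂ) (fourierCoeff f (-k)) := by
  rw [fourierCoeff, fourierCoeff, ← integral_conj]
  refine integral_congr_ae (Eventually.of_forall fun x => ?_)
  simp only [smul_eq_mul, map_mul, ← fourier_neg, neg_neg]

lemma isRealValued_iff (f : L2) :
    IsRealValued f ↔ ∀ k, coef (-k) f = (starRingEnd ℂ) (coef k f) := by
  have h1 : ∀ k, coef k ((memLp_conj f).toLp _) = (starRingEnd ℂ) (coef (-k) f) := fun k => by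
    rw [coef_congr (memLp_conj f).coeFn_toLp, fourierCoeff_conj, coef_eq]
  constructor
  · intro h k
    have h2 : (memLp_conj f).toLp _ = f := by
      refine Lp.ext ?_
      filter_upwards [(memLp_conj f).coeFn_toLp, h] with x hx hx'
      rw [hx]
      exact Complex.conj_eq_iff_im.2 hx'
    have h3 := h1 (-k)
    rw [h2, neg_neg] at h3
    exact h3
  · intro h
    have h2 : (memLp_conj f).toLp _ = f := ext_coef fun k => by
      rw [h1, h, Complex.conj_conj]
    have h3 := (memLp_conj f).coeFn_toLp
    rw [h2] at h3
    filter_upwards [h3] with x hx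
    exact Complex.conj_eq_iff_im.1 hx.symm

/-- The coefficients of a square, by Parseval's identity for `f` and the conjugate of `f`, shifted in
frequency. -/
lemma fourierCoeff_sq (f : L2) (k : ℤ) :
    fourierCoeff (fun x => (f x) ^ 2) k = ∑' l, coef l f * coef (k - l) f := by
  have hm : MemLp (fun x => fourier k x * (starRingEnd ℂ) (f x)) 2
      (AddCircle.haarAddCircle : Measure Torus) := by
    refine (Lp.memLp f).of_le ((by fun_prop : Continuous fun x : Torus =>
      (fourier k x : ℂ)).aestronglyMeasurable.mul (memLp_conj f).1)
      (Eventually.of_forall fun x => ?_)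
    rw [norm_mul, RCLike.norm_conj, fourier_apply, Circle.norm_coe, one_mul]
  have h1 : ∀ l, coef l (hm.toLp _) = (starRingEnd ℂ) (coef (k - l) f) := by
    intro l
    rw [coef_congr hm.coeFn_toLp, coef_eq, fourierCoeff, fourierCoeff, ← integral_conj]
    refine integral_congr_ae (Eventually.of_forall fun x => ?_)
    simp only [smul_eq_mul, map_mul, ← fourier_neg, neg_neg]
    rw [show k - l = -l + k by ring, fourier_add]
    ring
  have h2 := (fourierBasis (T := 2 * Real.pi)).tsum_inner_mul_inner (hm.toLp _) f
  have h3 : ∀ l, ⟪hm.toLp _, (fourierBasis (T := 2 * Real.pi) : HilbertBasis ℤ ℂ L2) l⟫_ℂ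
      * ⟪(fourierBasis (T := 2 * Real.pi) : HilbertBasis ℤ ℂ L2) l, f⟫_ℂ
      = coef l f * coef (k - l) f := by
    intro l
    rw [← inner_conj_symm]
    change (starRingEnd ℂ) (coef l (hm.toLp _)) * coef l f = _
    rw [h1, Complex.conj_conj, mul_comm]
  simp only [h3] at h2
  rw [h2, L2.inner_def, fourierCoeff]
  refine integral_congr_ae ?_
  filter_upwards [hm.coeFn_toLp] with x hx
  rw [hx]
  simp only [RCLike.inner_apply, map_mul, Complex.conj_conj, ← fourier_neg, smul_eq_mul]
  ring

lemma sobWt_sq (s : ℝ) (k : ℤ) : sobWt s k ^ 2 = ENNReal.ofReal (bracket k ^ (2 * s)) := by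
  have hb : 0 ≤ bracket k := zero_le_one.trans (one_le_bracket _)
  rw [sobWt, ← ENNReal.ofReal_pow (by positivity), ← Real.rpow_natCast, ← Real.rpow_mul hb]
  congr 2
  push_cast
  ring

lemma hsNorm_eq (s : ℝ) (f : L2) :
    hsNorm s f = ENNReal.ofReal (Real.sqrt (2 * Real.pi)) * seqNorm s fun k => coef k f := by
  rw [hsNorm, seqNorm, ← nrm_const_mul _ (measurable_of_countable _).aemeasurable, nrm_count_eq]
  congr 1
  refine tsum_congr fun k => ?_
  have hb : 0 ≤ bracket k := zero_le_one.trans (one_le_bracket _)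
  rw [hat_eq_coef, ENNReal.ofReal_mul (by positivity), ENNReal.ofReal_pow (norm_nonneg _),
    ofReal_norm, mul_pow, mul_pow, sobWt_sq, enorm_mul, ← ofReal_norm (Real.sqrt _ : ℂ),
    Complex.norm_real, Real.norm_of_nonneg (Real.sqrt_nonneg _)]
  ring

lemma hsNorm_lt_top_iff (s : ℝ) (f : L2) :
    hsNorm s f < ⊤ ↔ seqNorm s (fun k => coef k f) < ⊤ := by
  rw [hsNorm_eq]
  have h1 : ENNReal.ofReal (Real.sqrt (2 * Real.pi)) ≠ 0 := by
    rw [Ne, ENNReal.ofReal_eq_zero, not_le]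
    exact Real.sqrt_pos.2 Real.two_pi_pos
  constructor
  · intro h
    by_contra h'
    rw [not_lt, top_le_iff] at h'
    rw [h', ENNReal.mul_top h1] at h
    exact lt_irrefl _ h
  · exact fun h => ENNReal.mul_lt_top ENNReal.ofReal_lt_top h

lemma seqNorm_le_hsNorm (s : ℝ) (f : L2) : seqNorm s (fun k => coef k f) ≤ hsNorm s f := by
  rw [hsNorm_eq]
  refine le_mul_of_one_le_left zero_le ?_
  rw [ENNReal.one_le_ofReal, Real.one_le_sqrt]
  linarith [Real.pi_gt_three]

/-- The mild equation, coefficient by coefficient, for functions given by space-time Fourier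
integrals. -/
lemma isMildSolution_iff {j : ℕ} {g : C(Torus, ℝ)} {lam T : ℝ} {κ : ℤ → ℤ → ℂ}
    (hκ : FeedbackMatrix κ)
    (hK : ∀ f : L2, MeanZero f → ∀ k, coef k (K j g lam f) = ∑' l, κ k l * coef l f)
    {u₀ : L2} {u : ℝ → L2} {U : ℤ × ℝ → ℂ} (hU : Measurable U)
    (hU' : nrm Measure.count (modeNorm U) < ⊤) (hz : ∀ τ, U (0, τ) = 0)
    (hu : ∀ t ∈ Icc 0 T, ∀ k, coef k (u t) = ev U t k) :
    IsMildSolution j g lam T u₀ u ↔ CoeffSolution j κ univ T (fun k => coef k u₀) (ev U) := by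
  have hs : (Real.sqrt (2 * Real.pi) : ℂ) ≠ 0 := by
    exact_mod_cast (Real.sqrt_pos.2 Real.two_pi_pos).ne'
  refine forall₂_congr fun t ht => forall_congr' fun k => ?_
  have hm : ∀ r ∈ Icc 0 T, MeanZero (u r) := by
    intro r hr
    rw [meanZero_iff, hu r hr]
    simp [ev, hz]
  have hcq : Continuous fun r => (Complex.I * k / 2) * ∑' l, ev U r l * ev U r (k - l) := by
    simp only [← ev_cconv hU hU hU' hU']
    exact continuous_const.mul (continuous_ev (integrable_cconv hU hU hU' hU' k))
  have hcl : Continuous fun r => ∑' l, κ k l * ev U r l := by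
    refine ((continuous_forceCoeff hκ hU hU' k).sub hcq).congr fun r => ?_
    simp only [Pi.sub_apply, forceCoeff, add_sub_cancel_right]
  have h1 : ∫ r in (0 : ℝ)..t, phase j (t - r) k * hat (K j g lam (u r)) k
      = Real.sqrt (2 * Real.pi) * ∫ r in (0 : ℝ)..t, phase j (t - r) k * ∑' l, κ k l * ev U r l := by
    rw [← intervalIntegral.integral_const_mul]
    refine intervalIntegral.integral_congr fun r hr => ?_
    rw [uIcc_of_le ht.1] at hr
    have hr' : r ∈ Icc 0 T := ⟨hr.1, hr.2.trans ht.2⟩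
    simp only [hat_eq_coef, hK _ (hm r hr'), hu r hr']
    ring
  have h2 : ∫ r in (0 : ℝ)..t, phase j (t - r) k *
        ((1 / 2 : ℂ) * (Complex.I * (k : ℂ)) * hat (fun x => (u r x) ^ 2) k)
      = Real.sqrt (2 * Real.pi) * ∫ r in (0 : ℝ)..t, phase j (t - r) k *
        ((Complex.I * k / 2) * ∑' l, ev U r l * ev U r (k - l)) := by
    rw [← intervalIntegral.integral_const_mul]
    refine intervalIntegral.integral_congr fun r hr => ?_
    rw [uIcc_of_le ht.1] at hr
    have hr' : r ∈ Icc 0 T := ⟨hr.1, hr.2.trans ht.2⟩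
    simp only [hat_eq, fourierCoeff_sq, hu r hr']
    ring
  have h3 : ∫ r in (0 : ℝ)..t, phase j (t - r) k * forceCoeff κ (ev U r) k
      = (∫ r in (0 : ℝ)..t, phase j (t - r) k * ∑' l, κ k l * ev U r l)
        + ∫ r in (0 : ℝ)..t, phase j (t - r) k *
          ((Complex.I * k / 2) * ∑' l, ev U r l * ev U r (k - l)) := by
    rw [← intervalIntegral.integral_add (intervalIntegrable_phase_mul hcl k t 0 t)
      (intervalIntegrable_phase_mul hcq k t 0 t)]
    simp only [forceCoeff, mul_add]
  rw [h1, h2, indicator_univ, h3, hat_eq_coef, hat_eq_coef, hu t ht]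
  constructor
  · intro h
    refine mul_left_cancel₀ hs ?_
    rw [h]; ring
  · intro h
    rw [h]; ring

/-! ### Comparison of the restriction norms -/

/-- The `X^{s,1/2}` part of `ys`, as a sum over the modes. -/
lemma lintegral_wt_sq (j : ℕ) (s : ℝ) {U : ℤ × ℝ → ℂ} (hU : Measurable U) :
    ∫⁻ ξ, (wt j 1 ξ ^ (1 / 2 : ℝ) * (sobWt s ξ.1 * ‖U ξ‖ₑ)) ^ 2 ∂freqMeasure
      = ∑' k : ℤ, ∫⁻ τ : ℝ, ENNReal.ofReal (bracket k ^ (2 * s)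
        * (1 + |τ - (k : ℝ) ^ (2 * j + 1)|) * ‖U (k, τ)‖ ^ 2) := by
  have h1 : ∀ ξ : ℤ × ℝ, (wt j 1 ξ ^ (1 / 2 : ℝ) * (sobWt s ξ.1 * ‖U ξ‖ₑ)) ^ 2
      = ENNReal.ofReal (bracket ξ.1 ^ (2 * s) * (1 + |ξ.2 - (ξ.1 : ℝ) ^ (2 * j + 1)|)
        * ‖U ξ‖ ^ 2) := by
    intro ξ
    have hb : 0 ≤ bracket ξ.1 := zero_le_one.trans (one_le_bracket _)
    rw [mul_pow, mul_pow, rpow_half_sq, sobWt_sq, wt, modul, ENNReal.ofReal_mul (by positivity),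
      ENNReal.ofReal_mul (by positivity), ENNReal.ofReal_pow (norm_nonneg _), ofReal_norm]
    ring
  simp only [h1]
  refine lintegral_int_prod (measurable_of_int_prod fun k => ?_)
  have := measurable_mode hU k
  have hm : ∀ b : ℝ, Measurable fun τ : ℝ =>
      ENNReal.ofReal (b * (1 + |τ - (k : ℝ) ^ (2 * j + 1)|) * ‖U (k, τ)‖ ^ 2) := fun b => by
    fun_prop
  exact hm (bracket k ^ (2 * s))

lemma sqrt_two_pi_mul_self :
    (Real.sqrt (2 * Real.pi) : ℂ) * Real.sqrt (2 * Real.pi) = 2 * Real.pi := by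
  exact_mod_cast Real.mul_self_sqrt Real.two_pi_pos.le

lemma sqrt_two_pi_ne_zero : (Real.sqrt (2 * Real.pi) : ℂ) ≠ 0 := by
  exact_mod_cast (Real.sqrt_pos.2 Real.two_pi_pos).ne'

lemma yNorm_le (j : ℕ) (s : ℝ) {U : ℤ × ℝ → ℂ} (hU : Measurable U)
    (hi : ∀ k, Integrable fun τ : ℝ => U (k, τ)) {u : ℝ → L2}
    (hu : ∀ t k, coef k (u t) = ev U t k) :
    yNorm j s u ≤ ENNReal.ofReal (2 * Real.pi) * ys j 1 s U := by
  have h2 : (0 : ℝ) < 2 * Real.pi := Real.two_pi_pos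
  have hF : IsSpaceTimeFourier u fun τ k => 2 * Real.pi * U (k, τ) := by
    refine ⟨fun k => (hi k).const_mul _, Eventually.of_forall fun t k => ?_⟩
    have h1 : ∫ τ : ℝ, Complex.exp (Complex.I * t * τ) * (2 * Real.pi * U (k, τ))
        = 2 * Real.pi * ev U t k := by
      rw [ev, ← integral_const_mul]
      refine integral_congr_ae (Eventually.of_forall fun τ => ?_)
      ring_nf
    have hs := sqrt_two_pi_ne_zero
    rw [h1, hat_eq_coef, hu, ← sqrt_two_pi_mul_self]
    field_simp
  refine (iInf₂_le _ hF).trans ?_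
  have hn : ∀ k τ, ‖(2 * Real.pi * U (k, τ) : ℂ)‖ = 2 * Real.pi * ‖U (k, τ)‖ := by
    intro k τ
    rw [norm_mul, norm_mul, Complex.norm_real, Real.norm_of_nonneg Real.pi_pos.le]
    simp
  rw [ys, yn, mul_add]
  refine add_le_add ?_ (le_of_eq ?_)
  · have h3 : ENNReal.ofReal (1 / (2 * Real.pi)) * ∑' k : ℤ, ∫⁻ τ : ℝ,
        ENNReal.ofReal (bracket k ^ (2 * s) * bracket (τ - (k : ℝ) ^ (2 * j + 1)) ^ (2 * (1 / 2 : ℝ))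
          * ‖(2 * Real.pi * U (k, τ) : ℂ)‖ ^ 2)
        ≤ (ENNReal.ofReal (2 * Real.pi)
          * nrm freqMeasure fun ξ => wt j 1 ξ ^ (1 / 2 : ℝ) * (sobWt s ξ.1 * ‖U ξ‖ₑ)) ^ 2 := by
      rw [mul_pow, nrm_sq, lintegral_wt_sq j s hU, ← ENNReal.tsum_mul_left, ← ENNReal.tsum_mul_left]
      refine ENNReal.tsum_le_tsum fun k => ?_
      rw [← lintegral_const_mul' _ _ ENNReal.ofReal_ne_top,
        ← lintegral_const_mul' _ _ (ENNReal.pow_ne_top ENNReal.ofReal_ne_top)]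
      refine lintegral_mono fun τ => ?_
      have hb : 0 ≤ bracket k := zero_le_one.trans (one_le_bracket _)
      have h4 := bracket_le (τ - (k : ℝ) ^ (2 * j + 1))
      have h5 := one_le_bracket (τ - (k : ℝ) ^ (2 * j + 1))
      have h6 : (1 : ℝ) ≤ 2 * Real.pi := by linarith [Real.pi_gt_three]
      rw [← ENNReal.ofReal_mul (by positivity), ← ENNReal.ofReal_pow h2.le,
        ← ENNReal.ofReal_mul (by positivity), hn]
      refine ENNReal.ofReal_le_ofReal ?_
      rw [show (2 * (1 / 2 : ℝ)) = 1 by norm_num, Real.rpow_one]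
      calc 1 / (2 * Real.pi) * (bracket k ^ (2 * s) * bracket (τ - (k : ℝ) ^ (2 * j + 1))
            * (2 * Real.pi * ‖U (k, τ)‖) ^ 2)
          = 2 * Real.pi * (bracket k ^ (2 * s) * bracket (τ - (k : ℝ) ^ (2 * j + 1))
            * ‖U (k, τ)‖ ^ 2) := by field_simp
        _ ≤ (2 * Real.pi) ^ 2 * (bracket k ^ (2 * s) * (1 + |τ - (k : ℝ) ^ (2 * j + 1)|)
            * ‖U (k, τ)‖ ^ 2) := by
            gcongr
            nlinarith
    rw [xNormF]
    refine (ENNReal.rpow_le_rpow h3 (by norm_num)).trans_eq (sq_rpow_half _)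
  · rw [l2L1NormF, ← nrm_const_mul _ (measurable_of_countable _).aemeasurable, nrm_count_eq]
    congr 1
    refine tsum_congr fun k => ?_
    have hb : 0 ≤ bracket k := zero_le_one.trans (one_le_bracket _)
    rw [← lintegral_const_mul' _ _ ENNReal.ofReal_ne_top]
    congr 1
    refine lintegral_congr fun τ => ?_
    rw [hn, ENNReal.ofReal_mul (by positivity), ENNReal.ofReal_mul h2.le, ofReal_norm, sobWt]
    ring

/-- Elements of `Y^s_T` are given, almost everywhere on `(0,T)` and away from the zero mode, by
space-time Fourier integrals of finite norm. -/
lemma exists_ev_of_yNormT {j : ℕ} {s T : ℝ} (hs : 0 ≤ s) {v : ℝ → L2} (h : yNormT j s T v < ⊤) :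
    ∃ U : ℤ × ℝ → ℂ, Measurable U ∧ (∀ τ, U (0, τ) = 0) ∧ ys j 1 0 U < ⊤ ∧
      ∀ᵐ t ∂(volume.restrict (Ioo 0 T)), ∀ k ≠ 0, coef k (v t) = ev U t k := by
  obtain ⟨f, hf⟩ := iInf_lt_iff.1 h
  obtain ⟨hfv, hf⟩ := iInf_lt_iff.1 hf
  obtain ⟨F, hF⟩ := iInf_lt_iff.1 hf
  obtain ⟨⟨hFi, hFe⟩, hF⟩ := iInf_lt_iff.1 hF
  obtain ⟨hX, hL⟩ := ENNReal.add_lt_top.1 hF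
  -- a measurable modification of the space-time Fourier transform
  set Φ : ℤ → ℝ → ℂ := fun k => (hFi k).1.mk _ with hΦ
  have hΦF : ∀ k, ∀ᵐ τ : ℝ, F τ k = Φ k τ := fun k => (hFi k).1.ae_eq_mk
  have hΦm : ∀ k, Measurable (Φ k) := fun k => (hFi k).1.stronglyMeasurable_mk.measurable
  have h2 : (0 : ℝ) < 2 * Real.pi := Real.two_pi_pos
  set U : ℤ × ℝ → ℂ := fun ξ => if ξ.1 = 0 then 0 else (2 * Real.pi : ℂ)⁻¹ * Φ ξ.1 ξ.2 with hUdef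
  have hUm : Measurable U := by
    refine measurable_of_int_prod fun k => ?_
    by_cases hk : k = 0
    · simp only [hUdef, hk, if_true]
      exact measurable_const
    · simp only [hUdef, hk, if_false]
      exact (hΦm k).const_mul _
  have hUn : ∀ k τ, ‖U (k, τ)‖ ≤ ‖Φ k τ‖ := by
    intro k τ
    simp only [hUdef]
    split_ifs with hk
    · simp
    · rw [norm_mul, norm_inv]
      refine mul_le_of_le_one_left (norm_nonneg _) (inv_le_one_of_one_le₀ ?_)
      rw [norm_mul, Complex.norm_real, Real.norm_of_nonneg Real.pi_pos.le]
      simp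
      linarith [Real.pi_gt_three]
  refine ⟨U, hUm, fun τ => by simp [hUdef], ?_, ?_⟩
  · rw [ys_zero, yn]
    refine ENNReal.add_lt_top.2 ⟨?_, ?_⟩
    · have h3 := lintegral_wt_sq j 0 hUm
      simp only [sobWt_zero, one_mul, mul_zero, Real.rpow_zero] at h3
      rw [nrm, h3]
      refine ENNReal.rpow_lt_top_of_nonneg (by norm_num) (ne_of_lt ?_)
      rw [xNormF, ENNReal.rpow_lt_top_iff_of_pos (by norm_num)] at hX
      have h4 : ENNReal.ofReal (1 / (2 * Real.pi)) ≠ 0 := by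
        rw [Ne, ENNReal.ofReal_eq_zero, not_le]
        positivity
      have h5 : ∑' k : ℤ, ∫⁻ τ : ℝ, ENNReal.ofReal (bracket k ^ (2 * s)
          * bracket (τ - (k : ℝ) ^ (2 * j + 1)) ^ (2 * (1 / 2 : ℝ)) * ‖F τ k‖ ^ 2) < ⊤ := by
        by_contra h'
        rw [not_lt, top_le_iff] at h'
        rw [h', ENNReal.mul_top h4] at hX
        exact lt_irrefl _ hX
      refine lt_of_le_of_lt ?_ (ENNReal.mul_lt_top (ENNReal.ofReal_lt_top (r := 2)) h5)
      rw [← ENNReal.tsum_mul_left]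
      refine ENNReal.tsum_le_tsum fun k => ?_
      rw [← lintegral_const_mul' _ _ ENNReal.ofReal_ne_top]
      refine lintegral_mono_ae ?_
      filter_upwards [hΦF k] with τ hτ
      rw [← ENNReal.ofReal_mul (by norm_num), hτ]
      refine ENNReal.ofReal_le_ofReal ?_
      rw [show (2 * (1 / 2 : ℝ)) = 1 by norm_num, Real.rpow_one]
      have h6 : 1 ≤ bracket k ^ (2 * s) := Real.one_le_rpow (one_le_bracket _) (by positivity)
      have h7 := abs_le_bracket (τ - (k : ℝ) ^ (2 * j + 1))
      have h8 := one_le_bracket (τ - (k : ℝ) ^ (2 * j + 1))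
      calc (1 + |τ - (k : ℝ) ^ (2 * j + 1)|) * ‖U (k, τ)‖ ^ 2
          ≤ (2 * bracket (τ - (k : ℝ) ^ (2 * j + 1))) * ‖Φ k τ‖ ^ 2 := by
            gcongr
            · linarith
            · exact hUn k τ
        _ ≤ (bracket k ^ (2 * s)) * ((2 * bracket (τ - (k : ℝ) ^ (2 * j + 1))) * ‖Φ k τ‖ ^ 2) :=
            le_mul_of_one_le_left (by positivity) h6
        _ = _ := by ring
    · rw [l2L1NormF] at hL
      refine lt_of_le_of_lt ?_ hL
      rw [nrm_count_eq]
      refine ENNReal.rpow_le_rpow (ENNReal.tsum_le_tsum fun k => ?_) (by norm_num)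
      refine pow_le_pow_left₀ zero_le (lintegral_mono_ae ?_) 2
      filter_upwards [hΦF k] with τ hτ
      rw [← ofReal_norm, hτ]
      refine ENNReal.ofReal_le_ofReal ((hUn k τ).trans (le_mul_of_one_le_left (norm_nonneg _) ?_))
      exact Real.one_le_rpow (one_le_bracket _) hs
  · filter_upwards [hfv, ae_restrict_of_ae hFe] with t ht ht' k hk
    have h3 := ht' k
    have h4 : ∫ τ : ℝ, Complex.exp (Complex.I * t * τ) * F τ k = 2 * Real.pi * ev U t k := by
      rw [ev, ← integral_const_mul]
      refine integral_congr_ae ?_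
      filter_upwards [hΦF k] with τ hτ
      have : (Real.pi : ℂ) ≠ 0 := by exact_mod_cast Real.pi_ne_zero
      simp only [hτ, hUdef, hk, if_false]
      field_simp
    have hs' := sqrt_two_pi_ne_zero
    rw [ht, hat_eq_coef, h4, ← sqrt_two_pi_mul_self] at h3
    refine mul_left_cancel₀ hs' ?_
    rw [h3]
    field_simp

/-- Functions given by space-time Fourier integrals of finite norm are continuous in `H^s`. -/
lemma isContHs_of_ev {j : ℕ} {s T : ℝ} {U : ℤ × ℝ → ℂ} (hU : Measurable U)
    (hi : ∀ k, Integrable fun τ : ℝ => U (k, τ)) (hs : ys j 1 s U < ⊤) {u : ℝ → L2}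
    (hu : ∀ t k, coef k (u t) = ev U t k) : IsContHs s T u := by
  refine ⟨fun t _ => ?_, fun t₀ _ => ?_⟩
  · rw [MemHs, hsNorm_lt_top_iff]
    simp only [hu]
    exact (seqNorm_ev_le j 1 s hU t).trans_lt hs
  · refine Tendsto.mono_left ?_ nhdsWithin_le_nhds
    simp only [hsNorm_eq, map_sub, hu]
    rw [← mul_zero (ENNReal.ofReal (Real.sqrt (2 * Real.pi)))]
    refine ENNReal.Tendsto.const_mul ?_ (Or.inr ENNReal.ofReal_ne_top)
    have hfin : ∫⁻ k : ℤ, (2 * (sobWt s k * modeNorm U k)) ^ 2 ∂Measure.count ≠ ⊤ := by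
      have h1 : nrm Measure.count (fun k => sobWt s k * modeNorm U k) < ⊤ := by
        refine lt_of_le_of_lt ?_ hs
        refine le_trans (le_of_eq ?_) (le_add_self : _ ≤ ys j 1 s U)
        congr 1
        ext k
        exact (lintegral_const_mul _ (measurable_mode hU k).enorm).symm
      rw [← nrm_sq, nrm_const_mul _ (measurable_of_countable _).aemeasurable]
      exact (ENNReal.pow_lt_top (ENNReal.mul_lt_top (by simp) h1)).ne
    have hlim : Tendsto (fun t => ∫⁻ k : ℤ, (sobWt s k * ‖ev U t k - ev U t₀ k‖ₑ) ^ 2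
        ∂Measure.count) (𝓝 t₀) (𝓝 (∫⁻ _ : ℤ, 0 ∂Measure.count)) := by
      refine tendsto_lintegral_filter_of_dominated_convergence
        (fun k => (2 * (sobWt s k * modeNorm U k)) ^ 2)
        (Eventually.of_forall fun t => measurable_of_countable _)
        (Eventually.of_forall fun t => Eventually.of_forall fun k => ?_) hfin
        (Eventually.of_forall fun k => ?_)
      · refine pow_le_pow_left₀ zero_le ?_ 2
        rw [mul_left_comm]
        gcongr
        rw [two_mul]
        exact (enorm_sub_le).trans (add_le_add (enorm_ev_le U t k) (enorm_ev_le U t₀ k))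
      · have h1 : Tendsto (fun t => ev U t k - ev U t₀ k) (𝓝 t₀) (𝓝 0) := by
          rw [← sub_self (ev U t₀ k)]
          exact ((continuous_ev (hi k)).tendsto t₀).sub_const _
        have h2 := ENNReal.Tendsto.const_mul (a := sobWt s k) h1.enorm
          (Or.inr (sobWt_ne_top s k))
        simpa [Function.comp_def] using ((ENNReal.continuous_pow 2).tendsto _).comp h2
    rw [lintegral_zero] at hlim
    have h3 := hlim.ennrpow_const (1 / 2)
    rw [ENNReal.zero_rpow_of_pos (by norm_num)] at h3
    exact h3

/-- Continuity in `H^s` gives continuity of every Fourier coefficient. -/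
lemma IsContHs.continuousOn_coef {s T : ℝ} (hs : 0 ≤ s) {v : ℝ → L2} (h : IsContHs s T v) (k : ℤ) :
    ContinuousOn (fun t => coef k (v t)) (Icc 0 T) := by
  intro t₀ ht₀
  rw [ContinuousWithinAt, tendsto_iff_edist_tendsto_0]
  refine tendsto_of_tendsto_of_tendsto_of_le_of_le tendsto_const_nhds (h.2 t₀ ht₀)
    (fun _ => zero_le) fun t => ?_
  rw [edist_eq_enorm_sub, ← map_sub]
  exact (enorm_le_seqNorm hs _ k).trans (seqNorm_le_hsNorm s (v t - v t₀))

/-! ### Continuous monotone majorants -/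

/-- A sequence indexed by integer upper bounds for the size of the datum is dominated by a continuous
nondecreasing function of that size. -/
lemma exists_continuous_monotone_ge (D : ℕ → ℝ≥0) : ∃ α : ℝ≥0 → ℝ≥0, Continuous α ∧ Monotone α ∧
    (∀ r, 0 < α r) ∧ ∀ r : ℝ≥0, D ⌈(r : ℝ)⌉₊ ≤ α r := by
  -- a monotone step function, whose primitive, shifted by one, dominates it
  set Φ : ℝ → ℝ := fun x => 1 + ∑ i ∈ Finset.range (⌈x⌉₊ + 1), (D i : ℝ) with hΦ
  have hmono : Monotone Φ := by
    intro x y hxy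
    simp only [hΦ]
    gcongr
  have hpos : ∀ x, 1 ≤ Φ x := fun x => by
    simp only [hΦ, le_add_iff_nonneg_right]
    positivity
  have hint : ∀ a b : ℝ, IntervalIntegrable Φ volume a b := fun a b => hmono.intervalIntegrable
  set A : ℝ → ℝ := fun x => ∫ y in (0 : ℝ)..x, Φ y with hA
  have hAc : Continuous A := intervalIntegral.continuous_primitive hint 0
  have hAm : ∀ x y : ℝ, x ≤ y → A x ≤ A y := by
    intro x y hxy
    have h1 : A x + ∫ z in x..y, Φ z = A y :=
      intervalIntegral.integral_add_adjacent_intervals (hint _ _) (hint _ _)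
    have h2 : 0 ≤ ∫ z in x..y, Φ z :=
      intervalIntegral.integral_nonneg hxy fun z _ => zero_le_one.trans (hpos z)
    linarith
  have hge : ∀ r : ℝ≥0, Φ r ≤ A (r + 1) := by
    intro r
    have h1 : A r + ∫ z in (r : ℝ)..(r + 1), Φ z = A (r + 1) :=
      intervalIntegral.integral_add_adjacent_intervals (hint _ _) (hint _ _)
    have h0 : A 0 = 0 := intervalIntegral.integral_same
    have h2 : 0 ≤ A r := h0.symm.le.trans (hAm 0 r r.2)
    have h3 : ∫ _ in (r : ℝ)..(r + 1), Φ r ≤ ∫ z in (r : ℝ)..(r + 1), Φ z :=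
      intervalIntegral.integral_mono_on (by linarith) (by simp) (hint _ _)
        fun z hz => hmono hz.1
    simp only [intervalIntegral.integral_const, add_sub_cancel_left, one_smul] at h3
    linarith
  refine ⟨fun r => (A (r + 1)).toNNReal, ?_, fun r r' h => ?_, fun r => ?_, fun r => ?_⟩
  · fun_prop
  · exact Real.toNNReal_le_toNNReal (hAm _ _ (by have : (r : ℝ) ≤ r' := h; linarith))
  · exact Real.toNNReal_pos.2 (zero_lt_one.trans_le ((hpos r).trans (hge r)))
  · rw [Real.le_toNNReal_iff_coe_le (zero_le_one.trans ((hpos r).trans (hge r)))]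
    refine le_trans ?_ (hge r)
    have h1 : (D ⌈(r : ℝ)⌉₊ : ℝ) ≤ ∑ i ∈ Finset.range (⌈(r : ℝ)⌉₊ + 1), (D i : ℝ) :=
      Finset.single_le_sum (f := fun i => (D i : ℝ)) (fun i _ => (D i).2)
        (Finset.mem_range.2 (Nat.lt_succ_self _))
    simp only [hΦ]
    linarith

/-! ### Global well-posedness -/

/-- A solution in `Y^s_T` is given on `[0,T]` by a space-time Fourier integral of finite norm. The
mean of the solution is conserved, so that the zero mode vanishes. -/
lemma IsSolution.exists_ev {j : ℕ} {g : C(Torus, ℝ)} (hg : ∫ x : Torus, g x = 1) {lam s T : ℝ}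
    (hs : 0 ≤ s) (hT : 0 < T) {u₀ : L2} (h0 : MeanZero u₀) {v : ℝ → L2}
    (h : IsSolution j g lam s T u₀ v) :
    ∃ U : ℤ × ℝ → ℂ, Measurable U ∧ (∀ τ, U (0, τ) = 0) ∧ ys j 1 0 U < ⊤ ∧
      ∀ t ∈ Icc 0 T, ∀ k, coef k (v t) = ev U t k := by
  obtain ⟨U, hU, hz, hy, hae⟩ := exists_ev_of_yNormT hs h.memY
  refine ⟨U, hU, hz, hy, fun t ht k => ?_⟩
  by_cases hk : k = 0
  · subst hk
    have h1 := h.eqn t ht 0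
    have h2 : coef 0 u₀ = 0 := (meanZero_iff u₀).1 h0
    simp only [hat_eq_coef, coef_zero_K j hg, h2, mul_zero, Int.cast_zero, zero_mul,
      intervalIntegral.integral_zero, sub_zero] at h1
    rw [(mul_eq_zero.1 h1).resolve_left sqrt_two_pi_ne_zero]
    simp [ev, hz]
  · refine Measure.eqOn_Icc_of_ae_eq (μ := volume) (f := fun t => coef k (v t))
      (g := fun t => ev U t k) hT.ne ?_ (h.cont.continuousOn_coef hs k)
      (continuous_ev (integrable_of_ys hU hy k)).continuousOn ht
    rw [← restrict_Ioo_eq_restrict_Icc]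
    filter_upwards [hae] with t ht
    exact ht k hk

end PeriodicKdV

open PeriodicKdV in
theorem theoremB3 (j : ℕ) (hj : 1 ≤ j)
    (g : C(PeriodicKdV.Torus, ℝ)) (hg : ContDiff ℝ ∞ (fun x : ℝ => g (x : PeriodicKdV.Torus)))
    (hg_nonneg : ∀ x, 0 ≤ g x) (hg_int : ∫ x : PeriodicKdV.Torus, g x = 1)
    (lam : ℝ) (hlam : 0 ≤ lam) (s : ℝ) (hs : 0 ≤ s) (T : ℝ) (hT : 0 < T) :
    ∃ α : ℝ≥0 → ℝ≥0, Continuous α ∧ Monotone α ∧ (∀ r, 0 < α r) ∧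
      ∀ u₀ : PeriodicKdV.L2, PeriodicKdV.IsRealValued u₀ → PeriodicKdV.MeanZero u₀ →
        PeriodicKdV.MemHs s u₀ →
        ∃ u : ℝ → PeriodicKdV.L2, PeriodicKdV.IsSolution j g lam s T u₀ u ∧
          PeriodicKdV.yNormT j s T u
            ≤ (α (PeriodicKdV.hsNorm 0 u₀).toNNReal : ℝ≥0∞) * PeriodicKdV.hsNorm s u₀ ∧
          ∀ v : ℝ → PeriodicKdV.L2, PeriodicKdV.IsSolution j g lam s T u₀ v →
            ∀ t ∈ Icc 0 T, v t = u t := by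
  obtain ⟨κ, hκ, hK⟩ := exists_feedbackMatrix hj hg hg_int hlam
  choose D hD using fun n : ℕ => exists_global_solution hj hκ hs hT (n : ℝ≥0)
  obtain ⟨α, hα, hαm, hαp, hαD⟩ :=
    exists_continuous_monotone_ge fun n => (2 * Real.pi).toNNReal * D n
  refine ⟨α, hα, hαm, hαp, fun u₀ hreal hmean hmem => ?_⟩
  set x : ℤ → ℂ := fun k => coef k u₀ with hx
  have hxs : seqNorm s x < ⊤ := (hsNorm_lt_top_iff s u₀).1 hmem
  have hr : hsNorm 0 u₀ < ⊤ := by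
    rw [hsNorm_lt_top_iff, seqNorm_coef]
    exact enorm_lt_top
  set r : ℝ≥0 := (hsNorm 0 u₀).toNNReal with hrdef
  have hx0 : seqNorm 0 x ≤ ((⌈(r : ℝ)⌉₊ : ℝ≥0) : ℝ≥0∞) := by
    refine (seqNorm_le_hsNorm 0 u₀).trans ?_
    rw [← ENNReal.coe_toNNReal hr.ne]
    exact_mod_cast Nat.le_ceil (r : ℝ)
  obtain ⟨U, hU, hz, hy, hsol⟩ := hD ⌈(r : ℝ)⌉₊ x ((meanZero_iff u₀).1 hmean)
    ((isRealValued_iff u₀).1 hreal) hx0 hxs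
  have hys : ys j 1 s U < ⊤ := hy.trans_lt (ENNReal.mul_lt_top ENNReal.coe_lt_top hxs)
  have hy0 : ys j 1 0 U < ⊤ := (ys_zero_le j 1 hs U).trans_lt hys
  have hi := fun k => integrable_of_ys hU hy0 k
  have hn : nrm Measure.count (modeNorm U) < ⊤ := (nrm_modeNorm_le j 1 U).trans_lt hy0
  have hu : ∀ t k, coef k (synth (ev U t)) = ev U t k := fun t =>
    coef_synth ((seqNorm_ev_le j 1 0 hU t).trans_lt hy0)
  have hyT : yNormT j s T (fun t => synth (ev U t)) ≤ ENNReal.ofReal (2 * Real.pi) * ys j 1 s U :=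
    (iInf₂_le (fun t => synth (ev U t)) (ae_of_all _ fun _ => rfl)).trans (yNorm_le j s hU hi hu)
  refine ⟨fun t => synth (ev U t), ⟨fun t ht => ?_, ?_, isContHs_of_ev hU hi hys hu, ?_⟩, ?_,
    fun v hv t ht => ?_⟩
  · rw [isRealValued_iff]
    simp only [hu]
    exact CoeffSolution.real hj hκ (fun k => by simp) ((isRealValued_iff u₀).1 hreal) hU hz hy0
      hsol t ht
  · exact hyT.trans_lt (ENNReal.mul_lt_top ENNReal.ofReal_lt_top hys)
  · exact (isMildSolution_iff hκ hK hU hn hz fun t _ => hu t).2 hsol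
  · calc _ ≤ ENNReal.ofReal (2 * Real.pi) * (D ⌈(r : ℝ)⌉₊ * seqNorm s x) := hyT.trans (by gcongr)
      _ = (((2 * Real.pi).toNNReal * D ⌈(r : ℝ)⌉₊ : ℝ≥0) : ℝ≥0∞) * seqNorm s x := by
          rw [ENNReal.coe_mul, mul_assoc]; rfl
      _ ≤ _ := by
          gcongr
          · exact hαD r
          · exact seqNorm_le_hsNorm s u₀
  · obtain ⟨V, hV, hVz, hVy, hVe⟩ := hv.exists_ev hg_int hs hT hmean
    have hVsol := (isMildSolution_iff hκ hK hV ((nrm_modeNorm_le j 1 V).trans_lt hVy) hVz hVe).1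
      hv.eqn
    refine ext_coef fun k => ?_
    rw [hVe t ht, hu, CoeffSolution.unique hj hκ hV hU hVz hz hVy hy0 hVsol hsol t ht]
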